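/- Notation. For $a>0$, $\ell\in\mathbb R$ let $p_a(x)=(1+|x|)^a$ and $e_\ell(x)=e^{\ell(1+|x|)}$ on $\mathbb R^2$. For a weight $\rho$, $L^2_\rho$ has norm $\|f\|_{L^2_\rho}^2=\int |f|^2/\rho\,dx$. For $\alpha<0$, $\mathcal C^\alpha_\rho$ is the closure of $C_c^\infty(\mathbb R^2)$ in the distributions under $$\|T\|_{\mathcal C^\alpha_\rho}=\sup_{x\in\mathbb R^2}\ \sup_{\lambda\in(0,1]}\ \sup_{\varphi}\frac{|\langle T,\lambda^{-2}\varphi((\cdot-x)/\lambda)\rangle|}{\lambda^\alpha\rho(x)},$$ where $\varphi$ ranges over the smooth functions supported in the unit ball with $C^{\lceil-\alpha\rceil}$-norm at most $1$. For $\alpha\in(1,2)$, $\mathcal H^\alpha_\rho$ is the weighted Sobolev space of order $\alpha$, normed by $\|v\|^2_{\mathcal H^\alpha_\rho}=\|v\|^2_{L^2_\rho}+\|\nabla v\|_{L^2_\rho}^2+\sum_{i=1}^2\int\int_{|x-y|<1}\frac{|\partial_iv(x)-\partial_iv(y)|^2}{|x-y|^{2\alpha}\rho(x)}\,dy\,dx$.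 Let $\chi$ be a smooth radial function on $\mathbb R^2$, equal to $1$ on the unit ball and supported in the ball of radius $2$, let $G(x)=-\frac{\log|x|}{2\pi}\chi(x)$, and let $F$ be the smooth function that vanishes on the unit ball and equals $-\Delta G$ outside it (so $-\Delta G=\delta_0+F$). Let $K_t(x)=(4\pi t)^{-1}e^{-|x|^2/(4t)}$. For $\kappa>0$ let $\mathscr M=\mathcal C^{-1-\kappa}_{p_\kappa}\times\mathcal C^{-\kappa}_{p_\kappa}$, with the sum of the two norms. For $q=(X,U)\in\mathscr M$ put $V=G*X$ and consider $$\partial_t w=\Delta w-2\nabla V\cdot\nabla w+(U+F*X)w,\qquad w(0,\cdot)=f. \qquad (\ast)$$ For $f\in L^2_{e_{\ell_0}}$ and $T>0$, a mild solution of $(\ast)$ on $(0,T]$ is an element $w$ of $\mathcal E_{\ell_0,T}$, the completion of the smooth functions on $(0,T]\times\mathbb R^2$ under the norm $\sup_{t\in(0,T]}t^{\frac12+\kappa}\|w(t)\|_{\mathcal H^{1+2\kappa}_{e_{\ell_0+t}}}$, such that for all $t\in(0,T]$ $$w(t)=K_t*f+\int_0^tK_{t-s}*\big(-2\nabla V\cdot\nabla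 w(s)+(U+F*X)w(s)\big)\,ds ,$$ where the products of $\partial_iV,\,U+F*X\in\mathcal C^{-\kappa}_{p_\kappa}$ with functions are defined by continuous extension from smooth compactly supported first factors. Theorem. There is $\kappa_0>0$ such that for every $\kappa\in(0,\kappa_0)$ and every $\chi$ as above there is a map $(q,f,t)\mapsto w^{q,f}(t)$, defined on $\mathscr M\times\big(\bigcup_{\ell_0\in\mathbb R}L^2_{e_{\ell_0}}\big)\times\mathbb R_+$, such that for every $\ell_0\in\mathbb R$: 0. (Mild solution) For all $(q,f)\in\mathscr M\times L^2_{e_{\ell_0}}$, $w^{q,f}(0)=f$, and for every $T>0$ the restriction of $w^{q,f}$ to $(0,T]$ is the unique mild solution of $(\ast)$ in $\mathcal E_{\ell_0,T}$. 1. (Continuity in the data) For every $t\ge0$, $(q,f)\mapsto w^{q,f}(t)$ is continuous from $\mathscr M\times L^2_{e_{\ell_0}}$ into $L^2_{e_{\ell_0+t}}$, and linear in $f$. 2. (Continuity in time) For all $(q,f)\in\mathscr M\times L^2_{e_{\ell_0}}$ and $T>0$, $t\mapsto w^{q,f}(t)$ is continuous from $[0,T]$ into $L^2_{e_{\ell_0+T}}$.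 3. (Semigroup property) For all $(q,f)\in\mathscr M\times L^2_{e_{\ell_0}}$ and $0\le s\le t$, $w^{q,f}(t)=w^{q,g}(s)$ with $g=w^{q,f}(t-s)$. -/

import Mathlib

open MeasureTheory TopologicalSpace Filter Topology
open scoped Pointwise Distributions Convolution ENNReal ContDiff LineDeriv CompactConvergenceCLM

noncomputable section
namespace PAM

/-- `ℝ²` with its Euclidean norm. -/
abbrev Plane := EuclideanSpace ℝ (Fin 2)
/-- `C_c^∞(ℝ²)`. -/
abbrev Test := TestFunction (⊤ : Opens Plane) ℝ ⊤
/-- Distributions on `ℝ²`. -/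
abbrev Distr := Distribution (⊤ : Opens Plane) ℝ ⊤

theorem norm_iteratedFDeriv_convolution_le {k : Plane → ℝ} (hk : Integrable k) (i : ℕ) :
    ∀ {F : Type} [NormedAddCommGroup F] [NormedSpace ℝ F] [CompleteSpace F]
      {φ : Plane → F} (_ : ContDiff ℝ ∞ φ) (_ : HasCompactSupport φ)
      {C : ℝ} (_ : ∀ x, ‖iteratedFDeriv ℝ i φ x‖ ≤ C) (x : Plane),
      ‖iteratedFDeriv ℝ i (k ⋆[ContinuousLinearMap.lsmul ℝ ℝ, volume] φ) x‖ ≤ (∫ y, ‖k y‖) * C := by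
  induction i with
  | zero =>
    intro F _ _ _ φ hφ hc C hC x
    simp only [norm_iteratedFDeriv_zero] at hC ⊢
    rw [convolution_def, ← integral_mul_const]
    refine norm_integral_le_of_norm_le (hk.norm.mul_const C) (Eventually.of_forall fun y => ?_)
    rw [ContinuousLinearMap.lsmul_apply, norm_smul]
    exact mul_le_mul_of_nonneg_left (hC _) (norm_nonneg _)
  | succ n ih =>
    intro F _ _ _ φ hφ hc C hC x
    have h1 : fderiv ℝ (k ⋆[ContinuousLinearMap.lsmul ℝ ℝ, volume] φ) =
        (k ⋆[ContinuousLinearMap.lsmul ℝ ℝ, volume] (fderiv ℝ φ)) := by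
      funext z
      rw [(hc.hasFDerivAt_convolution_right (ContinuousLinearMap.lsmul ℝ ℝ) hk.locallyIntegrable
        (hφ.of_le (by exact_mod_cast le_top)) z).fderiv]
      rfl
    rw [← norm_iteratedFDeriv_fderiv, h1]
    refine ih (hφ.fderiv_right (by simp)) (hc.fderiv ℝ) (fun z => ?_) x
    rw [norm_iteratedFDeriv_fderiv]
    exact hC z

/-- Convolution `φ ↦ k * φ` of a test function with an integrable, compactly supported kernel. -/
def convTest (k : Plane → ℝ) (hk : Integrable k) (hc : HasCompactSupport k) : Test →L[ℝ] Test :=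
  TestFunction.mkCLM ℝ
    (fun φ => ⟨k ⋆[ContinuousLinearMap.lsmul ℝ ℝ, volume] φ,
      φ.hasCompactSupport.contDiff_convolution_right _ hk.locallyIntegrable φ.contDiff,
      hc.convolution _ φ.hasCompactSupport, fun _ _ => trivial⟩)
    (fun f g => TestFunction.ext fun x => congrFun (ConvolutionExists.distrib_add
      (f.hasCompactSupport.convolutionExists_right _ hk.locallyIntegrable f.continuous)
      (g.hasCompactSupport.convolutionExists_right _ hk.locallyIntegrable g.continuous)) x)
    (fun c f => TestFunction.ext fun x => congrFun convolution_smul x)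
    (fun K hK => by
      let K' : Compacts Plane := ⟨tsupport k + (K : Set Plane), hc.isCompact.add K.isCompact⟩
      let A : ContDiffMapSupportedIn Plane ℝ ⊤ K →L[ℝ] ContDiffMapSupportedIn Plane ℝ ⊤ K' :=
        ContDiffMapSupportedIn.mkCLM ℝ
          (fun f => k ⋆[ContinuousLinearMap.lsmul ℝ ℝ, volume] f)
          (fun f g x => congrFun (ConvolutionExists.distrib_add
            (f.hasCompactSupport.convolutionExists_right _ hk.locallyIntegrable f.continuous)
            (g.hasCompactSupport.convolutionExists_right _ hk.locallyIntegrable g.continuous)) x)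
          (fun c f x => congrFun convolution_smul x)
          (fun f => f.hasCompactSupport.contDiff_convolution_right _ hk.locallyIntegrable
            f.contDiff)
          (fun f x hx => by
            by_contra h
            exact hx (Set.add_subset_add (subset_tsupport k) f.support_subset
              (support_convolution_subset _ h)))
          (fun i _ => ⟨{i}, ∫ y, ‖k y‖, integral_nonneg fun _ => norm_nonneg _, fun f x _ => by
            rw [Finset.sup_singleton]
            exact norm_iteratedFDeriv_convolution_le hk i f.contDiff f.hasCompactSupport
              (fun z => ContDiffMapSupportedIn.norm_iteratedFDeriv_apply_le_seminorm_top ℝ) x⟩)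
      exact (TestFunction.continuous_ofSupportedIn (Ω := ⊤) (K := K') (fun _ _ => trivial)).comp
        A.continuous)

/-- The distribution `k * X`, i.e. `⟨k * X, φ⟩ = ⟨X, k(-·) * φ⟩`. -/
def conv (k : Plane → ℝ) (hk : Integrable k) (hc : HasCompactSupport k) (X : Distr) : Distr :=
  (convTest (fun x => k (-x)) hk.comp_neg
    (hc.comp_homeomorph (Homeomorph.neg Plane))).precompCompactConvergenceCLM ℝ X

/-- The distribution `φ ↦ ∫ g φ` of a locally integrable function. -/
def ofFun (g : Plane → ℝ) : Distr :=
  TestFunction.integralAgainstBilinCLM (ContinuousLinearMap.mul ℝ ℝ) volume g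

/-- A smooth radial cutoff, equal to `1` on the unit ball and supported in the ball of radius 2. -/
structure Cutoff where
  toFun : Plane → ℝ
  smooth : ContDiff ℝ ∞ toFun
  radial : ∀ x y, ‖x‖ = ‖y‖ → toFun x = toFun y
  eq_one : ∀ x, ‖x‖ < 1 → toFun x = 1
  supp : tsupport toFun ⊆ Metric.closedBall 0 2

namespace Cutoff
variable (χ : Cutoff)

/-- `G(x) = -(log|x| / 2π) χ(x)`. -/
def G (x : Plane) : ℝ := -(Real.log ‖x‖ / (2 * Real.pi)) * χ.toFun x

open Laplacian in
/-- The smooth function `F` with `-Δ G = δ₀ + F`: it vanishes on the unit ball and equals `-Δ G`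
(a pointwise Laplacian) away from it. -/
def F (x : Plane) : ℝ := if ‖x‖ < 1 then 0 else -(Δ χ.G) x

theorem tsupport_G : tsupport χ.G ⊆ Metric.closedBall 0 2 :=
  (closure_mono (Function.support_mul_subset_right _ _)).trans χ.supp

theorem hasCompactSupport_G : HasCompactSupport χ.G :=
  (isCompact_closedBall 0 2).of_isClosed_subset (isClosed_tsupport _) χ.tsupport_G

theorem integrable_G : Integrable χ.G := by
  have h : IntegrableOn (fun x : Plane => Real.log ‖x‖) (Metric.ball 0 3) volume := by
    rw [integrableOn_fun_norm_addHaar volume (f := Real.log)]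
    have : ContinuousOn (fun y : ℝ => y ^ (Module.finrank ℝ Plane - 1) • Real.log y) (Set.Icc 0 3) := by
      have : Continuous fun y : ℝ => y * Real.log y := Real.continuous_mul_log
      simpa using this.continuousOn
    exact (this.integrableOn_Icc).mono_set Set.Ioo_subset_Icc_self
  obtain ⟨C, hC⟩ := χ.smooth.continuous.bounded_above_of_compact_support
    ((isCompact_closedBall 0 2).of_isClosed_subset (isClosed_tsupport _) χ.supp)
  have h2 : IntegrableOn χ.G (Metric.ball 0 3) volume :=
    ((h.div_const (2 * Real.pi)).neg).mul_bdd χ.smooth.continuous.aestronglyMeasurable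
      (Eventually.of_forall hC)
  rw [← integrableOn_iff_integrable_of_support_subset]
  · exact h2
  · exact (subset_tsupport _).trans (χ.tsupport_G.trans
      (Metric.closedBall_subset_ball (by norm_num)))

theorem support_F : Function.support χ.F ⊆ Metric.closedBall 0 2 := by
  intro x hx
  by_contra h
  apply hx
  unfold F
  split_ifs with h1
  · rfl
  · have : χ.G =ᶠ[𝓝 x] fun _ => 0 := by
      have := (isClosed_tsupport χ.G).isOpen_compl.mem_nhds (fun h' => h (χ.tsupport_G h'))
      filter_upwards [this] with y hy
      exact image_eq_zero_of_notMem_tsupport hy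
    have h3 := (InnerProductSpace.laplacian_congr_nhds this).eq_of_nhds
    rw [h3]
    simp

theorem hasCompactSupport_F : HasCompactSupport χ.F :=
  HasCompactSupport.of_support_subset_isCompact (isCompact_closedBall 0 2) χ.support_F

theorem contDiffAt_G {x : Plane} (hx : x ≠ 0) : ContDiffAt ℝ ∞ χ.G x :=
  (((contDiffAt_norm ℝ hx).log (norm_ne_zero_iff.2 hx)).div_const _).neg.mul χ.smooth.contDiffAt

theorem integrable_F : Integrable χ.F := by
  have hcont : ContinuousOn χ.F (Metric.closedBall 0 2 \ Metric.ball 0 1) := by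
    have : ContinuousOn (fun x => -(Laplacian.laplacian χ.G) x) (Metric.closedBall 0 2 \ Metric.ball 0 1) := by
      rw [InnerProductSpace.laplacian_eq_iteratedFDeriv_orthonormalBasis χ.G (EuclideanSpace.basisFun (Fin 2) ℝ)]
      intro x hx
      have hx0 : x ≠ 0 := by rintro rfl; simp at hx
      have : ContinuousAt (iteratedFDeriv ℝ 2 χ.G) x :=
        ((χ.contDiffAt_G hx0).iteratedFDeriv_right (m := 0) (i := 2) (by rw [zero_add]; exact WithTop.coe_le_coe.2 le_top)).continuousAt
      refine ContinuousAt.continuousWithinAt ?_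
      refine ContinuousAt.neg ?_
      refine tendsto_finsetSum _ fun i _ => ?_
      exact ((ContinuousMultilinearMap.apply ℝ (fun _ : Fin 2 => Plane) ℝ
        ![EuclideanSpace.basisFun (Fin 2) ℝ i, EuclideanSpace.basisFun (Fin 2) ℝ i]).continuous.tendsto _).comp this
    refine this.congr fun x hx => ?_
    have : ¬ ‖x‖ < 1 := by simpa using hx.2
    simp [F, this]
  rw [← integrableOn_iff_integrable_of_support_subset (s := Metric.closedBall 0 2 \ Metric.ball 0 1)]
  · exact hcont.integrableOn_compact ((isCompact_closedBall 0 2).diff Metric.isOpen_ball)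
  · intro x hx
    refine ⟨χ.support_F hx, fun h => hx ?_⟩
    have : ‖x‖ < 1 := by simpa using h
    simp [F, this]

end Cutoff

/-! ### Weights and weighted spaces -/

/-- `p_a(x) = (1 + |x|)^a`. -/
def polyWeight (a : ℝ) (x : Plane) : ℝ := (1 + ‖x‖) ^ a

/-- `e_ℓ(x) = exp(ℓ (1 + |x|))`. -/
def expWeight (l : ℝ) (x : Plane) : ℝ := Real.exp (l * (1 + ‖x‖))

/-- `(∫ |v|² / ρ dx)^{1/2}`. -/
def l2Norm (ρ : Plane → ℝ) (v : Plane → ℝ) : ℝ≥0∞ :=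
  (∫⁻ x, ‖v x‖ₑ ^ 2 / ENNReal.ofReal (ρ x)) ^ (1 / 2 : ℝ)

/-- The weighted space `L²_{e_ℓ}`, as a set of Lebesgue-a.e. classes of functions. -/
def L2exp (l : ℝ) : Set (Plane →ₘ[volume] ℝ) := {f | l2Norm (expWeight l) f < ⊤}

/-- The test function `y ↦ r⁻² φ((y - x) / r)`. -/
def rescale (x : Plane) (r : ℝ) (hr : 0 < r) (φ : Test) : Test where
  toFun y := (r ^ 2)⁻¹ * φ (r⁻¹ • (y - x))
  contDiff' := contDiff_const.mul
    (φ.contDiff.comp ((contDiff_id.sub contDiff_const).const_smul _))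
  hasCompactSupport' := by
    have h := φ.hasCompactSupport.comp_homeomorph
      ((Homeomorph.subRight x).trans (Homeomorph.smulOfNeZero r⁻¹ (inv_ne_zero hr.ne')))
    exact h.mul_left
  tsupport_subset' := fun _ _ => trivial

/-- Test functions supported in the unit ball with `C^m`-norm at most `1`. -/
def unitTests (m : ℕ) : Set Test :=
  {φ | tsupport φ ⊆ Metric.closedBall 0 1 ∧ ∀ i ≤ m, ∀ x, ‖iteratedFDeriv ℝ i φ x‖ ≤ 1}

/-- The norm of `C^α_ρ`, `α < 0`:
`sup_x sup_{r ∈ (0,1]} sup_φ |⟨T, rescale x r φ⟩| / (r^α ρ(x))`, `φ` in `unitTests ⌈-α⌉`. -/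
def holderNorm (α : ℝ) (ρ : Plane → ℝ) (T : Distr) : ℝ≥0∞ :=
  ⨆ (x : Plane) (r : Set.Ioc (0 : ℝ) 1) (φ ∈ unitTests ⌈-α⌉₊),
    ENNReal.ofReal (|T (rescale x r r.2.1 φ)| / ((r : ℝ) ^ α * ρ x))

/-- The filter of smooth compactly supported approximations of `T` in the norm of `C^α_ρ`. -/
def approx (α : ℝ) (ρ : Plane → ℝ) (T : Distr) : Filter Test :=
  comap (fun φ : Test => holderNorm α ρ (T - ofFun φ)) (𝓝 0)

/-- `C^α_ρ`: the closure of `C_c^∞` for `holderNorm α ρ`. -/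
def HolderSpace (α : ℝ) (ρ : Plane → ℝ) : Set Distr :=
  {T | ∀ ε > 0, ∃ φ : Test, holderNorm α ρ (T - ofFun φ) < ε}

/-- The space of enhanced noises `C^{-1-κ}_{p_κ} × C^{-κ}_{p_κ}`. -/
def Noise (κ : ℝ) : Set (Distr × Distr) :=
  {q | q.1 ∈ HolderSpace (-1 - κ) (polyWeight κ) ∧ q.2 ∈ HolderSpace (-κ) (polyWeight κ)}

/-- The norm on the space of enhanced noises. -/
def noiseNorm (κ : ℝ) (q : Distr × Distr) : ℝ≥0∞ :=
  holderNorm (-1 - κ) (polyWeight κ) q.1 + holderNorm (-κ) (polyWeight κ) q.2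

/-- `D` is the weak gradient of `v`. -/
def IsWeakGrad (v : Plane → ℝ) (D : Fin 2 → Plane → ℝ) : Prop :=
  LocallyIntegrable v ∧ ∀ i, LocallyIntegrable (D i) ∧
    ∂_{(EuclideanSpace.single i 1 : Plane)} (ofFun v) = ofFun (D i)

/-- The norm of the weighted fractional Sobolev space `H^{1+σ}_ρ`, `0 < σ < 1`, in
Sobolev-Slobodeckij form (`p = q = 2` Besov norm); it is `∞` if `v` has no weak gradient. -/
def sobolevNorm (σ : ℝ) (ρ : Plane → ℝ) (v : Plane → ℝ) : ℝ≥0∞ :=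
  ⨅ (D : Fin 2 → Plane → ℝ) (_ : IsWeakGrad v D),
    ((∫⁻ x, ‖v x‖ₑ ^ 2 / ENNReal.ofReal (ρ x)) +
      (∑ i, ∫⁻ x, ‖D i x‖ₑ ^ 2 / ENNReal.ofReal (ρ x)) +
      ∑ i, ∫⁻ x, ∫⁻ y in Metric.ball x 1,
        ‖D i x - D i y‖ₑ ^ 2 / ENNReal.ofReal (‖x - y‖ ^ (2 + 2 * σ) * ρ x)) ^ (1 / 2 : ℝ)

/-- `sup_{t ∈ (0,T]} t^β ‖u(t)‖` in `H^{1+σ}_{e_{ℓ+t}}`. -/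
def pathNorm (l T σ β : ℝ) (u : ℝ → Plane → ℝ) : ℝ≥0∞ :=
  ⨆ t ∈ Set.Ioc 0 T, ENNReal.ofReal (t ^ β) * sobolevNorm σ (expWeight (l + t)) (u t)

/-- The completion of the smooth functions on `(0,T] × ℝ²` under `pathNorm`. -/
def PathSpace (l T σ β : ℝ) : Set (ℝ → Plane → ℝ) :=
  {u | pathNorm l T σ β u < ⊤ ∧ ∀ ε > 0, ∃ v : ℝ → Plane → ℝ,
    ContDiffOn ℝ ∞ (Function.uncurry v) (Set.Ioc 0 T ×ˢ Set.univ) ∧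
      pathNorm l T σ β (u - v) < ε}

/-! ### Mild solutions -/

/-- The heat kernel `K_t` on the plane. -/
def heatKernel (t : ℝ) (x : Plane) : ℝ := (4 * Real.pi * t)⁻¹ * Real.exp (-‖x‖ ^ 2 / (4 * t))

/-- `⟨T · v, ψ⟩ = c`, where the product of a distribution `T ∈ C^{-κ}_{p_κ}` and a function `v` is
defined by continuous extension from smooth `T`: whenever smooth compactly supported `φ` tend to
`T` in `C^{-κ}_{p_κ}`, the numbers `∫ φ v ψ` tend to `c`. -/
def HasProductPairing (κ : ℝ) (T : Distr) (v ψ : Plane → ℝ) (c : ℝ) : Prop :=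
  T ∈ HolderSpace (-κ) (polyWeight κ) ∧
    Tendsto (fun φ : Test => ∫ x, φ x * v x * ψ x) (approx (-κ) (polyWeight κ) T) (𝓝 c)

/-- `V = G * X`. -/
def potential (χ : Cutoff) (X : Distr) : Distr := conv χ.G χ.integrable_G χ.hasCompactSupport_G X

/-- `U + F * X`. -/
def zeroOrder (χ : Cutoff) (q : Distr × Distr) : Distr :=
  q.2 + conv χ.F χ.integrable_F χ.hasCompactSupport_F q.1

/-- `⟨-2 ∇V · ∇v + (U + F * X) v, ψ⟩ = c`. -/
def HasForcingPairing (χ : Cutoff) (κ : ℝ) (q : Distr × Distr) (v ψ : Plane → ℝ) (c : ℝ) : Prop :=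
  ∃ (D : Fin 2 → Plane → ℝ) (a : Fin 2 → ℝ) (b : ℝ), IsWeakGrad v D ∧
    (∀ i, HasProductPairing κ (∂_{(EuclideanSpace.single i 1 : Plane)} (potential χ q.1))
      (D i) ψ (a i)) ∧
    HasProductPairing κ (zeroOrder χ q) v ψ b ∧ c = -2 * ∑ i, a i + b

/-- `w` is a mild solution on `(0,T]`, with weight `e_ℓ` at time zero and initial condition `f`:
it lies in the path space with `α = 1 + 2κ`, `β = 1/2 + κ`, and
`w(t) = K_t * f + ∫₀ᵗ K_{t-s} * (-2 ∇V · ∇w(s) + (U + F * X) w(s)) ds` for `t ∈ (0,T]`.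
Here `H s x` is the value at `x` of `K_{t-s} * (⋯)`. -/
structure IsMildSolution (χ : Cutoff) (κ : ℝ) (q : Distr × Distr) (l T : ℝ)
    (f : Plane →ₘ[volume] ℝ) (w : ℝ → Plane →ₘ[volume] ℝ) : Prop where
  mem : (fun t => (w t : Plane → ℝ)) ∈ PathSpace l T (2 * κ) (1 / 2 + κ)
  eq : ∀ t ∈ Set.Ioc 0 T, ∃ H : ℝ → Plane → ℝ,
    (∀ s ∈ Set.Ioo 0 t, ∀ x,
      HasForcingPairing χ κ q (w s) (fun y => heatKernel (t - s) (x - y)) (H s x)) ∧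
    ∀ᵐ x, IntervalIntegrable (fun s => H s x) volume 0 t ∧
      w t x = (∫ y, heatKernel t (x - y) * f y) + ∫ s in (0 : ℝ)..t, H s x

end PAM
end

open PAM

noncomputable section
namespace PAM
open Set (Ioc Ioo)
open ENNReal (ofReal ofReal_ne_top mul_ne_top mul_lt_top ofReal_lt_top ofReal_mul ofReal_le_ofReal add_ne_top)


/-- A function of time and space together with its gradient. -/
abbrev Fld := Fin 3 → ℝ → Plane → ℝ

/-- Sequences of smooth coefficients, of order zero and one. -/
abbrev Coef := Fin 3 → ℕ → Test

/-! ### The heat kernel -/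

theorem heatKernel_nonneg {t : ℝ} (ht : 0 ≤ t) (x : Plane) : 0 ≤ heatKernel t x := by
  unfold heatKernel; positivity

theorem continuous_heatKernel (t : ℝ) : Continuous (heatKernel t) := by
  unfold heatKernel; fun_prop

theorem measurable_heatKernel : Measurable fun p : ℝ × Plane => heatKernel p.1 p.2 := by
  unfold heatKernel; fun_prop

theorem integrable_heatKernel {t : ℝ} (ht : 0 < t) : Integrable (heatKernel t) := by
  have h := GaussianFourier.integrable_cexp_neg_mul_sq_norm_add (V := Plane)
    (b := ((4 * t)⁻¹ : ℝ)) (by simpa using by positivity) 0 0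
  have h2 := h.re
  refine (h2.const_mul ((4 * Real.pi * t)⁻¹)).congr (Eventually.of_forall fun x => ?_)
  simp only [heatKernel, zero_mul, add_zero]
  congr 1
  have : (-(((4 * t)⁻¹ : ℝ) : ℂ) * (‖x‖ : ℂ) ^ 2) = ((-‖x‖ ^ 2 / (4 * t) : ℝ) : ℂ) := by
    push_cast; field_simp
  rw [this]
  exact Complex.exp_ofReal_re _

theorem integral_heatKernel {t : ℝ} (ht : 0 < t) : ∫ x, heatKernel t x = 1 := by
  have h := GaussianFourier.integral_rexp_neg_mul_sq_norm (V := Plane) (b := (4 * t)⁻¹)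
    (by positivity)
  unfold heatKernel
  rw [integral_const_mul]
  have : (fun x : Plane => Real.exp (-‖x‖ ^ 2 / (4 * t))) =
      fun x => Real.exp (-(4 * t)⁻¹ * ‖x‖ ^ 2) := by
    funext x; congr 1; field_simp
  rw [this, h]
  simp
  field_simp

theorem lintegral_heatKernel {t : ℝ} (ht : 0 < t) :
    ∫⁻ x, ofReal (heatKernel t x) = 1 := by
  rw [← ofReal_integral_eq_lintegral_ofReal (integrable_heatKernel ht)
    (Eventually.of_forall fun x => heatKernel_nonneg ht.le x), integral_heatKernel ht]
  simp

theorem heatKernel_mul_exp_le {t : ℝ} (ht : 0 < t) (c : ℝ) (z : Plane) :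
    heatKernel t z * Real.exp (c * ‖z‖) ≤ 2 * Real.exp (2 * c ^ 2 * t) * heatKernel (2 * t) z := by
  unfold heatKernel
  have h1 : (4 * Real.pi * t)⁻¹ = 2 * (4 * Real.pi * (2 * t))⁻¹ := by field_simp
  rw [h1, mul_assoc, ← Real.exp_add]
  have h2 : 2 * Real.exp (2 * c ^ 2 * t) * ((4 * Real.pi * (2 * t))⁻¹ *
      Real.exp (-‖z‖ ^ 2 / (4 * (2 * t)))) = 2 * (4 * Real.pi * (2 * t))⁻¹ *
      Real.exp (2 * c ^ 2 * t + -‖z‖ ^ 2 / (4 * (2 * t))) := by rw [Real.exp_add]; ring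
  rw [h2]
  refine mul_le_mul_of_nonneg_left (Real.exp_le_exp.2 ?_) (by positivity)
  have : 2 * c ^ 2 * t + -‖z‖ ^ 2 / (4 * (2 * t)) - (-‖z‖ ^ 2 / (4 * t) + c * ‖z‖) =
      (4 * c * t - ‖z‖) ^ 2 / (8 * t) := by field_simp; ring
  have h3 : 0 ≤ (4 * c * t - ‖z‖) ^ 2 / (8 * t) := by positivity
  linarith

theorem heatKernel_le_two_mul {t : ℝ} (ht : 0 < t) (z : Plane) :
    heatKernel t z ≤ 2 * heatKernel (2 * t) z := by
  simpa using heatKernel_mul_exp_le ht 0 z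

theorem norm_mul_heatKernel_le {t : ℝ} (ht : 0 < t) (z : Plane) :
    ‖z‖ * heatKernel t z ≤ 4 * √t * heatKernel (2 * t) z := by
  unfold heatKernel
  have h1 : (4 * Real.pi * t)⁻¹ = 2 * (4 * Real.pi * (2 * t))⁻¹ := by field_simp
  have hs : √t * √t = t := Real.mul_self_sqrt ht.le
  have hs0 : 0 < √t := Real.sqrt_pos.2 ht
  have h2 : -‖z‖ ^ 2 / (4 * t) = -‖z‖ ^ 2 / (4 * (2 * t)) + -(‖z‖ ^ 2 / (8 * t)) := by
    field_simp; ring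
  have h3 : ‖z‖ * Real.exp (-(‖z‖ ^ 2 / (8 * t))) ≤ 2 * √t := by
    rw [Real.exp_neg, ← div_eq_mul_inv, div_le_iff₀ (Real.exp_pos _)]
    have := Real.add_one_le_exp (‖z‖ ^ 2 / (8 * t))
    have h4 : ‖z‖ ≤ 2 * √t * (‖z‖ ^ 2 / (8 * t) + 1) := by
      have : 2 * √t * (‖z‖ ^ 2 / (8 * t) + 1) - ‖z‖ = ((‖z‖ - 2 * √t) ^ 2 + 4 * t) / (4 * √t) := by
        have e : t = √t * √t := hs.symm
        generalize √t = s at e hs0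
        subst e
        field_simp; ring
      have : 0 ≤ ((‖z‖ - 2 * √t) ^ 2 + 4 * t) / (4 * √t) := by positivity
      linarith
    exact h4.trans (by gcongr)
  rw [h1, h2, Real.exp_add]
  calc _ = 2 * (4 * Real.pi * (2 * t))⁻¹ * Real.exp (-‖z‖ ^ 2 / (4 * (2 * t))) *
        (‖z‖ * Real.exp (-(‖z‖ ^ 2 / (8 * t)))) := by ring
    _ ≤ 2 * (4 * Real.pi * (2 * t))⁻¹ * Real.exp (-‖z‖ ^ 2 / (4 * (2 * t))) * (2 * √t) := by
        gcongr
    _ = _ := by ring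

theorem norm_sq_mul_heatKernel_le {t : ℝ} (ht : 0 < t) (z : Plane) :
    ‖z‖ ^ 2 * heatKernel t z ≤ 16 * t * heatKernel (2 * t) z := by
  unfold heatKernel
  have h1 : (4 * Real.pi * t)⁻¹ = 2 * (4 * Real.pi * (2 * t))⁻¹ := by field_simp
  have h2 : -‖z‖ ^ 2 / (4 * t) = -‖z‖ ^ 2 / (4 * (2 * t)) + -(‖z‖ ^ 2 / (8 * t)) := by
    field_simp; ring
  have h3 : ‖z‖ ^ 2 * Real.exp (-(‖z‖ ^ 2 / (8 * t))) ≤ 8 * t := by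
    rw [Real.exp_neg, ← div_eq_mul_inv, div_le_iff₀ (Real.exp_pos _)]
    have := Real.add_one_le_exp (‖z‖ ^ 2 / (8 * t))
    have h4 : ‖z‖ ^ 2 ≤ 8 * t * (‖z‖ ^ 2 / (8 * t) + 1) := by
      have : 8 * t * (‖z‖ ^ 2 / (8 * t) + 1) = ‖z‖ ^ 2 + 8 * t := by field_simp
      linarith
    exact h4.trans (by gcongr)
  rw [h1, h2, Real.exp_add]
  calc _ = 2 * (4 * Real.pi * (2 * t))⁻¹ * Real.exp (-‖z‖ ^ 2 / (4 * (2 * t))) *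
        (‖z‖ ^ 2 * Real.exp (-(‖z‖ ^ 2 / (8 * t)))) := by ring
    _ ≤ 2 * (4 * Real.pi * (2 * t))⁻¹ * Real.exp (-‖z‖ ^ 2 / (4 * (2 * t))) * (8 * t) := by
        gcongr
    _ = _ := by ring

theorem heatKernel_shift_le {t : ℝ} (ht : 0 < t) {w u : Plane} (h : ‖u - w‖ ≤ √t) :
    heatKernel (2 * t) u ≤ 4 * heatKernel (4 * t) w := by
  unfold heatKernel
  have h1 : (4 * Real.pi * (2 * t))⁻¹ = 2 * (4 * Real.pi * (4 * t))⁻¹ := by field_simp; norm_num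
  have h0 : ‖u - w‖ ^ 2 ≤ t := by
    calc ‖u - w‖ ^ 2 ≤ √t ^ 2 := by gcongr
      _ = t := Real.sq_sqrt ht.le
  have h2 : ‖w‖ ^ 2 ≤ 2 * ‖u‖ ^ 2 + 2 * t := by
    have : ‖w‖ ≤ ‖u‖ + ‖u - w‖ := by
      calc ‖w‖ = ‖u - (u - w)‖ := by congr 1; abel
        _ ≤ _ := norm_sub_le _ _
    nlinarith [sq_nonneg (‖u‖ - ‖u - w‖), norm_nonneg w, norm_nonneg u, norm_nonneg (u - w)]
  have h3 : -‖u‖ ^ 2 / (4 * (2 * t)) ≤ -‖w‖ ^ 2 / (4 * (4 * t)) + 1 / 8 := by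
    have : -‖w‖ ^ 2 / (4 * (4 * t)) + 1 / 8 - -‖u‖ ^ 2 / (4 * (2 * t)) =
      (2 * ‖u‖ ^ 2 + 2 * t - ‖w‖ ^ 2) / (16 * t) := by field_simp; ring
    have h5 : 0 ≤ (2 * ‖u‖ ^ 2 + 2 * t - ‖w‖ ^ 2) / (16 * t) := by
      apply div_nonneg _ (by positivity); linarith
    linarith
  have h4 : Real.exp (1 / 8) ≤ 2 := by
    have := Real.exp_one_lt_d9
    have h5 : Real.exp (1 / 8) ^ 8 = Real.exp 1 := by rw [← Real.exp_nat_mul]; norm_num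
    by_contra hc
    push Not at hc
    have : (2 : ℝ) ^ 8 ≤ Real.exp (1 / 8) ^ 8 := by gcongr
    linarith
  calc _ ≤ 2 * (4 * Real.pi * (4 * t))⁻¹ * Real.exp (-‖w‖ ^ 2 / (4 * (4 * t)) + 1 / 8) := by
        rw [h1]; gcongr
    _ = 2 * (4 * Real.pi * (4 * t))⁻¹ * (Real.exp (-‖w‖ ^ 2 / (4 * (4 * t))) * Real.exp (1 / 8)) := by
        rw [Real.exp_add]
    _ ≤ 2 * (4 * Real.pi * (4 * t))⁻¹ * (Real.exp (-‖w‖ ^ 2 / (4 * (4 * t))) * 2) := by gcongr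
    _ = _ := by ring

/-- The heat kernel (`i = 0`) and its partial derivatives (`i = 1, 2`). -/
def kern (i : Fin 3) (t : ℝ) (x : Plane) : ℝ :=
  Fin.cases (heatKernel t x) (fun j : Fin 2 => -(x j / (2 * t)) * heatKernel t x) i

@[simp] theorem kern_zero (t : ℝ) (x : Plane) : kern 0 t x = heatKernel t x := rfl

@[simp] theorem kern_succ (j : Fin 2) (t : ℝ) (x : Plane) :
    kern j.succ t x = -(x j / (2 * t)) * heatKernel t x := rfl

theorem measurable_kern (i : Fin 3) : Measurable fun p : ℝ × Plane => kern i p.1 p.2 := by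
  refine Fin.cases ?_ (fun j => ?_) i
  · exact measurable_heatKernel
  · have := measurable_heatKernel
    simp only [kern_succ]
    refine Measurable.mul ?_ this
    refine (Measurable.div ?_ (by fun_prop)).neg
    exact (EuclideanSpace.proj (𝕜 := ℝ) j).continuous.measurable.comp measurable_snd

theorem hasFDerivAt_heatKernel (t : ℝ) (x : Plane) :
    HasFDerivAt (heatKernel t) ((-(1 / (2 * t)) * heatKernel t x) • innerSL ℝ x) x := by
  unfold heatKernel
  have h1 : HasFDerivAt (fun x : Plane => ‖x‖ ^ 2) (2 • innerSL ℝ x) x :=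
    (hasStrictFDerivAt_norm_sq x).hasFDerivAt
  have h2 := (((h1.neg.mul_const (4 * t)⁻¹).exp).const_mul ((4 * Real.pi * t)⁻¹))
  refine (h2.congr_fderiv ?_).congr_of_eventuallyEq (Eventually.of_forall fun y => ?_)
  · ext v
    simp [div_eq_mul_inv]
    ring
  · simp [div_eq_mul_inv]

theorem hasFDerivAt_kern_succ (j : Fin 2) (t : ℝ) (x : Plane) :
    HasFDerivAt (kern j.succ t) ((-(1 / (2 * t)) * heatKernel t x) • (EuclideanSpace.proj j : Plane →L[ℝ] ℝ) +
      (-(x j / (2 * t))) • ((-(1 / (2 * t)) * heatKernel t x) • innerSL ℝ x)) x := by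
  have h1 : HasFDerivAt (fun x : Plane => x j) (EuclideanSpace.proj j : Plane →L[ℝ] ℝ) x :=
    (EuclideanSpace.proj j : Plane →L[ℝ] ℝ).hasFDerivAt
  have h2 := ((h1.mul_const (2 * t)⁻¹).neg).mul (hasFDerivAt_heatKernel t x)
  refine (h2.congr_fderiv ?_).congr_of_eventuallyEq (Eventually.of_forall fun y => ?_)
  · ext v
    simp [div_eq_mul_inv]
    ring
  · simp [div_eq_mul_inv]

theorem fderiv_heatKernel_single (t : ℝ) (j : Fin 2) (x : Plane) :
    fderiv ℝ (heatKernel t) x (EuclideanSpace.single j 1) = kern j.succ t x := by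
  rw [(hasFDerivAt_heatKernel t x).fderiv]
  simp [EuclideanSpace.inner_single_right]
  ring

theorem abs_coord_le (x : Plane) (j : Fin 2) : |x j| ≤ ‖x‖ := by
  simpa using PiLp.norm_apply_le x j

theorem abs_kern_succ_le {t : ℝ} (ht : 0 < t) (j : Fin 2) (x : Plane) :
    |kern j.succ t x| ≤ 2 / √t * heatKernel (2 * t) x := by
  have hs : √t * √t = t := Real.mul_self_sqrt ht.le
  have hs0 : 0 < √t := Real.sqrt_pos.2 ht
  have hK := heatKernel_nonneg ht.le x
  rw [kern_succ, abs_mul, abs_neg, abs_div, abs_of_nonneg hK, abs_of_pos (by positivity : 0 < 2 * t)]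
  calc |x j| / (2 * t) * heatKernel t x ≤ ‖x‖ / (2 * t) * heatKernel t x := by
        gcongr; exact abs_coord_le x j
    _ = (‖x‖ * heatKernel t x) / (2 * t) := by ring
    _ ≤ (4 * √t * heatKernel (2 * t) x) / (2 * t) :=
        div_le_div_of_nonneg_right (norm_mul_heatKernel_le ht x) (by positivity)
    _ = (4 * √t / (2 * (√t * √t))) * heatKernel (2 * t) x := by rw [hs]; ring
    _ = _ := by congr 1; field_simp; norm_num

theorem norm_fderiv_heatKernel_le {t : ℝ} (ht : 0 < t) (x : Plane) :
    ‖fderiv ℝ (heatKernel t) x‖ ≤ 2 / √t * heatKernel (2 * t) x := by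
  have hs : √t * √t = t := Real.mul_self_sqrt ht.le
  have hs0 : 0 < √t := Real.sqrt_pos.2 ht
  have hK := heatKernel_nonneg ht.le x
  rw [(hasFDerivAt_heatKernel t x).fderiv, norm_smul, innerSL_apply_norm, norm_mul, norm_neg,
    Real.norm_of_nonneg hK, Real.norm_of_nonneg (by positivity : 0 ≤ 1 / (2 * t))]
  calc _ = (‖x‖ * heatKernel t x) / (2 * t) := by ring
    _ ≤ (4 * √t * heatKernel (2 * t) x) / (2 * t) :=
        div_le_div_of_nonneg_right (norm_mul_heatKernel_le ht x) (by positivity)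
    _ = (4 * √t / (2 * (√t * √t))) * heatKernel (2 * t) x := by rw [hs]; ring
    _ = _ := by congr 1; field_simp; norm_num

theorem norm_fderiv_kern_succ_le {t : ℝ} (ht : 0 < t) (j : Fin 2) (x : Plane) :
    ‖fderiv ℝ (kern j.succ t) x‖ ≤ 5 / t * heatKernel (2 * t) x := by
  have hK := heatKernel_nonneg ht.le x
  rw [(hasFDerivAt_kern_succ j t x).fderiv]
  have hp : ‖(EuclideanSpace.proj j : Plane →L[ℝ] ℝ)‖ ≤ 1 :=
    ContinuousLinearMap.opNorm_le_bound _ zero_le_one fun v => by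
      simpa using abs_coord_le v j
  refine (norm_add_le _ _).trans ?_
  rw [norm_smul, norm_smul, norm_smul, innerSL_apply_norm, norm_mul, norm_neg,
    Real.norm_of_nonneg hK, Real.norm_of_nonneg (by positivity : 0 ≤ 1 / (2 * t)), norm_neg, norm_div,
    Real.norm_of_nonneg (by positivity : 0 ≤ 2 * t), Real.norm_eq_abs]
  have h1 := heatKernel_le_two_mul ht x
  have h2 := norm_sq_mul_heatKernel_le ht x
  calc _ ≤ 1 / (2 * t) * heatKernel t x * 1 + ‖x‖ / (2 * t) * (1 / (2 * t) * heatKernel t x * ‖x‖) := by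
        gcongr; exact abs_coord_le x j
    _ = 1 / (2 * t) * heatKernel t x + (‖x‖ ^ 2 * heatKernel t x) / (4 * t ^ 2) := by
        field_simp; ring
    _ ≤ 1 / (2 * t) * (2 * heatKernel (2 * t) x) + (16 * t * heatKernel (2 * t) x) / (4 * t ^ 2) := by
        gcongr
    _ = _ := by field_simp; ring

theorem differentiable_kern (i : Fin 3) (t : ℝ) : Differentiable ℝ (kern i t) := by
  refine Fin.cases ?_ (fun j => ?_) i
  · exact fun x => (hasFDerivAt_heatKernel t x).differentiableAt
  · exact fun x => (hasFDerivAt_kern_succ j t x).differentiableAt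

theorem abs_sub_le_of_fderiv_le {k : Plane → ℝ} (hk : Differentiable ℝ k) {t c : ℝ} (ht : 0 < t)
    (hc : 0 ≤ c) (h : ∀ x, ‖fderiv ℝ k x‖ ≤ c * heatKernel (2 * t) x) {w u : Plane}
    (hu : ‖u - w‖ ≤ √t) : |k u - k w| ≤ 4 * c * ‖u - w‖ * heatKernel (4 * t) w := by
  have := (convex_closedBall w (√t)).norm_image_sub_le_of_norm_fderiv_le (𝕜 := ℝ) (f := k)
    (C := c * (4 * heatKernel (4 * t) w)) (fun x _ => hk x) (fun x hx => (h x).trans (by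
      gcongr
      exact heatKernel_shift_le ht (by simpa [dist_eq_norm] using hx)))
    (Metric.mem_closedBall_self (by positivity)) (y := u) (by simpa [dist_eq_norm] using hu)
  rw [Real.norm_eq_abs] at this
  linarith

theorem abs_heatKernel_sub_le {t : ℝ} (ht : 0 < t) {w u : Plane} (hu : ‖u - w‖ ≤ √t) :
    |heatKernel t u - heatKernel t w| ≤ 8 / √t * ‖u - w‖ * heatKernel (4 * t) w := by
  have := abs_sub_le_of_fderiv_le (differentiable_kern 0 t) ht (by positivity)
    (norm_fderiv_heatKernel_le ht) hu
  simp only [kern_zero] at this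
  convert this using 1
  ring

/-- Bound on `kern i t` that is uniform in `i`. -/
theorem abs_kern_le {t T : ℝ} (ht : 0 < t) (hT : t ≤ T) (i : Fin 3) (x : Plane) :
    |kern i t x| ≤ 4 * (1 + √T) / √t * heatKernel (4 * t) x := by
  have hs0 : 0 < √t := Real.sqrt_pos.2 ht
  have hsT : √t ≤ √T := Real.sqrt_le_sqrt hT
  have hK := heatKernel_nonneg (by positivity : 0 ≤ 4 * t) x
  have h42 : heatKernel (2 * t) x ≤ 2 * heatKernel (4 * t) x := by
    have := heatKernel_le_two_mul (by positivity : 0 < 2 * t) x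
    rwa [show 2 * (2 * t) = 4 * t by ring] at this
  have h1 : 1 ≤ √T / √t := by rw [le_div_iff₀ hs0]; linarith
  refine Fin.cases ?_ (fun j => ?_) i
  · rw [kern_zero, abs_of_nonneg (heatKernel_nonneg ht.le x)]
    calc heatKernel t x ≤ 4 * 1 * heatKernel (4 * t) x := by
          linarith [heatKernel_le_two_mul ht x]
      _ ≤ 4 * (1 + √T) / √t * heatKernel (4 * t) x := by
          gcongr
          rw [mul_div_assoc, add_div]
          gcongr
          have : 0 ≤ 1 / √t := by positivity
          linarith
  · refine (abs_kern_succ_le ht j x).trans ?_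
    calc 2 / √t * heatKernel (2 * t) x ≤ 2 / √t * (2 * heatKernel (4 * t) x) := by gcongr
      _ = 4 * (1 + 0) / √t * heatKernel (4 * t) x := by ring
      _ ≤ _ := by gcongr; positivity

/-- Increment bound on `kern i t` that is uniform in `i`. -/
theorem abs_kern_sub_le {t T : ℝ} (ht : 0 < t) (hT : t ≤ T) (i : Fin 3) {w u : Plane}
    (hu : ‖u - w‖ ≤ √t) :
    |kern i t u - kern i t w| ≤ 20 * (1 + √T) / t * ‖u - w‖ * heatKernel (4 * t) w := by
  have hs : √t * √t = t := Real.mul_self_sqrt ht.le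
  have hs0 : 0 < √t := Real.sqrt_pos.2 ht
  have hsT : √t ≤ √T := Real.sqrt_le_sqrt hT
  have hK := heatKernel_nonneg (by positivity : 0 ≤ 4 * t) w
  refine Fin.cases ?_ (fun j => ?_) i
  · refine (abs_heatKernel_sub_le ht hu).trans ?_
    have : 8 / √t ≤ 20 * (1 + √T) / t := by
      rw [div_le_div_iff₀ hs0 ht]
      nth_rw 1 [← hs]
      nlinarith [mul_pos hs0 hs0]
    gcongr
  · have := abs_sub_le_of_fderiv_le (differentiable_kern j.succ t) ht (by positivity)
      (norm_fderiv_kern_succ_le ht j) hu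
    refine this.trans ?_
    have : 4 * (5 / t) ≤ 20 * (1 + √T) / t := by
      rw [← mul_div_assoc]
      refine div_le_div_of_nonneg_right ?_ ht.le
      nlinarith [Real.sqrt_nonneg T]
    gcongr

/-! ### Weighted square-integrable functions -/

theorem sq_lintegral_mul_le {α : Type*} [MeasurableSpace α] (μ : Measure α) {f g : α → ℝ≥0∞}
    (hf : AEMeasurable f μ) (hg : AEMeasurable g μ) :
    (∫⁻ a, f a * g a ∂μ) ^ 2 ≤ (∫⁻ a, f a ∂μ) * ∫⁻ a, f a * g a ^ 2 ∂μ := by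
  have h := ENNReal.lintegral_mul_le_Lp_mul_Lq μ (p := 2) (q := 2) Real.HolderConjugate.two_two
    (hf.pow_const (1 / 2 : ℝ)) ((hf.pow_const (1 / 2 : ℝ)).mul hg)
  have e1 : ∀ a, f a ^ (1 / 2 : ℝ) * f a ^ (1 / 2 : ℝ) = f a := fun a => by
    rw [← ENNReal.rpow_add_of_nonneg _ _ (by norm_num) (by norm_num)]; norm_num
  have e2 : ∀ a, (f a ^ (1 / 2 : ℝ)) ^ (2 : ℝ) = f a := fun a => by
    rw [← ENNReal.rpow_mul]; norm_num
  simp only [Pi.mul_apply, ← mul_assoc, e1] at h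
  simp only [e2, ENNReal.mul_rpow_of_nonneg _ _ (zero_le_two : (0 : ℝ) ≤ 2), ENNReal.rpow_two] at h
  calc _ ≤ ((∫⁻ a, f a ∂μ) ^ (1 / 2 : ℝ) * (∫⁻ a, f a * g a ^ 2 ∂μ) ^ (1 / 2 : ℝ)) ^ 2 := by gcongr
    _ = _ := by
      rw [mul_pow, ← ENNReal.rpow_two, ← ENNReal.rpow_two, ← ENNReal.rpow_mul, ← ENNReal.rpow_mul]
      norm_num

/-- The density `e_l(x)⁻¹`. -/
def ew (l : ℝ) (x : Plane) : ℝ≥0∞ := ofReal (Real.exp (-(l * (1 + ‖x‖))))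

theorem measurable_ew (l : ℝ) : Measurable (ew l) := by unfold ew; fun_prop

theorem ew_ne_zero (l : ℝ) (x : Plane) : ew l x ≠ 0 := by simp [ew, Real.exp_pos]

theorem ew_ne_top (l : ℝ) (x : Plane) : ew l x ≠ ⊤ := by simp [ew]

theorem ew_antitone {l l' : ℝ} (h : l ≤ l') (x : Plane) : ew l' x ≤ ew l x := by
  unfold ew
  gcongr

theorem ew_eq_inv (l : ℝ) (x : Plane) : ew l x = (ofReal (expWeight l x))⁻¹ := by
  rw [ew, expWeight, Real.exp_neg, ENNReal.ofReal_inv_of_pos (Real.exp_pos _)]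

theorem ew_le_mul (l : ℝ) (x y : Plane) :
    ew l x ≤ ofReal (Real.exp (|l| * ‖x - y‖)) * ew l y := by
  unfold ew
  rw [← ofReal_mul (Real.exp_pos _).le, ← Real.exp_add]
  gcongr
  have h1 : |‖x‖ - ‖y‖| ≤ ‖x - y‖ := abs_norm_sub_norm_le x y
  have h2 : l * (‖y‖ - ‖x‖) ≤ |l| * ‖x - y‖ := by
    calc _ ≤ |l * (‖y‖ - ‖x‖)| := le_abs_self _
      _ = |l| * |‖x‖ - ‖y‖| := by rw [abs_mul, abs_sub_comm]
      _ ≤ _ := by gcongr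
  linarith

/-- The measure `e_l(x)⁻¹ dx`. -/
def expMeas (l : ℝ) : Measure Plane :=
  volume.withDensity fun x => ofReal (Real.exp (-(l * (1 + ‖x‖))))

instance (l : ℝ) : SigmaFinite (expMeas l) := by unfold expMeas; infer_instance

theorem lintegral_expMeas (l : ℝ) (F : Plane → ℝ≥0∞) :
    ∫⁻ x, F x ∂(expMeas l) = ∫⁻ x, ew l x * F x := by
  refine (lintegral_withDensity_eq_lintegral_mul_non_measurable _ (measurable_ew l) ?_ F).trans ?_
  rotate_left
  · rfl
  · exact Eventually.of_forall fun x => (ew_ne_top l x).lt_top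

theorem eLpNorm_two_sq {α : Type*} [MeasurableSpace α] (μ : Measure α) {ε : Type*} [ENorm ε] (f : α → ε) :
    eLpNorm f 2 μ ^ 2 = ∫⁻ x, ‖f x‖ₑ ^ 2 ∂μ := by
  rw [eLpNorm_eq_lintegral_rpow_enorm_toReal (by simp) (by simp), ← ENNReal.rpow_two, ← ENNReal.rpow_mul]
  simp

theorem expMeas_absolutelyContinuous (l : ℝ) : expMeas l ≪ volume :=
  withDensity_absolutelyContinuous _ _

theorem absolutelyContinuous_expMeas (l : ℝ) : (volume : Measure Plane) ≪ expMeas l :=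
  withDensity_absolutelyContinuous' (measurable_ew l).aemeasurable
    (Eventually.of_forall fun x => ew_ne_zero l x)

theorem l2Norm_eq_eLpNorm (l : ℝ) (v : Plane → ℝ) :
    l2Norm (expWeight l) v = eLpNorm v 2 (expMeas l) := by
  rw [l2Norm, eLpNorm_eq_lintegral_rpow_enorm_toReal (by simp) (by simp), lintegral_expMeas]
  simp only [ENNReal.toReal_ofNat, ENNReal.rpow_two]
  congr 1
  refine lintegral_congr fun x => ?_
  rw [ew_eq_inv, div_eq_mul_inv, mul_comm]

/-- Convolution of the heat kernel with an extended nonnegative function. -/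
def kconv (t : ℝ) (F : Plane → ℝ≥0∞) (x : Plane) : ℝ≥0∞ :=
  ∫⁻ y, ofReal (heatKernel t (x - y)) * F y

theorem measurable_kconv (t : ℝ) {F : Plane → ℝ≥0∞} (hF : Measurable F) : Measurable (kconv t F) := by
  unfold kconv
  refine Measurable.lintegral_prod_right' (f := fun p : Plane × Plane =>
    ofReal (heatKernel t (p.1 - p.2)) * F p.2) ?_
  have := (continuous_heatKernel t).measurable
  fun_prop

theorem lintegral_kconv_sq_le {l t : ℝ} (ht : 0 < t) {F : Plane → ℝ≥0∞} (hF : Measurable F) :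
    ∫⁻ x, kconv t F x ^ 2 ∂(expMeas l) ≤
      ofReal (2 * Real.exp (2 * l ^ 2 * t)) * ∫⁻ x, F x ^ 2 ∂(expMeas l) := by
  have hK := (continuous_heatKernel t).measurable
  have hew := measurable_ew l
  have hone : ∀ x, ∫⁻ y, ofReal (heatKernel t (x - y)) = 1 := fun x => by
    rw [lintegral_sub_left_eq_self (fun y => ofReal (heatKernel t y)) x, lintegral_heatKernel ht]
  calc ∫⁻ x, kconv t F x ^ 2 ∂(expMeas l)
      ≤ ∫⁻ x, ∫⁻ y, ofReal (heatKernel t (x - y)) * F y ^ 2 ∂volume ∂(expMeas l) := by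
        refine lintegral_mono fun x => ?_
        have := sq_lintegral_mul_le volume (f := fun y => ofReal (heatKernel t (x - y))) (g := F)
          (by fun_prop) hF.aemeasurable
        rwa [hone, one_mul] at this
    _ = ∫⁻ x, ∫⁻ y, ew l x * (ofReal (heatKernel t (x - y)) * F y ^ 2) := by
        rw [lintegral_expMeas]
        refine lintegral_congr fun x => ?_
        rw [lintegral_const_mul]
        fun_prop
    _ ≤ ∫⁻ x, ∫⁻ y, ofReal (2 * Real.exp (2 * l ^ 2 * t)) *
          (ofReal (heatKernel (2 * t) (x - y)) * (ew l y * F y ^ 2)) := by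
        refine lintegral_mono fun x => lintegral_mono fun y => ?_
        calc _ ≤ (ofReal (Real.exp (|l| * ‖x - y‖)) * ew l y) *
              (ofReal (heatKernel t (x - y)) * F y ^ 2) := by gcongr; exact ew_le_mul l x y
          _ = ofReal (heatKernel t (x - y) * Real.exp (|l| * ‖x - y‖)) * (ew l y * F y ^ 2) := by
              rw [ofReal_mul (heatKernel_nonneg ht.le _)]; ring
          _ ≤ ofReal (2 * Real.exp (2 * l ^ 2 * t) * heatKernel (2 * t) (x - y)) *
              (ew l y * F y ^ 2) := by
              have := heatKernel_mul_exp_le ht |l| (x - y)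
              rw [sq_abs] at this
              exact mul_le_mul_left (ofReal_le_ofReal this) _
          _ = _ := by rw [ofReal_mul (by positivity)]; ring
    _ = ofReal (2 * Real.exp (2 * l ^ 2 * t)) * ∫⁻ x, ∫⁻ y,
          (ofReal (heatKernel (2 * t) (x - y)) * (ew l y * F y ^ 2)) := by
        have hK2 := (continuous_heatKernel (2 * t)).measurable
        rw [← lintegral_const_mul]
        · refine lintegral_congr fun x => ?_
          rw [lintegral_const_mul]
          fun_prop
        · refine Measurable.lintegral_prod_right' (f := fun p : Plane × Plane =>
            ofReal (heatKernel (2 * t) (p.1 - p.2)) * (ew l p.2 * F p.2 ^ 2)) ?_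
          fun_prop
    _ = _ := by
        have hK2 := (continuous_heatKernel (2 * t)).measurable
        congr 1
        rw [lintegral_lintegral_swap (by fun_prop), lintegral_expMeas]
        refine lintegral_congr fun y => ?_
        rw [lintegral_mul_const _ (by fun_prop)]
        rw [lintegral_sub_right_eq_self (fun x => ofReal (heatKernel (2 * t) x)) y,
          lintegral_heatKernel (by positivity), one_mul]

theorem kconv_lt_top {l t : ℝ} (ht : 0 < t) {F : Plane → ℝ≥0∞} (hF : Measurable F)
    (h : ∫⁻ x, F x ^ 2 ∂(expMeas l) < ⊤) (x : Plane) : kconv t F x < ⊤ := by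
  have hK := (continuous_heatKernel t).measurable
  have hone : ∫⁻ y, ofReal (heatKernel t (x - y)) = 1 := by
    rw [lintegral_sub_left_eq_self (fun y => ofReal (heatKernel t y)) x, lintegral_heatKernel ht]
  have h1 := sq_lintegral_mul_le volume (f := fun y => ofReal (heatKernel t (x - y))) (g := F)
    (by fun_prop) hF.aemeasurable
  rw [hone, one_mul] at h1
  have h2 : ∀ y, ofReal (heatKernel t (x - y)) ≤
      ofReal ((4 * Real.pi * t)⁻¹ * Real.exp (l ^ 2 * t + |l| * (1 + ‖x‖))) * ew l y := by
    intro y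
    unfold ew
    rw [← ofReal_mul (by positivity)]
    apply ofReal_le_ofReal
    unfold heatKernel
    rw [mul_assoc ((4 * Real.pi * t)⁻¹), ← Real.exp_add]
    refine mul_le_mul_of_nonneg_left (Real.exp_le_exp.2 ?_) (by positivity)
    have h3 : ‖y‖ ≤ ‖x‖ + ‖x - y‖ := by
      calc ‖y‖ = ‖x - (x - y)‖ := by congr 1; abel
        _ ≤ _ := norm_sub_le _ _
    have h4 : l * (1 + ‖y‖) ≤ |l| * (1 + (‖x‖ + ‖x - y‖)) := by
      calc l * (1 + ‖y‖) ≤ |l| * (1 + ‖y‖) := by gcongr; exact le_abs_self l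
        _ ≤ _ := by gcongr
    have h5 : |l| * ‖x - y‖ ≤ l ^ 2 * t + ‖x - y‖ ^ 2 / (4 * t) := by
      have : l ^ 2 * t + ‖x - y‖ ^ 2 / (4 * t) - |l| * ‖x - y‖ = (2 * |l| * t - ‖x - y‖) ^ 2 / (4 * t) := by
        rw [← sq_abs l]; field_simp; ring
      have h6 : 0 ≤ (2 * |l| * t - ‖x - y‖) ^ 2 / (4 * t) := by positivity
      linarith
    have : -‖x - y‖ ^ 2 / (4 * t) = -(‖x - y‖ ^ 2 / (4 * t)) := by ring
    linarith
  have h3 : kconv t F x ^ 2 < ⊤ := by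
    refine h1.trans_lt ?_
    calc _ ≤ ∫⁻ y, ofReal ((4 * Real.pi * t)⁻¹ * Real.exp (l ^ 2 * t + |l| * (1 + ‖x‖))) *
          (ew l y * F y ^ 2) := by
          refine lintegral_mono fun y => ?_
          rw [← mul_assoc]
          gcongr
          exact h2 y
      _ < ⊤ := by
          have hew := measurable_ew l
          rw [lintegral_const_mul _ (by fun_prop), ← lintegral_expMeas]
          exact mul_lt_top ofReal_lt_top h
  by_contra hc
  simp only [not_lt, top_le_iff] at hc
  simp [hc] at h3

/-! ### Radial integrals -/

theorem lintegral_comp_smul_plane {r : ℝ} (hr : 0 < r) (F : Plane → ℝ≥0∞) :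
    ∫⁻ z, F z = ofReal (r ^ 2) * ∫⁻ z, F (r • z) := by
  have he : MeasurableEmbedding fun z : Plane => r • z :=
    (Homeomorph.smulOfNeZero r hr.ne').measurableEmbedding
  have h := he.lintegral_map (μ := volume) F
  rw [Measure.map_addHaar_smul _ hr.ne', lintegral_smul_measure] at h
  rw [← h, smul_eq_mul, ← mul_assoc, ← ofReal_mul (by positivity)]
  simp only [finrank_euclideanSpace, Fintype.card_fin]
  rw [abs_of_pos (by positivity), mul_inv_cancel₀ (by positivity)]
  simp

/-- `|z|^{-p}` restricted to the ball of radius `r`. -/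
def near (p r : ℝ) (z : Plane) : ℝ≥0∞ := if ‖z‖ ≤ r then ofReal (‖z‖ ^ (-p)) else 0

/-- `|z|^{-p}` restricted to the complement of the ball of radius `r`. -/
def far (p r : ℝ) (z : Plane) : ℝ≥0∞ := if r < ‖z‖ then ofReal (‖z‖ ^ (-p)) else 0

theorem measurable_near (p r : ℝ) : Measurable (near p r) := by
  unfold near
  exact Measurable.ite (measurableSet_le measurable_norm measurable_const) (by fun_prop) measurable_const

theorem measurable_far (p r : ℝ) : Measurable (far p r) := by
  unfold far
  exact Measurable.ite (measurableSet_lt measurable_const measurable_norm) (by fun_prop) measurable_const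

theorem ofReal_rpow_smul {r : ℝ} (hr : 0 < r) (p : ℝ) (z : Plane) :
    ofReal (‖r • z‖ ^ (-p)) = ofReal (r ^ (-p)) * ofReal (‖z‖ ^ (-p)) := by
  rw [norm_smul, Real.norm_of_nonneg hr.le, Real.mul_rpow hr.le (norm_nonneg _),
    ofReal_mul (by positivity)]

theorem ofReal_sq_mul_rpow {r : ℝ} (hr : 0 < r) (p : ℝ) :
    ofReal (r ^ 2) * ofReal (r ^ (-p)) = ofReal (r ^ (2 - p)) := by
  rw [← ofReal_mul (by positivity), ← Real.rpow_two, ← Real.rpow_add hr, sub_eq_add_neg]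

theorem lintegral_near {p r : ℝ} (hr : 0 < r) :
    ∫⁻ z, near p r z = ofReal (r ^ (2 - p)) * ∫⁻ z, near p 1 z := by
  rw [lintegral_comp_smul_plane hr, ← ofReal_sq_mul_rpow hr, mul_assoc,
    ← lintegral_const_mul _ (measurable_near p 1)]
  congr 1
  refine lintegral_congr fun z => ?_
  have : ‖r • z‖ ≤ r ↔ ‖z‖ ≤ 1 := by
    rw [norm_smul, Real.norm_of_nonneg hr.le]
    exact mul_le_iff_le_one_right hr
  simp only [near, this, ofReal_rpow_smul hr]
  split_ifs <;> simp

theorem lintegral_far {p r : ℝ} (hr : 0 < r) :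
    ∫⁻ z, far p r z = ofReal (r ^ (2 - p)) * ∫⁻ z, far p 1 z := by
  rw [lintegral_comp_smul_plane hr, ← ofReal_sq_mul_rpow hr, mul_assoc,
    ← lintegral_const_mul _ (measurable_far p 1)]
  congr 1
  refine lintegral_congr fun z => ?_
  have : r < ‖r • z‖ ↔ 1 < ‖z‖ := by
    rw [norm_smul, Real.norm_of_nonneg hr.le]
    exact lt_mul_iff_one_lt_right hr
  simp only [far, this, ofReal_rpow_smul hr]
  split_ifs <;> simp

theorem lintegral_near_lt_top {p : ℝ} (hp : p < 2) : ∫⁻ z, near p 1 z < ⊤ := by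
  have h : Integrable (fun z : Plane => (fun s : ℝ => if s ≤ 1 then s ^ (-p) else 0) ‖z‖) := by
    refine (integrable_fun_norm_addHaar (E := Plane) volume
      (f := fun s : ℝ => if s ≤ 1 then s ^ (-p) else 0)).2 ?_
    have h1 : IntegrableOn (fun y : ℝ => y ^ (1 - p)) (Ioc 0 1) := by
      rw [integrableOn_Ioc_iff_integrableOn_Ioo]
      exact (intervalIntegral.integrableOn_Ioo_rpow_iff one_pos).2 (by linarith)
    have h2 := (integrable_indicator_iff measurableSet_Ioc).2 h1
    refine h2.integrableOn.congr_fun (fun y hy => ?_) measurableSet_Ioi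
    have hy' : (0 : ℝ) < y := hy
    simp only [finrank_euclideanSpace, Fintype.card_fin, smul_eq_mul]
    by_cases h : y ≤ 1
    · rw [Set.indicator_of_mem (by exact ⟨hy', h⟩)]
      simp only [h, if_true]
      rw [sub_eq_add_neg, Real.rpow_add hy', Real.rpow_one]
      norm_num
    · rw [Set.indicator_of_notMem (fun h' => h h'.2)]
      simp [h]
  refine lt_of_eq_of_lt (lintegral_congr fun z => ?_) h.lintegral_lt_top
  simp only [near]
  split_ifs <;> simp

theorem lintegral_far_lt_top {p : ℝ} (hp : 2 < p) : ∫⁻ z, far p 1 z < ⊤ := by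
  have h : Integrable (fun z : Plane => (fun s : ℝ => if 1 < s then s ^ (-p) else 0) ‖z‖) := by
    refine (integrable_fun_norm_addHaar (E := Plane) volume
      (f := fun s : ℝ => if 1 < s then s ^ (-p) else 0)).2 ?_
    have h1 : IntegrableOn (fun y : ℝ => y ^ (1 - p)) (Set.Ioi 1) :=
      integrableOn_Ioi_rpow_of_lt (by linarith) one_pos
    have h2 := (integrable_indicator_iff measurableSet_Ioi).2 h1
    refine h2.integrableOn.congr_fun (fun y hy => ?_) measurableSet_Ioi
    have hy' : (0 : ℝ) < y := hy
    simp only [finrank_euclideanSpace, Fintype.card_fin, smul_eq_mul]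
    by_cases h : 1 < y
    · rw [Set.indicator_of_mem (by exact h)]
      simp only [h, if_true]
      rw [sub_eq_add_neg, Real.rpow_add hy', Real.rpow_one]
      norm_num
    · rw [Set.indicator_of_notMem (show y ∉ Set.Ioi 1 from h)]
      simp [h]
  refine lt_of_eq_of_lt (lintegral_congr fun z => ?_) h.lintegral_lt_top
  simp only [far]
  split_ifs <;> simp

/-! ### The weighted Sobolev–Slobodeckij norm of order `2κ` -/

/-- The measure `1_{|x-y|<1} |x-y|^{-2-4κ} e_l(x)⁻¹ dx dy`. -/
def slobMeas (κ l : ℝ) : Measure (Plane × Plane) :=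
  (volume.prod volume).withDensity fun p => ofReal
    (if ‖p.1 - p.2‖ < 1 then ‖p.1 - p.2‖ ^ (-(2 + 4 * κ)) * Real.exp (-(l * (1 + ‖p.1‖))) else 0)

instance (κ l : ℝ) : SigmaFinite (slobMeas κ l) := by unfold slobMeas; infer_instance

/-- The density of `slobMeas`. -/
def sd (κ l : ℝ) (x y : Plane) : ℝ≥0∞ :=
  ofReal (if ‖x - y‖ < 1 then ‖x - y‖ ^ (-(2 + 4 * κ)) * Real.exp (-(l * (1 + ‖x‖))) else 0)

theorem measurable_sd (κ l : ℝ) : Measurable fun p : Plane × Plane => sd κ l p.1 p.2 := by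
  unfold sd
  exact (Measurable.ite (measurableSet_lt (by fun_prop) measurable_const) (by fun_prop)
    measurable_const).ennreal_ofReal

theorem sd_eq {κ l : ℝ} {x y : Plane} (h : ‖x - y‖ < 1) :
    sd κ l x y = ofReal (‖x - y‖ ^ (-(2 + 4 * κ))) * ew l x := by
  rw [sd, if_pos h, ew, ofReal_mul (by positivity)]

theorem sd_eq_zero {κ l : ℝ} {x y : Plane} (h : ¬ ‖x - y‖ < 1) : sd κ l x y = 0 := by
  rw [sd, if_neg h, ENNReal.ofReal_zero]

theorem sd_antitone {κ l l' : ℝ} (h : l ≤ l') (x y : Plane) : sd κ l' x y ≤ sd κ l x y := by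
  by_cases hxy : ‖x - y‖ < 1
  · rw [sd_eq hxy, sd_eq hxy]; gcongr; exact ew_antitone h x
  · rw [sd_eq_zero hxy]; exact zero_le

theorem slobMeas_absolutelyContinuous (κ l : ℝ) :
    slobMeas κ l ≪ (volume : Measure Plane).prod volume :=
  withDensity_absolutelyContinuous _ _

theorem lintegral_slobMeas (κ l : ℝ) {F : Plane × Plane → ℝ≥0∞}
    (hF : AEMeasurable F ((volume : Measure Plane).prod volume)) :
    ∫⁻ p, F p ∂(slobMeas κ l) = ∫⁻ x, ∫⁻ y, sd κ l x y * F (x, y) := by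
  have h1 : ∫⁻ p, F p ∂(slobMeas κ l) = ∫⁻ p : Plane × Plane, sd κ l p.1 p.2 * F p := by
    refine (lintegral_withDensity_eq_lintegral_mul_non_measurable _ (measurable_sd κ l) ?_ F).trans ?_
    · exact Eventually.of_forall fun x => ofReal_lt_top
    · rfl
  rw [h1]
  exact lintegral_prod _ ((measurable_sd κ l).aemeasurable.mul hF)

/-- The weighted `H^{2κ}` norm. -/
def nrm (κ l : ℝ) (g : Plane → ℝ) : ℝ≥0∞ :=
  eLpNorm g 2 (expMeas l) + eLpNorm (fun p : Plane × Plane => g p.1 - g p.2) 2 (slobMeas κ l)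

theorem slob_le_of_bounds {κ l t c : ℝ} (ht : 0 < t) (hc : 0 ≤ c) {u : Plane → ℝ} (hu : Measurable u)
    {Q : Plane → ℝ≥0∞} (hQ : Measurable Q) (h1 : ∀ x, ‖u x‖ₑ ≤ ofReal (c / √t) * Q x)
    (h2 : ∀ x y, ‖x - y‖ ≤ √t → ‖u x - u y‖ₑ ≤ ofReal (c / t * ‖x - y‖) * Q x) :
    ∫⁻ p, ‖u p.1 - u p.2‖ₑ ^ 2 ∂(slobMeas κ l) ≤
      ofReal (c ^ 2 * t ^ (-(1 + 2 * κ))) * ((∫⁻ z, near (4 * κ) 1 z) +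
        2 * (1 + ofReal (Real.exp |l|)) * ∫⁻ z, far (2 + 4 * κ) 1 z) *
        ∫⁻ x, Q x ^ 2 ∂(expMeas l) := by
  have hs0 : 0 < √t := Real.sqrt_pos.2 ht
  have hew := measurable_ew l
  have hn := measurable_near (4 * κ) (√t)
  have hf := measurable_far (2 + 4 * κ) (√t)
  set E : ℝ≥0∞ := ofReal (Real.exp |l|) with hE
  set a : ℝ≥0∞ := ofReal (c ^ 2 / t ^ 2) with ha
  set b : ℝ≥0∞ := ofReal (2 * (c ^ 2 / t)) with hb
  set S := ∫⁻ x, Q x ^ 2 ∂(expMeas l) with hS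
  have key : ∀ x y, sd κ l x y * ‖u x - u y‖ₑ ^ 2 ≤
      a * (near (4 * κ) (√t) (x - y) * (ew l x * Q x ^ 2)) +
      b * (far (2 + 4 * κ) (√t) (x - y) * (ew l x * Q x ^ 2) +
        E * (far (2 + 4 * κ) (√t) (x - y) * (ew l y * Q y ^ 2))) := by
    intro x y
    by_cases hxy : ‖x - y‖ < 1
    swap
    · rw [sd_eq_zero hxy, zero_mul]; exact zero_le
    rw [sd_eq hxy]
    by_cases hxt : ‖x - y‖ ≤ √t
    · refine le_add_right ?_
      rcases eq_or_ne x y with rfl | hne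
      · simp
      have hpos : 0 < ‖x - y‖ := norm_pos_iff.2 (sub_ne_zero.2 hne)
      calc _ ≤ ofReal (‖x - y‖ ^ (-(2 + 4 * κ))) * ew l x *
            (ofReal (c / t * ‖x - y‖) * Q x) ^ 2 := by gcongr; exact h2 x y hxt
        _ = (ofReal (‖x - y‖ ^ (-(2 + 4 * κ))) * ofReal (c / t * ‖x - y‖) ^ 2) *
            (ew l x * Q x ^ 2) := by ring
        _ = a * near (4 * κ) (√t) (x - y) * (ew l x * Q x ^ 2) := by
            congr 1
            rw [near, if_pos hxt, ha, ← ENNReal.ofReal_pow (by positivity),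
              ← ofReal_mul (by positivity), ← ofReal_mul (by positivity)]
            congr 1
            have : ‖x - y‖ ^ (-(4 * κ)) = ‖x - y‖ ^ (-(2 + 4 * κ)) * ‖x - y‖ ^ 2 := by
              rw [← Real.rpow_two, ← Real.rpow_add hpos]; congr 1; ring
            rw [this]; ring
        _ = _ := by ring
    · refine le_add_left ?_
      push Not at hxt
      have hux : ‖u x - u y‖ₑ ^ 2 ≤ b * (Q x ^ 2 + Q y ^ 2) := by
        have e1 : ‖u x - u y‖ₑ ≤ ofReal (c / √t) * (Q x + Q y) := by
          calc ‖u x - u y‖ₑ ≤ ‖u x‖ₑ + ‖u y‖ₑ := enorm_sub_le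
            _ ≤ _ := by rw [mul_add]; exact add_le_add (h1 x) (h1 y)
        have e2 : (Q x + Q y) ^ 2 ≤ 2 * (Q x ^ 2 + Q y ^ 2) := by

          have h := ENNReal.rpow_add_le_mul_rpow_add_rpow (Q x) (Q y) (p := 2) one_le_two
          simp only [ENNReal.rpow_two] at h
          refine h.trans (le_of_eq ?_)
          norm_num
        calc _ ≤ (ofReal (c / √t) * (Q x + Q y)) ^ 2 := by gcongr
          _ = ofReal (c / √t) ^ 2 * (Q x + Q y) ^ 2 := by ring
          _ ≤ ofReal (c / √t) ^ 2 * (2 * (Q x ^ 2 + Q y ^ 2)) := by gcongr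
          _ = _ := by
              rw [← mul_assoc]
              congr 1
              rw [← ENNReal.ofReal_pow (by positivity), div_pow, Real.sq_sqrt ht.le, hb,
                ofReal_mul zero_le_two, mul_comm]
              norm_num
      have hwy : ew l x ≤ E * ew l y := by
        refine (ew_le_mul l x y).trans ?_
        refine mul_le_mul_left (ofReal_le_ofReal (Real.exp_le_exp.2 ?_)) _
        calc |l| * ‖x - y‖ ≤ |l| * 1 := by gcongr
          _ = |l| := mul_one _
      rw [far, if_pos hxt]
      calc _ ≤ ofReal (‖x - y‖ ^ (-(2 + 4 * κ))) * ew l x * (b * (Q x ^ 2 + Q y ^ 2)) := by gcongr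
        _ = b * (ofReal (‖x - y‖ ^ (-(2 + 4 * κ))) * (ew l x * Q x ^ 2) +
            ofReal (‖x - y‖ ^ (-(2 + 4 * κ))) * (ew l x * Q y ^ 2)) := by ring
        _ ≤ b * (ofReal (‖x - y‖ ^ (-(2 + 4 * κ))) * (ew l x * Q x ^ 2) +
            ofReal (‖x - y‖ ^ (-(2 + 4 * κ))) * ((E * ew l y) * Q y ^ 2)) := by gcongr
        _ = _ := by ring
  rw [lintegral_slobMeas κ l (by fun_prop)]
  have i1 : ∀ g : Plane → ℝ≥0∞, Measurable g →
      ∫⁻ x, ∫⁻ y, g (x - y) * (ew l x * Q x ^ 2) = (∫⁻ z, g z) * S := by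
    intro g hg
    rw [hS, lintegral_expMeas, ← lintegral_const_mul _ (by fun_prop)]
    refine lintegral_congr fun x => ?_
    rw [lintegral_mul_const _ (by fun_prop), lintegral_sub_left_eq_self g x]
  have i2 : ∀ g : Plane → ℝ≥0∞, Measurable g →
      ∫⁻ x, ∫⁻ y, g (x - y) * (ew l y * Q y ^ 2) = (∫⁻ z, g z) * S := by
    intro g hg
    rw [lintegral_lintegral_swap (by fun_prop), hS, lintegral_expMeas,
      ← lintegral_const_mul _ (by fun_prop)]
    refine lintegral_congr fun x => ?_
    rw [lintegral_mul_const _ (by fun_prop), lintegral_sub_right_eq_self g x]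
  calc _ ≤ ∫⁻ x, ∫⁻ y, (a * (near (4 * κ) (√t) (x - y) * (ew l x * Q x ^ 2)) +
      b * (far (2 + 4 * κ) (√t) (x - y) * (ew l x * Q x ^ 2) +
        E * (far (2 + 4 * κ) (√t) (x - y) * (ew l y * Q y ^ 2)))) :=
        lintegral_mono fun x => lintegral_mono fun y => key x y
    _ = a * (∫⁻ x, ∫⁻ y, near (4 * κ) (√t) (x - y) * (ew l x * Q x ^ 2)) +
        b * ((∫⁻ x, ∫⁻ y, far (2 + 4 * κ) (√t) (x - y) * (ew l x * Q x ^ 2)) +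
        E * ∫⁻ x, ∫⁻ y, far (2 + 4 * κ) (√t) (x - y) * (ew l y * Q y ^ 2)) := by
        have m1 : Measurable fun p : Plane × Plane => near (4 * κ) (√t) (p.1 - p.2) * (ew l p.1 * Q p.1 ^ 2) := by
          fun_prop
        have m2 : Measurable fun p : Plane × Plane => far (2 + 4 * κ) (√t) (p.1 - p.2) * (ew l p.1 * Q p.1 ^ 2) := by
          fun_prop
        have m3 : Measurable fun p : Plane × Plane => far (2 + 4 * κ) (√t) (p.1 - p.2) * (ew l p.2 * Q p.2 ^ 2) := by
          fun_prop
        have n1 := m1.lintegral_prod_right' (ν := volume)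
        have n2 := m2.lintegral_prod_right' (ν := volume)
        have n3 := m3.lintegral_prod_right' (ν := volume)
        dsimp only at n1 n2 n3
        rw [← lintegral_const_mul _ n1, ← lintegral_const_mul E n3,
          ← lintegral_add_left n2, ← lintegral_const_mul b (f := fun x => (∫⁻ y, far (2 + 4 * κ) (√t) (x - y) *
            (ew l x * Q x ^ 2)) + E * ∫⁻ y, far (2 + 4 * κ) (√t) (x - y) * (ew l y * Q y ^ 2))
            (n2.add (n3.const_mul E)),
          ← lintegral_add_left (n1.const_mul a)]
        refine lintegral_congr fun x => ?_
        have m1' : Measurable fun y : Plane => near (4 * κ) (√t) (x - y) * (ew l x * Q x ^ 2) := by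
          fun_prop
        have m2' : Measurable fun y : Plane => far (2 + 4 * κ) (√t) (x - y) * (ew l x * Q x ^ 2) := by
          fun_prop
        have m3' : Measurable fun y : Plane => far (2 + 4 * κ) (√t) (x - y) * (ew l y * Q y ^ 2) := by
          fun_prop
        rw [lintegral_add_left (m1'.const_mul a), lintegral_const_mul _ m1', lintegral_const_mul b
          (f := fun y => far (2 + 4 * κ) (√t) (x - y) * (ew l x * Q x ^ 2) +
            E * (far (2 + 4 * κ) (√t) (x - y) * (ew l y * Q y ^ 2)))
          (m2'.add (m3'.const_mul E)), lintegral_add_left m2', lintegral_const_mul _ m3']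
    _ = _ := by
        rw [i1 _ hn, i1 _ hf, i2 _ hf, lintegral_near hs0, lintegral_far hs0]
        have e1 : a * ofReal (√t ^ (2 - 4 * κ)) = ofReal (c ^ 2 * t ^ (-(1 + 2 * κ))) := by
          rw [ha, ← ofReal_mul (by positivity)]
          congr 1
          rw [Real.sqrt_eq_rpow, ← Real.rpow_mul ht.le, div_eq_mul_inv, mul_assoc, ← Real.rpow_two t,
            ← Real.rpow_neg ht.le, ← Real.rpow_add ht]
          congr 2; ring
        have e2 : b * ofReal (√t ^ (2 - (2 + 4 * κ))) =
            2 * ofReal (c ^ 2 * t ^ (-(1 + 2 * κ))) := by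
          rw [hb, ← ofReal_mul (by positivity), ← ENNReal.ofReal_ofNat, ← ofReal_mul (by positivity)]
          congr 1
          rw [Real.sqrt_eq_rpow, ← Real.rpow_mul ht.le, div_eq_mul_inv, mul_assoc, mul_assoc, ← Real.rpow_neg_one t,
            ← Real.rpow_add ht]
          congr 3; ring
        calc _ = (a * ofReal (√t ^ (2 - 4 * κ))) * (∫⁻ z, near (4 * κ) 1 z) * S +
              (b * ofReal (√t ^ (2 - (2 + 4 * κ)))) * (∫⁻ z, far (2 + 4 * κ) 1 z) * ((1 + E) * S) := by
              ring
          _ = _ := by rw [e1, e2]; ring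

/-- Convolution with the heat kernel or one of its derivatives. -/
def hconv (i : Fin 3) (t : ℝ) (f : Plane → ℝ) (x : Plane) : ℝ := ∫ y, kern i t (x - y) * f y

theorem measurable_hconv (i : Fin 3) (t : ℝ) {f : Plane → ℝ} (hf : Measurable f) :
    Measurable (hconv i t f) := by
  have hk : Measurable (kern i t) := (measurable_kern i).comp (measurable_const.prodMk measurable_id)
  have : StronglyMeasurable fun p : Plane × Plane => kern i t (p.1 - p.2) * f p.2 :=
    (by fun_prop : Measurable _).stronglyMeasurable
  exact this.integral_prod_right.measurable

theorem integrable_kern_mul {l t : ℝ} (ht : 0 < t) (i : Fin 3) {f : Plane → ℝ} (hf : Measurable f)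
    (h : eLpNorm f 2 (expMeas l) < ⊤) (x : Plane) : Integrable fun y => kern i t (x - y) * f y := by
  have hk : Measurable (kern i t) := (measurable_kern i).comp (measurable_const.prodMk measurable_id)
  refine ⟨(by fun_prop : Measurable _).aestronglyMeasurable, ?_⟩
  have hQ := kconv_lt_top (l := l) (t := 4 * t) (by positivity) (F := fun y => ‖f y‖ₑ) (by fun_prop)
    (by rw [← eLpNorm_two_sq]; exact ENNReal.pow_lt_top h) x
  refine lt_of_le_of_lt ?_ (mul_lt_top (ofReal_lt_top (r := 4 * (1 + √t) / √t)) hQ)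
  have hK4 := (continuous_heatKernel (4 * t)).measurable
  rw [kconv, ← lintegral_const_mul _ (by fun_prop)]
  refine lintegral_mono fun y => ?_
  rw [enorm_mul, ← mul_assoc, ← ofReal_mul (by positivity)]
  gcongr
  rw [Real.enorm_eq_ofReal_abs]
  exact ofReal_le_ofReal (abs_kern_le ht le_rfl i _)

theorem enorm_hconv_le {t T : ℝ} (ht : 0 < t) (hT : t ≤ T) (i : Fin 3) {f : Plane → ℝ} (hf : Measurable f)
    (x : Plane) : ‖hconv i t f x‖ₑ ≤ ofReal (4 * (1 + √T) / √t) * kconv (4 * t) (fun y => ‖f y‖ₑ) x := by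
  have hK4 := (continuous_heatKernel (4 * t)).measurable
  refine (enorm_integral_le_lintegral_enorm _).trans ?_
  rw [kconv, ← lintegral_const_mul _ (by fun_prop)]
  refine lintegral_mono fun y => ?_
  rw [enorm_mul, ← mul_assoc, ← ofReal_mul (by positivity)]
  gcongr
  rw [Real.enorm_eq_ofReal_abs]
  exact ofReal_le_ofReal (abs_kern_le ht hT i _)

theorem enorm_hconv_sub_le {l t T : ℝ} (ht : 0 < t) (hT : t ≤ T) (i : Fin 3) {f : Plane → ℝ}
    (hf : Measurable f) (h : eLpNorm f 2 (expMeas l) < ⊤) (x y : Plane) (hxy : ‖x - y‖ ≤ √t) :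
    ‖hconv i t f x - hconv i t f y‖ₑ ≤
      ofReal (20 * (1 + √T) / t * ‖x - y‖) * kconv (4 * t) (fun y => ‖f y‖ₑ) x := by
  have hK4 := (continuous_heatKernel (4 * t)).measurable
  rw [hconv, hconv, ← integral_sub (integrable_kern_mul ht i hf h x) (integrable_kern_mul ht i hf h y)]
  refine (enorm_integral_le_lintegral_enorm _).trans ?_
  rw [kconv, ← lintegral_const_mul _ (by fun_prop)]
  refine lintegral_mono fun z => ?_
  rw [← sub_mul, enorm_mul, ← mul_assoc, ← ofReal_mul (by positivity)]
  gcongr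
  rw [Real.enorm_eq_ofReal_abs]
  have e : (y - z) - (x - z) = y - x := by abel
  have := abs_kern_sub_le ht hT i (w := x - z) (u := y - z) (by rwa [e, norm_sub_rev])
  rw [e, norm_sub_rev y x, abs_sub_comm] at this
  exact ofReal_le_ofReal this

theorem eLpNorm_hconv_zero_le {l t : ℝ} (ht : 0 < t) {f : Plane → ℝ} (hf : Measurable f) :
    eLpNorm (hconv 0 t f) 2 (expMeas l) ≤
      ofReal (2 * Real.exp (l ^ 2 * t)) * eLpNorm f 2 (expMeas l) := by
  have h1 : ∀ x, ‖hconv 0 t f x‖ₑ ≤ kconv t (fun y => ‖f y‖ₑ) x := fun x => by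
    refine (enorm_integral_le_lintegral_enorm _).trans (le_of_eq ?_)
    refine lintegral_congr fun y => ?_
    rw [enorm_mul, kern_zero, Real.enorm_eq_ofReal (heatKernel_nonneg ht.le _)]
  have h2 : eLpNorm (hconv 0 t f) 2 (expMeas l) ^ 2 ≤
      (ofReal (2 * Real.exp (l ^ 2 * t)) * eLpNorm f 2 (expMeas l)) ^ 2 := by
    rw [eLpNorm_two_sq, mul_pow, eLpNorm_two_sq]
    calc _ ≤ ∫⁻ x, kconv t (fun y => ‖f y‖ₑ) x ^ 2 ∂(expMeas l) := by
          refine lintegral_mono fun x => ?_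
          gcongr
          exact h1 x
      _ ≤ _ := lintegral_kconv_sq_le ht (by fun_prop)
      _ ≤ _ := by
          gcongr
          rw [← ENNReal.ofReal_pow (by positivity), mul_pow, ← Real.exp_nat_mul]
          apply ofReal_le_ofReal
          push_cast
          rw [show 2 * l ^ 2 * t = 2 * (l ^ 2 * t) by ring]
          gcongr
          norm_num
  exact (ENNReal.pow_le_pow_left_iff two_ne_zero).1 h2

theorem nrm_hconv_le {κ : ℝ} (hκ : 0 < κ) (hκ' : κ < 1 / 2) (L T : ℝ) :
    ∃ C : ℝ≥0∞, C ≠ ⊤ ∧ ∀ l, |l| ≤ L → ∀ t, 0 < t → t ≤ T → ∀ (i : Fin 3) (f : Plane → ℝ),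
      Measurable f → eLpNorm f 2 (expMeas l) < ⊤ →
      nrm κ l (hconv i t f) ≤ C * ofReal (t ^ (-(1 / 2 + κ))) * eLpNorm f 2 (expMeas l) := by
  set c : ℝ := 20 * (1 + √T) with hc
  have hc0 : 0 ≤ c := by positivity
  set N : ℝ≥0∞ := (∫⁻ z, near (4 * κ) 1 z) +
        2 * (1 + ofReal (Real.exp L)) * ∫⁻ z, far (2 + 4 * κ) 1 z with hN
  have hNtop : N ≠ ⊤ := by
    refine ENNReal.add_ne_top.2 ⟨(lintegral_near_lt_top (by linarith)).ne, mul_ne_top ?_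
      (lintegral_far_lt_top (by linarith)).ne⟩
    exact mul_ne_top (by simp) (by simp)
  set B : ℝ≥0∞ := ofReal (2 * Real.exp (2 * L ^ 2 * (4 * T))) with hB
  have hBtop : B ≠ ⊤ := ofReal_ne_top
  set A : ℝ≥0∞ := ofReal (c ^ 2) * B with hA
  refine ⟨ofReal ((1 + T) ^ κ) * A ^ (1 / 2 : ℝ) + (A * N) ^ (1 / 2 : ℝ), ?_, ?_⟩
  · refine ENNReal.add_ne_top.2 ⟨mul_ne_top (by simp) ?_, ?_⟩
    · exact ENNReal.rpow_ne_top_of_nonneg (by norm_num) (mul_ne_top (by simp) hBtop)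
    · exact ENNReal.rpow_ne_top_of_nonneg (by norm_num)
        (mul_ne_top (mul_ne_top (by simp) hBtop) hNtop)
  intro l hl t ht htT i f hf hfl
  have hT : 0 < T := ht.trans_le htT
  set Q := kconv (4 * t) (fun y => ‖f y‖ₑ) with hQ
  have hQm : Measurable Q := measurable_kconv _ (by fun_prop)
  have hs0 : 0 < √t := Real.sqrt_pos.2 ht
  have h1 : ∀ x, ‖hconv i t f x‖ₑ ≤ ofReal (c / √t) * Q x := fun x => by
    refine (enorm_hconv_le ht htT i hf x).trans ?_
    gcongr
    rw [hc]
    nlinarith [Real.sqrt_nonneg T]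
  have h2 : ∀ x y, ‖x - y‖ ≤ √t → ‖hconv i t f x - hconv i t f y‖ₑ ≤
      ofReal (c / t * ‖x - y‖) * Q x := fun x y hxy => enorm_hconv_sub_le ht htT i hf hfl x y hxy
  have hQ2 : ∫⁻ x, Q x ^ 2 ∂(expMeas l) ≤ B * eLpNorm f 2 (expMeas l) ^ 2 := by
    refine (lintegral_kconv_sq_le (by positivity) (by fun_prop)).trans ?_
    rw [eLpNorm_two_sq, hB]
    have : l ^ 2 ≤ L ^ 2 := sq_le_sq' (by linarith [abs_le.1 hl]) (abs_le.1 hl).2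
    gcongr
  have hr : ∀ x y : ℝ≥0∞, x ^ 2 ≤ y * eLpNorm f 2 (expMeas l) ^ 2 →
      x ≤ y ^ (1 / 2 : ℝ) * eLpNorm f 2 (expMeas l) := fun x y hxy => by
    rw [← ENNReal.pow_le_pow_left_iff two_ne_zero, mul_pow]
    refine hxy.trans (le_of_eq ?_)
    rw [← ENNReal.rpow_two (y ^ _), ← ENNReal.rpow_mul]
    norm_num
  have ht2 : ofReal (t ^ (-(1 + 2 * κ))) = ofReal (t ^ (-(1 / 2 + κ))) ^ 2 := by
    rw [← ENNReal.ofReal_pow (by positivity), ← Real.rpow_two, ← Real.rpow_mul ht.le]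
    congr 2; ring
  have hsq : ∀ y z : ℝ≥0∞, (y ^ 2 * z) ^ (1 / 2 : ℝ) = y * z ^ (1 / 2 : ℝ) := fun y z => by
    rw [ENNReal.mul_rpow_of_nonneg _ _ (by norm_num), ← ENNReal.rpow_two, ← ENNReal.rpow_mul]
    norm_num
  have b1 : eLpNorm (hconv i t f) 2 (expMeas l) ≤ ofReal ((1 + T) ^ κ) * A ^ (1 / 2 : ℝ) *
      ofReal (t ^ (-(1 / 2 + κ))) * eLpNorm f 2 (expMeas l) := by
    have : eLpNorm (hconv i t f) 2 (expMeas l) ≤ ((ofReal ((1 + T) ^ κ) *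
        ofReal (t ^ (-(1 / 2 + κ)))) ^ 2 * A) ^ (1 / 2 : ℝ) * eLpNorm f 2 (expMeas l) := by
      apply hr
      rw [eLpNorm_two_sq]
      calc _ ≤ ∫⁻ x, ofReal (c / √t) ^ 2 * Q x ^ 2 ∂(expMeas l) := by
            refine lintegral_mono fun x => ?_
            rw [← mul_pow]
            gcongr
            exact h1 x
        _ ≤ ofReal (c / √t) ^ 2 * (B * eLpNorm f 2 (expMeas l) ^ 2) := by
            rw [lintegral_const_mul _ (by fun_prop)]
            gcongr
        _ ≤ (ofReal ((1 + T) ^ κ) * ofReal (t ^ (-(1 / 2 + κ)))) ^ 2 *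
            ofReal c ^ 2 * (B * eLpNorm f 2 (expMeas l) ^ 2) := by
            gcongr
            rw [← mul_pow]
            gcongr
            rw [← ofReal_mul (by positivity), ← ofReal_mul (by positivity)]
            apply ofReal_le_ofReal
            have : 1 / √t ≤ (1 + T) ^ κ * t ^ (-(1 / 2 + κ)) := by
              rw [neg_add, Real.rpow_add ht, Real.rpow_neg ht.le, ← Real.sqrt_eq_rpow]
              have : 1 ≤ (1 + T) ^ κ * t ^ (-κ) := by
                rw [Real.rpow_neg ht.le, ← div_eq_mul_inv, one_le_div (by positivity)]
                gcongr
                linarith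
              calc 1 / √t = (√t)⁻¹ * 1 := by ring
                _ ≤ (√t)⁻¹ * ((1 + T) ^ κ * t ^ (-κ)) := by gcongr
                _ = _ := by ring
            calc c / √t = (1 / √t) * c := by ring
              _ ≤ _ := by gcongr
        _ = _ := by rw [hA, ENNReal.ofReal_pow hc0]; ring
    rw [hsq] at this
    refine this.trans (le_of_eq ?_)
    ring
  have b2 : eLpNorm (fun p : Plane × Plane => hconv i t f p.1 - hconv i t f p.2) 2 (slobMeas κ l) ≤
      (A * N) ^ (1 / 2 : ℝ) * ofReal (t ^ (-(1 / 2 + κ))) * eLpNorm f 2 (expMeas l) := by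
    have : eLpNorm (fun p : Plane × Plane => hconv i t f p.1 - hconv i t f p.2) 2 (slobMeas κ l) ≤
        (ofReal (t ^ (-(1 / 2 + κ))) ^ 2 * (A * N)) ^ (1 / 2 : ℝ) * eLpNorm f 2 (expMeas l) := by
      apply hr
      rw [eLpNorm_two_sq]
      refine (slob_le_of_bounds ht hc0 (measurable_hconv i t hf) hQm h1 h2).trans ?_
      rw [ofReal_mul (by positivity), ht2]
      calc _ ≤ ofReal (c ^ 2) * ofReal (t ^ (-(1 / 2 + κ))) ^ 2 * N *
            (B * eLpNorm f 2 (expMeas l) ^ 2) := by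
            rw [hN]
            gcongr
        _ = _ := by rw [hA]; ring
    rw [hsq] at this
    refine this.trans (le_of_eq ?_)
    ring
  rw [nrm, add_mul, add_mul]
  exact add_le_add b1 b2

/-! ### Test functions and the Hölder norm -/

theorem ofFun_apply {g : Plane → ℝ} (hg : LocallyIntegrable g) (φ : Test) :
    ofFun g φ = ∫ x, φ x * g x := by
  have : LocallyIntegrableOn g ((⊤ : Opens Plane) : Set Plane) volume := by
    simpa [locallyIntegrableOn_univ] using hg
  exact TestFunction.integralAgainstBilinCLM_eq_integral this

theorem Test.locallyIntegrable (φ : Test) : LocallyIntegrable (φ : Plane → ℝ) :=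
  φ.continuous.locallyIntegrable

theorem Test.integrable' (φ : Test) : Integrable (φ : Plane → ℝ) :=
  φ.continuous.integrable_of_hasCompactSupport φ.hasCompactSupport

theorem rescale_apply (x : Plane) (r : ℝ) (hr : 0 < r) (φ : Test) (y : Plane) :
    rescale x r hr φ y = (r ^ 2)⁻¹ * φ (r⁻¹ • (y - x)) := rfl

theorem rescale_smul (x : Plane) (r : ℝ) (hr : 0 < r) (c : ℝ) (φ : Test) :
    rescale x r hr (c • φ) = c • rescale x r hr φ := by
  ext y
  simp [rescale_apply]
  ring

theorem le_holderNorm {α : ℝ} {ρ : Plane → ℝ} (T : Distr) {x : Plane} {r : ℝ} (hr : 0 < r) (hr1 : r ≤ 1)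
    {φ : Test} (hφ : φ ∈ unitTests ⌈-α⌉₊) :
    ofReal (|T (rescale x r hr φ)| / (r ^ α * ρ x)) ≤ holderNorm α ρ T :=
  le_iSup_of_le x (le_iSup_of_le (⟨r, hr, hr1⟩ : Ioc (0 : ℝ) 1)
    (le_iSup₂_of_le φ hφ le_rfl))

theorem exists_smul_mem_unitTests (m : ℕ) {φ : Test} (hφ : tsupport φ ⊆ Metric.closedBall 0 1) :
    ∃ C : ℝ, 0 < C ∧ C⁻¹ • φ ∈ unitTests m := by
  have hb : ∀ i : ℕ, ∃ B, ∀ x, ‖iteratedFDeriv ℝ i φ x‖ ≤ B := fun i =>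
    (φ.contDiff.continuous_iteratedFDeriv (m := i) (by exact_mod_cast le_top)).bounded_above_of_compact_support
      (φ.hasCompactSupport.iteratedFDeriv i)
  choose B hB using hb
  have hB0 : ∀ i, 0 ≤ B i := fun i => (norm_nonneg _).trans (hB i 0)
  refine ⟨1 + ∑ i ∈ Finset.range (m + 1), B i, by
    have := Finset.sum_nonneg fun i (_ : i ∈ Finset.range (m + 1)) => hB0 i
    linarith, ?_, ?_⟩
  · refine (closure_mono ?_).trans hφ
    intro x hx
    simp at hx ⊢
    exact hx.2
  · intro i hi x
    have h1 : iteratedFDeriv ℝ i (⇑((1 + ∑ i ∈ Finset.range (m + 1), B i)⁻¹ • φ)) x =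
        (1 + ∑ i ∈ Finset.range (m + 1), B i)⁻¹ • iteratedFDeriv ℝ i φ x := by
      rw [FunLike.coe_smul]
      exact iteratedFDeriv_const_smul_apply (φ.contDiff.contDiffAt.of_le (by exact_mod_cast le_top))
    have hS : B i ≤ ∑ i ∈ Finset.range (m + 1), B i :=
      Finset.single_le_sum (f := B) (fun j _ => hB0 j) (by simp; omega)
    have hpos : 0 < 1 + ∑ i ∈ Finset.range (m + 1), B i := by linarith [hB0 i]
    rw [h1, norm_smul, norm_inv, Real.norm_of_nonneg hpos.le, inv_mul_le_iff₀ hpos]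
    linarith [hB i x]

theorem exists_abs_rescale_le (α : ℝ) {ψ : Test} (hψ : tsupport ψ ⊆ Metric.closedBall 0 1) :
    ∃ C : ℝ, 0 < C ∧ ∀ (ρ : Plane → ℝ) (T : Distr) (x : Plane) (r : ℝ) (hr : 0 < r), r ≤ 1 → 0 < ρ x →
      ofReal |T (rescale x r hr ψ)| ≤ ofReal (C * r ^ α * ρ x) * holderNorm α ρ T := by
  obtain ⟨C, hC, hu⟩ := exists_smul_mem_unitTests ⌈-α⌉₊ hψ
  refine ⟨C, hC, fun ρ T x r hr hr1 hρ => ?_⟩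
  have h := le_holderNorm (ρ := ρ) T (x := x) hr hr1 hu
  rw [rescale_smul, map_smul, smul_eq_mul, abs_mul, abs_of_pos (inv_pos.2 hC)] at h
  have hd : 0 < r ^ α * ρ x := mul_pos (Real.rpow_pos_of_pos hr _) hρ
  calc _ = ofReal ((C * r ^ α * ρ x) * (C⁻¹ * |T (rescale x r hr ψ)| / (r ^ α * ρ x))) := by
        congr 1; field_simp
    _ = ofReal (C * r ^ α * ρ x) * ofReal (C⁻¹ * |T (rescale x r hr ψ)| / (r ^ α * ρ x)) := by
        rw [ofReal_mul (by rw [mul_assoc]; positivity)]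
    _ ≤ _ := by gcongr

theorem polyWeight_pos (a : ℝ) (x : Plane) : 0 < polyWeight a x := by
  unfold polyWeight; positivity

theorem one_le_polyWeight {a : ℝ} (ha : 0 ≤ a) (x : Plane) : 1 ≤ polyWeight a x := by
  unfold polyWeight
  exact Real.one_le_rpow (by linarith [norm_nonneg x]) ha

theorem measurable_polyWeight (a : ℝ) : Measurable (polyWeight a) := by
  unfold polyWeight; fun_prop

theorem polyWeight_le_of_norm_sub_le {a : ℝ} (ha : 0 ≤ a) (ha1 : a ≤ 1) {R : ℝ} (hR : 0 ≤ R) {x y : Plane}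
    (h : ‖x - y‖ ≤ R) : polyWeight a x ≤ (1 + R) * polyWeight a y := by
  unfold polyWeight
  have h1 : 1 + ‖x‖ ≤ (1 + R) * (1 + ‖y‖) := by
    have : ‖x‖ ≤ ‖y‖ + ‖x - y‖ := by
      calc ‖x‖ = ‖y + (x - y)‖ := by congr 1; abel
        _ ≤ _ := norm_add_le _ _
    nlinarith [norm_nonneg y]
  calc (1 + ‖x‖) ^ a ≤ ((1 + R) * (1 + ‖y‖)) ^ a := by gcongr
    _ = (1 + R) ^ a * (1 + ‖y‖) ^ a := Real.mul_rpow (by positivity) (by positivity)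
    _ ≤ (1 + R) ^ (1 : ℝ) * (1 + ‖y‖) ^ a := by
        gcongr
        linarith
    _ = _ := by rw [Real.rpow_one]

/-! ### Convolutions of continuous functions -/

/-- Convolution of real functions on the plane. -/
def cv (f g : Plane → ℝ) (x : Plane) : ℝ := ∫ y, f y * g (x - y)

theorem cv_eq (f g : Plane → ℝ) : cv f g = f ⋆[ContinuousLinearMap.mul ℝ ℝ, volume] g := rfl

theorem cv_continuous {f g : Plane → ℝ} (hf : LocallyIntegrable f) (hg : Continuous g)
    (hg' : HasCompactSupport g) : Continuous (cv f g) := by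
  rw [cv_eq]
  exact hg'.continuous_convolution_right _ hf hg

theorem cv_hasCompactSupport {f g : Plane → ℝ} (hf : HasCompactSupport f) (hg : HasCompactSupport g) :
    HasCompactSupport (cv f g) := by
  rw [cv_eq]
  exact hf.convolution _ hg

theorem cv_comm (f g : Plane → ℝ) : cv f g = cv g f := by
  funext x
  unfold cv
  rw [← integral_sub_left_eq_self _ volume x]
  simp [mul_comm]

theorem integrable_cv_integrand {f g : Plane → ℝ} (hf : LocallyIntegrable f) (hg : Continuous g)
    (hg' : HasCompactSupport g) (x : Plane) : Integrable fun y => f y * g (x - y) :=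
  hg'.convolutionExists_right (ContinuousLinearMap.mul ℝ ℝ) hf hg x

theorem cv_assoc {f g k : Plane → ℝ} (hf : Continuous f) (hg : Continuous g)
    (hg' : HasCompactSupport g) (hk : Continuous k) (hk' : HasCompactSupport k) :
    cv (cv f g) k = cv f (cv g k) := by
  funext x
  simp only [cv_eq]
  refine convolution_assoc _ _ _ _ (fun a b c => by simp [mul_assoc]) hf.aestronglyMeasurable
    hg.aestronglyMeasurable hk.aestronglyMeasurable (Eventually.of_forall fun y => ?_)
    (Eventually.of_forall fun y => ?_) ?_
  · exact hg'.convolutionExists_right _ hf.locallyIntegrable hg y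
  · exact hk'.norm.convolutionExists_right _ hg.norm.locallyIntegrable hk.norm y
  · refine HasCompactSupport.convolutionExists_right _ (hg'.norm.convolution _ hk'.norm)
      hf.norm.locallyIntegrable (hk'.norm.continuous_convolution_right _ hg.norm.locallyIntegrable hk.norm) x

theorem integral_mul_cv {h Ψ θ : Plane → ℝ} (hh : LocallyIntegrable h) (hΨ : Continuous Ψ)
    (hΨ' : HasCompactSupport Ψ) (hθ : Continuous θ) (hθ' : HasCompactSupport θ) (he : ∀ x, θ (-x) = θ x) :
    ∫ x, h x * cv Ψ θ x = ∫ y, Ψ y * cv h θ y := by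
  have hint : Integrable (fun p : Plane × Plane => h p.1 * (Ψ p.2 * θ (p.1 - p.2))) (volume.prod volume) := by
    obtain ⟨M, hM⟩ := hΨ.bounded_above_of_compact_support hΨ'
    obtain ⟨N, hN⟩ := hθ.bounded_above_of_compact_support hθ'
    have hM0 : 0 ≤ M := (norm_nonneg _).trans (hM 0)
    have hN0 : 0 ≤ N := (norm_nonneg _).trans (hN 0)
    set B := tsupport Ψ with hB
    set A := B + tsupport θ with hA
    have hBc : IsCompact B := hΨ'
    have hAc : IsCompact A := hBc.add hθ'
    have hbd : Integrable (fun p : Plane × Plane => (A.indicator (fun x => ‖h x‖) p.1) *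
        (B.indicator (fun _ => M * N) p.2)) (volume.prod volume) := by
      refine Integrable.mul_prod ?_ ?_
      · exact (integrable_indicator_iff hAc.measurableSet).2 (hh.integrableOn_isCompact hAc).norm
      · exact (integrable_indicator_iff hBc.measurableSet).2
          (integrableOn_const hBc.measure_lt_top.ne)
    refine hbd.mono' ?_ (Eventually.of_forall fun p => ?_)
    · refine AEStronglyMeasurable.mul hh.aestronglyMeasurable.comp_fst ?_
      exact ((hΨ.comp continuous_snd).mul (hθ.comp (continuous_fst.sub continuous_snd))).aestronglyMeasurable
    · by_cases h2 : p.2 ∈ B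
      · by_cases h1 : p.1 ∈ A
        · rw [Set.indicator_of_mem h1, Set.indicator_of_mem h2, norm_mul, norm_mul]
          gcongr
          · exact hM _
          · exact hN _
        · have : θ (p.1 - p.2) = 0 := by
            by_contra hc
            apply h1
            refine ⟨p.2, h2, p.1 - p.2, subset_tsupport _ hc, by simp⟩
          rw [this]; simp [Set.indicator_of_notMem h1]
      · have : Ψ p.2 = 0 := image_eq_zero_of_notMem_tsupport h2
        rw [this]; simp [Set.indicator_of_notMem h2]
  calc ∫ x, h x * cv Ψ θ x = ∫ x, ∫ y, h x * (Ψ y * θ (x - y)) := by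
        refine integral_congr_ae (Eventually.of_forall fun x => ?_)
        simp only [cv]
        rw [integral_const_mul]
    _ = ∫ y, ∫ x, h x * (Ψ y * θ (x - y)) := integral_integral_swap hint
    _ = _ := by
        refine integral_congr_ae (Eventually.of_forall fun y => ?_)
        simp only [cv]
        rw [← integral_const_mul]
        refine integral_congr_ae (Eventually.of_forall fun x => ?_)
        simp only
        rw [← neg_sub y x, he]
        ring

/-! ### A family of mollifiers -/

/-- A bump function supported in the ball of radius `1/2`. -/
def bump : ContDiffBump (0 : Plane) := ⟨1 / 4, 1 / 2, by norm_num, by norm_num⟩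

/-- An even smooth probability density supported in the ball of radius `1/2`. -/
def mol : Test := ⟨bump.normed volume, bump.contDiff_normed, bump.hasCompactSupport_normed, fun _ _ => trivial⟩

theorem mol_neg (x : Plane) : mol (-x) = mol x := bump.normed_neg x

theorem mol_nonneg (x : Plane) : 0 ≤ mol x := bump.nonneg_normed x

theorem integral_mol : ∫ x, mol x = 1 := bump.integral_normed

theorem mol_eq_zero {x : Plane} (hx : 1 / 2 ≤ ‖x‖) : mol x = 0 := by
  by_contra h
  have : x ∈ Function.support (bump.normed volume) := h
  rw [bump.support_normed_eq] at this
  simp [bump] at this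
  linarith

theorem tsupport_mol : tsupport mol ⊆ Metric.closedBall 0 1 := by
  have : tsupport (mol : Plane → ℝ) = Metric.closedBall 0 (1 / 2) := bump.tsupport_normed_eq
  rw [this]
  exact Metric.closedBall_subset_closedBall (by norm_num)

/-- The rescaled mollifier `r⁻² mol(z / r)`. -/
def molr (r : ℝ) (z : Plane) : ℝ := (r ^ 2)⁻¹ * mol (r⁻¹ • z)

theorem molr_neg (r : ℝ) (z : Plane) : molr r (-z) = molr r z := by
  rw [molr, smul_neg, mol_neg, molr]

theorem continuous_molr (r : ℝ) : Continuous (molr r) := by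
  have := mol.continuous
  unfold molr; fun_prop

theorem molr_nonneg (r : ℝ) (z : Plane) : 0 ≤ molr r z :=
  mul_nonneg (by positivity) (mol_nonneg _)

theorem molr_eq_zero {r : ℝ} (hr : 0 < r) {z : Plane} (hz : r ≤ ‖z‖) : molr r z = 0 := by
  rw [molr, mol_eq_zero, mul_zero]
  rw [norm_smul, norm_inv, Real.norm_of_nonneg hr.le, ← div_eq_inv_mul, le_div_iff₀ hr]
  linarith

theorem hasCompactSupport_molr {r : ℝ} (hr : 0 < r) : HasCompactSupport (molr r) := by
  refine HasCompactSupport.of_support_subset_isCompact (isCompact_closedBall 0 r) fun z hz => ?_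
  by_contra h
  apply hz
  apply molr_eq_zero hr
  simp at h
  exact h.le

theorem integral_molr {r : ℝ} (hr : 0 < r) : ∫ z, molr r z = 1 := by
  unfold molr
  rw [integral_const_mul, Measure.integral_comp_inv_smul_of_nonneg _ _ hr.le, integral_mol]
  simp [hr.ne']

theorem integral_molr_sub {r : ℝ} (hr : 0 < r) (x : Plane) : ∫ z, molr r (x - z) = 1 := by
  rw [integral_sub_left_eq_self (molr r) volume x, integral_molr hr]

theorem integrable_molr_sub {r : ℝ} (hr : 0 < r) (x : Plane) : Integrable fun z => molr r (x - z) :=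
  ((continuous_molr r).integrable_of_hasCompactSupport (hasCompactSupport_molr hr)).comp_sub_left x

theorem exists_molr_le : ∃ M : ℝ, 0 < M ∧ ∀ r z, molr r z ≤ M * (r ^ 2)⁻¹ := by
  obtain ⟨M, hM⟩ := mol.continuous.bounded_above_of_compact_support mol.hasCompactSupport
  have hM0 : 0 ≤ M := (norm_nonneg _).trans (hM 0)
  refine ⟨M + 1, by linarith, fun r z => ?_⟩
  rw [molr, mul_comm]
  gcongr
  have := hM (r⁻¹ • z)
  rw [Real.norm_of_nonneg (mol_nonneg _)] at this
  linarith

theorem cv_molr (φ : Test) {r : ℝ} (hr : 0 < r) (y : Plane) :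
    cv φ (molr r) y = ofFun φ (rescale y r hr mol) := by
  rw [ofFun_apply φ.locallyIntegrable, cv]
  refine integral_congr_ae (Eventually.of_forall fun u => ?_)
  simp only [rescale_apply]
  rw [← neg_sub u y, molr_neg, molr]
  ring

/-- Averages of values close to `c` are close to `c`. -/
theorem abs_cv_molr_sub_le {f : Plane → ℝ} (hf : LocallyIntegrable f) {r : ℝ} (hr : 0 < r) {x : Plane} {c ε : ℝ}
    (h : ∀ y, ‖x - y‖ < r → |f y - c| ≤ ε) : |cv f (molr r) x - c| ≤ ε := by
  have h1 : cv f (molr r) x - c = ∫ y, (f y - c) * molr r (x - y) := by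
    have : c = ∫ y, c * molr r (x - y) := by rw [integral_const_mul, integral_molr_sub hr, mul_one]
    nth_rw 1 [this]
    rw [cv, ← integral_sub (integrable_cv_integrand hf (continuous_molr r) (hasCompactSupport_molr hr) x)
      ((integrable_molr_sub hr x).const_mul c)]
    simp [sub_mul]
  rw [h1, ← Real.norm_eq_abs]
  calc _ ≤ ∫ y, ε * molr r (x - y) := by
        refine norm_integral_le_of_norm_le ((integrable_molr_sub hr x).const_mul ε)
          (Eventually.of_forall fun y => ?_)
        rw [norm_mul, Real.norm_of_nonneg (molr_nonneg _ _), Real.norm_eq_abs]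
        by_cases hy : ‖x - y‖ < r
        · exact mul_le_mul_of_nonneg_right (h y hy) (molr_nonneg _ _)
        · rw [molr_eq_zero hr (not_lt.1 hy)]; simp
    _ = ε := by rw [integral_const_mul, integral_molr_sub hr, mul_one]

theorem tendsto_integral_mul_mollified {h : Plane → ℝ} (hh : LocallyIntegrable h) (φ : Test) :
    Tendsto (fun n : ℕ => ∫ x, h x * cv (cv φ (molr ((1 / 2) ^ n))) (molr ((1 / 2) ^ n)) x) atTop
      (𝓝 (∫ x, h x * φ x)) := by
  have hr : ∀ n : ℕ, (0 : ℝ) < (1 / 2) ^ n := fun n => by positivity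
  have hr1 : ∀ n : ℕ, ((1 : ℝ) / 2) ^ n ≤ 1 := fun n => pow_le_one₀ (by norm_num) (by norm_num)
  obtain ⟨M, hM⟩ := φ.continuous.bounded_above_of_compact_support φ.hasCompactSupport
  have hM0 : 0 ≤ M := (norm_nonneg _).trans (hM 0)
  obtain ⟨R, hR⟩ := φ.hasCompactSupport.isCompact.isBounded.subset_closedBall 0
  have hφ0 : ∀ y, R < ‖y‖ → φ y = 0 := fun y hy => by
    apply image_eq_zero_of_notMem_tsupport
    intro h; have := hR h; simp at this; linarith
  have hc : ∀ n : ℕ, Continuous (cv φ (molr ((1 / 2) ^ n))) := fun n =>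
    cv_continuous φ.locallyIntegrable (continuous_molr _) (hasCompactSupport_molr (hr n))
  have hc2 : ∀ n : ℕ, Continuous (cv (cv φ (molr ((1 / 2) ^ n))) (molr ((1 / 2) ^ n))) := fun n =>
    cv_continuous (hc n).locallyIntegrable (continuous_molr _) (hasCompactSupport_molr (hr n))
  have two : ∀ (n : ℕ) (x : Plane) (c ε : ℝ), 0 ≤ ε → (∀ y, ‖x - y‖ < 2 * (1 / 2) ^ n → |φ y - c| ≤ ε) →
      |cv (cv φ (molr ((1 / 2) ^ n))) (molr ((1 / 2) ^ n)) x - c| ≤ ε := by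
    intro n x c ε hε hy
    refine abs_cv_molr_sub_le (hc n).locallyIntegrable (hr n) fun y hxy => ?_
    refine abs_cv_molr_sub_le φ.locallyIntegrable (hr n) fun z hyz => hy z ?_
    calc ‖x - z‖ = ‖(x - y) + (y - z)‖ := by congr 1; abel
      _ ≤ ‖x - y‖ + ‖y - z‖ := norm_add_le _ _
      _ < _ := by linarith
  refine tendsto_integral_of_dominated_convergence
    (fun x => (Metric.closedBall (0 : Plane) (R + 2)).indicator (fun x => ‖h x‖) x * M)
    (fun n => hh.aestronglyMeasurable.mul (hc2 n).aestronglyMeasurable) ?_ (fun n => Eventually.of_forall fun x => ?_)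
    (Eventually.of_forall fun x => ?_)
  · refine Integrable.mul_const ?_ _
    exact (integrable_indicator_iff measurableSet_closedBall).2
      (hh.integrableOn_isCompact (isCompact_closedBall 0 (R + 2))).norm
  · by_cases hx : x ∈ Metric.closedBall (0 : Plane) (R + 2)
    · rw [Set.indicator_of_mem hx, norm_mul]
      gcongr
      have := two n x 0 M hM0 (fun y _ => by simpa using hM y)
      simpa using this
    · rw [Set.indicator_of_notMem hx]
      have := two n x 0 0 le_rfl (fun y hy => by
        rw [hφ0 y]
        · simp
        · simp at hx
          have : ‖x‖ ≤ ‖y‖ + ‖x - y‖ := by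
            calc ‖x‖ = ‖y + (x - y)‖ := by congr 1; abel
              _ ≤ _ := norm_add_le _ _
          linarith [hr1 n])
      rw [sub_zero] at this
      rw [abs_nonpos_iff.1 this]; simp
  · refine Tendsto.const_mul _ ?_
    rw [Metric.tendsto_atTop]
    intro ε hε
    obtain ⟨δ, hδ, hφδ⟩ := Metric.continuous_iff.1 φ.continuous x (ε / 2) (by positivity)
    obtain ⟨N, hN⟩ := exists_pow_lt_of_lt_one (by positivity : 0 < δ / 2) (by norm_num : (1 : ℝ) / 2 < 1)
    refine ⟨N, fun n hn => ?_⟩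
    rw [Real.dist_eq]
    refine lt_of_le_of_lt (two n x (φ x) (ε / 2) (by positivity) fun y hy => ?_) (by linarith)
    have h1 : ((1 : ℝ) / 2) ^ n ≤ (1 / 2) ^ N := pow_le_pow_of_le_one (by norm_num) (by norm_num) hn
    have := hφδ y (by rw [dist_eq_norm, norm_sub_rev]; linarith)
    rw [Real.dist_eq] at this
    exact this.le

theorem sum_pow_indicator_le {p a : ℝ} (hp : 1 ≤ p) (ha : 0 < a) (N : ℕ) :
    ∑ n ∈ Finset.range N, (if (2 : ℝ) ^ n < a then ((2 : ℝ) ^ n) ^ p else 0) ≤ 2 * a ^ p := by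
  have hgeo : ∀ N : ℕ, ∑ n ∈ Finset.range N, ((2 : ℝ) ^ n) ^ p ≤ ((2 : ℝ) ^ N) ^ p := by
    intro N
    induction N with
    | zero => simp
    | succ N ih =>
      rw [Finset.sum_range_succ]
      have : ((2 : ℝ) ^ (N + 1)) ^ p = 2 ^ p * ((2 : ℝ) ^ N) ^ p := by
        rw [pow_succ, Real.mul_rpow (by positivity) (by positivity), mul_comm]
      have h2 : (2 : ℝ) ≤ 2 ^ p := by
        calc (2 : ℝ) = 2 ^ (1 : ℝ) := by simp
          _ ≤ 2 ^ p := by gcongr; norm_num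
      rw [this]
      have : 0 ≤ ((2 : ℝ) ^ N) ^ p := by positivity
      nlinarith
  induction N with
  | zero => simp; positivity
  | succ N ih =>
    rw [Finset.sum_range_succ]
    split_ifs with h
    · have h1 : ∑ n ∈ Finset.range N, (if (2 : ℝ) ^ n < a then ((2 : ℝ) ^ n) ^ p else 0) ≤
          ∑ n ∈ Finset.range N, ((2 : ℝ) ^ n) ^ p := by
        refine Finset.sum_le_sum fun n _ => ?_
        split_ifs
        · exact le_rfl
        · positivity
      have h2 : ((2 : ℝ) ^ N) ^ p ≤ a ^ p := by gcongr
      linarith [hgeo N]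
    · linarith

/-! ### Duality between negative Hölder spaces and fractional `L¹` regularity -/

/-- The kernel `1_{|z|<1} |z|^{-2-κ}`. -/
def dk (κ : ℝ) (z : Plane) : ℝ≥0∞ := if ‖z‖ < 1 then ofReal (‖z‖ ^ (-(2 + κ))) else 0

theorem measurable_dk (κ : ℝ) : Measurable (dk κ) := by
  unfold dk
  exact Measurable.ite (measurableSet_lt measurable_norm measurable_const) (by fun_prop) measurable_const

/-- The polynomial weight as an extended nonnegative function. -/
def pw (κ : ℝ) (x : Plane) : ℝ≥0∞ := ofReal (polyWeight κ x)

theorem measurable_pw (κ : ℝ) : Measurable (pw κ) := (measurable_polyWeight κ).ennreal_ofReal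

/-- Dyadic truncations of `dk`. -/
def dkn (κ : ℝ) (n : ℕ) (z : Plane) : ℝ≥0∞ :=
  if ‖z‖ < (1 / 2) ^ n then ofReal (((2 : ℝ) ^ n) ^ (2 + κ)) else 0

theorem measurable_dkn (κ : ℝ) (n : ℕ) : Measurable (dkn κ n) := by
  unfold dkn
  exact Measurable.ite (measurableSet_lt measurable_norm measurable_const) measurable_const measurable_const

theorem sum_dkn_le {κ : ℝ} (hκ : 0 < κ) (N : ℕ) {z : Plane} (hz : z ≠ 0) :
    ∑ n ∈ Finset.range N, dkn κ n z ≤ 2 * dk κ z := by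
  have hz0 : 0 < ‖z‖ := norm_pos_iff.2 hz
  by_cases h1 : ‖z‖ < 1
  · have := sum_pow_indicator_le (p := 2 + κ) (a := ‖z‖⁻¹) (by linarith) (by positivity) N
    rw [dk, if_pos h1]
    calc _ = ofReal (∑ n ∈ Finset.range N, (if (2 : ℝ) ^ n < ‖z‖⁻¹ then ((2 : ℝ) ^ n) ^ (2 + κ) else 0)) := by
          rw [ENNReal.ofReal_sum_of_nonneg (fun n _ => by split_ifs <;> positivity)]
          refine Finset.sum_congr rfl fun n _ => ?_
          have : ‖z‖ < (1 / 2) ^ n ↔ (2 : ℝ) ^ n < ‖z‖⁻¹ := by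
            rw [one_div, inv_pow, lt_inv_comm₀ hz0 (by positivity)]
          simp only [dkn, this]
          split_ifs <;> simp
      _ ≤ ofReal (2 * ‖z‖⁻¹ ^ (2 + κ)) := ofReal_le_ofReal this
      _ = _ := by
          rw [ofReal_mul zero_le_two, Real.inv_rpow hz0.le, ← Real.rpow_neg hz0.le]
          norm_num
  · refine le_of_eq_of_le (Finset.sum_eq_zero fun n _ => ?_) zero_le
    rw [dkn, if_neg]
    intro h
    exact h1 (h.trans_le (pow_le_one₀ (by norm_num) (by norm_num)))

theorem mollified_sub_eq {h : Plane → ℝ} (hh : LocallyIntegrable h) (φ : Test) {r s : ℝ} (hr : 0 < r)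
    (hs : 0 < s) :
    (∫ x, h x * cv (cv φ (molr s)) (molr s) x) - ∫ x, h x * cv (cv φ (molr r)) (molr r) x =
      ∫ y, (cv φ (molr s) y + cv φ (molr r) y) * ∫ u, (h u - h y) * (molr s (y - u) - molr r (y - u)) := by
  have cz := continuous_molr
  have kz : ∀ {r : ℝ}, 0 < r → HasCompactSupport (molr r) := fun hr => hasCompactSupport_molr hr
  have ca : ∀ {r : ℝ}, 0 < r → Continuous (cv φ (molr r)) := fun hr =>
    cv_continuous φ.locallyIntegrable (cz _) (kz hr)
  have ka : ∀ {r : ℝ}, 0 < r → HasCompactSupport (cv φ (molr r)) := fun hr =>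
    cv_hasCompactSupport φ.hasCompactSupport (kz hr)
  have hcomm : cv (cv φ (molr s)) (molr r) = cv (cv φ (molr r)) (molr s) := by
    rw [cv_assoc φ.continuous (cz _) (kz hs) (cz _) (kz hr), cv_comm (molr s),
      cv_assoc φ.continuous (cz _) (kz hr) (cz _) (kz hs)]
  have hint : ∀ {r s : ℝ}, 0 < r → 0 < s → ∀ x, Integrable fun y => cv φ (molr r) y * molr s (x - y) :=
    fun hr hs x => integrable_cv_integrand (ca hr).locallyIntegrable (cz _) (kz hs) x
  have e1 : ∀ x, cv (cv φ (molr s)) (molr s) x - cv (cv φ (molr r)) (molr r) x =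
      cv (fun y => cv φ (molr s) y + cv φ (molr r) y) (fun z => molr s z - molr r z) x := by
    intro x
    have e2 : cv (fun y => cv φ (molr s) y + cv φ (molr r) y) (fun z => molr s z - molr r z) x =
        (cv (cv φ (molr s)) (molr s) x - cv (cv φ (molr s)) (molr r) x) +
        (cv (cv φ (molr r)) (molr s) x - cv (cv φ (molr r)) (molr r) x) := by
      have s1 : cv (cv φ (molr s)) (molr s) x - cv (cv φ (molr s)) (molr r) x =
        ∫ y, (cv φ (molr s) y * molr s (x - y) - cv φ (molr s) y * molr r (x - y)) :=
          (integral_sub (hint hs hs x) (hint hs hr x)).symm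
      have s2 : cv (cv φ (molr r)) (molr s) x - cv (cv φ (molr r)) (molr r) x =
        ∫ y, (cv φ (molr r) y * molr s (x - y) - cv φ (molr r) y * molr r (x - y)) :=
          (integral_sub (hint hr hs x) (hint hr hr x)).symm
      have i1 : Integrable fun y => cv φ (molr s) y * molr s (x - y) - cv φ (molr s) y * molr r (x - y) :=
        (hint hs hs x).sub (hint hs hr x)
      have i2 : Integrable fun y => cv φ (molr r) y * molr s (x - y) - cv φ (molr r) y * molr r (x - y) :=
        (hint hr hs x).sub (hint hr hr x)
      rw [s1, s2, ← integral_add i1 i2]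
      refine integral_congr_ae (Eventually.of_forall fun y => ?_)
      simp only
      ring
    rw [e2, hcomm]
    ring
  have hi : ∀ {r : ℝ}, 0 < r → Integrable fun x => h x * cv (cv φ (molr r)) (molr r) x := by
    intro r hr
    have := integrable_cv_integrand (f := h) (g := fun x => cv (cv φ (molr r)) (molr r) (-x)) hh
      ((cv_continuous (ca hr).locallyIntegrable (cz _) (kz hr)).comp continuous_neg)
      ((cv_hasCompactSupport (ka hr) (kz hr)).comp_homeomorph (Homeomorph.neg Plane)) 0
    simpa using this
  rw [← integral_sub (hi hs) (hi hr)]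
  simp_rw [← mul_sub, e1]
  have c1 : Continuous fun y => cv φ (molr s) y + cv φ (molr r) y := (ca hs).add (ca hr)
  have k1 : HasCompactSupport fun y => cv φ (molr s) y + cv φ (molr r) y := (ka hs).add (ka hr)
  have c2 : Continuous fun z => molr s z - molr r z := (cz s).sub (cz r)
  have k2 : HasCompactSupport fun z => molr s z - molr r z := (kz hs).sub (kz hr)
  rw [integral_mul_cv hh c1 k1 c2 k2 (fun x => by rw [molr_neg, molr_neg])]
  refine integral_congr_ae (Eventually.of_forall fun y => ?_)
  simp only
  congr 1
  have hθ : Integrable fun u => molr s (y - u) - molr r (y - u) :=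
    (integrable_molr_sub hs y).sub (integrable_molr_sub hr y)
  have h0 : ∫ u, (molr s (y - u) - molr r (y - u)) = 0 := by
    rw [integral_sub (integrable_molr_sub hs y) (integrable_molr_sub hr y), integral_molr_sub hs,
      integral_molr_sub hr, sub_self]
  have : ∫ u, (h u - h y) * (molr s (y - u) - molr r (y - u)) =
      (∫ u, h u * (molr s (y - u) - molr r (y - u))) - ∫ u, h y * (molr s (y - u) - molr r (y - u)) := by
    rw [← integral_sub (integrable_cv_integrand (g := fun z => molr s z - molr r z) hh ((cz s).sub (cz r))
      ((kz hs).sub (kz hr)) y) (hθ.const_mul _)]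
    simp [sub_mul]
  rw [this, integral_const_mul, h0, mul_zero, sub_zero]
  rfl

set_option maxHeartbeats 400000 in
theorem exists_duality {κ : ℝ} (hκ : 0 < κ) (hκ1 : κ < 1) :
    ∃ C : ℝ≥0∞, C ≠ ⊤ ∧ ∀ (φ : Test) (h : Plane → ℝ), LocallyIntegrable h → Measurable h →
      ‖∫ x, h x * φ x‖ₑ ≤ C * holderNorm (-κ) (polyWeight κ) (ofFun φ) *
        ((∫⁻ y, pw κ y * ‖h y‖ₑ) + ∫⁻ y, ∫⁻ u, pw κ y * (dk κ (y - u) * ‖h y - h u‖ₑ)) := by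
  obtain ⟨c, hc, hcb⟩ := exists_abs_rescale_le (-κ) tsupport_mol
  obtain ⟨M, hM, hMb⟩ := exists_molr_le
  set V : ℝ≥0∞ := volume (Metric.ball (0 : Plane) 1) with hV
  refine ⟨ofReal (c * M) * 2 * V + ofReal (15 * c * M) * 2, ?_, fun φ h hh hm => ?_⟩
  · exact ENNReal.add_ne_top.2 ⟨mul_ne_top (mul_ne_top ofReal_ne_top
      ENNReal.ofNat_ne_top) measure_ball_lt_top.ne,
      mul_ne_top ofReal_ne_top ENNReal.ofNat_ne_top⟩
  set N := holderNorm (-κ) (polyWeight κ) (ofFun φ) with hN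
  set J : ℕ → ℝ := fun n => ∫ x, h x * cv (cv φ (molr ((1 / 2) ^ n))) (molr ((1 / 2) ^ n)) x with hJ
  have hdk := measurable_dk κ
  have hpw := measurable_pw κ
  have hr : ∀ n : ℕ, (0 : ℝ) < (1 / 2) ^ n := fun n => by positivity
  have hr1 : ∀ n : ℕ, ((1 : ℝ) / 2) ^ n ≤ 1 := fun n => pow_le_one₀ (by norm_num) (by norm_num)
  have hΨ : ∀ (n : ℕ) y, ‖cv φ (molr ((1 / 2) ^ n)) y‖ₑ ≤ ofReal (c * ((2 : ℝ) ^ n) ^ κ) * pw κ y * N := by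
    intro n y
    rw [cv_molr φ (hr n), Real.enorm_eq_ofReal_abs]
    refine (hcb (polyWeight κ) (ofFun φ) y _ (hr n) (hr1 n) (polyWeight_pos κ y)).trans (le_of_eq ?_)
    rw [ofReal_mul (by positivity), pw]
    congr 4
    rw [Real.rpow_neg (hr n).le, ← Real.inv_rpow (hr n).le, one_div, inv_pow, inv_inv]
  have hstep : ∀ n, ‖J (n + 1) - J n‖ₑ ≤ ofReal (15 * c * M) * N *
      ∫⁻ y, ∫⁻ u, pw κ y * (dkn κ n (y - u) * ‖h y - h u‖ₑ) := by
    intro n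
    have hdkn := measurable_dkn κ n
    simp only [hJ]
    rw [mollified_sub_eq hh φ (hr n) (hr (n + 1))]
    refine (enorm_integral_le_lintegral_enorm _).trans ?_
    rw [← lintegral_const_mul]
    swap
    · refine Measurable.lintegral_prod_right' (f := fun p : Plane × Plane =>
        pw κ p.1 * (dkn κ n (p.1 - p.2) * ‖h p.1 - h p.2‖ₑ)) (by fun_prop)
    refine lintegral_mono fun y => ?_
    simp only
    rw [enorm_mul]
    have b1 : ‖cv φ (molr ((1 / 2) ^ (n + 1))) y + cv φ (molr ((1 / 2) ^ n)) y‖ₑ ≤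
        ofReal (3 * c * ((2 : ℝ) ^ n) ^ κ) * pw κ y * N := by
      refine (enorm_add_le _ _).trans ((add_le_add (hΨ (n + 1) y) (hΨ n y)).trans ?_)
      rw [← add_mul, ← add_mul, ← ENNReal.ofReal_add (by positivity) (by positivity)]
      gcongr
      have : ((2 : ℝ) ^ (n + 1)) ^ κ ≤ 2 * ((2 : ℝ) ^ n) ^ κ := by
        rw [pow_succ, Real.mul_rpow (by positivity) (by positivity), mul_comm]
        gcongr
        calc (2 : ℝ) ^ κ ≤ 2 ^ (1 : ℝ) := by gcongr; norm_num
          _ = 2 := by simp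
      nlinarith
    have b2 : ‖∫ u, (h u - h y) * (molr ((1 / 2) ^ (n + 1)) (y - u) - molr ((1 / 2) ^ n) (y - u))‖ₑ ≤
        ∫⁻ u, ofReal (5 * M * ((2 : ℝ) ^ n) ^ 2) *
          ((if ‖y - u‖ < (1 / 2) ^ n then 1 else 0) * ‖h y - h u‖ₑ) := by
      refine (enorm_integral_le_lintegral_enorm _).trans (lintegral_mono fun u => ?_)
      simp only
      rw [enorm_mul, ← enorm_neg (h u - h y), neg_sub, mul_comm, ← mul_assoc]
      gcongr
      by_cases hu : ‖y - u‖ < (1 / 2) ^ n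
      · rw [if_pos hu, mul_one, Real.enorm_eq_ofReal_abs]
        apply ofReal_le_ofReal
        have m1 := hMb ((1 / 2) ^ (n + 1)) (y - u)
        have m2 := hMb ((1 / 2) ^ n) (y - u)
        have q1 := molr_nonneg ((1 / 2) ^ (n + 1)) (y - u)
        have q2 := molr_nonneg ((1 / 2) ^ n) (y - u)

        have e2 : ((((1 : ℝ) / 2) ^ n) ^ 2)⁻¹ = ((2 : ℝ) ^ n) ^ 2 := by
          rw [one_div, inv_pow, inv_pow, inv_inv]
        have e3 : ((((1 : ℝ) / 2) ^ (n + 1)) ^ 2)⁻¹ = 4 * ((2 : ℝ) ^ n) ^ 2 := by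
          rw [one_div, inv_pow, inv_pow, inv_inv, pow_succ]; ring
        rw [e2] at m2
        rw [e3] at m1
        rw [abs_le]
        constructor <;> nlinarith [sq_nonneg ((2 : ℝ) ^ n)]
      · rw [if_neg hu, molr_eq_zero (hr n) (not_lt.1 hu), molr_eq_zero (hr (n + 1)), sub_self]
        · simp
        · refine le_trans ?_ (not_lt.1 hu)
          exact pow_le_pow_of_le_one (by norm_num) (by norm_num) (Nat.le_succ n)
    refine (mul_le_mul' b1 b2).trans (le_of_eq ?_)
    have mI : Measurable fun z : Plane => (if ‖z‖ < (1 / 2) ^ n then (1 : ℝ≥0∞) else 0) :=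
      Measurable.ite (measurableSet_lt measurable_norm measurable_const) measurable_const measurable_const
    have mI' : Measurable fun u : Plane => (if ‖y - u‖ < (1 / 2) ^ n then (1 : ℝ≥0∞) else 0) :=
      mI.comp (measurable_const.sub measurable_id)
    rw [← lintegral_const_mul _ (by fun_prop), ← lintegral_const_mul _ (by fun_prop)]
    refine lintegral_congr fun u => ?_
    have e : ofReal (3 * c * ((2 : ℝ) ^ n) ^ κ) * ofReal (5 * M * ((2 : ℝ) ^ n) ^ 2) *
        (if ‖y - u‖ < (1 / 2) ^ n then (1 : ℝ≥0∞) else 0) = ofReal (15 * c * M) * dkn κ n (y - u) := by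
      rw [dkn]
      split_ifs
      · rw [← ofReal_mul (by positivity), ← ofReal_mul (by positivity), mul_one,
          Real.rpow_add (by positivity), Real.rpow_two]
        congr 1; ring
      · simp
    calc _ = (ofReal (3 * c * ((2 : ℝ) ^ n) ^ κ) * ofReal (5 * M * ((2 : ℝ) ^ n) ^ 2) *
        (if ‖y - u‖ < (1 / 2) ^ n then (1 : ℝ≥0∞) else 0)) * pw κ y * N * ‖h y - h u‖ₑ := by ring
      _ = _ := by rw [e]; ring
  have hJ0 : ‖J 0‖ₑ ≤ ofReal (c * M) * 2 * V * N * ∫⁻ y, pw κ y * ‖h y‖ₑ := by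
    simp only [hJ, pow_zero]
    rw [integral_mul_cv hh (cv_continuous φ.locallyIntegrable (continuous_molr _) (hasCompactSupport_molr one_pos))
      (cv_hasCompactSupport φ.hasCompactSupport (hasCompactSupport_molr one_pos)) (continuous_molr _)
      (hasCompactSupport_molr one_pos) (molr_neg 1)]
    refine (enorm_integral_le_lintegral_enorm _).trans ?_
    have mI : Measurable fun z : Plane => (if ‖z‖ < 1 then (1 : ℝ≥0∞) else 0) :=
      Measurable.ite (measurableSet_lt measurable_norm measurable_const) measurable_const measurable_const
    calc _ ≤ ∫⁻ y, ∫⁻ u, ofReal (c * M) * N * 2 * ((if ‖u - y‖ < 1 then 1 else 0) * (pw κ u * ‖h u‖ₑ)) := by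
          refine lintegral_mono fun y => ?_
          simp only
          rw [enorm_mul]
          have h1 := hΨ 0 y
          simp only [pow_zero, Real.one_rpow, mul_one] at h1
          have h2 : ‖cv h (molr 1) y‖ₑ ≤ ∫⁻ u, ofReal M * ((if ‖u - y‖ < 1 then 1 else 0) * ‖h u‖ₑ) := by
            refine (enorm_integral_le_lintegral_enorm _).trans (lintegral_mono fun u => ?_)
            simp only
            rw [enorm_mul, mul_comm, ← mul_assoc]
            gcongr
            rw [norm_sub_rev]
            by_cases hu : ‖y - u‖ < 1
            · rw [if_pos hu, mul_one, Real.enorm_eq_ofReal (molr_nonneg _ _)]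
              apply ofReal_le_ofReal
              simpa using hMb 1 (y - u)
            · rw [if_neg hu, molr_eq_zero one_pos (not_lt.1 hu)]; simp
          refine (mul_le_mul' h1 h2).trans ?_
          have mI' : Measurable fun u : Plane => (if ‖u - y‖ < 1 then (1 : ℝ≥0∞) else 0) :=
            mI.comp (measurable_id.sub measurable_const)
          rw [← lintegral_const_mul _ (by fun_prop)]
          refine lintegral_mono fun u => ?_
          simp only
          by_cases hu : ‖u - y‖ < 1
          · rw [if_pos hu, one_mul, one_mul, ofReal_mul hc.le]
            have hp : pw κ y ≤ 2 * pw κ u := by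
              unfold pw
              rw [← ENNReal.ofReal_ofNat, ← ofReal_mul (by norm_num)]
              apply ofReal_le_ofReal
              have := polyWeight_le_of_norm_sub_le hκ.le hκ1.le zero_le_one (x := y) (y := u)
                (by rw [norm_sub_rev]; exact hu.le)
              norm_num at this ⊢
              exact this
            calc _ ≤ ofReal c * (2 * pw κ u) * N * (ofReal M * ‖h u‖ₑ) := by gcongr
              _ = _ := by ring
          · rw [if_neg hu]; simp
      _ = _ := by
          rw [lintegral_lintegral_swap]
          swap
          · exact (Measurable.const_mul ((mI.comp (measurable_snd.sub measurable_fst)).mul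
              (by fun_prop)) _).aemeasurable
          have : ∀ u, ∫⁻ y, ofReal (c * M) * N * 2 * ((if ‖u - y‖ < 1 then 1 else 0) * (pw κ u * ‖h u‖ₑ)) =
              ofReal (c * M) * N * 2 * V * (pw κ u * ‖h u‖ₑ) := by
            intro u
            have mI' : Measurable fun y : Plane => (if ‖u - y‖ < 1 then (1 : ℝ≥0∞) else 0) :=
              mI.comp (measurable_const.sub measurable_id)
            rw [lintegral_const_mul _ (by fun_prop), lintegral_mul_const _ mI']
            rw [lintegral_sub_left_eq_self (fun z : Plane => if ‖z‖ < 1 then (1 : ℝ≥0∞) else 0) u]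
            have : ∫⁻ z : Plane, (if ‖z‖ < 1 then (1 : ℝ≥0∞) else 0) = V := by
              rw [hV, ← lintegral_indicator_one measurableSet_ball]
              refine lintegral_congr fun z => ?_
              simp [Set.indicator]
            rw [this]; ring
          simp_rw [this]
          rw [lintegral_const_mul _ (by fun_prop)]
          ring
  have hJN : ∀ n, ‖J n‖ₑ ≤ ‖J 0‖ₑ + ∑ k ∈ Finset.range n, ‖J (k + 1) - J k‖ₑ := by
    intro n
    induction n with
    | zero => simp
    | succ n ih =>
      rw [Finset.sum_range_succ, ← add_assoc]
      calc ‖J (n + 1)‖ₑ = ‖J n + (J (n + 1) - J n)‖ₑ := by congr 1; ring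
        _ ≤ ‖J n‖ₑ + ‖J (n + 1) - J n‖ₑ := enorm_add_le _ _
        _ ≤ _ := by gcongr
  have hall : ∀ n, ‖J n‖ₑ ≤ (ofReal (c * M) * 2 * V + ofReal (15 * c * M) * 2) * N *
        ((∫⁻ y, pw κ y * ‖h y‖ₑ) + ∫⁻ y, ∫⁻ u, pw κ y * (dk κ (y - u) * ‖h y - h u‖ₑ)) := by
    intro n
    have hs : ∑ k ∈ Finset.range n, ∫⁻ y, ∫⁻ u, pw κ y * (dkn κ k (y - u) * ‖h y - h u‖ₑ) ≤
        2 * ∫⁻ y, ∫⁻ u, pw κ y * (dk κ (y - u) * ‖h y - h u‖ₑ) := by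
      have mm : ∀ k, Measurable fun p : Plane × Plane => pw κ p.1 * (dkn κ k (p.1 - p.2) * ‖h p.1 - h p.2‖ₑ) :=
        fun k => by have := measurable_dkn κ k; fun_prop
      have mm2 : Measurable fun p : Plane × Plane => pw κ p.1 * (dk κ (p.1 - p.2) * ‖h p.1 - h p.2‖ₑ) := by
        fun_prop
      rw [← lintegral_finsetSum _ (fun k _ => (mm k).lintegral_prod_right'),
        ← lintegral_const_mul _ mm2.lintegral_prod_right']
      refine lintegral_mono fun y => ?_
      simp only
      have mk : ∀ k, Measurable fun u => pw κ y * (dkn κ k (y - u) * ‖h y - h u‖ₑ) :=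
        fun k => by have := measurable_dkn κ k; fun_prop
      have mk2 : Measurable fun u => pw κ y * (dk κ (y - u) * ‖h y - h u‖ₑ) := by fun_prop
      rw [← lintegral_finsetSum _ (fun k _ => mk k), ← lintegral_const_mul _ mk2]
      refine lintegral_mono fun u => ?_
      simp only
      rw [← Finset.mul_sum, ← Finset.sum_mul]
      rcases eq_or_ne y u with rfl | hne
      · simp
      calc _ ≤ pw κ y * ((2 * dk κ (y - u)) * ‖h y - h u‖ₑ) := by
            gcongr
            exact sum_dkn_le hκ n (sub_ne_zero.2 hne)
        _ = _ := by ring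
    refine (hJN n).trans ?_
    calc _ ≤ ofReal (c * M) * 2 * V * N * (∫⁻ y, pw κ y * ‖h y‖ₑ) + ∑ k ∈ Finset.range n,
          ofReal (15 * c * M) * N * ∫⁻ y, ∫⁻ u, pw κ y * (dkn κ k (y - u) * ‖h y - h u‖ₑ) :=
          add_le_add hJ0 (Finset.sum_le_sum fun k _ => hstep k)
      _ ≤ ofReal (c * M) * 2 * V * N * (∫⁻ y, pw κ y * ‖h y‖ₑ) + ofReal (15 * c * M) * N *
          (2 * ∫⁻ y, ∫⁻ u, pw κ y * (dk κ (y - u) * ‖h y - h u‖ₑ)) := by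
          rw [← Finset.mul_sum]
          gcongr
      _ ≤ _ := by
          rw [mul_add]
          refine add_le_add ?_ ?_
          · gcongr
            exact le_self_add
          · rw [mul_assoc (ofReal (15 * c * M)), mul_left_comm N 2, ← mul_assoc, ← mul_assoc]
            gcongr
            exact le_add_self
  exact le_of_tendsto ((continuous_enorm.tendsto _).comp (tendsto_integral_mul_mollified hh φ))
    (Eventually.of_forall hall)

/-! ### Pairing a rough coefficient with a fractionally regular function and the heat kernel -/

/-- The fractional modulus of `g` at `y`. -/
def gn (κ : ℝ) (g : Plane → ℝ) (y : Plane) : ℝ≥0∞ := (∫⁻ u, sd κ 0 y u * ‖g y - g u‖ₑ ^ 2) ^ (1 / 2 : ℝ)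

/-- Size plus fractional modulus of `g` at `y`. -/
def gm (κ : ℝ) (g : Plane → ℝ) (y : Plane) : ℝ≥0∞ := ‖g y‖ₑ + gn κ g y

theorem measurable_gn (κ : ℝ) {g : Plane → ℝ} (hg : Measurable g) : Measurable (gn κ g) := by
  have h : Measurable fun p : Plane × Plane => sd κ 0 p.1 p.2 * ‖g p.1 - g p.2‖ₑ ^ 2 :=
    (measurable_sd κ 0).mul (by fun_prop)
  exact h.lintegral_prod_right'.pow_const _

theorem measurable_gm (κ : ℝ) {g : Plane → ℝ} (hg : Measurable g) : Measurable (gm κ g) :=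
  hg.enorm.add (measurable_gn κ hg)

theorem gn_sq (κ : ℝ) (g : Plane → ℝ) (y : Plane) :
    gn κ g y ^ 2 = ∫⁻ u, sd κ 0 y u * ‖g y - g u‖ₑ ^ 2 := by
  rw [gn, ← ENNReal.rpow_two, ← ENNReal.rpow_mul]
  simp

theorem sd_eq_mul (κ l : ℝ) (x y : Plane) : sd κ l x y = ew l x * sd κ 0 x y := by
  by_cases h : ‖x - y‖ < 1
  · rw [sd_eq h, sd_eq h, mul_comm]; simp [ew]
  · rw [sd_eq_zero h, sd_eq_zero h, mul_zero]

theorem lintegral_gn_sq (κ l : ℝ) {g : Plane → ℝ} (hg : Measurable g) :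
    ∫⁻ y, gn κ g y ^ 2 ∂(expMeas l) =
      eLpNorm (fun p : Plane × Plane => g p.1 - g p.2) 2 (slobMeas κ l) ^ 2 := by
  rw [eLpNorm_two_sq, lintegral_slobMeas κ l (by fun_prop), lintegral_expMeas]
  refine lintegral_congr fun y => ?_
  have : Measurable fun u => sd κ 0 y u * ‖g y - g u‖ₑ ^ 2 :=
    ((measurable_sd κ 0).comp measurable_prodMk_left).mul (by fun_prop)
  rw [gn_sq, ← lintegral_const_mul _ this]
  refine lintegral_congr fun u => ?_
  simp only
  rw [sd_eq_mul κ l, mul_assoc]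

theorem lintegral_gm_sq_le (κ l : ℝ) {g : Plane → ℝ} (hg : Measurable g) :
    ∫⁻ y, gm κ g y ^ 2 ∂(expMeas l) ≤ 2 * nrm κ l g ^ 2 := by
  calc _ ≤ ∫⁻ y, (2 * ‖g y‖ₑ ^ 2 + 2 * gn κ g y ^ 2) ∂(expMeas l) := by
        refine lintegral_mono fun y => ?_
        rw [← mul_add]
        have := ENNReal.rpow_add_le_mul_rpow_add_rpow ‖g y‖ₑ (gn κ g y) (p := 2) one_le_two
        norm_num at this
        exact this
    _ = 2 * (eLpNorm g 2 (expMeas l) ^ 2 +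
        eLpNorm (fun p : Plane × Plane => g p.1 - g p.2) 2 (slobMeas κ l) ^ 2) := by
        rw [lintegral_add_left (by fun_prop), lintegral_const_mul _ (by fun_prop),
          lintegral_const_mul _ ((measurable_gn κ hg).pow_const 2), lintegral_gn_sq κ l hg, eLpNorm_two_sq (expMeas l),
          mul_add]
    _ ≤ _ := by
        gcongr
        rw [nrm]
        set a := eLpNorm g 2 (expMeas l)
        set b := eLpNorm (fun p : Plane × Plane => g p.1 - g p.2) 2 (slobMeas κ l)
        calc a ^ 2 + b ^ 2 ≤ a ^ 2 + b ^ 2 + 2 * a * b := le_self_add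
          _ = _ := by ring

theorem lintegral_dk_mul_le (κ : ℝ) {g : Plane → ℝ} (hg : Measurable g) (y : Plane) :
    ∫⁻ u, dk κ (y - u) * ‖g y - g u‖ₑ ≤ (∫⁻ z, near (2 - 2 * κ) 1 z) ^ (1 / 2 : ℝ) * gn κ g y := by
  set a : Plane → ℝ≥0∞ := fun u => (if ‖y - u‖ < 1 then ofReal (‖y - u‖ ^ (-(3 * κ))) else 0) * ‖g y - g u‖ₑ
    with ha
  have hma : Measurable a := (Measurable.ite (measurableSet_lt (by fun_prop) measurable_const) (by fun_prop)
    measurable_const).mul (by fun_prop)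
  have hn := measurable_near (2 - 2 * κ) 1
  have h := sq_lintegral_mul_le volume (f := fun u => near (2 - 2 * κ) 1 (y - u)) (g := a)
    (by fun_prop) hma.aemeasurable
  have hpow : ∀ u, y ≠ u → ‖y - u‖ < 1 → ∀ p q : ℝ, ofReal (‖y - u‖ ^ (-p)) * ofReal (‖y - u‖ ^ (-q)) =
      ofReal (‖y - u‖ ^ (-(p + q))) := by
    intro u hu _ p q
    rw [← ofReal_mul (by positivity), ← Real.rpow_add (norm_pos_iff.2 (sub_ne_zero.2 hu)), neg_add]
  have e1 : ∀ u, near (2 - 2 * κ) 1 (y - u) * a u = dk κ (y - u) * ‖g y - g u‖ₑ := by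
    intro u
    rcases eq_or_ne y u with rfl | hu
    · simp [ha]
    by_cases hlt : ‖y - u‖ < 1
    · simp only [ha, near, dk, if_pos hlt, if_pos hlt.le]
      rw [← mul_assoc, hpow u hu hlt]
      ring_nf
    · simp only [ha, dk, if_neg hlt]; simp
  have e2 : ∀ u, near (2 - 2 * κ) 1 (y - u) * a u ^ 2 = sd κ 0 y u * ‖g y - g u‖ₑ ^ 2 := by
    intro u
    rcases eq_or_ne y u with rfl | hu
    · simp [ha]
    by_cases hlt : ‖y - u‖ < 1
    · simp only [ha, near, if_pos hlt, if_pos hlt.le, sd_eq hlt]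
      rw [mul_pow, ← mul_assoc, sq (ofReal _), hpow u hu hlt, hpow u hu hlt]
      simp only [ew, zero_mul, neg_zero, Real.exp_zero, ENNReal.ofReal_one, mul_one]
      ring_nf
    · simp only [ha, if_neg hlt, sd_eq_zero hlt]; simp
  simp_rw [e1, e2] at h
  rw [lintegral_sub_left_eq_self (fun z => near (2 - 2 * κ) 1 z) y] at h
  rw [gn, ← ENNReal.mul_rpow_of_nonneg _ _ (by norm_num)]
  rw [← ENNReal.rpow_two] at h
  have := ENNReal.rpow_le_rpow h (by norm_num : (0 : ℝ) ≤ 1 / 2)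
  rw [← ENNReal.rpow_mul] at this
  simpa using this

theorem pw_le_two_mul {κ : ℝ} (hκ : 0 < κ) (hκ1 : κ < 1) {y u : Plane} (h : ‖y - u‖ < 1) :
    pw κ y ≤ 2 * pw κ u := by
  unfold pw
  rw [← ENNReal.ofReal_ofNat, ← ofReal_mul (by norm_num)]
  apply ofReal_le_ofReal
  have := polyWeight_le_of_norm_sub_le hκ.le hκ1.le zero_le_one (x := y) (y := u)
    (by rw [norm_sub_rev] at h; first | exact h.le | (rw [norm_sub_rev]; exact h.le))
  norm_num at this ⊢
  exact this

theorem heatKernel_le_four_mul {t : ℝ} (ht : 0 < t) (z : Plane) :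
    heatKernel t z ≤ 4 * heatKernel (4 * t) z := by
  have h1 := heatKernel_le_two_mul ht z
  have h2 := heatKernel_le_two_mul (by positivity : 0 < 2 * t) z
  rw [← mul_assoc] at h2
  norm_num at h2
  linarith

theorem pairing_integrand_le {κ τ : ℝ} (hκ : 0 < κ) (hκ1 : κ < 1) (hτ : 0 < τ) (g : Plane → ℝ) (x y u : Plane) :
    pw κ y * (dk κ (y - u) * ‖g y * heatKernel τ (x - y) - g u * heatKernel τ (x - u)‖ₑ) ≤
      pw κ y * ofReal (heatKernel τ (x - y)) * (dk κ (y - u) * ‖g y - g u‖ₑ) +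
      ofReal (16 / √τ) * (near (1 + κ) (√τ) (y - u) *
        (ofReal (heatKernel (4 * τ) (x - u)) * (pw κ u * ‖g u‖ₑ))) +
      (ofReal (heatKernel τ (x - y)) * (pw κ y * ‖g y‖ₑ) * far (2 + κ) (√τ) (y - u) +
       2 * (far (2 + κ) (√τ) (y - u) * (ofReal (heatKernel τ (x - u)) * (pw κ u * ‖g u‖ₑ)))) := by
  have hs : 0 < √τ := Real.sqrt_pos.2 hτ
  have hK : ∀ z, ‖heatKernel τ z‖ₑ = ofReal (heatKernel τ z) := fun z =>
    Real.enorm_eq_ofReal (heatKernel_nonneg hτ.le z)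
  by_cases h1 : ‖y - u‖ < 1
  swap
  · rw [dk, if_neg h1]; simp
  have hp := pw_le_two_mul hκ hκ1 h1
  by_cases hn : ‖y - u‖ ≤ √τ
  · refine le_trans ?_ le_self_add
    have e : g y * heatKernel τ (x - y) - g u * heatKernel τ (x - u) =
        (g y - g u) * heatKernel τ (x - y) + g u * (heatKernel τ (x - y) - heatKernel τ (x - u)) := by ring
    have hd : ‖heatKernel τ (x - y) - heatKernel τ (x - u)‖ₑ ≤
        ofReal (8 / √τ * ‖y - u‖) * ofReal (heatKernel (4 * τ) (x - u)) := by
      rw [Real.enorm_eq_ofReal_abs, ← ofReal_mul (by positivity)]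
      apply ofReal_le_ofReal
      have e2 : ‖(x - y) - (x - u)‖ = ‖y - u‖ := by rw [sub_sub_sub_cancel_left, norm_sub_rev]
      have := abs_heatKernel_sub_le hτ (w := x - u) (u := x - y) (by rw [e2]; exact hn)
      rwa [e2] at this
    have hdn : dk κ (y - u) * ofReal (8 / √τ * ‖y - u‖) = ofReal (8 / √τ) * near (1 + κ) (√τ) (y - u) := by
      rw [dk, if_pos h1, near, if_pos hn, ← ofReal_mul (by positivity), ← ofReal_mul (by positivity)]
      congr 1
      rcases eq_or_ne ‖y - u‖ 0 with h0 | h0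
      · rw [h0, Real.zero_rpow (by linarith), Real.zero_rpow (by linarith)]; simp
      · have hpos : 0 < ‖y - u‖ := lt_of_le_of_ne (norm_nonneg _) (Ne.symm h0)
        have : ‖y - u‖ ^ (-(1 + κ)) = ‖y - u‖ ^ (-(2 + κ)) * ‖y - u‖ := by
          rw [← Real.rpow_add_one h0]; congr 1; ring
        rw [this]; ring
    rw [e]
    calc _ ≤ pw κ y * (dk κ (y - u) * (‖g y - g u‖ₑ * ofReal (heatKernel τ (x - y)) +
          ‖g u‖ₑ * (ofReal (8 / √τ * ‖y - u‖) * ofReal (heatKernel (4 * τ) (x - u))))) := by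
          gcongr
          refine (enorm_add_le _ _).trans ?_
          rw [enorm_mul, enorm_mul, hK]
          gcongr
      _ = pw κ y * ofReal (heatKernel τ (x - y)) * (dk κ (y - u) * ‖g y - g u‖ₑ) +
          pw κ y * ((dk κ (y - u) * ofReal (8 / √τ * ‖y - u‖)) *
            (‖g u‖ₑ * ofReal (heatKernel (4 * τ) (x - u)))) := by ring
      _ ≤ _ := by
          refine add_le_add le_rfl ?_
          rw [hdn]
          calc _ ≤ (2 * pw κ u) * (ofReal (8 / √τ) * near (1 + κ) (√τ) (y - u) *
                (‖g u‖ₑ * ofReal (heatKernel (4 * τ) (x - u)))) := by gcongr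
            _ = (2 * ofReal (8 / √τ)) * (near (1 + κ) (√τ) (y - u) *
                (ofReal (heatKernel (4 * τ) (x - u)) * (pw κ u * ‖g u‖ₑ))) := by ring
            _ = _ := by
                congr 1
                rw [← ENNReal.ofReal_ofNat 2, ← ofReal_mul (by norm_num)]
                congr 1; ring
  · refine le_trans ?_ le_add_self
    have hdf : dk κ (y - u) = far (2 + κ) (√τ) (y - u) := by
      rw [dk, if_pos h1, far, if_pos (not_le.1 hn)]
    rw [hdf]
    calc _ ≤ pw κ y * (far (2 + κ) (√τ) (y - u) * (‖g y‖ₑ * ofReal (heatKernel τ (x - y)) +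
          ‖g u‖ₑ * ofReal (heatKernel τ (x - u)))) := by
          gcongr
          refine (enorm_sub_le).trans ?_
          rw [enorm_mul, enorm_mul, hK, hK]
      _ = ofReal (heatKernel τ (x - y)) * (pw κ y * ‖g y‖ₑ) * far (2 + κ) (√τ) (y - u) +
          pw κ y * (far (2 + κ) (√τ) (y - u) * (‖g u‖ₑ * ofReal (heatKernel τ (x - u)))) := by ring
      _ ≤ _ := by
          refine add_le_add le_rfl ?_
          calc _ ≤ (2 * pw κ u) * (far (2 + κ) (√τ) (y - u) * (‖g u‖ₑ * ofReal (heatKernel τ (x - u)))) := by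
                gcongr
            _ = _ := by ring

theorem setLIntegral_lt_top_of_sq {l : ℝ} {g : Plane → ℝ≥0∞} (hg : Measurable g)
    (h : ∫⁻ x, g x ^ 2 ∂(expMeas l) < ⊤) {k : Set Plane} (hk : IsCompact k) : ∫⁻ x in k, g x < ⊤ := by
  obtain ⟨b, hb⟩ := hk.isBounded.exists_norm_le
  have hlow : ∀ x ∈ k, ofReal (Real.exp (-(|l| * (1 + b)))) ≤ ew l x := by
    intro x hx
    unfold ew
    apply ofReal_le_ofReal
    apply Real.exp_le_exp.2
    have h1 : l * (1 + ‖x‖) ≤ |l| * (1 + b) :=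
      mul_le_mul (le_abs_self l) (by linarith [hb x hx]) (by positivity) (abs_nonneg _)
    linarith
  have hsq : ∫⁻ x in k, g x ^ 2 < ⊤ := by
    have h2 : ofReal (Real.exp (-(|l| * (1 + b)))) * ∫⁻ x in k, g x ^ 2 < ⊤ := by
      rw [← lintegral_const_mul _ (by fun_prop)]
      refine lt_of_le_of_lt ?_ h
      rw [lintegral_expMeas]
      refine (setLIntegral_mono' hk.measurableSet fun x hx => ?_).trans (setLIntegral_le_lintegral k _)
      gcongr
      exact hlow x hx
    by_contra hcon
    rw [not_lt, top_le_iff] at hcon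
    rw [hcon, ENNReal.mul_top (by simp [Real.exp_pos])] at h2
    exact lt_irrefl _ h2
  have h3 := sq_lintegral_mul_le (volume.restrict k) (f := fun _ => 1) (g := g) aemeasurable_const (by fun_prop)
  simp only [one_mul] at h3
  have h4 : (∫⁻ x in k, g x) ^ 2 < ⊤ :=
    h3.trans_lt (mul_lt_top (by simpa using hk.measure_lt_top) hsq)
  exact lt_top_iff_ne_top.2 fun h5 => by rw [h5] at h4; simp at h4

theorem locallyIntegrable_of_eLpNorm {l : ℝ} {g : Plane → ℝ} (hg : Measurable g)
    (h : eLpNorm g 2 (expMeas l) < ⊤) : LocallyIntegrable g := by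
  rw [locallyIntegrable_iff]
  intro k hk
  refine ⟨hg.aestronglyMeasurable, setLIntegral_lt_top_of_sq (l := l) hg.enorm ?_ hk⟩
  rw [← eLpNorm_two_sq]
  exact ENNReal.pow_lt_top h

theorem lintegral_lintegral_sub_mul {n q : Plane → ℝ≥0∞} (hn : Measurable n) (hq : Measurable q) :
    ∫⁻ y, ∫⁻ u, n (y - u) * q u = (∫⁻ z, n z) * ∫⁻ u, q u := by
  rw [lintegral_lintegral_swap (by fun_prop)]
  have : ∀ u, ∫⁻ y, n (y - u) * q u = (∫⁻ z, n z) * q u := fun u => by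
    rw [lintegral_mul_const _ (by fun_prop), lintegral_sub_right_eq_self n u]
  simp_rw [this]
  rw [lintegral_const_mul _ hq]

set_option maxHeartbeats 1000000 in
theorem exists_pairing_bound {κ : ℝ} (hκ : 0 < κ) (hκ1 : κ < 1) (T : ℝ) :
    ∃ C : ℝ≥0∞, C ≠ ⊤ ∧ ∀ (φ : Test) (l τ : ℝ), 0 < τ → τ ≤ T → ∀ g : Plane → ℝ, Measurable g →
      eLpNorm g 2 (expMeas l) < ⊤ → ∀ x,
      ‖∫ y, φ y * g y * heatKernel τ (x - y)‖ₑ ≤ C * holderNorm (-κ) (polyWeight κ) (ofFun φ) *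
        ofReal (τ ^ (-(κ / 2))) * kconv (4 * τ) (fun y => pw κ y * gm κ g y) x := by
  obtain ⟨C₀, hC₀, hdual⟩ := exists_duality hκ hκ1
  set c₁ := (∫⁻ z, near (2 - 2 * κ) 1 z) ^ (1 / 2 : ℝ) with hc₁
  set c₂ := ∫⁻ z, near (1 + κ) 1 z with hc₂
  set c₃ := ∫⁻ z, far (2 + κ) 1 z with hc₃
  have hc₁t : c₁ ≠ ⊤ := (ENNReal.rpow_lt_top_of_nonneg (by norm_num) (lintegral_near_lt_top (by linarith)).ne).ne
  have hc₂t : c₂ ≠ ⊤ := (lintegral_near_lt_top (by linarith)).ne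
  have hc₃t : c₃ ≠ ⊤ := (lintegral_far_lt_top (by linarith)).ne
  refine ⟨C₀ * (ofReal (T ^ (κ / 2)) * 4 * (1 + c₁) + 16 * c₂ + 12 * c₃), ?_, ?_⟩
  · refine mul_ne_top hC₀ (ENNReal.add_ne_top.2 ⟨ENNReal.add_ne_top.2 ⟨?_, ?_⟩, ?_⟩)
    · exact mul_ne_top (mul_ne_top ofReal_ne_top ENNReal.ofNat_ne_top)
        (ENNReal.add_ne_top.2 ⟨ENNReal.one_ne_top, hc₁t⟩)
    · exact mul_ne_top ENNReal.ofNat_ne_top hc₂t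
    · exact mul_ne_top ENNReal.ofNat_ne_top hc₃t
  intro φ l τ hτ hT g hg hgl x
  have hs : 0 < √τ := Real.sqrt_pos.2 hτ
  have hKc : Continuous fun y => heatKernel τ (x - y) := (continuous_heatKernel τ).comp (by fun_prop)
  have hKm := hKc.measurable
  have hK4m : Measurable fun y => heatKernel (4 * τ) (x - y) :=
    ((continuous_heatKernel (4 * τ)).comp (by fun_prop)).measurable
  have hpw := measurable_pw κ
  have hdk := measurable_dk κ
  have hnr := measurable_near (1 + κ) (√τ)
  have hfr := measurable_far (2 + κ) (√τ)
  have hgn := measurable_gn κ hg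
  have h0 := hdual φ (fun y => g y * heatKernel τ (x - y))
    (LocallyIntegrable.mul_continuous hKc (locallyIntegrable_of_eLpNorm hg hgl)) (hg.mul hKm)
  set N := holderNorm (-κ) (polyWeight κ) (ofFun φ) with hN
  set q : Plane → ℝ≥0∞ := fun y => ofReal (heatKernel (4 * τ) (x - y)) * (pw κ y * ‖g y‖ₑ) with hq
  set q' : Plane → ℝ≥0∞ := fun y => ofReal (heatKernel τ (x - y)) * (pw κ y * ‖g y‖ₑ) with hq'
  have hqm : Measurable q := by rw [hq]; fun_prop
  have hqm' : Measurable q' := by rw [hq']; fun_prop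
  have hK4 : ∀ y, ofReal (heatKernel τ (x - y)) ≤ 4 * ofReal (heatKernel (4 * τ) (x - y)) := fun y => by
    rw [← ENNReal.ofReal_ofNat 4, ← ofReal_mul (by norm_num)]
    exact ofReal_le_ofReal (heatKernel_le_four_mul hτ _)
  set Q₁ := ∫⁻ y, q y with hQ₁
  set Q₂ := ∫⁻ y, ofReal (heatKernel (4 * τ) (x - y)) * (pw κ y * gn κ g y) with hQ₂
  have hQ : kconv (4 * τ) (fun y => pw κ y * gm κ g y) x = Q₁ + Q₂ := by
    rw [hQ₁, hQ₂, ← lintegral_add_left hqm, kconv]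
    refine lintegral_congr fun y => ?_
    simp only [hq, gm]
    ring
  have hq4 : ∫⁻ y, q' y ≤ 4 * Q₁ := by
    rw [hQ₁, ← lintegral_const_mul _ hqm]
    refine lintegral_mono fun y => ?_
    simp only [hq, hq']
    rw [← mul_assoc 4]
    exact mul_le_mul_left (hK4 y) _
  have hA : ∫⁻ y, pw κ y * ‖g y * heatKernel τ (x - y)‖ₑ = ∫⁻ y, q' y := by
    refine lintegral_congr fun y => ?_
    simp only [hq']
    rw [enorm_mul, Real.enorm_eq_ofReal (heatKernel_nonneg hτ.le _)]
    ring
  have hB : ∫⁻ y, ∫⁻ u, pw κ y * (dk κ (y - u) * ‖g y * heatKernel τ (x - y) - g u * heatKernel τ (x - u)‖ₑ) ≤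
      c₁ * (4 * Q₂) + ofReal (16 / √τ) * ((∫⁻ z, near (1 + κ) (√τ) z) * Q₁) +
        ((∫⁻ y, q' y) * (∫⁻ z, far (2 + κ) (√τ) z) + 2 * ((∫⁻ z, far (2 + κ) (√τ) z) * ∫⁻ y, q' y)) := by
    calc _ ≤ ∫⁻ y, (c₁ * (4 * (ofReal (heatKernel (4 * τ) (x - y)) * (pw κ y * gn κ g y))) +
          ofReal (16 / √τ) * (∫⁻ u, near (1 + κ) (√τ) (y - u) * q u) +
          (q' y * (∫⁻ z, far (2 + κ) (√τ) z) + 2 * (∫⁻ u, far (2 + κ) (√τ) (y - u) * q' u))) := by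
          refine lintegral_mono fun y => ?_
          refine (lintegral_mono fun u => pairing_integrand_le hκ hκ1 hτ g x y u).trans ?_
          rw [lintegral_add_left (by fun_prop), lintegral_add_left (by fun_prop),
            lintegral_add_left (by fun_prop), lintegral_const_mul _ (by fun_prop),
            lintegral_const_mul (ofReal (16 / √τ)) (by fun_prop),
            lintegral_const_mul _ (by fun_prop), lintegral_const_mul 2 (by fun_prop)]
          refine add_le_add (add_le_add ?_ le_rfl) (add_le_add ?_ le_rfl)
          · calc _ ≤ pw κ y * (4 * ofReal (heatKernel (4 * τ) (x - y))) * (c₁ * gn κ g y) :=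
                  mul_le_mul' (mul_le_mul' le_rfl (hK4 y)) (lintegral_dk_mul_le κ hg y)
              _ = _ := by ring
          · rw [lintegral_sub_left_eq_self (fun z => far (2 + κ) (√τ) z) y]
      _ = _ := by
          have m1 : Measurable fun y => ∫⁻ u, near (1 + κ) (√τ) (y - u) * q u :=
            Measurable.lintegral_prod_right' (f := fun p : Plane × Plane => near (1 + κ) (√τ) (p.1 - p.2) * q p.2)
              (by fun_prop)
          have m2 : Measurable fun y => ∫⁻ u, far (2 + κ) (√τ) (y - u) * q' u :=
            Measurable.lintegral_prod_right' (f := fun p : Plane × Plane => far (2 + κ) (√τ) (p.1 - p.2) * q' p.2)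
              (by fun_prop)
          rw [lintegral_add_left (by fun_prop), lintegral_add_left (by fun_prop),
            lintegral_add_left (by fun_prop), lintegral_const_mul _ (by fun_prop),
            lintegral_const_mul 4 (by fun_prop), lintegral_const_mul _ m1,
            lintegral_mul_const _ hqm', lintegral_const_mul _ m2, lintegral_lintegral_sub_mul hnr hqm,
            lintegral_lintegral_sub_mul hfr hqm']
  have en : ofReal (16 / √τ) * (∫⁻ z, near (1 + κ) (√τ) z) = 16 * c₂ * ofReal (τ ^ (-(κ / 2))) := by
    rw [lintegral_near hs, ← mul_assoc, ← ofReal_mul (by positivity), ← ENNReal.ofReal_ofNat 16, mul_right_comm,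
      ← ofReal_mul (by norm_num)]
    congr 2
    rw [div_mul_eq_mul_div, mul_div_assoc]
    congr 1
    rw [Real.sqrt_eq_rpow, ← Real.rpow_mul hτ.le, ← Real.rpow_sub hτ]
    congr 1; ring
  have ef : (∫⁻ z, far (2 + κ) (√τ) z) = c₃ * ofReal (τ ^ (-(κ / 2))) := by
    rw [lintegral_far hs, mul_comm]
    congr 2
    rw [Real.sqrt_eq_rpow, ← Real.rpow_mul hτ.le]
    congr 1; ring
  have e1 : 1 ≤ ofReal (T ^ (κ / 2)) * ofReal (τ ^ (-(κ / 2))) := by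
    rw [← ofReal_mul (by have := hτ.trans_le hT; positivity), ← ENNReal.ofReal_one]
    apply ofReal_le_ofReal
    rw [Real.rpow_neg hτ.le, ← div_eq_mul_inv, le_div_iff₀ (by positivity), one_mul]
    exact Real.rpow_le_rpow hτ.le hT (by positivity)
  set ρ := ofReal (τ ^ (-(κ / 2))) with hρ
  set σ := ofReal (T ^ (κ / 2)) with hσ
  rw [hA] at h0
  have e0 : ∫ y, φ y * g y * heatKernel τ (x - y) = ∫ y, g y * heatKernel τ (x - y) * φ y := by
    congr 1; funext y; ring
  rw [e0, hQ]
  refine h0.trans ?_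
  have hfin : (∫⁻ y, q' y) + ∫⁻ y, ∫⁻ u, pw κ y * (dk κ (y - u) *
        ‖g y * heatKernel τ (x - y) - g u * heatKernel τ (x - u)‖ₑ) ≤
      (σ * 4 * (1 + c₁) + 16 * c₂ + 12 * c₃) * (ρ * (Q₁ + Q₂)) := by
    refine (add_le_add hq4 hB).trans ?_
    rw [← mul_assoc (ofReal (16 / √τ)), en, ef]
    calc _ ≤ 1 * (4 * Q₁) + (1 * (c₁ * (4 * Q₂)) + 16 * c₂ * ρ * Q₁ + (4 * Q₁ * (c₃ * ρ) + 2 * (c₃ * ρ * (4 * Q₁)))) := by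
          rw [one_mul, one_mul]
          gcongr
      _ ≤ (σ * ρ) * (4 * Q₁) + ((σ * ρ) * (c₁ * (4 * Q₂)) + 16 * c₂ * ρ * Q₁ + (4 * Q₁ * (c₃ * ρ) + 2 * (c₃ * ρ * (4 * Q₁)))) := by
          gcongr
      _ ≤ (σ * ρ) * (4 * Q₁) + ((σ * ρ) * (c₁ * (4 * Q₂)) + 16 * c₂ * ρ * Q₁ + (4 * Q₁ * (c₃ * ρ) + 2 * (c₃ * ρ * (4 * Q₁)))) +
          (σ * ρ * 4 * Q₂ + σ * ρ * 4 * c₁ * Q₁ + 16 * c₂ * ρ * Q₂ + 12 * c₃ * ρ * Q₂) := le_self_add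
      _ = _ := by ring
  calc _ ≤ C₀ * N * ((σ * 4 * (1 + c₁) + 16 * c₂ + 12 * c₃) * (ρ * (Q₁ + Q₂))) := by gcongr
    _ = _ := by ring

theorem pw_sq_mul_ew_le {κ τ : ℝ} (hκ : 0 < κ) (hκ1 : κ ≤ 1 / 2) (hτ : 0 < τ) (l : ℝ) (x : Plane) :
    pw κ x ^ 2 * ew (l + τ) x ≤ ofReal (τ ^ (-(2 * κ))) * ew l x := by
  have hr : 0 < 1 + ‖x‖ := by positivity
  rw [pw, ew, ew, ← ENNReal.ofReal_pow (polyWeight_pos κ x).le, ← ofReal_mul (by positivity),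
    ← ofReal_mul (by positivity)]
  apply ofReal_le_ofReal
  have e1 : polyWeight κ x ^ 2 = (1 + ‖x‖) ^ (2 * κ) := by
    rw [polyWeight, ← Real.rpow_natCast, ← Real.rpow_mul hr.le]; congr 1; push_cast; ring
  have e2 : Real.exp (-((l + τ) * (1 + ‖x‖))) = Real.exp (-(l * (1 + ‖x‖))) * Real.exp (-(τ * (1 + ‖x‖))) := by
    rw [← Real.exp_add]; congr 1; ring
  have e3 : (τ * (1 + ‖x‖)) ^ (2 * κ) ≤ Real.exp (τ * (1 + ‖x‖)) := by
    have hs : 0 < τ * (1 + ‖x‖) := by positivity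
    rcases le_total (τ * (1 + ‖x‖)) 1 with h | h
    · exact (Real.rpow_le_one hs.le h (by positivity)).trans (Real.one_le_exp hs.le)
    · calc _ ≤ (τ * (1 + ‖x‖)) ^ (1 : ℝ) := Real.rpow_le_rpow_of_exponent_le h (by linarith)
        _ = τ * (1 + ‖x‖) := Real.rpow_one _
        _ ≤ _ := by linarith [Real.add_one_le_exp (τ * (1 + ‖x‖))]
  rw [Real.mul_rpow hτ.le hr.le] at e3
  rw [e1, e2, Real.rpow_neg hτ.le, Real.exp_neg (τ * (1 + ‖x‖))]
  have hE := Real.exp_pos (τ * (1 + ‖x‖))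
  have hp : 0 < τ ^ (2 * κ) := by positivity
  rw [mul_comm (Real.exp (-(l * (1 + ‖x‖)))), ← mul_assoc]
  gcongr
  rw [← div_eq_mul_inv, div_le_iff₀ hE, ← div_eq_inv_mul, le_div_iff₀ hp, mul_comm]
  exact e3

theorem lintegral_pw_gm_sq_le {κ τ : ℝ} (hκ : 0 < κ) (hκ1 : κ ≤ 1 / 2) (hτ : 0 < τ) (l : ℝ) {g : Plane → ℝ}
    (hg : Measurable g) :
    ∫⁻ y, (pw κ y * gm κ g y) ^ 2 ∂(expMeas (l + τ)) ≤
      ofReal (τ ^ (-(2 * κ))) * (2 * nrm κ l g ^ 2) := by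
  have hgm := measurable_gm κ hg
  have hew := measurable_ew l
  calc _ ≤ ∫⁻ y, ofReal (τ ^ (-(2 * κ))) * (ew l y * gm κ g y ^ 2) := by
        rw [lintegral_expMeas]
        refine lintegral_mono fun y => ?_
        simp only
        calc _ = (pw κ y ^ 2 * ew (l + τ) y) * gm κ g y ^ 2 := by ring
          _ ≤ (ofReal (τ ^ (-(2 * κ))) * ew l y) * gm κ g y ^ 2 :=
            mul_le_mul_left (pw_sq_mul_ew_le hκ hκ1 hτ l y) _
          _ = _ := by ring
    _ = ofReal (τ ^ (-(2 * κ))) * ∫⁻ y, gm κ g y ^ 2 ∂(expMeas l) := by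
        rw [lintegral_const_mul _ (by fun_prop), lintegral_expMeas]
    _ ≤ _ := by gcongr; exact lintegral_gm_sq_le κ l hg

/-! ### Elementary properties of the norms -/

theorem eLpNorm_le_nrm (κ l : ℝ) (g : Plane → ℝ) : eLpNorm g 2 (expMeas l) ≤ nrm κ l g := le_self_add

theorem nrm_add_le (κ l : ℝ) {g g' : Plane → ℝ} (hg : Measurable g) (hg' : Measurable g') :
    nrm κ l (fun x => g x + g' x) ≤ nrm κ l g + nrm κ l g' := by
  have h1 : eLpNorm (fun x => g x + g' x) 2 (expMeas l) ≤ eLpNorm g 2 (expMeas l) + eLpNorm g' 2 (expMeas l) :=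
    eLpNorm_add_le hg.aestronglyMeasurable hg'.aestronglyMeasurable one_le_two
  have h2 : eLpNorm (fun p : Plane × Plane => (g p.1 + g' p.1) - (g p.2 + g' p.2)) 2 (slobMeas κ l) ≤
      eLpNorm (fun p : Plane × Plane => g p.1 - g p.2) 2 (slobMeas κ l) +
      eLpNorm (fun p : Plane × Plane => g' p.1 - g' p.2) 2 (slobMeas κ l) := by
    have e : (fun p : Plane × Plane => (g p.1 + g' p.1) - (g p.2 + g' p.2)) =
      (fun p : Plane × Plane => g p.1 - g p.2) + fun p : Plane × Plane => g' p.1 - g' p.2 := by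
      funext p; simp only [Pi.add_apply]; ring
    rw [e]
    exact eLpNorm_add_le (by fun_prop : Measurable _).aestronglyMeasurable
      (by fun_prop : Measurable _).aestronglyMeasurable one_le_two
  unfold nrm
  exact (add_le_add h1 h2).trans (le_of_eq (by ring))

theorem nrm_const_mul (κ l c : ℝ) (g : Plane → ℝ) :
    nrm κ l (fun x => c * g x) = ‖c‖ₑ * nrm κ l g := by
  have e : (fun p : Plane × Plane => c * g p.1 - c * g p.2) = c • fun p : Plane × Plane => g p.1 - g p.2 := by
    funext p; simp [mul_sub]
  have e' : (fun x => c * g x) = c • g := rfl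
  unfold nrm
  rw [e, e', eLpNorm_const_smul, eLpNorm_const_smul, mul_add]

theorem nrm_neg (κ l : ℝ) (g : Plane → ℝ) : nrm κ l (fun x => - g x) = nrm κ l g := by
  have := nrm_const_mul κ l (-1) g
  simpa using this

theorem nrm_sub_le (κ l : ℝ) {g g' : Plane → ℝ} (hg : Measurable g) (hg' : Measurable g') :
    nrm κ l (fun x => g x - g' x) ≤ nrm κ l g + nrm κ l g' := by
  have := nrm_add_le κ l hg (g' := fun x => - g' x) hg'.neg
  rw [nrm_neg] at this
  simpa [sub_eq_add_neg] using this

theorem nrm_zero (κ l : ℝ) : nrm κ l (fun _ => 0) = 0 := by simp [nrm]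

theorem ae_prod_congr {g g' : Plane → ℝ} (h : g =ᵐ[volume] g') :
    (fun p : Plane × Plane => g p.1 - g p.2) =ᵐ[(volume : Measure Plane).prod volume]
      fun p => g' p.1 - g' p.2 := by
  filter_upwards [Measure.quasiMeasurePreserving_fst.ae h, Measure.quasiMeasurePreserving_snd.ae h] with p h1 h2
  rw [h1, h2]

theorem nrm_congr_ae (κ l : ℝ) {g g' : Plane → ℝ} (h : g =ᵐ[volume] g') : nrm κ l g = nrm κ l g' := by
  unfold nrm
  rw [eLpNorm_congr_ae ((expMeas_absolutelyContinuous l).ae_eq h),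
    eLpNorm_congr_ae ((slobMeas_absolutelyContinuous κ l).ae_eq (ae_prod_congr h))]

theorem expMeas_mono {l l' : ℝ} (h : l ≤ l') : expMeas l' ≤ expMeas l :=
  withDensity_mono (Eventually.of_forall fun x => ew_antitone h x)

theorem slobMeas_mono {κ l l' : ℝ} (h : l ≤ l') : slobMeas κ l' ≤ slobMeas κ l :=
  withDensity_mono (Eventually.of_forall fun p => sd_antitone h p.1 p.2)

theorem nrm_mono_weight {κ l l' : ℝ} (h : l ≤ l') (g : Plane → ℝ) : nrm κ l' g ≤ nrm κ l g :=
  add_le_add (eLpNorm_mono_measure _ (expMeas_mono h)) (eLpNorm_mono_measure _ (slobMeas_mono h))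

theorem ae_eq_zero_of_eLpNorm {l : ℝ} {g : Plane → ℝ} (hg : Measurable g) (h : eLpNorm g 2 (expMeas l) = 0) :
    g =ᵐ[volume] 0 :=
  (absolutelyContinuous_expMeas l).ae_eq ((eLpNorm_eq_zero_iff hg.aestronglyMeasurable two_ne_zero).1 h)

/-- Measurable functions with a finite weighted fractional norm. -/
def Reg (κ : ℝ) (g : Plane → ℝ) : Prop := Measurable g ∧ ∃ l, nrm κ l g < ⊤

theorem Reg.add {κ : ℝ} {g g' : Plane → ℝ} (h : Reg κ g) (h' : Reg κ g') : Reg κ fun x => g x + g' x := by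
  obtain ⟨hm, l, hl⟩ := h
  obtain ⟨hm', l', hl'⟩ := h'
  refine ⟨hm.add hm', max l l', (nrm_add_le κ _ hm hm').trans_lt (ENNReal.add_lt_top.2
    ⟨(nrm_mono_weight (le_max_left _ _) g).trans_lt hl, (nrm_mono_weight (le_max_right _ _) g').trans_lt hl'⟩)⟩

theorem Reg.const_mul {κ : ℝ} {g : Plane → ℝ} (h : Reg κ g) (c : ℝ) : Reg κ fun x => c * g x := by
  obtain ⟨hm, l, hl⟩ := h
  exact ⟨hm.const_mul c, l, by rw [nrm_const_mul]; exact mul_lt_top (by simp) hl⟩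

theorem Reg.locallyIntegrable {κ : ℝ} {g : Plane → ℝ} (h : Reg κ g) : LocallyIntegrable g := by
  obtain ⟨hm, l, hl⟩ := h
  exact locallyIntegrable_of_eLpNorm hm ((eLpNorm_le_nrm κ l g).trans_lt hl)

/-! ### Negative Hölder norms -/

theorem holderNorm_add_le (α : ℝ) {ρ : Plane → ℝ} (hρ : ∀ x, 0 < ρ x) (S T : Distr) :
    holderNorm α ρ (S + T) ≤ holderNorm α ρ S + holderNorm α ρ T := by
  refine iSup_le fun x => iSup_le fun r => iSup₂_le fun φ hφ => ?_
  have hp : 0 < (r : ℝ) ^ α * ρ x := mul_pos (Real.rpow_pos_of_pos r.2.1 _) (hρ x)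
  refine le_trans ?_ (add_le_add (le_holderNorm S r.2.1 r.2.2 hφ (x := x)) (le_holderNorm T r.2.1 r.2.2 hφ (x := x)))
  rw [← ENNReal.ofReal_add (by positivity) (by positivity), ← add_div]
  apply ofReal_le_ofReal
  gcongr
  exact abs_add_le _ _

theorem holderNorm_smul (α : ℝ) (ρ : Plane → ℝ) (c : ℝ) (T : Distr) :
    holderNorm α ρ (c • T) ≤ ‖c‖ₑ * holderNorm α ρ T := by
  refine iSup_le fun x => iSup_le fun r => iSup₂_le fun φ hφ => ?_
  refine le_trans (le_of_eq ?_) (mul_le_mul' le_rfl (le_holderNorm T r.2.1 r.2.2 hφ (x := x)))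
  rw [Real.enorm_eq_ofReal_abs, ← ofReal_mul (abs_nonneg _), ← mul_div_assoc, ← abs_mul]
  rfl

theorem holderNorm_neg (α : ℝ) (ρ : Plane → ℝ) (T : Distr) : holderNorm α ρ (-T) = holderNorm α ρ T := by
  unfold holderNorm
  congr! 8 with x r φ hφ
  have : (-T) (rescale x r r.2.1 φ) = - T (rescale x r r.2.1 φ) := rfl
  rw [this, abs_neg]

theorem holderNorm_sub_comm (α : ℝ) (ρ : Plane → ℝ) (S T : Distr) :
    holderNorm α ρ (S - T) = holderNorm α ρ (T - S) := by
  rw [← holderNorm_neg, neg_sub]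

theorem integrable_test_mul {g : Plane → ℝ} (hg : LocallyIntegrable g) (η : Test) :
    Integrable fun x => η x * g x :=
  hg.integrable_smul_left_of_hasCompactSupport η.continuous η.hasCompactSupport

theorem ofFun_add {g g' : Plane → ℝ} (hg : LocallyIntegrable g) (hg' : LocallyIntegrable g') :
    ofFun (fun x => g x + g' x) = ofFun g + ofFun g' := by
  ext η
  have : (ofFun g + ofFun g') η = ofFun g η + ofFun g' η := rfl
  rw [this, ofFun_apply (g := fun x => g x + g' x) (hg.add hg'), ofFun_apply hg, ofFun_apply hg',
    ← integral_add (integrable_test_mul hg η) (integrable_test_mul hg' η)]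
  simp [mul_add]

theorem ofFun_const_mul {g : Plane → ℝ} (hg : LocallyIntegrable g) (c : ℝ) :
    ofFun (fun x => c * g x) = c • ofFun g := by
  ext η
  have : (c • ofFun g) η = c * ofFun g η := rfl
  rw [this, ofFun_apply (g := fun x => c * g x) (hg.smul c), ofFun_apply hg, ← integral_const_mul]
  congr 1; funext x
  ring

theorem ofFun_sub {g g' : Plane → ℝ} (hg : LocallyIntegrable g) (hg' : LocallyIntegrable g') :
    ofFun (fun x => g x - g' x) = ofFun g - ofFun g' := by
  ext η
  have : (ofFun g - ofFun g') η = ofFun g η - ofFun g' η := rfl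
  rw [this, ofFun_apply (g := fun x => g x - g' x) (hg.sub hg'), ofFun_apply hg, ofFun_apply hg',
    ← integral_sub (integrable_test_mul hg η) (integrable_test_mul hg' η)]
  simp [mul_sub]

theorem ofFun_congr_ae {g g' : Plane → ℝ} (hg : LocallyIntegrable g) (hg' : LocallyIntegrable g')
    (h : g =ᵐ[volume] g') : ofFun g = ofFun g' := by
  ext η
  rw [ofFun_apply hg, ofFun_apply hg']
  refine integral_congr_ae ?_
  filter_upwards [h] with x hx
  rw [hx]

theorem lintegral_rescale (x : Plane) {r : ℝ} (hr : 0 < r) (φ : Test) :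
    ∫⁻ y, ‖rescale x r hr φ y‖ₑ = ∫⁻ y, ‖φ y‖ₑ := by
  have h1 : ∀ y, ‖rescale x r hr φ y‖ₑ = (fun z : Plane => ‖(r ^ 2)⁻¹ * φ (r⁻¹ • z)‖ₑ) (y - x) := fun y => rfl
  simp_rw [h1]
  rw [lintegral_sub_right_eq_self (fun z : Plane => ‖(r ^ 2)⁻¹ * φ (r⁻¹ • z)‖ₑ) x, lintegral_comp_smul_plane hr,
    ← lintegral_const_mul _ (by have := φ.continuous; fun_prop)]
  refine lintegral_congr fun z => ?_
  rw [enorm_mul, ← mul_assoc, smul_smul, inv_mul_cancel₀ hr.ne', one_smul,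
    Real.enorm_eq_ofReal (by positivity), ← ofReal_mul (by positivity),
    mul_inv_cancel₀ (by positivity), ENNReal.ofReal_one, one_mul]

theorem lintegral_unitTests_le {m : ℕ} {φ : Test} (hφ : φ ∈ unitTests m) :
    ∫⁻ y, ‖φ y‖ₑ ≤ volume (Metric.closedBall (0 : Plane) 1) := by
  rw [← lintegral_indicator_one measurableSet_closedBall]
  refine lintegral_mono fun y => ?_
  by_cases hy : y ∈ Metric.closedBall (0 : Plane) 1
  · have := hφ.2 0 (Nat.zero_le _) y
    rw [norm_iteratedFDeriv_zero] at this
    simp only [Set.indicator_of_mem hy, Pi.one_apply]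
    rw [← ofReal_norm, ← ENNReal.ofReal_one]
    exact ofReal_le_ofReal this
  · have : φ y = 0 := image_eq_zero_of_notMem_tsupport fun h => hy (hφ.1 h)
    simp [this]

theorem holderNorm_test_lt_top {α : ℝ} (hα : α ≤ 0) {ρ : Plane → ℝ} (hρ : ∀ x, 1 ≤ ρ x) (φ : Test) :
    holderNorm α ρ (ofFun φ) < ⊤ := by
  obtain ⟨B, hB⟩ := φ.continuous.bounded_above_of_compact_support φ.hasCompactSupport
  refine lt_of_le_of_lt (b := ofReal B * volume (Metric.closedBall (0 : Plane) 1)) ?_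
    (mul_lt_top ofReal_lt_top measure_closedBall_lt_top)
  refine iSup_le fun x => iSup_le fun r => iSup₂_le fun ψ hψ => ?_
  have h1 : 1 ≤ (r : ℝ) ^ α * ρ x :=
    one_le_mul_of_one_le_of_one_le (Real.one_le_rpow_of_pos_of_le_one_of_nonpos r.2.1 r.2.2 hα) (hρ x)
  calc _ ≤ ofReal |ofFun φ (rescale x r r.2.1 ψ)| :=
        ofReal_le_ofReal (div_le_self (abs_nonneg _) h1)
    _ = ‖∫ y, rescale x r r.2.1 ψ y * φ y‖ₑ := by
        rw [ofFun_apply φ.locallyIntegrable, Real.enorm_eq_ofReal_abs]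
    _ ≤ ∫⁻ y, ‖rescale x r r.2.1 ψ y * φ y‖ₑ := enorm_integral_le_lintegral_enorm _
    _ ≤ ∫⁻ y, ofReal B * ‖rescale x r r.2.1 ψ y‖ₑ := by
        refine lintegral_mono fun y => ?_
        simp only
        rw [enorm_mul, mul_comm]
        refine mul_le_mul_left ?_ _
        rw [← ofReal_norm]
        exact ofReal_le_ofReal (hB y)
    _ ≤ _ := by
        rw [lintegral_const_mul _ (by have := (rescale x r r.2.1 ψ).continuous; fun_prop), lintegral_rescale]
        exact mul_le_mul_right (lintegral_unitTests_le hψ) _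

/-- The norm of a test function in `C^{-κ}_{p_κ}`. -/
def hol (κ : ℝ) (φ : Test) : ℝ≥0∞ := holderNorm (-κ) (polyWeight κ) (ofFun φ)

theorem hol_lt_top {κ : ℝ} (hκ : 0 < κ) (φ : Test) : hol κ φ < ⊤ :=
  holderNorm_test_lt_top (by linarith) (one_le_polyWeight hκ.le) φ

theorem ofFun_test_sub (φ ψ : Test) : ofFun (φ - ψ : Test) = ofFun φ - ofFun ψ :=
  ofFun_sub φ.locallyIntegrable ψ.locallyIntegrable

theorem ofFun_test_add (φ ψ : Test) : ofFun (φ + ψ : Test) = ofFun φ + ofFun ψ :=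
  ofFun_add φ.locallyIntegrable ψ.locallyIntegrable

theorem hol_add_le (κ : ℝ) (φ ψ : Test) : hol κ (φ + ψ) ≤ hol κ φ + hol κ ψ := by
  rw [hol, ofFun_test_add]
  exact holderNorm_add_le _ (polyWeight_pos κ) _ _

/-- Cauchy sequences of test functions in `C^{-κ}_{p_κ}`. -/
def IsCoef (κ : ℝ) (a : ℕ → Test) : Prop :=
  ∀ ε : ℝ≥0∞, 0 < ε → ∃ N, ∀ m ≥ N, ∀ n ≥ N, hol κ (a m - a n) ≤ ε

theorem IsCoef.exists_bound {κ : ℝ} (hκ : 0 < κ) {a : ℕ → Test} (h : IsCoef κ a) :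
    ∃ R : ℝ≥0∞, R ≠ ⊤ ∧ ∀ᶠ n in atTop, hol κ (a n) ≤ R := by
  obtain ⟨N, hN⟩ := h 1 one_pos
  refine ⟨1 + hol κ (a N), ENNReal.add_ne_top.2 ⟨ENNReal.one_ne_top, (hol_lt_top hκ _).ne⟩, ?_⟩
  filter_upwards [eventually_ge_atTop N] with n hn
  calc hol κ (a n) = hol κ ((a n - a N) + a N) := by rw [sub_add_cancel]
    _ ≤ _ := (hol_add_le κ _ _).trans (add_le_add (hN n hn N le_rfl) le_rfl)

theorem IsCoef.sub {κ : ℝ} {a b : ℕ → Test} (ha : IsCoef κ a) (hb : IsCoef κ b) : IsCoef κ (a - b) := by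
  intro ε hε
  obtain ⟨N, hN⟩ := ha (ε / 2) (ENNReal.half_pos hε.ne')
  obtain ⟨M, hM⟩ := hb (ε / 2) (ENNReal.half_pos hε.ne')
  refine ⟨max N M, fun m hm n hn => ?_⟩
  have e : (a - b) m - (a - b) n = (a m - a n) + (b n - b m) := by simp only [Pi.sub_apply]; abel
  rw [e]
  refine (hol_add_le κ _ _).trans ?_
  rw [← ENNReal.add_halves ε]
  exact add_le_add (hN m (le_of_max_le_left hm) n (le_of_max_le_left hn))
    (hM n (le_of_max_le_right hn) m (le_of_max_le_right hm))

theorem isCoef_const (κ : ℝ) (φ : Test) : IsCoef κ fun _ => φ := by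
  intro ε hε
  refine ⟨0, fun m _ n _ => ?_⟩
  have : hol κ (φ - φ) = 0 := by
    rw [hol, ofFun_test_sub, sub_self]
    simp [holderNorm]
  rw [this]
  exact zero_le

/-! ### The pairing of a rough coefficient with a function and the heat kernel -/

/-- `K_τ * (A g)`, where `A` is the limit of the test functions `a n`. -/
def pair (a : ℕ → Test) (g : Plane → ℝ) (τ : ℝ) (x : Plane) : ℝ :=
  limUnder atTop fun n => ∫ y, a n y * g y * heatKernel τ (x - y)

theorem measurable_pair {α : Type*} [MeasurableSpace α] (a : ℕ → Test) {G : α → Plane → ℝ}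
    (hG : Measurable (Function.uncurry G)) {τ : α → ℝ} (hτ : Measurable τ) {X : α → Plane} (hX : Measurable X) :
    Measurable fun p => pair a (G p) (τ p) (X p) := by
  refine StronglyMeasurable.measurable ?_
  refine StronglyMeasurable.limUnder fun n => ?_
  have hK := measurable_heatKernel
  have ha := (a n).continuous.measurable
  have h : Measurable fun q : α × Plane => a n q.2 * G q.1 q.2 * heatKernel (τ q.1) (X q.1 - q.2) := by
    refine ((ha.comp measurable_snd).mul hG).mul ?_
    exact hK.comp ((hτ.comp measurable_fst).prodMk ((hX.comp measurable_fst).sub measurable_snd))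
  exact h.stronglyMeasurable.integral_prod_right

theorem measurable_hconv_param {α : Type*} [MeasurableSpace α] (i : Fin 3) {G : α → Plane → ℝ}
    (hG : Measurable (Function.uncurry G)) {τ : α → ℝ} (hτ : Measurable τ) {X : α → Plane} (hX : Measurable X) :
    Measurable fun p => hconv i (τ p) (G p) (X p) := by
  have hK := measurable_kern i
  have h : Measurable fun q : α × Plane => kern i (τ q.1) (X q.1 - q.2) * G q.1 q.2 :=
    (hK.comp ((hτ.comp measurable_fst).prodMk ((hX.comp measurable_fst).sub measurable_snd))).mul hG
  exact h.stronglyMeasurable.integral_prod_right.measurable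

theorem integrable_pairing (φ : Test) {g : Plane → ℝ} (hg : LocallyIntegrable g) (τ : ℝ) (x : Plane) :
    Integrable fun y => φ y * g y * heatKernel τ (x - y) := by
  have hK : Continuous fun y => heatKernel τ (x - y) := (continuous_heatKernel τ).comp (by fun_prop)
  have := integrable_test_mul (LocallyIntegrable.mul_continuous hK hg) φ
  simpa only [mul_assoc] using this

theorem kconv_pw_gm_lt_top {κ τ : ℝ} (hκ : 0 < κ) (hκ1 : κ ≤ 1 / 2) (hτ : 0 < τ) {g : Plane → ℝ} (hg : Reg κ g)
    {t : ℝ} (ht : 0 < t) (x : Plane) : kconv t (fun y => pw κ y * gm κ g y) x < ⊤ := by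
  obtain ⟨hm, l, hl⟩ := hg
  refine kconv_lt_top (l := l + τ) ht ((measurable_pw κ).mul (measurable_gm κ hm)) ?_ x
  refine (lintegral_pw_gm_sq_le hκ hκ1 hτ l hm).trans_lt ?_
  exact mul_lt_top ofReal_lt_top (mul_lt_top (by simp) (ENNReal.pow_lt_top hl))

theorem tendsto_pair {κ τ : ℝ} (hκ : 0 < κ) (hκ1 : κ ≤ 1 / 2) (hτ : 0 < τ) {a : ℕ → Test} (ha : IsCoef κ a)
    {g : Plane → ℝ} (hg : Reg κ g) (x : Plane) :
    Tendsto (fun n => ∫ y, a n y * g y * heatKernel τ (x - y)) atTop (𝓝 (pair a g τ x)) := by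
  obtain ⟨C, hC, hb⟩ := exists_pairing_bound hκ (by linarith) τ
  have hfin := kconv_pw_gm_lt_top hκ hκ1 hτ hg (by positivity : 0 < 4 * τ) x
  have hgl := hg.locallyIntegrable
  obtain ⟨hm, l, hl⟩ := hg
  set D := C * ofReal (τ ^ (-(κ / 2))) * kconv (4 * τ) (fun y => pw κ y * gm κ g y) x with hD
  have hDt : D ≠ ⊤ := mul_ne_top (mul_ne_top hC ofReal_ne_top) hfin.ne
  have hc : CauchySeq fun n => ∫ y, a n y * g y * heatKernel τ (x - y) := by
    refine EMetric.cauchySeq_iff.2 fun ε hε => ?_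
    obtain ⟨δ, hδ, hδε⟩ : ∃ δ : ℝ≥0∞, 0 < δ ∧ δ * D < ε := by
      have : Tendsto (fun δ : ℝ≥0∞ => δ * D) (𝓝[>] 0) (𝓝 (0 * D)) :=
        (ENNReal.Tendsto.mul_const tendsto_id (Or.inr hDt)).mono_left nhdsWithin_le_nhds
      rw [zero_mul] at this
      obtain ⟨δ, h1, h2⟩ := ((this.eventually (gt_mem_nhds hε)).and self_mem_nhdsWithin).exists
      exact ⟨δ, h2, h1⟩
    obtain ⟨N, hN⟩ := ha δ hδ
    refine ⟨N, fun m hm' n hn => lt_of_le_of_lt ?_ hδε⟩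
    rw [edist_eq_enorm_sub, ← integral_sub (integrable_pairing _ hgl τ x) (integrable_pairing _ hgl τ x)]
    have e : ∫ y, (a m y * g y * heatKernel τ (x - y) - a n y * g y * heatKernel τ (x - y)) =
        ∫ y, (a m - a n) y * g y * heatKernel τ (x - y) := by
      congr 1; funext y
      have : (a m - a n) y = a m y - a n y := rfl
      rw [this]; ring
    rw [e]
    refine (hb (a m - a n) l τ hτ le_rfl g hm ((eLpNorm_le_nrm κ l g).trans_lt hl) x).trans ?_
    calc _ = hol κ (a m - a n) * D := by rw [hD, hol]; ring
      _ ≤ _ := mul_le_mul_left (hN m hm' n hn) _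
  exact tendsto_nhds_limUnder (cauchySeq_tendsto_of_complete hc)

theorem exists_pair_bound {κ : ℝ} (hκ : 0 < κ) (hκ1 : κ ≤ 1 / 2) (T : ℝ) :
    ∃ C : ℝ≥0∞, C ≠ ⊤ ∧ ∀ (a : ℕ → Test) (R : ℝ≥0∞) (τ : ℝ), IsCoef κ a → (∀ᶠ n in atTop, hol κ (a n) ≤ R) →
      0 < τ → τ ≤ T → ∀ g : Plane → ℝ, Reg κ g → ∀ x,
      ‖pair a g τ x‖ₑ ≤ C * R *
        ofReal (τ ^ (-(κ / 2))) * kconv (4 * τ) (fun y => pw κ y * gm κ g y) x := by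
  obtain ⟨C, hC, hb⟩ := exists_pairing_bound hκ (by linarith) T
  refine ⟨C, hC, fun a R τ ha hR hτ hT g hg x => ?_⟩
  have h1 : ∀ᶠ n in atTop, ‖∫ y, a n y * g y * heatKernel τ (x - y)‖ₑ ≤ C * R *
        ofReal (τ ^ (-(κ / 2))) * kconv (4 * τ) (fun y => pw κ y * gm κ g y) x := by
    filter_upwards [hR] with n hn
    obtain ⟨hm, l, hl⟩ := hg
    refine (hb (a n) l τ hτ hT g hm ((eLpNorm_le_nrm κ l g).trans_lt hl) x).trans ?_
    gcongr
    exact hn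
  exact le_of_tendsto ((continuous_enorm.tendsto _).comp (tendsto_pair hκ hκ1 hτ ha hg x)) h1

theorem exists_eLpNorm_pair_le {κ : ℝ} (hκ : 0 < κ) (hκ1 : κ ≤ 1 / 2) (L T : ℝ) :
    ∃ C : ℝ≥0∞, C ≠ ⊤ ∧ ∀ (a : ℕ → Test) (R : ℝ≥0∞) (l τ : ℝ), |l| ≤ L → IsCoef κ a →
      (∀ᶠ n in atTop, hol κ (a n) ≤ R) → 0 < τ → τ ≤ T → ∀ g : Plane → ℝ, Measurable g → nrm κ l g < ⊤ →
      eLpNorm (pair a g τ) 2 (expMeas (l + τ)) ≤ C * R * ofReal (τ ^ (-(3 * κ / 2))) * nrm κ l g := by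
  obtain ⟨C, hC, hb⟩ := exists_pair_bound hκ hκ1 T
  refine ⟨C * ofReal (2 * Real.exp (4 * (L + T) ^ 2 * T)), mul_ne_top hC ofReal_ne_top, ?_⟩
  intro a R l τ hl ha hR hτ hT g hg hgl
  have hfm : Measurable fun y => pw κ y * gm κ g y := (measurable_pw κ).mul (measurable_gm κ hg)
  rw [← ENNReal.pow_le_pow_left_iff two_ne_zero, eLpNorm_two_sq]
  set c := C * R * ofReal (τ ^ (-(κ / 2))) with hc
  have hexp : (l + τ) ^ 2 ≤ (L + T) ^ 2 := by
    have := abs_le.1 hl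
    exact sq_le_sq' (by linarith) (by linarith)
  calc _ ≤ ∫⁻ x, c ^ 2 * kconv (4 * τ) (fun y => pw κ y * gm κ g y) x ^ 2 ∂(expMeas (l + τ)) := by
        refine lintegral_mono fun x => ?_
        simp only
        rw [← mul_pow]
        exact pow_le_pow_left' (hb a R τ ha hR hτ hT g ⟨hg, l, hgl⟩ x) 2
    _ = c ^ 2 * ∫⁻ x, kconv (4 * τ) (fun y => pw κ y * gm κ g y) x ^ 2 ∂(expMeas (l + τ)) :=
        lintegral_const_mul _ ((measurable_kconv _ hfm).pow_const 2)
    _ ≤ c ^ 2 * (ofReal (2 * Real.exp (2 * (l + τ) ^ 2 * (4 * τ))) *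
          (ofReal (τ ^ (-(2 * κ))) * (2 * nrm κ l g ^ 2))) := by
        gcongr
        refine (lintegral_kconv_sq_le (by positivity) hfm).trans ?_
        gcongr
        exact lintegral_pw_gm_sq_le hκ hκ1 hτ l hg
    _ ≤ c ^ 2 * (ofReal (2 * Real.exp (8 * (L + T) ^ 2 * T)) *
          (ofReal (τ ^ (-(2 * κ))) * (2 * nrm κ l g ^ 2))) := by
        refine mul_le_mul_right (mul_le_mul_left (ofReal_le_ofReal ?_) _) _
        refine mul_le_mul_of_nonneg_left (Real.exp_le_exp.2 ?_) zero_le_two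
        calc 2 * (l + τ) ^ 2 * (4 * τ) = 8 * ((l + τ) ^ 2 * τ) := by ring
          _ ≤ 8 * ((L + T) ^ 2 * T) := by gcongr
          _ = _ := by ring
    _ = _ := by
        have e1 : ofReal (2 * Real.exp (8 * (L + T) ^ 2 * T)) * 2 =
            ofReal (2 * Real.exp (4 * (L + T) ^ 2 * T)) ^ 2 := by
          rw [← ENNReal.ofReal_ofNat 2, ← ofReal_mul (by positivity), ← ENNReal.ofReal_pow (by positivity),
            mul_pow, ← Real.exp_nat_mul]
          congr 1; push_cast; ring_nf
        have e2 : ofReal (τ ^ (-(κ / 2))) ^ 2 * ofReal (τ ^ (-(2 * κ))) =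
            ofReal (τ ^ (-(3 * κ / 2))) ^ 2 := by
          rw [← ENNReal.ofReal_pow (by positivity), ← ENNReal.ofReal_pow (by positivity),
            ← ofReal_mul (by positivity), ← Real.rpow_natCast, ← Real.rpow_natCast, ← Real.rpow_mul hτ.le,
            ← Real.rpow_mul hτ.le, ← Real.rpow_add hτ]
          congr 2; push_cast; ring
        calc _ = C ^ 2 * R ^ 2 * (ofReal (τ ^ (-(κ / 2))) ^ 2 * ofReal (τ ^ (-(2 * κ)))) *
              (ofReal (2 * Real.exp (8 * (L + T) ^ 2 * T)) * 2) * nrm κ l g ^ 2 := by rw [hc]; ring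
          _ = _ := by rw [e1, e2]; ring

theorem pair_congr_ae (a : ℕ → Test) {g g' : Plane → ℝ} (h : g =ᵐ[volume] g') (τ : ℝ) : pair a g τ = pair a g' τ := by
  funext x
  unfold pair
  congr 1
  funext n
  refine integral_congr_ae ?_
  filter_upwards [h] with y hy
  rw [hy]

theorem pair_add {κ τ : ℝ} (hκ : 0 < κ) (hκ1 : κ ≤ 1 / 2) (hτ : 0 < τ) {a : ℕ → Test} (ha : IsCoef κ a)
    {g g' : Plane → ℝ} (hg : Reg κ g) (hg' : Reg κ g') (x : Plane) :
    pair a (fun y => g y + g' y) τ x = pair a g τ x + pair a g' τ x := by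
  refine tendsto_nhds_unique (tendsto_pair hκ hκ1 hτ ha (hg.add hg') x) ?_
  refine ((tendsto_pair hκ hκ1 hτ ha hg x).add (tendsto_pair hκ hκ1 hτ ha hg' x)).congr fun n => ?_
  rw [← integral_add (integrable_pairing _ hg.locallyIntegrable τ x) (integrable_pairing _ hg'.locallyIntegrable τ x)]
  congr 1; funext y; ring

theorem pair_const_mul {κ τ : ℝ} (hκ : 0 < κ) (hκ1 : κ ≤ 1 / 2) (hτ : 0 < τ) {a : ℕ → Test}
    (ha : IsCoef κ a) {g : Plane → ℝ} (hg : Reg κ g) (x : Plane) (c : ℝ) :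
    pair a (fun y => c * g y) τ x = c * pair a g τ x := by
  refine tendsto_nhds_unique (tendsto_pair hκ hκ1 hτ ha (hg.const_mul c) x) ?_
  refine ((tendsto_pair hκ hκ1 hτ ha hg x).const_mul c).congr fun n => ?_
  rw [← integral_const_mul]
  congr 1; funext y; ring

theorem pair_coef_sub {κ τ : ℝ} (hκ : 0 < κ) (hκ1 : κ ≤ 1 / 2) (hτ : 0 < τ) {a b : ℕ → Test}
    (ha : IsCoef κ a) (hb : IsCoef κ b) {g : Plane → ℝ} (hg : Reg κ g) (x : Plane) :
    pair (a - b) g τ x = pair a g τ x - pair b g τ x := by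
  refine tendsto_nhds_unique (tendsto_pair hκ hκ1 hτ (ha.sub hb) hg x) ?_
  refine ((tendsto_pair hκ hκ1 hτ ha hg x).sub (tendsto_pair hκ hκ1 hτ hb hg x)).congr fun n => ?_
  rw [← integral_sub (integrable_pairing _ hg.locallyIntegrable τ x) (integrable_pairing _ hg.locallyIntegrable τ x)]
  congr 1; funext y
  have : (a - b) n y = a n y - b n y := rfl
  rw [this]; ring

/-! ### Semigroup property of the heat kernel -/

theorem heatKernel_mul_heatKernel {s t : ℝ} (hs : 0 < s) (ht : 0 < t) (x y z : Plane) :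
    heatKernel s (x - y) * heatKernel t (y - z) = heatKernel (s + t) (x - z) *
      heatKernel (s * t / (s + t)) (y - ((t / (s + t)) • x + (s / (s + t)) • z)) := by
  have hst : 0 < s + t := by positivity
  set u := x - y with hu
  set v := y - z with hv
  have e1 : x - z = u + v := by rw [hu, hv]; abel
  have e2 : y - ((t / (s + t)) • x + (s / (s + t)) • z) = (s / (s + t)) • v - (t / (s + t)) • u := by
    have h1 : (s / (s + t) + t / (s + t)) • y = y := by rw [← add_div, div_self hst.ne', one_smul]
    conv_lhs => rw [← h1]
    rw [hu, hv]
    module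
  rw [e1, e2]
  clear_value u v
  unfold heatKernel
  rw [mul_mul_mul_comm, mul_mul_mul_comm (4 * Real.pi * (s + t))⁻¹, ← Real.exp_add, ← Real.exp_add]
  congr 1
  · field_simp
  · congr 1
    rw [norm_add_sq_real, norm_sub_sq_real, norm_smul, norm_smul, real_inner_smul_left, real_inner_smul_right,
      Real.norm_of_nonneg (by positivity), Real.norm_of_nonneg (by positivity), real_inner_comm u v]
    field_simp
    ring

theorem integral_heatKernel_mul {s t : ℝ} (hs : 0 < s) (ht : 0 < t) (x z : Plane) :
    ∫ y, heatKernel s (x - y) * heatKernel t (y - z) = heatKernel (s + t) (x - z) := by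
  simp_rw [heatKernel_mul_heatKernel hs ht x _ z]
  rw [integral_const_mul, integral_sub_right_eq_self (fun y => heatKernel (s * t / (s + t)) y),
    integral_heatKernel (by positivity), mul_one]

theorem lintegral_heatKernel_mul {s t : ℝ} (hs : 0 < s) (ht : 0 < t) (x z : Plane) :
    ∫⁻ y, ofReal (heatKernel s (x - y)) * ofReal (heatKernel t (y - z)) =
      ofReal (heatKernel (s + t) (x - z)) := by
  have hm := (continuous_heatKernel (s * t / (s + t))).measurable
  have h : ∀ y, ofReal (heatKernel s (x - y)) * ofReal (heatKernel t (y - z)) =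
      ofReal (heatKernel (s + t) (x - z)) *
      ofReal (heatKernel (s * t / (s + t)) (y - ((t / (s + t)) • x + (s / (s + t)) • z))) := fun y => by
    rw [← ofReal_mul (heatKernel_nonneg hs.le _), heatKernel_mul_heatKernel hs ht,
      ofReal_mul (heatKernel_nonneg (by positivity) _)]
  simp_rw [h]
  rw [lintegral_const_mul _ (by fun_prop),
    lintegral_sub_right_eq_self (fun y => ofReal (heatKernel (s * t / (s + t)) y)),
    lintegral_heatKernel (by positivity), mul_one]

theorem hconv_zero_hconv_zero {l s t : ℝ} (hs : 0 < s) (ht : 0 < t) {f : Plane → ℝ} (hf : Measurable f)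
    (h : eLpNorm f 2 (expMeas l) < ⊤) (x : Plane) :
    hconv 0 s (hconv 0 t f) x = hconv 0 (s + t) f x := by
  have m1 := (continuous_heatKernel s).measurable
  have m2 := (continuous_heatKernel t).measurable
  have hmeas : Measurable fun p : Plane × Plane => heatKernel s (x - p.1) * (heatKernel t (p.1 - p.2) * f p.2) := by
    fun_prop
  have hint : Integrable (fun p : Plane × Plane => heatKernel s (x - p.1) * (heatKernel t (p.1 - p.2) * f p.2))
      (volume.prod volume) := by
    refine ⟨hmeas.aestronglyMeasurable, ?_⟩
    rw [HasFiniteIntegral, lintegral_prod_symm _ hmeas.enorm.aemeasurable]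
    have hk := kconv_lt_top (l := l) (t := s + t) (by positivity) (F := fun y => ‖f y‖ₑ) (by fun_prop)
      (by rw [← eLpNorm_two_sq]; exact ENNReal.pow_lt_top h) x
    refine lt_of_le_of_lt (le_of_eq ?_) hk
    rw [kconv]
    refine lintegral_congr fun z => ?_
    rw [← lintegral_heatKernel_mul hs ht, ← lintegral_mul_const _ (by fun_prop)]
    refine lintegral_congr fun y => ?_
    rw [enorm_mul, enorm_mul, Real.enorm_eq_ofReal (heatKernel_nonneg hs.le _),
      Real.enorm_eq_ofReal (heatKernel_nonneg ht.le _), mul_assoc]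
  unfold hconv
  simp only [kern_zero]
  simp_rw [← integral_const_mul]
  rw [integral_integral_swap hint]
  refine integral_congr_ae (Eventually.of_forall fun z => ?_)
  simp only
  simp_rw [← mul_assoc]
  rw [integral_mul_const, integral_heatKernel_mul hs ht]

theorem eLpNorm_test_mul_lt_top (φ : Test) {l : ℝ} {g : Plane → ℝ} (h : eLpNorm g 2 (expMeas l) < ⊤) :
    eLpNorm (fun y => φ y * g y) 2 (expMeas l) < ⊤ := by
  obtain ⟨B, hB⟩ := φ.continuous.bounded_above_of_compact_support φ.hasCompactSupport
  refine (eLpNorm_le_mul_eLpNorm_of_ae_le_mul (g := g) (c := B) (Eventually.of_forall fun y => ?_) 2).trans_lt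
    (mul_lt_top ofReal_lt_top h)
  rw [norm_mul]
  gcongr
  exact hB y

theorem hconv_pair {κ r τ : ℝ} (hκ : 0 < κ) (hκ1 : κ ≤ 1 / 2) (hr : 0 < r) (hτ : 0 < τ) {a : ℕ → Test}
    (ha : IsCoef κ a) {g : Plane → ℝ} (hg : Reg κ g) (x : Plane) :
    hconv 0 r (pair a g τ) x = pair a g (r + τ) x := by
  obtain ⟨C, hC, hb⟩ := exists_pairing_bound hκ (by linarith) τ
  obtain ⟨R, hR, haR⟩ := ha.exists_bound hκ
  have hg2 := hg
  obtain ⟨hm, l, hl⟩ := hg2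
  have hgl := (eLpNorm_le_nrm κ l g).trans_lt hl
  have hfm : Measurable fun y => pw κ y * gm κ g y := (measurable_pw κ).mul (measurable_gm κ hm)
  set Q := kconv (4 * τ) (fun y => pw κ y * gm κ g y) with hQ
  have hQm : Measurable Q := measurable_kconv _ hfm
  have hQt : ∀ y, Q y < ⊤ := fun y => kconv_pw_gm_lt_top hκ hκ1 hτ hg (by positivity) y
  set c := C * R * ofReal (τ ^ (-(κ / 2))) with hc
  have hct : c ≠ ⊤ := mul_ne_top (mul_ne_top hC hR) ofReal_ne_top
  have hQ2 : ∫⁻ y, Q y ^ 2 ∂(expMeas (l + τ)) < ⊤ := by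
    refine (lintegral_kconv_sq_le (by positivity) hfm).trans_lt (mul_lt_top ofReal_lt_top ?_)
    refine (lintegral_pw_gm_sq_le hκ hκ1 hτ l hm).trans_lt ?_
    exact mul_lt_top ofReal_lt_top (mul_lt_top (by simp) (ENNReal.pow_lt_top hl))
  have hKr := (continuous_heatKernel r).measurable
  refine tendsto_nhds_unique (f := fun n => ∫ y, heatKernel r (x - y) * ∫ z, a n z * g z * heatKernel τ (y - z))
    (l := atTop) ?_ ?_
  · refine tendsto_integral_filter_of_dominated_convergence
      (fun y => heatKernel r (x - y) * (c * Q y).toReal) ?_ ?_ ?_ ?_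
    · refine Eventually.of_forall fun n => Measurable.aestronglyMeasurable ?_
      refine Measurable.mul (by fun_prop) ?_
      have ht := (continuous_heatKernel τ).measurable
      have hn := (a n).continuous.measurable
      have : Measurable fun p : Plane × Plane => a n p.2 * g p.2 * heatKernel τ (p.1 - p.2) := by fun_prop
      exact this.stronglyMeasurable.integral_prod_right.measurable
    · filter_upwards [haR] with n hn
      refine Eventually.of_forall fun y => ?_
      rw [norm_mul, Real.norm_of_nonneg (heatKernel_nonneg hr.le _)]
      refine mul_le_mul_of_nonneg_left ?_ (heatKernel_nonneg hr.le _)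
      have := hb (a n) l τ hτ le_rfl g hm hgl y
      rw [← toReal_enorm]
      refine ENNReal.toReal_mono (mul_ne_top hct (hQt y).ne) (this.trans ?_)
      rw [hc]
      gcongr
      exact hn
    · refine ⟨by fun_prop, ?_⟩
      rw [HasFiniteIntegral]
      have hk := kconv_lt_top (l := l + τ) hr hQm hQ2 x
      refine lt_of_le_of_lt (le_of_eq ?_) (mul_lt_top hct.lt_top hk)
      rw [kconv, ← lintegral_const_mul _ (by fun_prop)]
      refine lintegral_congr fun y => ?_
      rw [enorm_mul, Real.enorm_eq_ofReal (heatKernel_nonneg hr.le _), Real.enorm_eq_ofReal ENNReal.toReal_nonneg,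
        ENNReal.ofReal_toReal (mul_ne_top hct (hQt y).ne)]
      ring
    · exact Eventually.of_forall fun y => (tendsto_pair hκ hκ1 hτ ha hg y).const_mul _
  · refine (tendsto_pair hκ hκ1 (by positivity : 0 < r + τ) ha hg x).congr fun n => ?_
    have := hconv_zero_hconv_zero (l := l) hr hτ (f := fun y => a n y * g y)
      ((a n).continuous.measurable.mul hm) (eLpNorm_test_mul_lt_top (a n) hgl) x
    unfold hconv at this
    simp only [kern_zero] at this
    simp only [mul_comm (a n _ * g _)]
    exact this.symm

/-! ### Integrals in time -/

theorem lintegral_lintegral_sq_le {α : Type*} [MeasurableSpace α] (μ : Measure α) [SFinite μ] {β : Type*} [MeasurableSpace β] (ν : Measure β)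
    [SFinite ν] {u : β → α → ℝ≥0∞} (hu : Measurable (Function.uncurry u)) {B : β → ℝ≥0∞} (hB : Measurable B)
    (h0 : ∀ᵐ s ∂ν, B s ≠ 0 ∧ B s ≠ ⊤) (h : ∀ᵐ s ∂ν, ∫⁻ x, u s x ^ 2 ∂μ ≤ B s ^ 2) :
    ∫⁻ x, (∫⁻ s, u s x ∂ν) ^ 2 ∂μ ≤ (∫⁻ s, B s ∂ν) ^ 2 := by
  have hm1 : Measurable fun p : α × β => (B p.2)⁻¹ * u p.2 p.1 ^ 2 :=
    (hB.comp measurable_snd).inv.mul ((hu.comp (measurable_snd.prodMk measurable_fst)).pow_const 2)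
  have hux : ∀ x, Measurable fun s => u s x := fun x => hu.comp (measurable_id.prodMk measurable_const)
  calc _ ≤ ∫⁻ x, (∫⁻ s, B s ∂ν) * (∫⁻ s, (B s)⁻¹ * u s x ^ 2 ∂ν) ∂μ := by
        refine lintegral_mono fun x => ?_
        have h1 := sq_lintegral_mul_le ν (f := B) (g := fun s => (B s)⁻¹ * u s x) hB.aemeasurable
          (hB.inv.mul (hux x)).aemeasurable
        have e1 : ∫⁻ s, B s * ((B s)⁻¹ * u s x) ∂ν = ∫⁻ s, u s x ∂ν := by
          refine lintegral_congr_ae ?_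
          filter_upwards [h0] with s hs
          rw [← mul_assoc, ENNReal.mul_inv_cancel hs.1 hs.2, one_mul]
        have e2 : ∫⁻ s, B s * ((B s)⁻¹ * u s x) ^ 2 ∂ν = ∫⁻ s, (B s)⁻¹ * u s x ^ 2 ∂ν := by
          refine lintegral_congr_ae ?_
          filter_upwards [h0] with s hs
          calc B s * ((B s)⁻¹ * u s x) ^ 2 = (B s * (B s)⁻¹) * ((B s)⁻¹ * u s x ^ 2) := by ring
            _ = _ := by rw [ENNReal.mul_inv_cancel hs.1 hs.2, one_mul]
        rw [e1, e2] at h1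
        exact h1
    _ = (∫⁻ s, B s ∂ν) * ∫⁻ s, ∫⁻ x, (B s)⁻¹ * u s x ^ 2 ∂μ ∂ν := by
        rw [lintegral_const_mul _ hm1.lintegral_prod_right', lintegral_lintegral_swap hm1.aemeasurable]
    _ ≤ (∫⁻ s, B s ∂ν) * ∫⁻ s, B s ∂ν := by
        refine mul_le_mul_right (lintegral_mono_ae ?_) _
        filter_upwards [h0, h] with s hs hs'
        have hus : Measurable fun x => u s x ^ 2 := (hu.comp (measurable_const.prodMk measurable_id)).pow_const 2
        rw [lintegral_const_mul _ hus]
        calc (B s)⁻¹ * ∫⁻ x, u s x ^ 2 ∂μ ≤ (B s)⁻¹ * B s ^ 2 := by gcongr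
          _ = (B s * (B s)⁻¹) * B s := by ring
          _ = _ := by rw [ENNReal.mul_inv_cancel hs.1 hs.2, one_mul]
    _ = _ := (sq _).symm

theorem eLpNorm_integral_le {α : Type*} [MeasurableSpace α] (μ : Measure α) [SFinite μ] {β : Type*} [MeasurableSpace β] (ν : Measure β)
    [SFinite ν] {u : β → α → ℝ} (hu : Measurable (Function.uncurry u)) {B : β → ℝ≥0∞} (hB : Measurable B)
    (h0 : ∀ᵐ s ∂ν, B s ≠ 0 ∧ B s ≠ ⊤) (h : ∀ᵐ s ∂ν, eLpNorm (u s) 2 μ ≤ B s) (hf : ∫⁻ s, B s ∂ν ≠ ⊤) :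
    (∀ᵐ x ∂μ, Integrable (fun s => u s x) ν) ∧ ∫⁻ x, (∫⁻ s, ‖u s x‖ₑ ∂ν) ^ 2 ∂μ < ⊤ ∧
      eLpNorm (fun x => ∫ s, u s x ∂ν) 2 μ ≤ ∫⁻ s, B s ∂ν := by
  have key := lintegral_lintegral_sq_le μ ν (u := fun s x => ‖u s x‖ₑ) hu.enorm hB h0 (by
    filter_upwards [h] with s hs
    rw [← eLpNorm_two_sq]
    exact pow_le_pow_left' hs 2)
  have hm : Measurable fun x => ∫⁻ s, ‖u s x‖ₑ ∂ν :=
    Measurable.lintegral_prod_right' (f := fun p : α × β => ‖u p.2 p.1‖ₑ)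
      (hu.comp (measurable_snd.prodMk measurable_fst)).enorm
  refine ⟨?_, key.trans_lt (ENNReal.pow_lt_top hf.lt_top), ?_⟩
  · have h1 := ae_lt_top (hm.pow_const 2) (key.trans_lt (ENNReal.pow_lt_top hf.lt_top)).ne
    filter_upwards [h1] with x hx
    refine ⟨(hu.comp (measurable_id.prodMk measurable_const)).aestronglyMeasurable, ?_⟩
    by_contra hcon
    rw [HasFiniteIntegral, not_lt, top_le_iff] at hcon
    rw [hcon] at hx
    simp at hx
  · rw [← ENNReal.pow_le_pow_left_iff two_ne_zero, eLpNorm_two_sq]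
    refine le_trans (lintegral_mono fun x => ?_) key
    exact pow_le_pow_left' (enorm_integral_le_lintegral_enorm _) 2

theorem measurable_integral_param {α : Type*} [MeasurableSpace α] {β : Type*} [MeasurableSpace β] (ν : Measure β)
    [SFinite ν] {u : β → α → ℝ} (hu : Measurable (Function.uncurry u)) : Measurable fun x => ∫ s, u s x ∂ν := by
  have : StronglyMeasurable fun p : α × β => u p.2 p.1 :=
    (hu.comp (measurable_snd.prodMk measurable_fst)).stronglyMeasurable
  exact this.integral_prod_right.measurable

theorem nrm_integral_le (κ l : ℝ) {β : Type*} [MeasurableSpace β] (ν : Measure β) [SFinite ν] {u : β → Plane → ℝ}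
    (hu : Measurable (Function.uncurry u)) {B : β → ℝ≥0∞} (hB : Measurable B)
    (h0 : ∀ᵐ s ∂ν, B s ≠ 0 ∧ B s ≠ ⊤) (h : ∀ᵐ s ∂ν, nrm κ l (u s) ≤ B s) (hf : ∫⁻ s, B s ∂ν ≠ ⊤) :
    (∀ᵐ x, Integrable (fun s => u s x) ν) ∧ ∫⁻ x, (∫⁻ s, ‖u s x‖ₑ ∂ν) ^ 2 ∂(expMeas l) < ⊤ ∧
      nrm κ l (fun x => ∫ s, u s x ∂ν) ≤ 2 * ∫⁻ s, B s ∂ν := by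
  obtain ⟨h1, h3, h2⟩ := eLpNorm_integral_le (expMeas l) ν hu hB h0
    (by filter_upwards [h] with s hs; exact (eLpNorm_le_nrm κ l _).trans hs) hf
  have h1' := (absolutelyContinuous_expMeas l).ae_le h1
  have hu2 : Measurable (Function.uncurry fun (s : β) (p : Plane × Plane) => u s p.1 - u s p.2) :=
    (hu.comp (measurable_fst.prodMk (measurable_fst.comp measurable_snd))).sub
      (hu.comp (measurable_fst.prodMk (measurable_snd.comp measurable_snd)))
  obtain ⟨-, -, h4⟩ := eLpNorm_integral_le (slobMeas κ l) ν hu2 hB h0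
    (by filter_upwards [h] with s hs; exact le_add_self.trans hs) hf
  refine ⟨h1', h3, ?_⟩
  rw [nrm, two_mul]
  refine add_le_add h2 (le_of_eq_of_le (eLpNorm_congr_ae ((slobMeas_absolutelyContinuous κ l).ae_eq ?_)) h4)
  filter_upwards [Measure.quasiMeasurePreserving_fst.ae h1', Measure.quasiMeasurePreserving_snd.ae h1'] with p p1 p2
  rw [integral_sub p1 p2]

theorem lintegral_Ioo_rpow {q t : ℝ} (hq : q < 1) (ht : 0 < t) :
    ∫⁻ s in Ioo 0 t, ofReal (s ^ (-q)) = ofReal (t ^ (1 - q) / (1 - q)) := by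
  have hint : IntegrableOn (fun s : ℝ => s ^ (-q)) (Ioo 0 t) :=
    (intervalIntegral.integrableOn_Ioo_rpow_iff ht).2 (by linarith)
  rw [← ofReal_integral_eq_lintegral_ofReal hint
    ((ae_restrict_iff' measurableSet_Ioo).2 (Eventually.of_forall fun s hs => Real.rpow_nonneg hs.1.le _)),
    ← integral_Ioc_eq_integral_Ioo, ← intervalIntegral.integral_of_le ht.le, integral_rpow (Or.inl (by linarith))]
  congr 1
  rw [Real.zero_rpow (by linarith)]
  ring_nf

theorem lintegral_Ioo_comp_sub (t : ℝ) (f : ℝ → ℝ≥0∞) :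
    ∫⁻ s in Ioo 0 t, f (t - s) = ∫⁻ s in Ioo 0 t, f s := by
  rw [← lintegral_indicator measurableSet_Ioo, ← lintegral_indicator measurableSet_Ioo,
    ← lintegral_sub_left_eq_self _ t]
  refine lintegral_congr fun s => ?_
  by_cases hs : s ∈ Ioo 0 t
  · have : t - s ∈ Ioo 0 t := ⟨by linarith [hs.2], by linarith [hs.1]⟩
    rw [Set.indicator_of_mem hs, Set.indicator_of_mem this, sub_sub_cancel]
  · have : t - s ∉ Ioo 0 t := fun h => hs ⟨by linarith [h.2], by linarith [h.1]⟩
    rw [Set.indicator_of_notMem hs, Set.indicator_of_notMem this]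

theorem half_rpow_neg_le {t r : ℝ} (ht : 0 < t) (h1 : r ≤ 1) : (t / 2) ^ (-r) ≤ 2 * t ^ (-r) := by
  rw [Real.div_rpow ht.le zero_le_two, div_eq_mul_inv, ← Real.rpow_neg zero_le_two, neg_neg, mul_comm]
  gcongr
  calc (2 : ℝ) ^ r ≤ 2 ^ (1 : ℝ) := Real.rpow_le_rpow_of_exponent_le one_le_two h1
    _ = 2 := by simp

theorem lintegral_Ioo_rpow_mul_rpow_le {p q t : ℝ} (hp0 : 0 ≤ p) (hp : p < 1) (hq0 : 0 ≤ q) (hq : q < 1) (ht : 0 < t) :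
    ∫⁻ s in Ioo 0 t, ofReal ((t - s) ^ (-p) * s ^ (-q)) ≤
      ofReal ((2 / (1 - q) + 2 / (1 - p)) * t ^ (1 - p - q)) := by
  have hp' : 0 < 1 - p := by linarith
  have hq' : 0 < 1 - q := by linarith
  calc _ ≤ ∫⁻ s in Ioo 0 t, (ofReal (2 * t ^ (-p)) * ofReal (s ^ (-q)) +
        ofReal (2 * t ^ (-q)) * ofReal ((t - s) ^ (-p))) := by
        refine setLIntegral_mono' measurableSet_Ioo fun s hs => ?_
        have hts : 0 < t - s := by linarith [hs.2]
        have hs0 := hs.1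
        rw [← ofReal_mul (by positivity), ← ofReal_mul (by positivity),
          ← ENNReal.ofReal_add (by positivity) (by positivity)]
        apply ofReal_le_ofReal
        rcases le_total s (t / 2) with h | h
        · have : (t - s) ^ (-p) ≤ 2 * t ^ (-p) :=
            (Real.rpow_le_rpow_of_nonpos (by positivity) (by linarith) (by linarith)).trans (half_rpow_neg_le ht hp.le)
          have := mul_le_mul_of_nonneg_right this (by positivity : 0 ≤ s ^ (-q))
          have h3 : 0 ≤ 2 * t ^ (-q) * (t - s) ^ (-p) := by positivity
          linarith
        · have : s ^ (-q) ≤ 2 * t ^ (-q) :=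
            (Real.rpow_le_rpow_of_nonpos (by positivity) (by linarith) (by linarith)).trans (half_rpow_neg_le ht hq.le)
          have := mul_le_mul_of_nonneg_left this (by positivity : 0 ≤ (t - s) ^ (-p))
          have h3 : 0 ≤ 2 * t ^ (-p) * s ^ (-q) := by positivity
          linarith
    _ = ofReal (2 * t ^ (-p)) * ofReal (t ^ (1 - q) / (1 - q)) +
        ofReal (2 * t ^ (-q)) * ofReal (t ^ (1 - p) / (1 - p)) := by
        rw [lintegral_add_left (by fun_prop), lintegral_const_mul _ (by fun_prop),
          lintegral_const_mul _ (by fun_prop), lintegral_Ioo_rpow hq ht,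
          lintegral_Ioo_comp_sub t fun r => ofReal (r ^ (-p)), lintegral_Ioo_rpow hp ht]
    _ = _ := by
        rw [← ofReal_mul (by positivity), ← ofReal_mul (by positivity),
          ← ENNReal.ofReal_add (by positivity) (by positivity)]
        congr 1
        have e1 : t ^ (1 - p - q) = t ^ (-p) * t ^ (1 - q) := by rw [← Real.rpow_add ht]; congr 1; ring
        have e2 : t ^ (1 - p - q) = t ^ (-q) * t ^ (1 - p) := by rw [← Real.rpow_add ht]; congr 1; ring
        rw [add_mul]
        nth_rewrite 1 [e1]
        rw [e2]
        ring

/-! ### The Duhamel operator -/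

/-- `K_τ * (∑ A_j v_j)`. -/
def forc (a : Coef) (v : Fin 3 → Plane → ℝ) (τ : ℝ) (x : Plane) : ℝ :=
  ∑ j, pair (a j) (v j) τ x

/-- The integrand of the Duhamel term, with time cutoff `η`. -/
def duhI (η : ℝ → ℝ) (a : Coef) (W : Fld) (i : Fin 3) (t s : ℝ) (x : Plane) : ℝ :=
  η (t - s) * hconv i ((t - s) / 2) (forc a (fun j => W j s) ((t - s) / 2)) x

/-- The Duhamel term `∫₀ᵗ η(t-s) ∂_i K_{t-s} * (∑ A_j W_j(s)) ds`. -/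
def duh (η : ℝ → ℝ) (a : Coef) (W : Fld) (i : Fin 3) (t : ℝ) (x : Plane) : ℝ :=
  ∫ s in Ioo 0 t, duhI η a W i t s x

theorem measurable_forc_param {α : Type*} [MeasurableSpace α] (a : Coef) {G : Fin 3 → α → Plane → ℝ}
    (hG : ∀ j, Measurable (Function.uncurry (G j))) {τ : α → ℝ} (hτ : Measurable τ) {X : α → Plane}
    (hX : Measurable X) : Measurable fun p => forc a (fun j => G j p) (τ p) (X p) :=
  Finset.measurable_fun_sum _ fun j _ => measurable_pair (a j) (hG j) hτ hX

theorem measurable_duhI {η : ℝ → ℝ} (hη : Measurable η) (a : Coef) {W : Fld}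
    (hW : ∀ j, Measurable (Function.uncurry (W j))) (i : Fin 3) :
    Measurable fun p : (ℝ × Plane) × ℝ => duhI η a W i p.1.1 p.2 p.1.2 := by
  unfold duhI
  refine Measurable.mul (by fun_prop) ?_
  refine measurable_hconv_param i (G := fun (p : (ℝ × Plane) × ℝ) y => forc a (fun j => W j p.2) ((p.1.1 - p.2) / 2) y)
    (τ := fun p => (p.1.1 - p.2) / 2) (X := fun p => p.1.2) ?_ (by fun_prop) (by fun_prop)
  refine measurable_forc_param a (G := fun j (q : ((ℝ × Plane) × ℝ) × Plane) => W j q.1.2)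
    (fun j => ?_) (by fun_prop) measurable_snd
  have := hW j
  exact this.comp (by fun_prop : Measurable fun r : (((ℝ × Plane) × ℝ) × Plane) × Plane => (r.1.1.2, r.2))

theorem measurable_duhI_slice {η : ℝ → ℝ} (hη : Measurable η) (a : Coef) {W : Fld}
    (hW : ∀ j, Measurable (Function.uncurry (W j))) (i : Fin 3) (t : ℝ) :
    Measurable (Function.uncurry fun s x => duhI η a W i t s x) :=
  (measurable_duhI hη a hW i).comp
    (by fun_prop : Measurable fun q : ℝ × Plane => ((t, q.2), q.1))

theorem measurable_duh {η : ℝ → ℝ} (hη : Measurable η) (a : Coef) {W : Fld}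
    (hW : ∀ j, Measurable (Function.uncurry (W j))) (i : Fin 3) :
    Measurable (Function.uncurry (duh η a W i)) := by
  have hset : MeasurableSet {p : (ℝ × Plane) × ℝ | 0 < p.2 ∧ p.2 < p.1.1} :=
    (measurableSet_lt measurable_const measurable_snd).inter
      (measurableSet_lt measurable_snd (by fun_prop))
  have h := ((measurable_duhI hη a hW i).indicator hset).stronglyMeasurable.integral_prod_right' (ν := volume)
  convert h.measurable using 1
  funext p
  obtain ⟨t, x⟩ := p
  simp only [Function.uncurry, duh]
  rw [← integral_indicator measurableSet_Ioo]
  rfl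

theorem exists_eLpNorm_forc_le {κ : ℝ} (hκ : 0 < κ) (hκ1 : κ ≤ 1 / 2) (L T : ℝ) :
    ∃ C : ℝ≥0∞, C ≠ ⊤ ∧ ∀ (a : Coef) (R N : ℝ≥0∞) (l τ : ℝ), |l| ≤ L → (∀ j, IsCoef κ (a j)) →
      (∀ j, ∀ᶠ n in atTop, hol κ (a j n) ≤ R) → 0 < τ → τ ≤ T → ∀ v : Fin 3 → Plane → ℝ, (∀ j, Measurable (v j)) →
      (∀ j, nrm κ l (v j) ≤ N) → N < ⊤ →
      eLpNorm (forc a v τ) 2 (expMeas (l + τ)) ≤ C * R * ofReal (τ ^ (-(3 * κ / 2))) * N := by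
  obtain ⟨C, hC, hb⟩ := exists_eLpNorm_pair_le hκ hκ1 L T
  refine ⟨3 * C, mul_ne_top (by simp) hC, fun a R N l τ hl ha hR hτ hT v hv hN hNt => ?_⟩
  have hm : ∀ j, AEStronglyMeasurable (pair (a j) (v j) τ) (expMeas (l + τ)) := fun j =>
    (measurable_pair (α := Plane) (a j) (G := fun _ => v j) ((hv j).comp measurable_snd) measurable_const
      measurable_id).aestronglyMeasurable
  have e : forc a v τ = ∑ j, pair (a j) (v j) τ := by funext x; simp [forc]
  rw [e]
  refine (eLpNorm_sum_le (fun j _ => hm j) one_le_two).trans ?_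
  calc _ ≤ ∑ j : Fin 3, C * R * ofReal (τ ^ (-(3 * κ / 2))) * N := by
        refine Finset.sum_le_sum fun j _ => ?_
        refine (hb (a j) R l τ hl (ha j) (hR j) hτ hT (v j) (hv j) ((hN j).trans_lt hNt)).trans ?_
        gcongr
        exact hN j
    _ = _ := by simp; ring

theorem measurable_forc (a : Coef) {v : Fin 3 → Plane → ℝ} (hv : ∀ j, Measurable (v j)) (τ : ℝ) :
    Measurable (forc a v τ) :=
  measurable_forc_param (α := Plane) a (G := fun j _ => v j) (fun j => (hv j).comp measurable_snd) measurable_const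
    measurable_id

/-- Uniform bounds on the coefficients. -/
structure CoefBound (κ : ℝ) (a : Coef) (R : ℝ≥0∞) : Prop where
  coef : ∀ j, IsCoef κ (a j)
  le : ∀ j, ∀ᶠ n in atTop, hol κ (a j n) ≤ R

theorem exists_nrm_heat_forc_le {κ : ℝ} (hκ : 0 < κ) (hκ1 : κ ≤ 1 / 10) (L T : ℝ) :
    ∃ C : ℝ≥0∞, C ≠ ⊤ ∧ C ≠ 0 ∧ ∀ (a : Coef) (R N : ℝ≥0∞) (l s t : ℝ), |l| ≤ L → CoefBound κ a R →
      0 < s → s < t → t ≤ T → ∀ v : Fin 3 → Plane → ℝ, (∀ j, Measurable (v j)) →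
      (∀ j, nrm κ (l + s) (v j) ≤ N) → N < ⊤ → R < ⊤ →
      eLpNorm (forc a v ((t - s) / 2)) 2 (expMeas (l + t)) < ⊤ ∧
      (∀ i, nrm κ (l + t) (hconv i ((t - s) / 2) (forc a v ((t - s) / 2))) ≤
        C * R * ofReal ((t - s) ^ (-(1 / 2 + 5 * κ / 2))) * N) ∧
      eLpNorm (hconv 0 ((t - s) / 2) (forc a v ((t - s) / 2))) 2 (expMeas (l + t)) ≤
        C * R * ofReal ((t - s) ^ (-(3 * κ / 2))) * N := by
  obtain ⟨C₁, hC₁, h1⟩ := exists_eLpNorm_forc_le hκ (by linarith) (L + T) T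
  obtain ⟨C₂, hC₂, h2⟩ := nrm_hconv_le hκ (by linarith) (L + T) T
  set E := ofReal (2 * Real.exp ((L + T) ^ 2 * T)) with hE
  refine ⟨2 * C₁ * (C₂ + E) + 1, ?_, by simp, ?_⟩
  · exact ENNReal.add_ne_top.2 ⟨mul_ne_top (mul_ne_top (by simp) hC₁)
      (ENNReal.add_ne_top.2 ⟨hC₂, ofReal_ne_top⟩), by simp⟩
  intro a R N l s t hl ha hs hst hT v hv hN hNt hRt
  have hL := abs_le.1 hl
  have hts : 0 < t - s := by linarith
  set σ := (t - s) / 2 with hσ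
  have hσ0 : 0 < σ := by positivity
  have hσT : σ ≤ T := by linarith
  have hF : eLpNorm (forc a v σ) 2 (expMeas (l + t)) ≤ C₁ * R * ofReal (σ ^ (-(3 * κ / 2))) * N :=
    (eLpNorm_mono_measure _ (expMeas_mono (by linarith : l + s + σ ≤ l + t))).trans
      (h1 a R N (l + s) σ (abs_le.2 ⟨by linarith, by linarith⟩) ha.coef ha.le hσ0 hσT v hv hN hNt)
  have hFt : eLpNorm (forc a v σ) 2 (expMeas (l + t)) < ⊤ := by
    refine hF.trans_lt (mul_lt_top (mul_lt_top (mul_lt_top hC₁.lt_top hRt)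
      ofReal_lt_top) hNt)
  have hm := measurable_forc a hv σ
  have half : ∀ p : ℝ, p ≤ 1 → ofReal (σ ^ (-p)) ≤ 2 * ofReal ((t - s) ^ (-p)) := fun p hp => by
    rw [← ENNReal.ofReal_ofNat, ← ofReal_mul zero_le_two]
    exact ofReal_le_ofReal (half_rpow_neg_le hts hp)
  refine ⟨hFt, fun i => ?_, ?_⟩
  · refine (h2 (l + t) (abs_le.2 ⟨by linarith, by linarith⟩) σ hσ0 hσT i _ hm hFt).trans ?_
    calc _ ≤ C₂ * ofReal (σ ^ (-(1 / 2 + κ))) * (C₁ * R * ofReal (σ ^ (-(3 * κ / 2))) * N) := by gcongr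
      _ = C₂ * C₁ * R * (ofReal (σ ^ (-(1 / 2 + κ))) * ofReal (σ ^ (-(3 * κ / 2)))) * N := by ring
      _ = C₂ * C₁ * R * ofReal (σ ^ (-(1 / 2 + 5 * κ / 2))) * N := by
          rw [← ofReal_mul (by positivity), ← Real.rpow_add hσ0]
          congr 4; ring
      _ ≤ C₂ * C₁ * R * (2 * ofReal ((t - s) ^ (-(1 / 2 + 5 * κ / 2)))) * N := by
          gcongr
          exact half _ (by linarith)
      _ = (2 * C₁ * C₂) * R * ofReal ((t - s) ^ (-(1 / 2 + 5 * κ / 2))) * N := by ring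
      _ ≤ _ := by
          gcongr
          calc 2 * C₁ * C₂ ≤ 2 * C₁ * (C₂ + E) := by gcongr; exact le_self_add
            _ ≤ _ := le_self_add
  · refine (eLpNorm_hconv_zero_le hσ0 hm).trans ?_
    have hEl : ofReal (2 * Real.exp ((l + t) ^ 2 * σ)) ≤ E := by
      apply ofReal_le_ofReal
      have : (l + t) ^ 2 ≤ (L + T) ^ 2 := sq_le_sq' (by linarith) (by linarith)
      gcongr
    calc _ ≤ E * (C₁ * R * ofReal (σ ^ (-(3 * κ / 2))) * N) := by gcongr
      _ ≤ E * (C₁ * R * (2 * ofReal ((t - s) ^ (-(3 * κ / 2)))) * N) := by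
          gcongr
          exact half _ (by linarith)
      _ = (2 * C₁ * E) * R * ofReal ((t - s) ^ (-(3 * κ / 2))) * N := by ring
      _ ≤ _ := by
          gcongr
          calc 2 * C₁ * E ≤ 2 * C₁ * (C₂ + E) := by gcongr; exact le_add_self
            _ ≤ _ := le_self_add

/-- `W(t)` is bounded by `c t^{-1/2-κ} e^{Mt}` in the fractional norm with weight `e_{l+t}`. -/
def Bdd (κ l T M : ℝ) (c : ℝ≥0∞) (W : Fld) : Prop :=
  ∀ t ∈ Ioc 0 T, ∀ i, nrm κ (l + t) (W i t) ≤ c * ofReal (t ^ (-(1 / 2 + κ)) * Real.exp (M * t))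

theorem exists_bdd_duh {κ : ℝ} (hκ : 0 < κ) (hκ1 : κ < 1 / 10) (L T : ℝ) :
    ∃ C : ℝ≥0∞, C ≠ ⊤ ∧ ∀ (η : ℝ → ℝ) (a : Coef) (W : Fld) (l M : ℝ) (A R c : ℝ≥0∞),
      |l| ≤ L → Measurable η → (∀ τ ∈ Ioc 0 T, ‖η τ‖ₑ * ofReal (Real.exp (-(M * τ))) ≤
        A * ofReal (τ ^ (-(1 / 4 : ℝ)))) → CoefBound κ a R → (∀ j, Measurable (Function.uncurry (W j))) →
      A ≠ 0 → A ≠ ⊤ → R ≠ 0 → R ≠ ⊤ → c ≠ 0 → c ≠ ⊤ → Bdd κ l T M c W →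
      (∀ t ∈ Ioc 0 T, ∀ i, (∀ᵐ x, IntegrableOn (fun s => duhI η a W i t s x) (Ioo 0 t)) ∧
        ∫⁻ x, (∫⁻ s in Ioo 0 t, ‖duhI η a W i t s x‖ₑ) ^ 2 ∂(expMeas (l + t)) < ⊤) ∧
      Bdd κ l T M (C * R * A * c) (duh η a W) := by
  obtain ⟨C, hC, hC0, hb⟩ := exists_nrm_heat_forc_le hκ hκ1.le L T
  set p : ℝ := 3 / 4 + 5 * κ / 2 with hp
  set β : ℝ := 1 / 2 + κ with hβ
  refine ⟨C * 2 * ofReal ((2 / (1 - β) + 2 / (1 - p)) * T ^ (1 - p)),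
    mul_ne_top (mul_ne_top hC (by simp)) ofReal_ne_top, ?_⟩
  intro η a W l M A R c hl hη hηA ha hW hA0 hAt hR0 hRt hc0 hct hWb
  have key : ∀ t ∈ Ioc 0 T, ∀ i, ((∀ᵐ x, IntegrableOn (fun s => duhI η a W i t s x) (Ioo 0 t)) ∧
        ∫⁻ x, (∫⁻ s in Ioo 0 t, ‖duhI η a W i t s x‖ₑ) ^ 2 ∂(expMeas (l + t)) < ⊤) ∧
      nrm κ (l + t) (duh η a W i t) ≤ C * 2 * ofReal ((2 / (1 - β) + 2 / (1 - p)) * T ^ (1 - p)) * R * A * c *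
        ofReal (t ^ (-β) * Real.exp (M * t)) := by
    intro t ht i
    have ht0 := ht.1
    set D := C * R * A * c * ofReal (Real.exp (M * t)) with hD
    have hDt : D ≠ ⊤ := mul_ne_top (mul_ne_top (mul_ne_top (mul_ne_top hC hRt) hAt) hct)
      ofReal_ne_top
    have hD0 : D ≠ 0 := mul_ne_zero (mul_ne_zero (mul_ne_zero (mul_ne_zero hC0 hR0) hA0) hc0)
      (by simp [Real.exp_pos])
    set B : ℝ → ℝ≥0∞ := fun s => D * ofReal ((t - s) ^ (-p) * s ^ (-β)) with hB
    have hBm : Measurable B := by rw [hB]; fun_prop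
    have hBint : ∫⁻ s in Ioo 0 t, B s ≤ D * ofReal ((2 / (1 - β) + 2 / (1 - p)) * t ^ (1 - p - β)) := by
      rw [hB, lintegral_const_mul _ (by fun_prop)]
      gcongr
      exact lintegral_Ioo_rpow_mul_rpow_le (by rw [hp]; positivity) (by rw [hp]; linarith) (by rw [hβ]; positivity)
        (by rw [hβ]; linarith) ht0
    have h0 : ∀ᵐ s ∂(volume.restrict (Ioo 0 t)), B s ≠ 0 ∧ B s ≠ ⊤ := by
      refine (ae_restrict_iff' measurableSet_Ioo).2 (Eventually.of_forall fun s hs => ⟨?_, ?_⟩)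
      · refine mul_ne_zero hD0 ?_
        have h1 : 0 < t - s := by linarith [hs.2]
        have h2 := hs.1
        simp only [ne_eq, ENNReal.ofReal_eq_zero, not_le]
        positivity
      · exact mul_ne_top hDt ofReal_ne_top
    have hn : ∀ᵐ s ∂(volume.restrict (Ioo 0 t)), nrm κ (l + t) (fun x => duhI η a W i t s x) ≤ B s := by
      refine (ae_restrict_iff' measurableSet_Ioo).2 (Eventually.of_forall fun s hs => ?_)
      have hts : 0 < t - s := by linarith [hs.2]
      have hs0 := hs.1
      have hWs := hWb s ⟨hs.1, by linarith [hs.2, ht.2]⟩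
      have h1 := (hb a R (c * ofReal (s ^ (-β) * Real.exp (M * s))) l s t hl ha hs.1 hs.2 ht.2 (fun j => W j s)
        (fun j => (hW j).comp (measurable_const.prodMk measurable_id)) hWs
        (mul_lt_top hct.lt_top ofReal_lt_top) hRt.lt_top).2.1 i
      unfold duhI
      rw [nrm_const_mul]
      have e1 : ofReal (s ^ (-β) * Real.exp (M * s)) = ofReal (s ^ (-β)) *
          (ofReal (Real.exp (-(M * (t - s)))) * ofReal (Real.exp (M * t))) := by
        rw [← ofReal_mul (by positivity), ← ofReal_mul (by positivity), ← Real.exp_add]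
        congr 3; ring
      have e2 : ofReal ((t - s) ^ (-p) * s ^ (-β)) = ofReal ((t - s) ^ (-(1 / 4 : ℝ))) *
          ofReal ((t - s) ^ (-(1 / 2 + 5 * κ / 2))) * ofReal (s ^ (-β)) := by
        rw [← ofReal_mul (by positivity), ← ofReal_mul (by positivity), ← Real.rpow_add hts]
        congr 3; rw [hp]; ring
      calc _ ≤ ‖η (t - s)‖ₑ * (C * R * ofReal ((t - s) ^ (-(1 / 2 + 5 * κ / 2))) *
            (c * ofReal (s ^ (-β) * Real.exp (M * s)))) := mul_le_mul_right h1 _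
        _ = (‖η (t - s)‖ₑ * ofReal (Real.exp (-(M * (t - s))))) * (C * R *
            ofReal ((t - s) ^ (-(1 / 2 + 5 * κ / 2))) *
            (c * ofReal (s ^ (-β)) * ofReal (Real.exp (M * t)))) := by rw [e1]; ring
        _ ≤ (A * ofReal ((t - s) ^ (-(1 / 4 : ℝ)))) * (C * R *
            ofReal ((t - s) ^ (-(1 / 2 + 5 * κ / 2))) *
            (c * ofReal (s ^ (-β)) * ofReal (Real.exp (M * t)))) :=
            mul_le_mul_left (hηA (t - s) ⟨hts, by linarith [ht.2]⟩) _
        _ = _ := by simp only [hB, hD]; rw [e2]; ring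
    obtain ⟨i1, i3, i2⟩ := nrm_integral_le κ (l + t) (volume.restrict (Ioo 0 t))
      (measurable_duhI_slice hη a hW i t) hBm h0 hn (hBint.trans_lt (mul_lt_top hDt.lt_top
        ofReal_lt_top)).ne
    refine ⟨⟨i1, i3⟩, i2.trans ?_⟩
    have hpow : (2 / (1 - β) + 2 / (1 - p)) * t ^ (1 - p - β) ≤ (2 / (1 - β) + 2 / (1 - p)) * T ^ (1 - p) * t ^ (-β) := by
      have hb1 : 0 < 1 - β := by rw [hβ]; linarith
      have hp1 : 0 < 1 - p := by rw [hp]; linarith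
      rw [mul_assoc, sub_eq_add_neg (1 - p), Real.rpow_add ht0]
      gcongr
      exact ht.2
    calc _ ≤ 2 * (D * ofReal ((2 / (1 - β) + 2 / (1 - p)) * T ^ (1 - p) * t ^ (-β))) := by
          gcongr
          exact hBint.trans (by gcongr)
      _ = _ := by
          have hT0 : 0 < T := ht0.trans_le ht.2
          have hb1 : 0 < 1 - β := by rw [hβ]; linarith
          have hp1 : 0 < 1 - p := by rw [hp]; linarith
          rw [ofReal_mul (by positivity), ofReal_mul (by positivity : 0 ≤ t ^ (-β)), hD]
          ring
  exact ⟨fun t ht i => (key t ht i).1, fun t ht i => (key t ht i).2⟩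

/-! ### Linearity of the Duhamel operator -/

theorem exists_eLpNorm_forc_lt_top {κ τ : ℝ} (hκ : 0 < κ) (hκ1 : κ ≤ 1 / 2) (hτ : 0 < τ) {a : Coef}
    (ha : ∀ j, IsCoef κ (a j)) {v : Fin 3 → Plane → ℝ} (hv : ∀ j, Reg κ (v j)) :
    ∃ l, eLpNorm (forc a v τ) 2 (expMeas l) < ⊤ := by
  choose R hR hb using fun j => (ha j).exists_bound hκ
  choose l hl using fun j => (hv j).2
  set m := ∑ j, |l j| with hm
  have hlm : ∀ j, l j ≤ m := fun j =>
    (le_abs_self _).trans (Finset.single_le_sum (f := fun j => |l j|) (fun j _ => abs_nonneg _) (Finset.mem_univ j))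
  obtain ⟨C, hC, h⟩ := exists_eLpNorm_forc_le hκ hκ1 |m| τ
  refine ⟨m + τ, (h a (∑ j, R j) (∑ j, nrm κ m (v j)) m τ le_rfl ha (fun j => ?_) hτ le_rfl v (fun j => (hv j).1)
    (fun j => Finset.single_le_sum (f := fun j => nrm κ m (v j)) (fun j _ => zero_le) (Finset.mem_univ j)) ?_).trans_lt ?_⟩
  · filter_upwards [hb j] with n hn
    exact hn.trans (Finset.single_le_sum (f := R) (fun j _ => zero_le) (Finset.mem_univ j))
  · exact ENNReal.sum_lt_top.2 fun j _ => (nrm_mono_weight (hlm j) _).trans_lt (hl j)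
  · refine mul_lt_top (mul_lt_top (mul_lt_top hC.lt_top ?_) ofReal_lt_top) ?_
    · exact ENNReal.sum_lt_top.2 fun j _ => (hR j).lt_top
    · exact ENNReal.sum_lt_top.2 fun j _ => (nrm_mono_weight (hlm j) _).trans_lt (hl j)

theorem forc_lin {κ τ : ℝ} (hκ : 0 < κ) (hκ1 : κ ≤ 1 / 2) (hτ : 0 < τ) {a : Coef}
    (ha : ∀ j, IsCoef κ (a j)) {v v' : Fin 3 → Plane → ℝ} (hv : ∀ j, Reg κ (v j)) (hv' : ∀ j, Reg κ (v' j)) (c d : ℝ)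
    (x : Plane) :
    forc a (fun j y => c * v j y + d * v' j y) τ x = c * forc a v τ x + d * forc a v' τ x := by
  simp only [forc, Finset.mul_sum, ← Finset.sum_add_distrib]
  refine Finset.sum_congr rfl fun j _ => ?_
  rw [pair_add hκ hκ1 hτ (ha j) ((hv j).const_mul c) ((hv' j).const_mul d), pair_const_mul hκ hκ1 hτ (ha j) (hv j),
    pair_const_mul hκ hκ1 hτ (ha j) (hv' j)]

theorem forc_coef_sub {κ τ : ℝ} (hκ : 0 < κ) (hκ1 : κ ≤ 1 / 2) (hτ : 0 < τ) {a b : Coef}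
    (ha : ∀ j, IsCoef κ (a j)) (hb : ∀ j, IsCoef κ (b j)) {v : Fin 3 → Plane → ℝ} (hv : ∀ j, Reg κ (v j))
    (x : Plane) : forc (a - b) v τ x = forc a v τ x - forc b v τ x := by
  simp only [forc, ← Finset.sum_sub_distrib]
  refine Finset.sum_congr rfl fun j _ => ?_
  rw [← pair_coef_sub hκ hκ1 hτ (ha j) (hb j) (hv j)]
  rfl

theorem forc_congr_ae (a : Coef) {v v' : Fin 3 → Plane → ℝ} (h : ∀ j, v j =ᵐ[volume] v' j) (τ : ℝ) :
    forc a v τ = forc a v' τ := by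
  funext x
  simp only [forc]
  refine Finset.sum_congr rfl fun j _ => ?_
  rw [pair_congr_ae (a j) (h j)]

theorem hconv_lin {t l l' : ℝ} (ht : 0 < t) (i : Fin 3) {f f' : Plane → ℝ} (hf : Measurable f) (hf' : Measurable f')
    (h : eLpNorm f 2 (expMeas l) < ⊤) (h' : eLpNorm f' 2 (expMeas l') < ⊤) (c d : ℝ) (x : Plane) :
    hconv i t (fun y => c * f y + d * f' y) x = c * hconv i t f x + d * hconv i t f' x := by
  unfold hconv
  rw [← integral_const_mul, ← integral_const_mul, ← integral_add ((integrable_kern_mul ht i hf h x).const_mul c)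
    ((integrable_kern_mul ht i hf' h' x).const_mul d)]
  congr 1; funext y; ring

theorem hconv_congr_ae (i : Fin 3) (t : ℝ) {f f' : Plane → ℝ} (h : f =ᵐ[volume] f') : hconv i t f = hconv i t f' := by
  funext x
  refine integral_congr_ae ?_
  filter_upwards [h] with y hy
  rw [hy]

theorem duhI_lin {κ : ℝ} (hκ : 0 < κ) (hκ1 : κ ≤ 1 / 2) (η : ℝ → ℝ) {a : Coef}
    (ha : ∀ j, IsCoef κ (a j)) {W W' : Fld} {s t : ℝ} (hst : s < t) (hv : ∀ j, Reg κ (W j s))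
    (hv' : ∀ j, Reg κ (W' j s)) (c d : ℝ) (i : Fin 3) (x : Plane) :
    duhI η a (fun j s y => c * W j s y + d * W' j s y) i t s x =
      c * duhI η a W i t s x + d * duhI η a W' i t s x := by
  have hσ : 0 < (t - s) / 2 := by linarith
  obtain ⟨l, hl⟩ := exists_eLpNorm_forc_lt_top hκ hκ1 hσ ha hv
  obtain ⟨l', hl'⟩ := exists_eLpNorm_forc_lt_top hκ hκ1 hσ ha hv'
  unfold duhI
  have e : forc a (fun j y => c * W j s y + d * W' j s y) ((t - s) / 2) = fun y =>
      c * forc a (fun j => W j s) ((t - s) / 2) y + d * forc a (fun j => W' j s) ((t - s) / 2) y :=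
    funext fun y => forc_lin hκ hκ1 hσ ha hv hv' c d y
  rw [e, hconv_lin hσ i (measurable_forc a (fun j => (hv j).1) _) (measurable_forc a (fun j => (hv' j).1) _) hl hl']
  ring

theorem duhI_coef_sub {κ : ℝ} (hκ : 0 < κ) (hκ1 : κ ≤ 1 / 2) (η : ℝ → ℝ) {a b : Coef}
    (ha : ∀ j, IsCoef κ (a j)) (hb : ∀ j, IsCoef κ (b j)) {W : Fld} {s t : ℝ} (hst : s < t)
    (hv : ∀ j, Reg κ (W j s)) (i : Fin 3) (x : Plane) :
    duhI η (a - b) W i t s x = duhI η a W i t s x - duhI η b W i t s x := by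
  have hσ : 0 < (t - s) / 2 := by linarith
  obtain ⟨l, hl⟩ := exists_eLpNorm_forc_lt_top hκ hκ1 hσ ha hv
  obtain ⟨l', hl'⟩ := exists_eLpNorm_forc_lt_top hκ hκ1 hσ hb hv
  unfold duhI
  have e : forc (a - b) (fun j => W j s) ((t - s) / 2) = fun y =>
      1 * forc a (fun j => W j s) ((t - s) / 2) y + (-1) * forc b (fun j => W j s) ((t - s) / 2) y :=
    funext fun y => by rw [forc_coef_sub hκ hκ1 hσ ha hb hv]; ring
  rw [e, hconv_lin hσ i (measurable_forc a (fun j => (hv j).1) _) (measurable_forc b (fun j => (hv j).1) _) hl hl']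
  ring

theorem duh_congr (η : ℝ → ℝ) (a : Coef) {W W' : Fld} {t : ℝ}
    (h : ∀ s ∈ Ioo 0 t, ∀ j, W j s =ᵐ[volume] W' j s) (i : Fin 3) (x : Plane) :
    duh η a W i t x = duh η a W' i t x := by
  refine setIntegral_congr_fun measurableSet_Ioo fun s hs => ?_
  simp only [duhI]
  rw [forc_congr_ae a (h s hs)]

theorem Bdd.reg {κ l T M : ℝ} {c : ℝ≥0∞} {W : Fld} (h : Bdd κ l T M c W) (hc : c ≠ ⊤)
    (hW : ∀ j, Measurable (Function.uncurry (W j))) {t : ℝ} (ht : t ∈ Ioc 0 T) (i : Fin 3) : Reg κ (W i t) :=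
  ⟨(hW i).comp (measurable_const.prodMk measurable_id), l + t,
    (h t ht i).trans_lt (mul_lt_top hc.lt_top ofReal_lt_top)⟩

theorem Bdd.mono {κ l T M : ℝ} {c c' : ℝ≥0∞} {W : Fld} (h : Bdd κ l T M c W) (hc : c ≤ c') :
    Bdd κ l T M c' W := fun t ht i => (h t ht i).trans (mul_le_mul_left hc _)

theorem Bdd.mono_exp {κ l T M M' : ℝ} {c : ℝ≥0∞} {W : Fld} (h : Bdd κ l T M c W) (hM : M ≤ M') :
    Bdd κ l T M' c W := fun t ht i => (h t ht i).trans (by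
      have := ht.1
      gcongr)

theorem Bdd.lin {κ l T M : ℝ} {c c' : ℝ≥0∞} {W W' : Fld} (h : Bdd κ l T M c W)
    (h' : Bdd κ l T M c' W') (hW : ∀ j, Measurable (Function.uncurry (W j)))
    (hW' : ∀ j, Measurable (Function.uncurry (W' j))) (p q : ℝ) :
    Bdd κ l T M (‖p‖ₑ * c + ‖q‖ₑ * c') (fun i t x => p * W i t x + q * W' i t x) := by
  intro t ht i
  have m1 : Measurable (W i t) := (hW i).comp (measurable_const.prodMk measurable_id)
  have m2 : Measurable (W' i t) := (hW' i).comp (measurable_const.prodMk measurable_id)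
  refine (nrm_add_le κ (l + t) (m1.const_mul p) (m2.const_mul q)).trans ?_
  rw [nrm_const_mul, nrm_const_mul, add_mul, mul_assoc, mul_assoc]
  exact add_le_add (mul_le_mul_right (h t ht i) _) (mul_le_mul_right (h' t ht i) _)

theorem exp_neg_le_rpow {x : ℝ} (hx : 0 < x) : Real.exp (-x) ≤ x ^ (-(1 / 4 : ℝ)) := by
  rw [Real.exp_neg, Real.rpow_neg hx.le]
  refine inv_anti₀ (by positivity) ?_
  rcases le_total x 1 with h | h
  · exact (Real.rpow_le_one hx.le h (by norm_num)).trans (Real.one_le_exp hx.le)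
  · calc x ^ (1 / 4 : ℝ) ≤ x ^ (1 : ℝ) := Real.rpow_le_rpow_of_exponent_le h (by norm_num)
      _ = x := Real.rpow_one x
      _ ≤ _ := by linarith [Real.add_one_le_exp x]

/-- For a large exponential rate, the Duhamel operator is a contraction. -/
theorem exists_contraction {κ : ℝ} (hκ : 0 < κ) (hκ1 : κ < 1 / 10) (L T : ℝ) {R : ℝ≥0∞} (hR : R ≠ ⊤) :
    ∃ M₀ : ℝ, 0 ≤ M₀ ∧ ∀ M, M₀ ≤ M → ∀ (a : Coef) (W : Fld) (l : ℝ) (c : ℝ≥0∞),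
      |l| ≤ L → CoefBound κ a R → (∀ j, Measurable (Function.uncurry (W j))) → c ≠ 0 → c ≠ ⊤ → Bdd κ l T M c W →
      Bdd κ l T M (c / 2) (duh 1 a W) := by
  obtain ⟨C, hC, h⟩ := exists_bdd_duh hκ hκ1 L T
  have ht : Tendsto (fun M : ℝ => C * (R + 1) * ofReal (M ^ (-(1 / 4 : ℝ)))) atTop (𝓝 (C * (R + 1) * 0)) := by
    refine ENNReal.Tendsto.const_mul ?_ (Or.inr (mul_ne_top hC (by simp [hR])))
    have := ENNReal.tendsto_ofReal (tendsto_rpow_neg_atTop (by norm_num : (0 : ℝ) < 1 / 4))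
    simpa using this
  rw [mul_zero] at ht
  obtain ⟨M₀, hM₀⟩ := eventually_atTop.1 ((ht.eventually (ge_mem_nhds (by norm_num : (0 : ℝ≥0∞) < 1 / 2))).and
    (eventually_gt_atTop 0))
  refine ⟨max M₀ 0, le_max_right _ _, fun M hM a W l c hl ha hW hc0 hct hWb => ?_⟩
  obtain ⟨hM1, hM2⟩ := hM₀ M (le_of_max_le_left hM)
  have ha' : CoefBound κ a (R + 1) := ⟨ha.coef, fun j => (ha.le j).mono fun n hn => hn.trans le_self_add⟩
  obtain ⟨-, h2⟩ := h 1 a W l M (ofReal (M ^ (-(1 / 4 : ℝ)))) (R + 1) c hl measurable_const (fun τ hτ => by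
      have hτ0 := hτ.1
      rw [← ofReal_mul (by positivity), ← Real.mul_rpow hM2.le hτ.1.le]
      simp only [Pi.one_apply, enorm_one, one_mul]
      exact ofReal_le_ofReal (exp_neg_le_rpow (by positivity))) ha' hW
    (by simp only [ne_eq, ENNReal.ofReal_eq_zero, not_le]; positivity) ofReal_ne_top (by simp) (by simp [hR])
    hc0 hct hWb
  refine h2.mono ?_
  calc _ ≤ 1 / 2 * c := mul_le_mul_left hM1 _
    _ = c / 2 := by rw [one_div, ENNReal.div_eq_inv_mul]

/-! ### Fixed points of the Duhamel operator -/

/-- Jointly measurable fields bounded by `c t^{-1/2-κ}` on `(0,T]`. -/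
def Adm (κ l T : ℝ) (W : Fld) : Prop :=
  (∀ j, Measurable (Function.uncurry (W j))) ∧ ∃ c : ℝ≥0∞, c ≠ 0 ∧ c ≠ ⊤ ∧ Bdd κ l T 0 c W

theorem Bdd.adm {κ l T M : ℝ} {c : ℝ≥0∞} {W : Fld} (h : Bdd κ l T M c W) (hc : c ≠ ⊤)
    (hM : 0 ≤ M) (hW : ∀ j, Measurable (Function.uncurry (W j))) : Adm κ l T W := by
  refine ⟨hW, c * ofReal (Real.exp (M * T)) + 1, by simp, by simp [ENNReal.mul_eq_top, hc], ?_⟩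
  intro t ht i
  have ht0 := ht.1
  refine (h t ht i).trans ?_
  calc _ ≤ c * ofReal (Real.exp (M * T) * (t ^ (-(1 / 2 + κ)) * Real.exp (0 * t))) := by
        refine mul_le_mul_right (ofReal_le_ofReal ?_) _
        rw [zero_mul, Real.exp_zero, mul_one, mul_comm]
        gcongr
        exact ht.2
    _ = c * ofReal (Real.exp (M * T)) * ofReal (t ^ (-(1 / 2 + κ)) * Real.exp (0 * t)) := by
        rw [ofReal_mul (by positivity)]; ring
    _ ≤ _ := by gcongr; exact le_self_add

theorem Adm.exists_bdd {κ l T : ℝ} {W : Fld} (h : Adm κ l T W) {M : ℝ} (hM : 0 ≤ M) :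
    ∃ c : ℝ≥0∞, c ≠ 0 ∧ c ≠ ⊤ ∧ Bdd κ l T M c W := by
  obtain ⟨-, c, h0, ht, hb⟩ := h
  exact ⟨c, h0, ht, hb.mono_exp hM⟩

theorem Adm.reg {κ l T : ℝ} {W : Fld} (h : Adm κ l T W) {t : ℝ} (ht : t ∈ Ioc 0 T) (i : Fin 3) :
    Reg κ (W i t) := by
  obtain ⟨c, -, hc, hb⟩ := h.2
  exact hb.reg hc h.1 ht i

theorem Adm.slice {κ l T : ℝ} {W : Fld} (h : Adm κ l T W) (t : ℝ) (i : Fin 3) :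
    Measurable (W i t) := (h.1 i).comp (measurable_const.prodMk measurable_id)

theorem Adm.lin {κ l T : ℝ} {W W' : Fld} (h : Adm κ l T W) (h' : Adm κ l T W') (p q : ℝ) :
    Adm κ l T (fun i t x => p * W i t x + q * W' i t x) := by
  obtain ⟨hm, c, -, hc, hb⟩ := h
  obtain ⟨hm', c', -, hc', hb'⟩ := h'
  refine (hb.lin hb' hm hm' p q).adm ?_ le_rfl fun j => ?_
  · exact ENNReal.add_ne_top.2 ⟨mul_ne_top enorm_ne_top hc, mul_ne_top enorm_ne_top hc'⟩
  · exact ((hm j).const_mul p).add ((hm' j).const_mul q)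

theorem Adm.duh_facts {κ l T : ℝ} (hκ : 0 < κ) (hκ1 : κ < 1 / 10) {W : Fld} (h : Adm κ l T W)
    {η : ℝ → ℝ} (hη : Measurable η) (hη1 : ∀ s, |η s| ≤ 1) {a : Coef} {R : ℝ≥0∞} (ha : CoefBound κ a R)
    (hR : R ≠ ⊤) :
    (∀ t ∈ Ioc 0 T, ∀ i, (∀ᵐ x, IntegrableOn (fun s => duhI η a W i t s x) (Ioo 0 t)) ∧
        ∫⁻ x, (∫⁻ s in Ioo 0 t, ‖duhI η a W i t s x‖ₑ) ^ 2 ∂(expMeas (l + t)) < ⊤) ∧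
      Adm κ l T (duh η a W) := by
  by_cases hT : 0 < T
  swap
  · refine ⟨fun t ht => absurd (ht.1.trans_le ht.2) hT, fun j => measurable_duh hη a h.1 j, 1, by simp, by simp,
      fun t ht => absurd (ht.1.trans_le ht.2) hT⟩
  obtain ⟨C, hC, hb⟩ := exists_bdd_duh hκ hκ1 |l| T
  obtain ⟨hm, c, h0, hc, hWb⟩ := h
  have ha' : CoefBound κ a (R + 1) := ⟨ha.coef, fun j => (ha.le j).mono fun n hn => hn.trans le_self_add⟩
  obtain ⟨h1, h2⟩ := hb η a W l 0 (ofReal (T ^ (1 / 4 : ℝ))) (R + 1) c le_rfl hη (fun τ hτ => by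
    have hτ0 := hτ.1
    rw [← ofReal_mul (by positivity), zero_mul, neg_zero, Real.exp_zero, ENNReal.ofReal_one, mul_one,
      Real.enorm_eq_ofReal_abs]
    apply ofReal_le_ofReal
    refine (hη1 τ).trans ?_
    rw [Real.rpow_neg hτ.1.le, ← div_eq_mul_inv, one_le_div (by positivity)]
    exact Real.rpow_le_rpow hτ.1.le hτ.2 (by norm_num)) ha' hm
    (by simp only [ne_eq, ENNReal.ofReal_eq_zero, not_le]; positivity) ofReal_ne_top (by simp) (by simp [hR])
    h0 hc hWb
  refine ⟨h1, h2.adm ?_ le_rfl fun j => measurable_duh hη a hm j⟩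
  exact mul_ne_top (mul_ne_top (mul_ne_top hC (by simp [hR])) ofReal_ne_top) hc

theorem duh_lin {κ l T : ℝ} (hκ : 0 < κ) (hκ1 : κ < 1 / 10) {W W' : Fld} (h : Adm κ l T W)
    (h' : Adm κ l T W') {η : ℝ → ℝ} (hη : Measurable η) (hη1 : ∀ s, |η s| ≤ 1) {a : Coef} {R : ℝ≥0∞}
    (ha : CoefBound κ a R) (hR : R ≠ ⊤) (p q : ℝ) {t : ℝ} (ht : t ∈ Ioc 0 T) (i : Fin 3) :
    ∀ᵐ x, duh η a (fun i t x => p * W i t x + q * W' i t x) i t x = p * duh η a W i t x + q * duh η a W' i t x := by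
  filter_upwards [((h.duh_facts hκ hκ1 hη hη1 ha hR).1 t ht i).1, ((h'.duh_facts hκ hκ1 hη hη1 ha hR).1 t ht i).1] with x h1 h2
  unfold duh
  rw [← integral_const_mul, ← integral_const_mul, ← integral_add (h1.const_mul p) (h2.const_mul q)]
  refine setIntegral_congr_fun measurableSet_Ioo fun s hs => ?_
  have hs' : s ∈ Ioc 0 T := ⟨hs.1, hs.2.le.trans ht.2⟩
  exact duhI_lin hκ (by linarith) η ha.coef hs.2 (fun j => h.reg hs' j) (fun j => h'.reg hs' j) p q i x

theorem duh_coef_sub {κ l T : ℝ} (hκ : 0 < κ) (hκ1 : κ < 1 / 10) {W : Fld} (h : Adm κ l T W)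
    {η : ℝ → ℝ} (hη : Measurable η) (hη1 : ∀ s, |η s| ≤ 1) {a b : Coef} {R R' : ℝ≥0∞}
    (ha : CoefBound κ a R) (hR : R ≠ ⊤) (hb : CoefBound κ b R') (hR' : R' ≠ ⊤) {t : ℝ} (ht : t ∈ Ioc 0 T)
    (i : Fin 3) :
    ∀ᵐ x, duh η (a - b) W i t x = duh η a W i t x - duh η b W i t x := by
  filter_upwards [((h.duh_facts hκ hκ1 hη hη1 ha hR).1 t ht i).1, ((h.duh_facts hκ hκ1 hη hη1 hb hR').1 t ht i).1] with x h1 h2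
  unfold duh
  rw [← integral_sub h1 h2]
  refine setIntegral_congr_fun measurableSet_Ioo fun s hs => ?_
  have hs' : s ∈ Ioc 0 T := ⟨hs.1, hs.2.le.trans ht.2⟩
  exact duhI_coef_sub hκ (by linarith) η ha.coef hb.coef hs.2 (fun j => h.reg hs' j) i x

/-- `W` solves `W = g + duh W` on `(0,T]`. -/
def Solves (T : ℝ) (a : Coef) (g W : Fld) : Prop :=
  ∀ t ∈ Ioc 0 T, ∀ i, ∀ᵐ x, W i t x = g i t x + duh 1 a W i t x

/-- `duh 1 a` halves the norm with exponential rate `M`. -/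
def Contr (κ l T M : ℝ) (a : Coef) : Prop :=
  ∀ (W : Fld) (c : ℝ≥0∞), (∀ j, Measurable (Function.uncurry (W j))) → c ≠ 0 → c ≠ ⊤ →
    Bdd κ l T M c W → Bdd κ l T M (c / 2) (duh 1 a W)

theorem exists_contr {κ : ℝ} (hκ : 0 < κ) (hκ1 : κ < 1 / 10) (l T : ℝ) {R : ℝ≥0∞} (hR : R ≠ ⊤) :
    ∃ M : ℝ, 0 ≤ M ∧ ∀ a, CoefBound κ a R → Contr κ l T M a := by
  obtain ⟨M, hM, h⟩ := exists_contraction hκ hκ1 |l| T hR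
  exact ⟨M, hM, fun a ha W c hW h0 ht hb => (h M le_rfl a W l c le_rfl ha hW h0 ht hb)⟩

theorem Contr.apriori {κ l T M : ℝ} {a : Coef} (h : Contr κ l T M a) (hM : 0 ≤ M)
    {g W : Fld} (hg : ∀ j, Measurable (Function.uncurry (g j))) (hW : Adm κ l T W)
    (hs : Solves T a g W) {c : ℝ≥0∞} (hc : c ≠ ⊤) (hgc : Bdd κ l T M c g) : Bdd κ l T M (2 * c) W := by
  obtain ⟨d, hd0, hdt, hd⟩ := hW.exists_bdd hM
  have key : ∀ n : ℕ, Bdd κ l T M (2 * c + d * 2⁻¹ ^ n) W := by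
    intro n
    induction n with
    | zero => exact hd.mono (by simp)
    | succ n ih =>
      have h1 := h W _ hW.1 (by simp [hd0]) (ENNReal.add_ne_top.2 ⟨mul_ne_top (by simp) hc,
        mul_ne_top hdt (by simp)⟩) ih
      intro t ht i
      rw [nrm_congr_ae κ (l + t) (hs t ht i)]
      have m1 : Measurable (g i t) := (hg i).comp (measurable_const.prodMk measurable_id)
      have m2 : Measurable (duh 1 a W i t) :=
        (measurable_duh measurable_const a hW.1 i).comp (measurable_const.prodMk measurable_id)
      refine (nrm_add_le κ (l + t) m1 m2).trans ((add_le_add (hgc t ht i) (h1 t ht i)).trans ?_)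
      rw [← add_mul]
      refine mul_le_mul_left ?_ _
      rw [ENNReal.div_eq_inv_mul, mul_add, ← mul_assoc, ENNReal.inv_mul_cancel (by simp) (by simp), one_mul, pow_succ,
        ← add_assoc, ← two_mul]
      exact le_of_eq (by ring)
  intro t ht i
  have hlim : Tendsto (fun n : ℕ => (2 * c + d * 2⁻¹ ^ n) * ofReal (t ^ (-(1 / 2 + κ)) * Real.exp (M * t))) atTop
      (𝓝 ((2 * c + d * 0) * ofReal (t ^ (-(1 / 2 + κ)) * Real.exp (M * t)))) := by
    refine ENNReal.Tendsto.mul_const ?_ (Or.inr ofReal_ne_top)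
    refine tendsto_const_nhds.add (ENNReal.Tendsto.const_mul ?_ (Or.inr hdt))
    exact ENNReal.tendsto_pow_atTop_nhds_zero_of_lt_one (by norm_num)
  rw [mul_zero, add_zero] at hlim
  exact ge_of_tendsto' hlim fun n => key n t ht i

theorem ae_eq_of_solves {κ l T : ℝ} (hκ : 0 < κ) (hκ1 : κ < 1 / 10) {a : Coef} {R : ℝ≥0∞}
    (ha : CoefBound κ a R) (hR : R ≠ ⊤) {g W W' : Fld} (hW : Adm κ l T W) (hW' : Adm κ l T W')
    (hs : Solves T a g W) (hs' : Solves T a g W') {t : ℝ} (ht : t ∈ Ioc 0 T) (i : Fin 3) :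
    W i t =ᵐ[volume] W' i t := by
  obtain ⟨M, hM, hcon⟩ := exists_contr hκ hκ1 l T hR
  have hD := hW.lin hW' 1 (-1)
  have hsD : Solves T a (fun _ _ _ => 0) (fun i t x => 1 * W i t x + (-1) * W' i t x) := by
    intro t ht i
    filter_upwards [hs t ht i, hs' t ht i,
      duh_lin hκ hκ1 hW hW' (η := 1) measurable_const (by simp) ha hR 1 (-1) ht i] with x h1 h2 h3
    rw [h3, h1, h2]
    ring
  have h0 := (hcon a ha).apriori hM (fun j => measurable_const) hD hsD (c := 0) (by simp)
    (fun t ht i => by rw [nrm_zero]; exact zero_le) t ht i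
  rw [mul_zero, zero_mul, nonpos_iff_eq_zero] at h0
  have h1 := le_antisymm ((eLpNorm_le_nrm κ (l + t) _).trans_eq h0) zero_le
  filter_upwards [ae_eq_zero_of_eLpNorm (hD.slice t i) h1] with x hx
  simp only [Pi.zero_apply] at hx
  linarith

theorem integral_count_eq_tsum {f : ℕ → ℝ} (hf : Summable f) :
    ∫ k, f k ∂(Measure.count : Measure ℕ) = ∑' k, f k := by
  rw [integral_countable (integrable_count_iff.2 hf.norm)]
  simp

/-- The sum of the Picard iterates started from `g`. -/
def picard (a : Coef) (g : Fld) (i : Fin 3) (t : ℝ) (x : Plane) : ℝ :=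
  ∫ k, ((duh 1 a)^[k] g) i t x ∂(Measure.count : Measure ℕ)

theorem measurable_iterate_duh (a : Coef) {g : Fld}
    (hg : ∀ j, Measurable (Function.uncurry (g j))) (k : ℕ) :
    ∀ j, Measurable (Function.uncurry (((duh 1 a)^[k] g) j)) := by
  induction k with
  | zero => exact hg
  | succ k ih =>
    intro j
    rw [Function.iterate_succ_apply']
    exact measurable_duh measurable_const a ih j

theorem measurable_picard (a : Coef) {g : Fld}
    (hg : ∀ j, Measurable (Function.uncurry (g j))) (j : Fin 3) : Measurable (Function.uncurry (picard a g j)) :=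
  measurable_integral_param (Measure.count : Measure ℕ) (u := fun k (p : ℝ × Plane) => ((duh 1 a)^[k] g) j p.1 p.2)
    (measurable_from_prod_countable_right fun k => measurable_iterate_duh a hg k j)

theorem Contr.bdd_iterate {κ l T M : ℝ} {a : Coef} {g : Fld} {c : ℝ≥0∞}
    (h : Contr κ l T M a) (hg : ∀ j, Measurable (Function.uncurry (g j))) (hc0 : c ≠ 0)
    (hc : c ≠ ⊤) (hgc : Bdd κ l T M c g) (k : ℕ) : Bdd κ l T M (c * 2⁻¹ ^ k) ((duh 1 a)^[k] g) := by
  induction k with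
  | zero => simpa using hgc
  | succ k ih =>
    rw [Function.iterate_succ_apply', pow_succ, ← mul_assoc, ← ENNReal.div_eq_inv_mul.trans (mul_comm _ _)]
    exact h _ _ (measurable_iterate_duh a hg k) (mul_ne_zero hc0 (by simp)) (mul_ne_top hc (by simp)) ih

theorem Contr.picard_facts {κ l T M : ℝ} {a : Coef} {g : Fld} {c : ℝ≥0∞}
    (h : Contr κ l T M a) (hg : ∀ j, Measurable (Function.uncurry (g j))) (hc0 : c ≠ 0)
    (hc : c ≠ ⊤) (hgc : Bdd κ l T M c g) :
    (∀ t ∈ Ioc 0 T, ∀ i, ∀ᵐ x, Summable fun k => ((duh 1 a)^[k] g) i t x) ∧ Bdd κ l T M (4 * c) (picard a g) := by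
  have key : ∀ t ∈ Ioc 0 T, ∀ i, (∀ᵐ x, Integrable (fun k => ((duh 1 a)^[k] g) i t x) Measure.count) ∧
      nrm κ (l + t) (picard a g i t) ≤ 4 * c * ofReal (t ^ (-(1 / 2 + κ)) * Real.exp (M * t)) := by
    intro t ht i
    have ht0 := ht.1
    set w := ofReal (t ^ (-(1 / 2 + κ)) * Real.exp (M * t)) with hw
    have hw0 : w ≠ 0 := by
      rw [hw]; simp only [ne_eq, ENNReal.ofReal_eq_zero, not_le]; positivity
    have hB : ∫⁻ k, c * 2⁻¹ ^ k * w ∂(Measure.count : Measure ℕ) = 2 * c * w := by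
      rw [lintegral_count, ENNReal.tsum_mul_right, ENNReal.tsum_mul_left, ENNReal.tsum_geometric]
      rw [ENNReal.one_sub_inv_two, inv_inv]
      ring
    obtain ⟨h1, -, h2⟩ := nrm_integral_le κ (l + t) (Measure.count : Measure ℕ)
      (u := fun k x => ((duh 1 a)^[k] g) i t x) (B := fun k => c * 2⁻¹ ^ k * w)
      (measurable_from_prod_countable_right fun k =>
        (measurable_iterate_duh a hg k i).comp (measurable_const.prodMk measurable_id))
      (measurable_of_countable _)
      (Eventually.of_forall fun k => ⟨mul_ne_zero (mul_ne_zero hc0 (by simp)) hw0,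
        mul_ne_top (mul_ne_top hc (by simp)) ofReal_ne_top⟩)
      (Eventually.of_forall fun k => h.bdd_iterate hg hc0 hc hgc k t ht i)
      (by rw [hB]; exact mul_ne_top (mul_ne_top (by simp) hc) ofReal_ne_top)
    refine ⟨h1, h2.trans_eq ?_⟩
    rw [hB]; ring
  refine ⟨fun t ht i => ?_, fun t ht i => (key t ht i).2⟩
  filter_upwards [(key t ht i).1] with x hx
  exact (integrable_count_iff.1 hx).of_norm

theorem Contr.picard_eq_add {κ l T M : ℝ} {a : Coef} {g : Fld} {c : ℝ≥0∞}
    (h : Contr κ l T M a) (hg : ∀ j, Measurable (Function.uncurry (g j))) (hc0 : c ≠ 0)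
    (hc : c ≠ ⊤) (hgc : Bdd κ l T M c g) {t : ℝ} (ht : t ∈ Ioc 0 T) (i : Fin 3) :
    ∀ᵐ x, picard a g i t x = g i t x + picard a (duh 1 a g) i t x := by
  filter_upwards [(h.picard_facts hg hc0 hc hgc).1 t ht i] with x hx
  have hx' : Summable fun k => ((duh 1 a)^[k] (duh 1 a g)) i t x := (summable_nat_add_iff 1).2 hx
  rw [picard, picard, integral_count_eq_tsum hx, integral_count_eq_tsum hx', hx.tsum_eq_zero_add]
  rfl

theorem picard_solves {κ l T : ℝ} (hκ : 0 < κ) (hκ1 : κ < 1 / 10) {a : Coef} {R : ℝ≥0∞}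
    (ha : CoefBound κ a R) (hR : R ≠ ⊤) {g : Fld} (hg : Adm κ l T g) :
    Adm κ l T (picard a g) ∧ Solves T a g (picard a g) := by
  obtain ⟨M, hM, hcon⟩ := exists_contr hκ hκ1 l T hR
  have h := hcon a ha
  obtain ⟨c, hc0, hc, hgc⟩ := hg.exists_bdd hM
  have hgm := hg.1
  set G : ℕ → Fld := fun n => (duh 1 a)^[n] g with hG
  have hGs : ∀ n, G (n + 1) = duh 1 a (G n) := fun n => Function.iterate_succ_apply' _ _ _
  have hGm : ∀ n j, Measurable (Function.uncurry (G n j)) := fun n => measurable_iterate_duh a hgm n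
  have hcn0 : ∀ n : ℕ, c * 2⁻¹ ^ n ≠ 0 := fun n => mul_ne_zero hc0 (by simp)
  have hcnt : ∀ n : ℕ, c * 2⁻¹ ^ n ≠ ⊤ := fun n => mul_ne_top hc (by simp)
  have hGb : ∀ n, Bdd κ l T M (c * 2⁻¹ ^ n) (G n) := fun n => h.bdd_iterate hgm hc0 hc hgc n
  have hPb : ∀ n, Bdd κ l T M (4 * (c * 2⁻¹ ^ n)) (picard a (G n)) := fun n =>
    (h.picard_facts (hGm n) (hcn0 n) (hcnt n) (hGb n)).2
  have hPm : ∀ n j, Measurable (Function.uncurry (picard a (G n) j)) := fun n j => measurable_picard a (hGm n) j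
  have hPA : ∀ n, Adm κ l T (picard a (G n)) := fun n =>
    (hPb n).adm (mul_ne_top (by simp) (hcnt n)) hM (hPm n)
  have hGA : ∀ n, Adm κ l T (G n) := fun n => (hGb n).adm (hcnt n) hM (hGm n)
  have hstep : ∀ n, ∀ t ∈ Ioc 0 T, ∀ i, ∀ᵐ x, picard a (G n) i t x = G n i t x + picard a (G (n + 1)) i t x := by
    intro n t ht i
    rw [hGs]
    exact h.picard_eq_add (hGm n) (hcn0 n) (hcnt n) (hGb n) ht i
  have hdstep : ∀ n, ∀ t ∈ Ioc 0 T, ∀ i, ∀ᵐ x, duh 1 a (picard a (G n)) i t x =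
      G (n + 1) i t x + duh 1 a (picard a (G (n + 1))) i t x := by
    intro n t ht i
    filter_upwards [duh_lin hκ hκ1 (hGA n) (hPA (n + 1)) (η := 1) measurable_const (by simp) ha hR 1 1 ht i] with x hx
    rw [duh_congr 1 a (W' := fun i t x => 1 * G n i t x + 1 * picard a (G (n + 1)) i t x), hx, hGs]
    · ring
    · intro s hs j
      filter_upwards [hstep n s ⟨hs.1, hs.2.le.trans ht.2⟩ j] with y hy
      rw [hy]; ring
  have he : ∀ n, ∀ t ∈ Ioc 0 T, ∀ i, ∀ᵐ x, picard a (G 1) i t x - duh 1 a (picard a (G 0)) i t x =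
      picard a (G (n + 1)) i t x - duh 1 a (picard a (G n)) i t x := by
    intro n t ht i
    induction n with
    | zero => exact Eventually.of_forall fun x => rfl
    | succ n ih =>
      filter_upwards [ih, hstep (n + 1) t ht i, hdstep n t ht i] with x h1 h2 h3
      rw [h1, h2, h3]
      ring
  have hzero : ∀ t ∈ Ioc 0 T, ∀ i, ∀ᵐ x, picard a (G 1) i t x = duh 1 a (picard a (G 0)) i t x := by
    intro t ht i
    have md : ∀ n, Measurable (duh 1 a (picard a (G n)) i t) := fun n =>
      (measurable_duh measurable_const a (hPm n) i).comp (measurable_const.prodMk measurable_id)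
    have mp : ∀ n, Measurable (picard a (G n) i t) := fun n => (hPm n i).comp (measurable_const.prodMk measurable_id)
    set w := ofReal (t ^ (-(1 / 2 + κ)) * Real.exp (M * t)) with hw
    have hle : ∀ n : ℕ, nrm κ (l + t) (fun x => picard a (G 1) i t x - duh 1 a (picard a (G 0)) i t x) ≤
        8 * c * w * 2⁻¹ ^ n := by
      intro n
      rw [nrm_congr_ae κ (l + t) (he n t ht i)]
      refine (nrm_sub_le κ (l + t) (mp (n + 1)) (md n)).trans ?_
      have b1 := hPb (n + 1) t ht i
      have b2 := h _ _ (hPm n) (mul_ne_zero (by simp) (hcn0 n)) (mul_ne_top (by simp) (hcnt n)) (hPb n) t ht i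
      refine (add_le_add b1 b2).trans ?_
      calc _ ≤ 4 * (c * 2⁻¹ ^ n) * w + 4 * (c * 2⁻¹ ^ n) * w := by
            refine add_le_add ?_ ?_
            · refine mul_le_mul_left (mul_le_mul_right (mul_le_mul_right ?_ _) _) _
              exact pow_le_pow_right_of_le_one' (by norm_num) (Nat.le_succ n)
            · refine mul_le_mul_left ?_ _
              exact ENNReal.half_le_self
        _ = _ := by ring
    have hlim : Tendsto (fun n : ℕ => 8 * c * w * 2⁻¹ ^ n) atTop (𝓝 (8 * c * w * 0)) :=
      ENNReal.Tendsto.const_mul (ENNReal.tendsto_pow_atTop_nhds_zero_of_lt_one (by norm_num))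
        (Or.inr (mul_ne_top (mul_ne_top (by simp) hc) ofReal_ne_top))
    rw [mul_zero] at hlim
    have h0 := le_antisymm (ge_of_tendsto' hlim hle) zero_le
    have h1 := le_antisymm ((eLpNorm_le_nrm κ (l + t) _).trans_eq h0) zero_le
    filter_upwards [ae_eq_zero_of_eLpNorm ((mp 1).sub (md 0)) h1] with x hx
    simp only [Pi.zero_apply] at hx
    exact sub_eq_zero.1 hx
  refine ⟨hPA 0, fun t ht i => ?_⟩
  filter_upwards [hstep 0 t ht i, hzero t ht i] with x h1 h2
  exact h1.trans (congrArg (G 0 i t x + ·) h2)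

/-- The standard basis vectors of the plane. -/
def bv (i : Fin 2) : Plane := EuclideanSpace.single i 1

theorem norm_bv (i : Fin 2) : ‖bv i‖ = 1 := by simp [bv]

/-- The partial derivative of a test function. -/
def dtest (i : Fin 2) (ψ : Test) : Test := TestFunction.lineDerivCLM ℝ (bv i) ψ

theorem dtest_apply (i : Fin 2) (ψ : Test) (x : Plane) : dtest i ψ x = fderiv ℝ ψ x (bv i) := by
  rw [dtest, TestFunction.lineDerivCLM_apply_of_le (by simp)]
  exact ((ψ.contDiff.differentiable (by simp)).differentiableAt).lineDeriv_eq_fderiv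

theorem lineDeriv_distr_apply (i : Fin 2) (S : Distr) (ψ : Test) :
    (∂_{(EuclideanSpace.single i 1 : Plane)} S) ψ = - S (dtest i ψ) := rfl

theorem isWeakGrad_iff {v : Plane → ℝ} {D : Fin 2 → Plane → ℝ} (hv : LocallyIntegrable v)
    (hD : ∀ i, LocallyIntegrable (D i)) :
    IsWeakGrad v D ↔ ∀ (ψ : Test) (i : Fin 2), ∫ x, ψ x * D i x = - ∫ x, dtest i ψ x * v x := by
  constructor
  · intro h ψ i
    rw [← ofFun_apply (hD i), ← (h.2 i).2, lineDeriv_distr_apply, ofFun_apply hv]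
  · refine fun h => ⟨hv, fun i => ⟨hD i, ?_⟩⟩
    ext ψ
    rw [lineDeriv_distr_apply, ofFun_apply hv, ofFun_apply (hD i), h ψ i]

theorem integral_test_mul_fderiv {v : Plane → ℝ} (hv : ContDiff ℝ 1 v) (ψ : Test) (i : Fin 2) :
    ∫ x, ψ x * fderiv ℝ v x (bv i) = - ∫ x, dtest i ψ x * v x := by
  have hc : Continuous fun x => fderiv ℝ v x (bv i) := (hv.continuous_fderiv (by simp)).clm_apply continuous_const
  have e : (fun x => dtest i ψ x * v x) = fun x => fderiv ℝ ψ x (bv i) * v x := by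
    funext x; rw [dtest_apply]
  rw [e]
  refine integral_mul_fderiv_eq_neg_fderiv_mul_of_integrable ?_ (integrable_test_mul hc.locallyIntegrable ψ)
    (integrable_test_mul hv.continuous.locallyIntegrable ψ) (fun x _ => ?_) (fun x _ => ?_)
  · rw [← e]
    exact integrable_test_mul hv.continuous.locallyIntegrable (dtest i ψ)
  · exact (ψ.contDiff.differentiable (by simp)).differentiableAt
  · exact (hv.differentiable (by simp)).differentiableAt

theorem isWeakGrad_of_contDiff {v : Plane → ℝ} (hv : ContDiff ℝ 1 v) :
    IsWeakGrad v fun i x => fderiv ℝ v x (bv i) :=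
  (isWeakGrad_iff hv.continuous.locallyIntegrable fun i =>
    ((hv.continuous_fderiv (by simp)).clm_apply continuous_const).locallyIntegrable).2
    fun ψ i => integral_test_mul_fderiv hv ψ i

theorem IsWeakGrad.unique {v : Plane → ℝ} {D D' : Fin 2 → Plane → ℝ} (h : IsWeakGrad v D) (h' : IsWeakGrad v D')
    (i : Fin 2) : D i =ᵐ[volume] D' i := by
  have hd := (h.2 i).1
  have hd' := (h'.2 i).1
  refine ae_eq_of_integral_contDiff_smul_eq hd hd' fun g hg hgc => ?_
  let ψ : Test := ⟨g, hg, hgc, fun _ _ => trivial⟩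
  have e1 := (isWeakGrad_iff h.1 fun i => (h.2 i).1).1 h ψ i
  have e2 := (isWeakGrad_iff h'.1 fun i => (h'.2 i).1).1 h' ψ i
  exact e1.trans e2.symm

theorem IsWeakGrad.congr {v v' : Plane → ℝ} {D D' : Fin 2 → Plane → ℝ} (h : IsWeakGrad v D) (hv : v =ᵐ[volume] v')
    (hD : ∀ i, D i =ᵐ[volume] D' i) : IsWeakGrad v' D' := by
  have l1 : LocallyIntegrable v' := h.1.congr hv
  have l2 : ∀ i, LocallyIntegrable (D' i) := fun i => (h.2 i).1.congr (hD i)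
  refine ⟨l1, fun i => ⟨l2 i, ?_⟩⟩
  rw [← ofFun_congr_ae h.1 l1 hv, ← ofFun_congr_ae (h.2 i).1 (l2 i) (hD i)]
  exact (h.2 i).2

theorem IsWeakGrad.lin {v v' : Plane → ℝ} {D D' : Fin 2 → Plane → ℝ} (h : IsWeakGrad v D) (h' : IsWeakGrad v' D')
    (c d : ℝ) : IsWeakGrad (fun x => c * v x + d * v' x) fun i x => c * D i x + d * D' i x := by
  have key : ∀ {g g' : Plane → ℝ}, LocallyIntegrable g → LocallyIntegrable g' → ∀ ψ : Test,
      ∫ x, ψ x * (c * g x + d * g' x) = c * (∫ x, ψ x * g x) + d * ∫ x, ψ x * g' x := by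
    intro g g' hg hg' ψ
    rw [← integral_const_mul, ← integral_const_mul, ← integral_add ((integrable_test_mul hg ψ).const_mul _)
      ((integrable_test_mul hg' ψ).const_mul _)]
    congr 1; funext x; ring
  have l1 : ∀ {g g' : Plane → ℝ}, LocallyIntegrable g → LocallyIntegrable g' →
      LocallyIntegrable (fun x => c * g x + d * g' x) := fun hg hg' => (hg.smul c).add (hg'.smul d)
  rw [isWeakGrad_iff (l1 h.1 h'.1) fun i => l1 (h.2 i).1 (h'.2 i).1]
  intro ψ i
  rw [key (h.2 i).1 (h'.2 i).1, key h.1 h'.1, (isWeakGrad_iff h.1 fun i => (h.2 i).1).1 h,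
    (isWeakGrad_iff h'.1 fun i => (h'.2 i).1).1 h']
  ring

theorem integrable_test_mul_prod {β : Type*} [MeasurableSpace β] (ν : Measure β) [SFinite ν] {l : ℝ}
    {u : β → Plane → ℝ} (hu : Measurable (Function.uncurry u))
    (hsq : ∫⁻ x, (∫⁻ s, ‖u s x‖ₑ ∂ν) ^ 2 ∂(expMeas l) < ⊤) (ψ : Test) :
    Integrable (Function.uncurry fun x s => ψ x * u s x) (volume.prod ν) := by
  have hm : Measurable fun x => ∫⁻ s, ‖u s x‖ₑ ∂ν :=
    Measurable.lintegral_prod_right (f := fun x s => ‖u s x‖ₑ) (hu.comp measurable_swap).enorm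
  have hmu : Measurable (Function.uncurry fun x s => ψ x * u s x) :=
    (ψ.continuous.measurable.comp measurable_fst).mul (hu.comp measurable_swap)
  refine ⟨hmu.aestronglyMeasurable, ?_⟩
  rw [hasFiniteIntegral_iff_enorm, lintegral_prod _ hmu.enorm.aemeasurable]
  obtain ⟨C, hC⟩ := ψ.continuous.bounded_above_of_compact_support ψ.hasCompactSupport
  calc ∫⁻ x, ∫⁻ s, ‖ψ x * u s x‖ₑ ∂ν = ∫⁻ x, ‖ψ x‖ₑ * ∫⁻ s, ‖u s x‖ₑ ∂ν := by
        refine lintegral_congr fun x => ?_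
        simp_rw [enorm_mul]
        exact lintegral_const_mul _ (by fun_prop)
    _ = ∫⁻ x in tsupport ψ, ‖ψ x‖ₑ * ∫⁻ s, ‖u s x‖ₑ ∂ν := by
        refine (setLIntegral_eq_of_support_subset fun x hx => subset_tsupport _ ?_).symm
        intro h0
        exact hx (by simp [h0])
    _ ≤ ∫⁻ x in tsupport ψ, ofReal C * ∫⁻ s, ‖u s x‖ₑ ∂ν := by
        refine lintegral_mono fun x => mul_le_mul_left ?_ _
        rw [← ofReal_norm]
        exact ofReal_le_ofReal (hC x)
    _ < ⊤ := by
        rw [lintegral_const_mul _ hm]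
        exact mul_lt_top ofReal_lt_top (setLIntegral_lt_top_of_sq hm hsq ψ.hasCompactSupport.isCompact)

theorem locallyIntegrable_integral {β : Type*} [MeasurableSpace β] (ν : Measure β) [SFinite ν] {l : ℝ}
    {u : β → Plane → ℝ} (hu : Measurable (Function.uncurry u))
    (hsq : ∫⁻ x, (∫⁻ s, ‖u s x‖ₑ ∂ν) ^ 2 ∂(expMeas l) < ⊤) : LocallyIntegrable fun x => ∫ s, u s x ∂ν := by
  refine locallyIntegrable_of_eLpNorm (l := l) (measurable_integral_param ν hu) ?_
  refine (ENNReal.pow_lt_top_iff.1 ?_).resolve_right two_ne_zero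
  rw [eLpNorm_two_sq]
  exact lt_of_le_of_lt (lintegral_mono fun x => by gcongr; exact enorm_integral_le_lintegral_enorm _) hsq

theorem isWeakGrad_integral {β : Type*} [MeasurableSpace β] (ν : Measure β) [SFinite ν] {l : ℝ}
    {u : Fin 3 → β → Plane → ℝ} (hu : ∀ i, Measurable (Function.uncurry (u i)))
    (hsq : ∀ i, ∫⁻ x, (∫⁻ s, ‖u i s x‖ₑ ∂ν) ^ 2 ∂(expMeas l) < ⊤)
    (h : ∀ᵐ s ∂ν, IsWeakGrad (u 0 s) fun i => u i.succ s) :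
    IsWeakGrad (fun x => ∫ s, u 0 s x ∂ν) fun i x => ∫ s, u i.succ s x ∂ν := by
  have key : ∀ (i : Fin 3) (ψ : Test), ∫ x, ψ x * ∫ s, u i s x ∂ν = ∫ s, (∫ x, ψ x * u i s x) ∂ν := by
    intro i ψ
    rw [← integral_integral_swap (integrable_test_mul_prod ν (hu i) (hsq i) ψ)]
    simp_rw [integral_const_mul]
  rw [isWeakGrad_iff (locallyIntegrable_integral ν (hu 0) (hsq 0))
    fun i => locallyIntegrable_integral ν (hu i.succ) (hsq i.succ)]
  intro ψ i
  rw [key, key, ← integral_neg]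
  refine integral_congr_ae ?_
  filter_upwards [h] with s hs
  exact (isWeakGrad_iff hs.1 fun i => (hs.2 i).1).1 hs ψ i

theorem contDiff_heatKernel (t : ℝ) : ContDiff ℝ ∞ (heatKernel t) := by
  unfold heatKernel
  exact contDiff_const.mul (((contDiff_norm_sq ℝ).neg.div_const _).exp)

theorem isWeakGrad_hconv {l t : ℝ} (ht : 0 < t) {f : Plane → ℝ} (hf : Measurable f)
    (h : eLpNorm f 2 (expMeas l) < ⊤) : IsWeakGrad (hconv 0 t f) fun i => hconv i.succ t f := by
  have h4 : (0 : ℝ) < 4 * t := by positivity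
  refine isWeakGrad_integral (l := l) volume (u := fun i y x => kern i t (x - y) * f y) (fun i => ?_) (fun i => ?_)
    (Eventually.of_forall fun y => ?_)
  · exact ((measurable_kern i).comp (measurable_const.prodMk (measurable_snd.sub measurable_fst))).mul
      (hf.comp measurable_fst)
  · have hb : ∀ x, ∫⁻ y, ‖kern i t (x - y) * f y‖ₑ ≤
        ofReal (4 * (1 + √t) / √t) * kconv (4 * t) (fun y => ‖f y‖ₑ) x := by
      intro x
      rw [kconv, ← lintegral_const_mul' _ _ ofReal_ne_top]
      refine lintegral_mono fun y => ?_
      rw [enorm_mul, ← mul_assoc, ← ofReal_mul (by positivity), ← ofReal_norm (kern i t (x - y))]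
      exact mul_le_mul_left (ofReal_le_ofReal (abs_kern_le ht le_rfl i _)) _
    calc ∫⁻ x, (∫⁻ y, ‖kern i t (x - y) * f y‖ₑ) ^ 2 ∂(expMeas l) ≤
        ∫⁻ x, ofReal (4 * (1 + √t) / √t) ^ 2 * kconv (4 * t) (fun y => ‖f y‖ₑ) x ^ 2 ∂(expMeas l) :=
          lintegral_mono fun x => by rw [← mul_pow]; exact pow_le_pow_left' (hb x) 2
      _ < ⊤ := by
        rw [lintegral_const_mul' _ _ (by simp)]
        refine mul_lt_top (by simp) (lt_of_le_of_lt (lintegral_kconv_sq_le h4 hf.enorm) ?_)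
        rw [← eLpNorm_two_sq]
        exact mul_lt_top ofReal_lt_top (ENNReal.pow_lt_top h)
  · have hd : ∀ x : Plane, HasFDerivAt (fun x => heatKernel t (x - y) * f y) (f y • fderiv ℝ (heatKernel t) (x - y)) x := by
      intro x
      have := ((hasFDerivAt_heatKernel t (x - y)).differentiableAt.hasFDerivAt.comp x
        ((hasFDerivAt_id x).sub_const y)).mul_const (f y)
      simpa using this
    have hc : ContDiff ℝ 1 fun x => heatKernel t (x - y) * f y :=
      (((contDiff_heatKernel t).of_le (by exact_mod_cast le_top)).comp (contDiff_id.sub contDiff_const)).mul contDiff_const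
    refine (isWeakGrad_of_contDiff hc).congr (Eventually.of_forall fun x => rfl)
      fun i => Eventually.of_forall fun x => ?_
    simp only [(hd x).fderiv]
    rw [smul_apply, bv, fderiv_heatKernel_single, smul_eq_mul, mul_comm]

theorem Adm.isWeakGrad_duhI {κ l T : ℝ} (hκ : 0 < κ) (hκ1 : κ < 1 / 10) {W : Fld} (h : Adm κ l T W)
    (η : ℝ → ℝ) {a : Coef} (ha : ∀ j, IsCoef κ (a j)) {s t : ℝ} (hs : 0 < s)
    (hst : s < t) (ht : t ≤ T) : IsWeakGrad (duhI η a W 0 t s) fun i => duhI η a W i.succ t s := by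
  have hτ : 0 < (t - s) / 2 := by linarith
  have hr : ∀ j, Reg κ (W j s) := h.reg ⟨hs, by linarith⟩
  obtain ⟨l', hl'⟩ := exists_eLpNorm_forc_lt_top hκ (by linarith) hτ ha hr
  have := (isWeakGrad_hconv hτ (measurable_forc a (fun j => (hr j).1) _) hl')
  have := this.lin this (η (t - s)) 0
  simp only [zero_mul, add_zero] at this
  exact this

theorem Adm.isWeakGrad_duh {κ l T : ℝ} (hκ : 0 < κ) (hκ1 : κ < 1 / 10) {W : Fld} (h : Adm κ l T W)
    {η : ℝ → ℝ} (hη : Measurable η) (hη1 : ∀ s, |η s| ≤ 1) {a : Coef} {R : ℝ≥0∞} (ha : CoefBound κ a R)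
    (hR : R ≠ ⊤) {t : ℝ} (ht : t ∈ Ioc 0 T) :
    IsWeakGrad (duh η a W 0 t) fun i => duh η a W i.succ t := by
  refine isWeakGrad_integral (l := l + t) (volume.restrict (Ioo 0 t)) (u := fun i s x => duhI η a W i t s x)
    (fun i => measurable_duhI_slice hη a h.1 i t) (fun i => (((h.duh_facts hκ hκ1 hη hη1 ha hR).1 t ht) i).2) ?_
  filter_upwards [ae_restrict_mem measurableSet_Ioo] with s hs
  exact h.isWeakGrad_duhI hκ hκ1 η ha.coef hs.1 hs.2 ht.2

/-- The heat flow and its gradient. -/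
def heat (f : Plane → ℝ) (i : Fin 3) (t : ℝ) (x : Plane) : ℝ := hconv i t f x

theorem measurable_heat {f : Plane → ℝ} (hf : Measurable f) (i : Fin 3) : Measurable (Function.uncurry (heat f i)) :=
  measurable_hconv_param i (G := fun _ : ℝ × Plane => f) (hf.comp measurable_snd) measurable_fst measurable_snd

theorem exists_bdd_heat {κ : ℝ} (hκ : 0 < κ) (hκ1 : κ < 1 / 2) (L T : ℝ) :
    ∃ C : ℝ≥0∞, C ≠ ⊤ ∧ ∀ (l : ℝ) (f : Plane → ℝ), |l| ≤ L → Measurable f → eLpNorm f 2 (expMeas l) < ⊤ →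
      Bdd κ l T 0 (C * eLpNorm f 2 (expMeas l)) (heat f) := by
  obtain ⟨C, hC, h⟩ := nrm_hconv_le hκ hκ1 (L + T) T
  refine ⟨C, hC, fun l f hl hf hfl t ht i => ?_⟩
  have hle : eLpNorm f 2 (expMeas (l + t)) ≤ eLpNorm f 2 (expMeas l) :=
    eLpNorm_mono_measure _ (expMeas_mono (by linarith [ht.1]))
  refine (h (l + t) ((abs_add_le _ _).trans (by rw [abs_of_pos ht.1]; linarith [ht.2])) t ht.1 ht.2 i f hf
    (hle.trans_lt hfl)).trans ?_
  rw [zero_mul, Real.exp_zero, mul_one, mul_right_comm]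
  exact mul_le_mul_left (mul_le_mul_right hle _) _

theorem adm_heat {κ : ℝ} (hκ : 0 < κ) (hκ1 : κ < 1 / 2) (l T : ℝ) {f : Plane → ℝ} (hf : Measurable f)
    (h : eLpNorm f 2 (expMeas l) < ⊤) : Adm κ l T (heat f) := by
  obtain ⟨C, hC, hb⟩ := exists_bdd_heat hκ hκ1 |l| T
  exact (hb l f le_rfl hf h).adm (mul_ne_top hC h.ne) le_rfl (measurable_heat hf)

theorem exists_eLpNorm_duh_le {κ : ℝ} (hκ : 0 < κ) (hκ1 : κ < 1 / 10) (L T : ℝ) :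
    ∃ C : ℝ≥0∞, C ≠ ⊤ ∧ ∀ (l : ℝ) (a : Coef) (W : Fld) (R c : ℝ≥0∞), |l| ≤ L → CoefBound κ a R →
      (∀ j, Measurable (Function.uncurry (W j))) → R ≠ 0 → R ≠ ⊤ → c ≠ 0 → c ≠ ⊤ → Bdd κ l T 0 c W →
      ∀ t ∈ Ioc 0 T, eLpNorm (duh 1 a W 0 t) 2 (expMeas (l + t)) ≤
        C * R * c * ofReal (t ^ (1 / 2 - 5 * κ / 2)) := by
  obtain ⟨C, hC, hC0, h⟩ := exists_nrm_heat_forc_le hκ hκ1.le L T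
  refine ⟨C * ofReal (2 / (1 - (1 / 2 + κ)) + 2 / (1 - 3 * κ / 2)),
    mul_ne_top hC ofReal_ne_top, fun l a W R c hl ha hW hR0 hR hc0 hc hB t ht => ?_⟩
  have hp : (0 : ℝ) < 1 - (1 / 2 + κ) := by linarith
  have hq : (0 : ℝ) < 1 - 3 * κ / 2 := by linarith
  have hint : ∫⁻ s in Ioo 0 t, C * R * c * ofReal ((t - s) ^ (-(3 * κ / 2)) * s ^ (-(1 / 2 + κ))) ≤
      C * ofReal (2 / (1 - (1 / 2 + κ)) + 2 / (1 - 3 * κ / 2)) * R * c * ofReal (t ^ (1 / 2 - 5 * κ / 2)) := by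
    rw [lintegral_const_mul' _ _ (mul_ne_top (mul_ne_top hC hR) hc)]
    refine (mul_le_mul_right (lintegral_Ioo_rpow_mul_rpow_le (by linarith) (by linarith) (by linarith) (by linarith) ht.1) _).trans_eq ?_
    rw [ofReal_mul (by positivity), show 1 - 3 * κ / 2 - (1 / 2 + κ) = 1 / 2 - 5 * κ / 2 by ring]
    ring
  refine le_trans ?_ hint
  refine (eLpNorm_integral_le (expMeas (l + t)) (volume.restrict (Ioo 0 t)) (u := fun s x => duhI 1 a W 0 t s x)
    (B := fun s => C * R * c * ofReal ((t - s) ^ (-(3 * κ / 2)) * s ^ (-(1 / 2 + κ))))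
    (measurable_duhI_slice measurable_const a hW 0 t) (by fun_prop) ?_ ?_ (ne_top_of_le_ne_top ?_ hint)).2.2
  · filter_upwards [ae_restrict_mem measurableSet_Ioo] with s hs
    have h1 : 0 < t - s := by linarith [hs.2]
    have h2 : 0 < s := hs.1
    refine ⟨mul_ne_zero (mul_ne_zero (mul_ne_zero hC0 hR0) hc0) ?_,
      mul_ne_top (mul_ne_top (mul_ne_top hC hR) hc) ofReal_ne_top⟩
    simp only [ne_eq, ENNReal.ofReal_eq_zero, not_le]
    positivity
  · filter_upwards [ae_restrict_mem measurableSet_Ioo] with s hs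
    have h1 : 0 < t - s := by linarith [hs.2]
    have hm : ∀ j, Measurable (W j s) := fun j => (hW j).comp (measurable_const.prodMk measurable_id)
    have := (h a R (c * ofReal (s ^ (-(1 / 2 + κ)) * Real.exp (0 * s))) l s t hl ha hs.1 hs.2 ht.2
      (fun j => W j s) hm (fun j => hB s ⟨hs.1, hs.2.le.trans ht.2⟩ j)
      (mul_lt_top hc.lt_top ofReal_lt_top) hR.lt_top).2.2
    have e : duhI 1 a W 0 t s = hconv 0 ((t - s) / 2) (forc a (fun j => W j s) ((t - s) / 2)) := by
      funext x; simp [duhI]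
    rw [e]
    refine this.trans_eq ?_
    rw [zero_mul, Real.exp_zero, mul_one, ofReal_mul (by positivity)]
    ring
  · exact mul_ne_top (mul_ne_top (mul_ne_top (mul_ne_top hC ofReal_ne_top) hR) hc)
      ofReal_ne_top

theorem ofReal_rpow_neg_mul_exp (κ l : ℝ) (x y : Plane) (a : ℝ≥0∞) (h0 : x = y → a = 0) :
    a / ofReal (‖x - y‖ ^ (2 + 2 * (2 * κ)) * expWeight l x) =
      ofReal (‖x - y‖ ^ (-(2 + 4 * κ))) * ew l x * a := by
  rcases eq_or_ne x y with h | h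
  · simp [h0 h]
  have hn : 0 < ‖x - y‖ := norm_pos_iff.2 (sub_ne_zero.2 h)
  have he : 0 < expWeight l x := Real.exp_pos _
  rw [ENNReal.div_eq_inv_mul, ofReal_mul (by positivity), ENNReal.mul_inv (Or.inr ofReal_ne_top)
    (Or.inl ofReal_ne_top), ← ew_eq_inv, ← ENNReal.ofReal_inv_of_pos (by positivity), ← Real.rpow_neg hn.le,
    show 2 + 2 * (2 * κ) = 2 + 4 * κ by ring]

theorem lintegral_slob_eq (κ l : ℝ) {g : Plane → ℝ} (hg : AEMeasurable g) :
    ∫⁻ x, ∫⁻ y in Metric.ball x 1, ‖g x - g y‖ₑ ^ 2 / ofReal (‖x - y‖ ^ (2 + 2 * (2 * κ)) * expWeight l x) =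
      eLpNorm (fun p : Plane × Plane => g p.1 - g p.2) 2 (slobMeas κ l) ^ 2 := by
  rw [eLpNorm_two_sq, lintegral_slobMeas κ l]
  · refine lintegral_congr fun x => ?_
    rw [← lintegral_indicator Metric.isOpen_ball.measurableSet]
    refine lintegral_congr fun y => ?_
    by_cases hxy : ‖x - y‖ < 1
    · rw [Set.indicator_of_mem (by rwa [Metric.mem_ball, dist_comm, dist_eq_norm]), sd_eq hxy,
        ofReal_rpow_neg_mul_exp _ _ _ _ _ (by rintro rfl; simp)]
    · rw [Set.indicator_of_notMem (by rwa [Metric.mem_ball, dist_comm, dist_eq_norm]), sd_eq_zero hxy, zero_mul]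
  · exact ((hg.comp_quasiMeasurePreserving Measure.quasiMeasurePreserving_fst).sub
      (hg.comp_quasiMeasurePreserving Measure.quasiMeasurePreserving_snd)).enorm.pow_const _

theorem lintegral_div_expWeight (l : ℝ) (g : Plane → ℝ) :
    ∫⁻ x, ‖g x‖ₑ ^ 2 / ofReal (expWeight l x) = eLpNorm g 2 (expMeas l) ^ 2 := by
  rw [eLpNorm_two_sq, lintegral_expMeas]
  refine lintegral_congr fun x => ?_
  rw [ENNReal.div_eq_inv_mul, ew_eq_inv]

theorem sobolevNorm_eq (κ l : ℝ) {v : Plane → ℝ} {D : Fin 2 → Plane → ℝ} (h : IsWeakGrad v D) :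
    sobolevNorm (2 * κ) (expWeight l) v = (eLpNorm v 2 (expMeas l) ^ 2 + ∑ i, eLpNorm (D i) 2 (expMeas l) ^ 2 +
      ∑ i, eLpNorm (fun p : Plane × Plane => D i p.1 - D i p.2) 2 (slobMeas κ l) ^ 2) ^ (1 / 2 : ℝ) := by
  have key : ∀ D', IsWeakGrad v D' → ((∫⁻ x, ‖v x‖ₑ ^ 2 / ofReal (expWeight l x)) +
      (∑ i, ∫⁻ x, ‖D' i x‖ₑ ^ 2 / ofReal (expWeight l x)) +
      ∑ i, ∫⁻ x, ∫⁻ y in Metric.ball x 1,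
        ‖D' i x - D' i y‖ₑ ^ 2 / ofReal (‖x - y‖ ^ (2 + 2 * (2 * κ)) * expWeight l x)) =
      eLpNorm v 2 (expMeas l) ^ 2 + ∑ i, eLpNorm (D i) 2 (expMeas l) ^ 2 +
      ∑ i, eLpNorm (fun p : Plane × Plane => D i p.1 - D i p.2) 2 (slobMeas κ l) ^ 2 := by
    intro D' h'
    simp_rw [lintegral_div_expWeight]
    have e : ∀ i, D' i =ᵐ[volume] D i := fun i => h'.unique h i
    congr 1
    · congr 1
      exact Finset.sum_congr rfl fun i _ => by
        rw [eLpNorm_congr_ae ((expMeas_absolutelyContinuous l).ae_eq (e i))]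
    · refine Finset.sum_congr rfl fun i _ => ?_
      rw [lintegral_slob_eq κ l (h'.2 i).1.aestronglyMeasurable.aemeasurable,
        eLpNorm_congr_ae ((slobMeas_absolutelyContinuous κ l).ae_eq (ae_prod_congr (e i)))]
  refine le_antisymm (iInf₂_le_of_le D h (by rw [key D h])) (le_iInf₂ fun D' h' => by rw [key D' h'])

theorem sobolevNorm_le (κ l : ℝ) {V : Fin 3 → Plane → ℝ} (h : IsWeakGrad (V 0) fun i => V i.succ) :
    sobolevNorm (2 * κ) (expWeight l) (V 0) ≤ ∑ i, nrm κ l (V i) := by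
  rw [sobolevNorm_eq κ l h, Fin.sum_univ_three]
  refine (ENNReal.rpow_le_rpow (z := 1 / 2) (?_ : _ ≤ (nrm κ l (V 0) + nrm κ l (V 1) + nrm κ l (V 2)) ^ 2)
    (by norm_num)).trans_eq ?_
  · simp only [Fin.sum_univ_two, nrm]
    have e1 : (Fin.succ 0 : Fin 3) = 1 := rfl
    have e2 : (Fin.succ 1 : Fin 3) = 2 := rfl
    rw [e1, e2]
    generalize eLpNorm (V 0) 2 (expMeas l) = a0
    generalize eLpNorm (V 1) 2 (expMeas l) = a1
    generalize eLpNorm (V 2) 2 (expMeas l) = a2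
    generalize eLpNorm (fun p : Plane × Plane => V 0 p.1 - V 0 p.2) 2 (slobMeas κ l) = b0
    generalize eLpNorm (fun p : Plane × Plane => V 1 p.1 - V 1 p.2) 2 (slobMeas κ l) = b1
    generalize eLpNorm (fun p : Plane × Plane => V 2 p.1 - V 2 p.2) 2 (slobMeas κ l) = b2
    refine le_of_le_of_eq (le_self_add (b := 2 * a0 * (a1 + a2 + b0 + b1 + b2) + 2 * a1 * (a2 + b0 + b1 + b2) +
      2 * a2 * (b0 + b1 + b2) + 2 * b0 * (b1 + b2) + 2 * b1 * b2 + b0 ^ 2)) ?_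
    ring
  · rw [← ENNReal.rpow_natCast, ← ENNReal.rpow_mul]
    norm_num

theorem rpow_half_sq (a : ℝ≥0∞) : (a ^ (1 / 2 : ℝ)) ^ 2 = a := by
  rw [← ENNReal.rpow_natCast, ← ENNReal.rpow_mul]; norm_num

theorem le_sobolevNorm (κ l : ℝ) {v : Plane → ℝ} {D : Fin 2 → Plane → ℝ} (h : IsWeakGrad v D) :
    eLpNorm v 2 (expMeas l) ≤ sobolevNorm (2 * κ) (expWeight l) v ∧
      ∀ i, nrm κ l (D i) ≤ 2 * sobolevNorm (2 * κ) (expWeight l) v := by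
  rw [sobolevNorm_eq κ l h]
  have key : ∀ {a b : ℝ≥0∞}, a ^ 2 ≤ b → a ≤ b ^ (1 / 2 : ℝ) := fun {a b} hab => by
    rwa [← ENNReal.pow_le_pow_left_iff two_ne_zero, rpow_half_sq]
  refine ⟨key (by rw [add_assoc]; exact le_self_add), fun i => ?_⟩
  rw [nrm, two_mul]
  refine add_le_add (key ?_) (key ?_)
  · refine le_trans ?_ (le_self_add.trans' (le_add_self))
    exact Finset.single_le_sum (f := fun i => eLpNorm (D i) 2 (expMeas l) ^ 2) (fun _ _ => zero_le) (Finset.mem_univ i)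
  · refine le_trans ?_ le_add_self
    exact Finset.single_le_sum (f := fun i => eLpNorm (fun p : Plane × Plane => D i p.1 - D i p.2) 2 (slobMeas κ l) ^ 2)
      (fun _ _ => zero_le) (Finset.mem_univ i)

theorem exists_isWeakGrad_of_sobolevNorm {σ : ℝ} {ρ v : Plane → ℝ} (h : sobolevNorm σ ρ v < ⊤) :
    ∃ D, IsWeakGrad v D := by
  by_contra hn
  push Not at hn
  refine h.ne ?_
  simp only [sobolevNorm, iInf_eq_top]
  exact fun D hD => absurd hD (hn D)

theorem enorm_sub_sq_le {u : Plane → ℝ} (hu : ContDiff ℝ 1 u) (x z : Plane) :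
    ‖u (x + z) - u x‖ₑ ^ 2 ≤ ofReal (‖z‖ ^ 2) * ∫⁻ θ in Ioc (0 : ℝ) 1, ‖fderiv ℝ u (x + θ • z)‖ₑ ^ 2 := by
  have hc : Continuous fun θ : ℝ => fderiv ℝ u (x + θ • z) :=
    (hu.continuous_fderiv (by simp)).comp (continuous_const.add (continuous_id.smul continuous_const))
  have hd : ∀ θ : ℝ, HasDerivAt (fun θ : ℝ => u (x + θ • z)) (fderiv ℝ u (x + θ • z) z) θ := by
    intro θ
    have h1 : HasDerivAt (fun θ : ℝ => x + θ • z) z θ := by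
      simpa using ((hasDerivAt_id θ).smul_const z).const_add x
    exact ((hu.differentiable (by simp)).differentiableAt.hasFDerivAt).comp_hasDerivAt θ h1
  have hI : u (x + z) - u x = ∫ θ in (0 : ℝ)..1, fderiv ℝ u (x + θ • z) z := by
    rw [intervalIntegral.integral_eq_sub_of_hasDerivAt (fun θ _ => hd θ)
      ((hc.clm_apply continuous_const).intervalIntegrable _ _)]
    simp
  have hm : Measurable fun θ : ℝ => ‖fderiv ℝ u (x + θ • z)‖ₑ := hc.measurable.enorm
  have h1 : ‖u (x + z) - u x‖ₑ ≤ ofReal ‖z‖ * ∫⁻ θ in Ioc (0 : ℝ) 1, ‖fderiv ℝ u (x + θ • z)‖ₑ := by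
    rw [hI, intervalIntegral.integral_of_le zero_le_one, ← lintegral_const_mul _ hm]
    refine (enorm_integral_le_lintegral_enorm _).trans (lintegral_mono fun θ => ?_)
    rw [mul_comm, ofReal_norm]
    exact ContinuousLinearMap.le_opENorm _ _
  have h2 := sq_lintegral_mul_le (volume.restrict (Ioc (0 : ℝ) 1)) (f := fun _ => 1) aemeasurable_const hm.aemeasurable
  simp only [one_mul, lintegral_one, Measure.restrict_apply_univ, Real.volume_Ioc, sub_zero, ENNReal.ofReal_one] at h2
  calc _ ≤ _ := pow_le_pow_left' h1 2
    _ ≤ _ := by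
      rw [mul_pow, ENNReal.ofReal_pow (norm_nonneg _)]
      exact mul_le_mul_right h2 _

theorem enorm_fderiv_le {u : Plane → ℝ} (x : Plane) :
    ‖fderiv ℝ u x‖ₑ ^ 2 ≤ 2 * ∑ i, ‖fderiv ℝ u x (bv i)‖ₑ ^ 2 := by
  have h : ‖fderiv ℝ u x‖ ≤ ∑ i, ‖fderiv ℝ u x (bv i)‖ := by
    refine ContinuousLinearMap.opNorm_le_bound _ (by positivity) fun y => ?_
    have hy : y = ∑ i, y i • bv i := by
      conv_lhs => rw [← (EuclideanSpace.basisFun (Fin 2) ℝ).sum_repr y]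
      simp [bv]
    conv_lhs => rw [hy]
    rw [map_sum, Finset.sum_mul]
    refine (norm_sum_le _ _).trans (Finset.sum_le_sum fun i _ => ?_)
    rw [map_smul, norm_smul, mul_comm]
    exact mul_le_mul_of_nonneg_left (abs_coord_le y i) (norm_nonneg _)
  have h2 : ‖fderiv ℝ u x‖ ^ 2 ≤ 2 * ∑ i, ‖fderiv ℝ u x (bv i)‖ ^ 2 := by
    refine (pow_le_pow_left₀ (norm_nonneg _) h 2).trans ?_
    simp only [Fin.sum_univ_two]
    nlinarith [sq_nonneg (‖fderiv ℝ u x (bv 0)‖ - ‖fderiv ℝ u x (bv 1)‖)]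
  have := ofReal_le_ofReal h2
  simpa only [Fin.sum_univ_two, ofReal_mul (zero_le_two (α := ℝ)), ENNReal.ofReal_add (sq_nonneg _) (sq_nonneg _),
    ENNReal.ofReal_pow (norm_nonneg _), ofReal_norm, ENNReal.ofReal_ofNat] using this

theorem slob_le_fderiv (κ l : ℝ) {u : Plane → ℝ} (hu : ContDiff ℝ 1 u) :
    eLpNorm (fun p : Plane × Plane => u p.1 - u p.2) 2 (slobMeas κ l) ^ 2 ≤
      ofReal (Real.exp |l|) * (∫⁻ z, near (4 * κ) 1 z) *
        (2 * ∑ i, eLpNorm (fun x => fderiv ℝ u x (bv i)) 2 (expMeas l) ^ 2) := by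
  set E : Plane → ℝ≥0∞ := fun x => ‖fderiv ℝ u x‖ₑ ^ 2 with hE
  have hEm : Measurable E := (hu.continuous_fderiv (by simp)).measurable.enorm.pow_const 2
  have hnear := measurable_near (4 * κ) 1
  have hew := measurable_ew l
  have hE2 : ∫⁻ x, ew l x * E x ≤ 2 * ∑ i, eLpNorm (fun x => fderiv ℝ u x (bv i)) 2 (expMeas l) ^ 2 := by
    rw [← lintegral_expMeas]
    simp_rw [eLpNorm_two_sq]
    rw [← lintegral_finsetSum _ fun i _ => (((hu.continuous_fderiv (by simp)).clm_apply continuous_const).measurable.enorm.pow_const 2),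
      ← lintegral_const_mul' _ _ (by simp)]
    exact lintegral_mono fun x => enorm_fderiv_le x
  rw [eLpNorm_two_sq, lintegral_slobMeas κ l (F := fun p : Plane × Plane => ‖u p.1 - u p.2‖ₑ ^ 2)
    (((hu.continuous.measurable.comp measurable_fst).sub (hu.continuous.measurable.comp measurable_snd)).enorm.pow_const
      2).aemeasurable]
  have hpt : ∀ x z : Plane, sd κ l x (x + z) * ‖u x - u (x + z)‖ₑ ^ 2 ≤
      near (4 * κ) 1 z * ∫⁻ θ in Ioc (0 : ℝ) 1, ew l x * E (x + θ • z) := by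
    intro x z
    rw [lintegral_const_mul _ (f := fun θ : ℝ => E (x + θ • z)) (hEm.comp (by fun_prop))]
    by_cases hz : ‖z‖ < 1
    · have hx : ‖x - (x + z)‖ = ‖z‖ := by simp
      rw [sd_eq (by rwa [hx]), hx, near, if_pos hz.le, ← neg_sub (u (x + z)) (u x), enorm_neg]
      rcases eq_or_ne z 0 with rfl | hz0
      · simp
      have hp : 0 < ‖z‖ := norm_pos_iff.2 hz0
      refine (mul_le_mul_right (enorm_sub_sq_le hu x z) _).trans_eq ?_
      have : ‖z‖ ^ (-(4 * κ)) = ‖z‖ ^ (-(2 + 4 * κ)) * ‖z‖ ^ 2 := by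
        rw [← Real.rpow_natCast, ← Real.rpow_add hp]; congr 1; push_cast; ring
      rw [this, ofReal_mul (by positivity)]
      ring
    · rw [sd_eq_zero (by simpa using hz), zero_mul]
      exact zero_le
  have hin : ∀ (z : Plane) (θ : ℝ), ‖z‖ ≤ 1 → θ ∈ Ioc (0 : ℝ) 1 →
      ∫⁻ x, ew l x * E (x + θ • z) ≤ ofReal (Real.exp |l|) * ∫⁻ x, ew l x * E x := by
    intro z θ hz hθ
    rw [← lintegral_add_right_eq_self (fun x => ew l x * E x) (θ • z), ← lintegral_const_mul' _ _ ofReal_ne_top]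
    refine lintegral_mono fun x => ?_
    rw [← mul_assoc]
    refine mul_le_mul_left ((ew_le_mul l x (x + θ • z)).trans (mul_le_mul_left (ofReal_le_ofReal ?_) _)) _
    refine Real.exp_le_exp.2 (mul_le_of_le_one_right (abs_nonneg _) ?_)
    rw [sub_add_cancel_left, norm_neg, norm_smul, Real.norm_of_nonneg hθ.1.le]
    exact mul_le_one₀ hθ.2 (norm_nonneg _) hz
  calc ∫⁻ x, ∫⁻ y, sd κ l x y * ‖u x - u y‖ₑ ^ 2
      = ∫⁻ x, ∫⁻ z, sd κ l x (x + z) * ‖u x - u (x + z)‖ₑ ^ 2 :=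
        lintegral_congr fun x => (lintegral_add_left_eq_self (fun y => sd κ l x y * ‖u x - u y‖ₑ ^ 2) x).symm
    _ ≤ ∫⁻ x, ∫⁻ z, near (4 * κ) 1 z * ∫⁻ θ in Ioc (0 : ℝ) 1, ew l x * E (x + θ • z) :=
        lintegral_mono fun x => lintegral_mono fun z => hpt x z
    _ = ∫⁻ z, near (4 * κ) 1 z * ∫⁻ θ in Ioc (0 : ℝ) 1, ∫⁻ x, ew l x * E (x + θ • z) := by
        rw [lintegral_lintegral_swap]
        · refine lintegral_congr fun z => ?_
          rw [lintegral_const_mul]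
          · congr 1
            rw [lintegral_lintegral_swap]
            refine Measurable.aemeasurable ?_
            exact (hew.comp measurable_fst).mul (hEm.comp (by fun_prop))
          · refine Measurable.lintegral_prod_right (f := fun x θ => ew l x * E (x + θ • z)) ?_
            exact (hew.comp measurable_fst).mul (hEm.comp (by fun_prop))
        · refine Measurable.aemeasurable ((hnear.comp measurable_snd).mul ?_)
          refine Measurable.lintegral_prod_right (f := fun (p : Plane × Plane) θ => ew l p.1 * E (p.1 + θ • p.2)) ?_
          exact (hew.comp (by fun_prop)).mul (hEm.comp (by fun_prop))
    _ ≤ ∫⁻ z, near (4 * κ) 1 z * (ofReal (Real.exp |l|) * ∫⁻ x, ew l x * E x) := by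
        refine lintegral_mono fun z => ?_
        by_cases hz : ‖z‖ ≤ 1
        · refine mul_le_mul_right ((setLIntegral_mono_ae' measurableSet_Ioc
            (Eventually.of_forall fun θ hθ => hin z θ hz hθ)).trans ?_) _
          simp
        · simp [near, hz]
    _ ≤ _ := by
        rw [lintegral_mul_const _ hnear, ← mul_assoc, mul_comm (∫⁻ z, near (4 * κ) 1 z)]
        exact mul_le_mul_right hE2 _

theorem exists_nrm_le_sobolevNorm {κ : ℝ} (hκ : κ < 1 / 2) (L : ℝ) : ∃ C : ℝ≥0∞, C ≠ ⊤ ∧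
    ∀ (l : ℝ) (u : Plane → ℝ), |l| ≤ L → ContDiff ℝ 1 u →
      nrm κ l u ≤ C * sobolevNorm (2 * κ) (expWeight l) u ∧
      ∀ i, nrm κ l (fun x => fderiv ℝ u x (bv i)) ≤ C * sobolevNorm (2 * κ) (expWeight l) u := by
  set K : ℝ≥0∞ := (ofReal (Real.exp L) * (∫⁻ z, near (4 * κ) 1 z) * 2) ^ (1 / 2 : ℝ) with hK
  have hKt : K ≠ ⊤ := by
    refine ENNReal.rpow_ne_top_of_nonneg (by norm_num) (mul_ne_top (mul_ne_top ofReal_ne_top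
      (lintegral_near_lt_top (by linarith)).ne) (by simp))
  refine ⟨2 + K, ENNReal.add_ne_top.2 ⟨by simp, hKt⟩, fun l u hl hu => ?_⟩
  have hw := isWeakGrad_of_contDiff hu
  obtain ⟨h1, h2⟩ := le_sobolevNorm κ l hw
  refine ⟨?_, fun i => (h2 i).trans (mul_le_mul_left le_self_add _)⟩
  have hs : eLpNorm (fun p : Plane × Plane => u p.1 - u p.2) 2 (slobMeas κ l) ≤
      K * sobolevNorm (2 * κ) (expWeight l) u := by
    rw [← ENNReal.pow_le_pow_left_iff two_ne_zero, mul_pow, hK, rpow_half_sq, mul_assoc (_ * _)]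
    refine (slob_le_fderiv κ l hu).trans (mul_le_mul' (mul_le_mul_left (ofReal_le_ofReal
      (Real.exp_le_exp.2 hl)) _) (mul_le_mul_right ?_ _))
    rw [sobolevNorm_eq κ l hw, rpow_half_sq]
    exact le_self_add.trans' le_add_self
  rw [nrm, add_mul]
  refine add_le_add (h1.trans ?_) hs
  exact le_mul_of_one_le_left' (by norm_num)

theorem rescale_add (x : Plane) (r : ℝ) (hr : 0 < r) (φ ψ : Test) :
    rescale x r hr (φ + ψ) = rescale x r hr φ + rescale x r hr ψ := by
  ext y
  exact mul_add _ _ _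

theorem rescale_zero_one (ψ : Test) : rescale 0 1 one_pos ψ = ψ := by
  ext y
  simp [rescale_apply]

/-- Multiplication of a test function by a smooth function. -/
def mulTest (f : Plane → ℝ) (hf : ContDiff ℝ ∞ f) (ψ : Test) : Test :=
  ⟨fun x => f x * ψ x, hf.mul ψ.contDiff, ψ.hasCompactSupport.mul_left, fun _ _ => trivial⟩

/-- Translation of a test function. -/
def shiftTest (y : Plane) (ψ : Test) : Test :=
  ⟨fun x => ψ (x + y), ψ.contDiff.comp (contDiff_id.add contDiff_const),
    ψ.hasCompactSupport.comp_homeomorph (Homeomorph.addRight y), fun _ _ => trivial⟩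

theorem tsupport_subset_closedBall {f : Plane → ℝ} {y : Plane} {r : ℝ} (h : ∀ x, f x ≠ 0 → ‖x - y‖ ≤ r) :
    tsupport f ⊆ Metric.closedBall y r :=
  closure_minimal (fun x hx => by simpa [dist_eq_norm] using h x hx) Metric.isClosed_closedBall

theorem exists_abs_rescale_le_of_ball {κ : ℝ} (hκ : 0 ≤ κ) (hκ1 : κ ≤ 1) (α : ℝ) (y : Plane) {ψ : Test}
    (hψ : ∀ x, ψ x ≠ 0 → ‖x - y‖ ≤ 1) :
    ∃ C : ℝ, 0 < C ∧ ∀ (T : Distr) (z : Plane) (r : ℝ) (hr : 0 < r), r ≤ 1 →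
      ofReal |T (rescale z r hr ψ)| ≤
        ofReal (C * r ^ α * polyWeight κ z) * holderNorm α (polyWeight κ) T := by
  obtain ⟨C, hC, h⟩ := exists_abs_rescale_le α (ψ := shiftTest y ψ) (tsupport_subset_closedBall fun x hx => by
    simpa using hψ (x + y) hx)
  refine ⟨C * (1 + ‖y‖), by positivity, fun T z r hr hr1 => ?_⟩
  have e : rescale z r hr ψ = rescale (z + r • y) r hr (shiftTest y ψ) := by
    ext x
    rw [rescale_apply, rescale_apply]
    change _ = _ * ψ (r⁻¹ • (x - (z + r • y)) + y)
    congr 2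
    rw [sub_add_eq_sub_sub, smul_sub r⁻¹ (x - z), smul_smul, inv_mul_cancel₀ hr.ne', one_smul, sub_add_cancel]
  rw [e]
  refine (h (polyWeight κ) T _ r hr hr1 (polyWeight_pos _ _)).trans (mul_le_mul_left (ofReal_le_ofReal ?_) _)
  have hp : polyWeight κ (z + r • y) ≤ (1 + ‖y‖) * polyWeight κ z := by
    refine polyWeight_le_of_norm_sub_le hκ hκ1 (norm_nonneg y) ?_
    rw [add_sub_cancel_left, norm_smul, Real.norm_of_nonneg hr.le]
    exact mul_le_of_le_one_left (norm_nonneg _) hr1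
  have : 0 < r ^ α := Real.rpow_pos_of_pos hr _
  calc C * r ^ α * polyWeight κ (z + r • y) ≤ C * r ^ α * ((1 + ‖y‖) * polyWeight κ z) := by gcongr
    _ = _ := by ring

theorem exists_abs_rescale_le_of_test {κ : ℝ} (hκ : 0 ≤ κ) (hκ1 : κ ≤ 1) (α : ℝ) (ψ : Test) :
    ∃ C : ℝ, 0 < C ∧ ∀ (T : Distr) (z : Plane) (r : ℝ) (hr : 0 < r), r ≤ 1 →
      ofReal |T (rescale z r hr ψ)| ≤
        ofReal (C * r ^ α * polyWeight κ z) * holderNorm α (polyWeight κ) T := by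
  have main : ∀ (s : Finset Plane) (ψ : Test), (∀ x, ψ x ≠ 0 → ∃ y ∈ s, ‖x - y‖ ≤ 1 / 2) →
      ∃ C : ℝ, 0 < C ∧ ∀ (T : Distr) (z : Plane) (r : ℝ) (hr : 0 < r), r ≤ 1 →
      ofReal |T (rescale z r hr ψ)| ≤
        ofReal (C * r ^ α * polyWeight κ z) * holderNorm α (polyWeight κ) T := by
    intro s
    induction s using Finset.induction_on with
    | empty =>
      intro ψ hψ
      exact exists_abs_rescale_le_of_ball hκ hκ1 α 0 (fun x hx => by simpa using hψ x hx)
    | insert y s _ ih =>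
      intro ψ hψ
      let b : ContDiffBump y := ⟨1 / 2, 1, by norm_num, by norm_num⟩
      have hb : ContDiff ℝ ∞ (b : Plane → ℝ) := b.contDiff
      have e : ψ = mulTest b hb ψ + mulTest (fun x => 1 - b x) (contDiff_const.sub hb) ψ := by
        ext x
        change ψ x = b x * ψ x + (1 - b x) * ψ x
        ring
      obtain ⟨C₁, hC₁, h₁⟩ := exists_abs_rescale_le_of_ball hκ hκ1 α y (ψ := mulTest b hb ψ) (fun x hx => by
        have hx' : b x ≠ 0 := left_ne_zero_of_mul hx
        have : x ∈ Function.support b := hx'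
        rw [b.support_eq, Metric.mem_ball, dist_eq_norm] at this
        exact this.le)
      obtain ⟨C₂, hC₂, h₂⟩ := ih (mulTest (fun x => 1 - b x) (contDiff_const.sub hb) ψ) (fun x hx => by
        obtain ⟨y', hy', hxy⟩ := hψ x (right_ne_zero_of_mul hx)
        rcases Finset.mem_insert.1 hy' with rfl | h
        · exfalso
          refine left_ne_zero_of_mul hx (sub_eq_zero.2 (b.one_of_mem_closedBall ?_).symm)
          rw [Metric.mem_closedBall, dist_eq_norm]
          exact hxy
        · exact ⟨y', h, hxy⟩)
      refine ⟨C₁ + C₂, by positivity, fun T z r hr hr1 => ?_⟩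
      have hp := polyWeight_pos κ z
      have hr' : 0 < r ^ α := Real.rpow_pos_of_pos hr _
      rw [e, rescale_add, map_add, add_mul, add_mul, ENNReal.ofReal_add (by positivity) (by positivity), add_mul]
      exact (ofReal_le_ofReal (abs_add_le _ _)).trans
        (ENNReal.ofReal_add_le.trans (add_le_add (h₁ T z r hr hr1) (h₂ T z r hr hr1)))
  obtain ⟨t, -, hcov⟩ := ψ.hasCompactSupport.isCompact.elim_nhds_subcover (fun y => Metric.ball y (1 / 2))
    (fun y _ => Metric.ball_mem_nhds y (by norm_num))
  refine main t ψ fun x hx => ?_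
  obtain ⟨y, hy, hxy⟩ := Set.mem_iUnion₂.1 (hcov (subset_tsupport _ hx))
  exact ⟨y, hy, by simpa [dist_eq_norm] using (Metric.mem_ball.1 hxy).le⟩

theorem iteratedFDeriv_two_sum_comp (ℓ : ℂ → ℝ) (e : Plane ≃ₗᵢ[ℝ] ℂ) (x : Plane) :
    (Laplacian.laplacian (ℓ ∘ e)) x = (Laplacian.laplacian ℓ) (e x) := by
  rw [InnerProductSpace.laplacian_eq_iteratedFDeriv_orthonormalBasis (ℓ ∘ e) (EuclideanSpace.basisFun (Fin 2) ℝ),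
    InnerProductSpace.laplacian_eq_iteratedFDeriv_orthonormalBasis ℓ ((EuclideanSpace.basisFun (Fin 2) ℝ).map e)]
  refine Finset.sum_congr rfl fun i _ => ?_
  have h := e.toContinuousLinearEquiv.iteratedFDerivWithin_comp_right ℓ uniqueDiffOn_univ (Set.mem_univ (e x)) 2
  rw [Set.preimage_univ, iteratedFDerivWithin_univ, iteratedFDerivWithin_univ] at h
  have h2 : iteratedFDeriv ℝ 2 (ℓ ∘ e) x = _ := h
  rw [h2, ContinuousMultilinearMap.compContinuousLinearMap_apply]
  congr 1
  funext j
  fin_cases j <;> simp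

theorem laplacian_log_norm {x : Plane} (hx : x ≠ 0) : (Laplacian.laplacian fun x : Plane => Real.log ‖x‖) x = 0 := by
  let e : Plane ≃ₗᵢ[ℝ] ℂ := Complex.orthonormalBasisOneI.repr.symm
  have he : (fun x : Plane => Real.log ‖x‖) = (fun z : ℂ => Real.log ‖z‖) ∘ e := by
    funext x; simp
  rw [he, iteratedFDeriv_two_sum_comp]
  have hx' : e x ≠ 0 := by simpa using hx
  exact (AnalyticAt.harmonicAt_log_norm (f := fun z => z) analyticAt_id hx').2.self_of_nhds

namespace Cutoff
variable (χ : Cutoff)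

theorem contDiffAt_laplacian_G {x : Plane} (hx : x ≠ 0) : ContDiffAt ℝ ∞ (Laplacian.laplacian χ.G) x := by
  rw [InnerProductSpace.laplacian_eq_iteratedFDeriv_orthonormalBasis χ.G (EuclideanSpace.basisFun (Fin 2) ℝ)]
  refine ContDiffAt.sum fun i _ => ?_
  have : ContDiffAt ℝ ∞ (iteratedFDeriv ℝ 2 χ.G) x :=
    (χ.contDiffAt_G hx).iteratedFDeriv_right (m := ∞) (i := 2) (le_of_eq rfl)
  exact (ContinuousMultilinearMap.apply ℝ (fun _ : Fin 2 => Plane) ℝ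
    ![EuclideanSpace.basisFun (Fin 2) ℝ i, EuclideanSpace.basisFun (Fin 2) ℝ i]).contDiff.contDiffAt.comp x this

theorem F_eq_neg_laplacian {x : Plane} (hx : x ≠ 0) : χ.F x = -(Laplacian.laplacian χ.G) x := by
  unfold F
  split_ifs with h
  · have e : χ.G =ᶠ[𝓝 x] (-(1 / (2 * Real.pi))) • fun x : Plane => Real.log ‖x‖ := by
      filter_upwards [(isOpen_lt continuous_norm continuous_const).mem_nhds h] with y hy
      rw [G, χ.eq_one y hy, Pi.smul_apply, smul_eq_mul]
      ring
    have h2 : ContDiffAt ℝ 2 (fun x : Plane => Real.log ‖x‖) x :=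
      ((contDiffAt_norm ℝ hx).log (norm_ne_zero_iff.2 hx))
    rw [(InnerProductSpace.laplacian_congr_nhds e).self_of_nhds, InnerProductSpace.laplacian_smul _ h2,
      laplacian_log_norm hx]
    simp
  · rfl

theorem contDiff_F : ContDiff ℝ ∞ χ.F := by
  rw [contDiff_iff_contDiffAt]
  intro x
  rcases eq_or_ne x 0 with rfl | hx
  · refine contDiffAt_const.congr_of_eventuallyEq (f := fun _ => (0 : ℝ)) ?_
    filter_upwards [Metric.ball_mem_nhds (0 : Plane) one_pos] with y hy
    simp only [Metric.mem_ball, dist_zero_right] at hy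
    simp [F, hy]
  · refine (χ.contDiffAt_laplacian_G hx).neg.congr_of_eventuallyEq ?_
    filter_upwards [isOpen_ne.mem_nhds hx] with y hy
    exact χ.F_eq_neg_laplacian hy

/-- `F` as a test function. -/
def FTest : Test := ⟨χ.F, χ.contDiff_F, χ.hasCompactSupport_F, fun _ _ => trivial⟩

/-- A smooth version of `G - G(2 ·)`. -/
def g (x : Plane) : ℝ :=
  (2 * Real.pi)⁻¹ * (Real.log 2 * χ.toFun ((2 : ℝ) • x) - Real.log ‖x‖ * (χ.toFun x - χ.toFun ((2 : ℝ) • x)))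

theorem G_sub_G {x : Plane} (hx : x ≠ 0) : χ.G x - χ.G ((2 : ℝ) • x) = χ.g x := by
  have : Real.log ‖(2 : ℝ) • x‖ = Real.log 2 + Real.log ‖x‖ := by
    rw [norm_smul, Real.norm_ofNat, Real.log_mul two_ne_zero (norm_ne_zero_iff.2 hx)]
  rw [G, G, g, this]
  field_simp
  ring

theorem contDiff_g : ContDiff ℝ ∞ χ.g := by
  have h2 : ContDiff ℝ ∞ fun x => χ.toFun ((2 : ℝ) • x) := χ.smooth.comp (contDiff_const_smul _)
  refine contDiff_const.mul ((contDiff_const.mul h2).sub ?_)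
  rw [contDiff_iff_contDiffAt]
  intro x
  rcases eq_or_ne x 0 with rfl | hx
  · refine contDiffAt_const.congr_of_eventuallyEq (f := fun _ => (0 : ℝ)) ?_
    filter_upwards [Metric.ball_mem_nhds (0 : Plane) (by norm_num : (0 : ℝ) < 1 / 2)] with y hy
    simp only [Metric.mem_ball, dist_zero_right] at hy
    rw [χ.eq_one y (by linarith), χ.eq_one _ (by rw [norm_smul, Real.norm_ofNat]; linarith), sub_self, mul_zero]
  · exact ((contDiffAt_norm ℝ hx).log (norm_ne_zero_iff.2 hx)).mul (χ.smooth.sub h2).contDiffAt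

theorem hasCompactSupport_g : HasCompactSupport χ.g := by
  refine HasCompactSupport.of_support_subset_isCompact (isCompact_closedBall 0 2) fun x hx => ?_
  by_contra h
  apply hx
  simp only [Metric.mem_closedBall, dist_zero_right, not_le] at h
  have h0 : ∀ y : Plane, 2 < ‖y‖ → χ.toFun y = 0 := fun y hy => image_eq_zero_of_notMem_tsupport fun h' => by
    have := χ.supp h'
    simp at this
    linarith
  rw [g, h0 x h, h0 _ (by rw [norm_smul, Real.norm_ofNat]; linarith)]
  simp

/-- `g` as a test function. -/
def gTest : Test := ⟨χ.g, χ.contDiff_g, χ.hasCompactSupport_g, fun _ _ => trivial⟩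

theorem sum_g {x : Plane} (hx : x ≠ 0) (m N : ℕ) (h : m ≤ N) :
    ∑ n ∈ Finset.Ico m N, χ.g ((2 : ℝ) ^ n • x) = χ.G ((2 : ℝ) ^ m • x) - χ.G ((2 : ℝ) ^ N • x) := by
  induction N, h using Nat.le_induction with
  | base => simp
  | succ N h ih =>
    rw [Finset.sum_Ico_succ_top h, ih, ← χ.G_sub_G (smul_ne_zero (by positivity) hx), smul_smul, ← pow_succ']
    ring

end Cutoff

theorem convTest_apply (k : Plane → ℝ) (hk : Integrable k) (hc : HasCompactSupport k) (φ : Test) (z : Plane) :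
    convTest k hk hc φ z = cv φ k z := by
  rw [cv_comm]
  rfl

theorem conv_ofFun (k : Plane → ℝ) (hk : Integrable k) (hc : HasCompactSupport k) (φ : Test) :
    conv k hk hc (ofFun φ) = ofFun (convTest k hk hc φ) := by
  ext ψ
  rw [ofFun_apply (Test.locallyIntegrable _)]
  have hc' : HasCompactSupport fun x => k (-x) := hc.comp_homeomorph (Homeomorph.neg Plane)
  change ofFun φ (convTest (fun x => k (-x)) hk.comp_neg hc' ψ) = _
  rw [ofFun_apply φ.locallyIntegrable]
  simp_rw [convTest_apply, cv, ← integral_const_mul, ← integral_mul_const]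
  obtain ⟨C, hC⟩ := ψ.continuous.bounded_above_of_compact_support ψ.hasCompactSupport
  have hi := (φ.integrable'.convolution_integrand (ContinuousLinearMap.mul ℝ ℝ) hk).bdd_mul
    (f := fun p : Plane × Plane => ψ p.1) (c := C) (ψ.continuous.comp continuous_fst).aestronglyMeasurable
    (Eventually.of_forall fun p => hC p.1)
  rw [integral_integral_swap (f := fun z x => ψ z * (φ x * k (z - x))) hi]
  refine integral_congr_ae (Eventually.of_forall fun x => integral_congr_ae (Eventually.of_forall fun z => ?_))
  simp only [neg_sub]
  ring

theorem fderiv_cv (φ k : Test) (z : Plane) (i : Fin 2) : fderiv ℝ (cv φ k) z (bv i) = cv φ (dtest i k) z := by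
  have hk : ContDiff ℝ 1 k := k.contDiff.of_le (by exact_mod_cast le_top)
  rw [cv_eq, (k.hasCompactSupport.hasFDerivAt_convolution_right (ContinuousLinearMap.mul ℝ ℝ)
    φ.locallyIntegrable hk z).fderiv,
    convolution_precompR_apply _ φ.locallyIntegrable (k.hasCompactSupport.fderiv ℝ) (hk.continuous_fderiv (by simp)),
    cv_eq, show (dtest i k : Plane → ℝ) = fun y => fderiv ℝ k y (bv i) from funext (dtest_apply i k)]

theorem lineDeriv_ofFun_test (i : Fin 2) (Φ : Test) :
    ∂_{(EuclideanSpace.single i 1 : Plane)} (ofFun Φ) = ofFun (dtest i Φ) := by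
  ext ψ
  rw [lineDeriv_distr_apply, ofFun_apply Φ.locallyIntegrable, ofFun_apply (Test.locallyIntegrable _),
    ← integral_test_mul_fderiv (Φ.contDiff.of_le (by exact_mod_cast le_top))]
  simp_rw [dtest_apply]

/-- Dilation of a test function. -/
def dilTest (ρ : ℝ) (hρ : ρ ≠ 0) (k : Test) : Test :=
  ⟨fun x => k (ρ⁻¹ • x), k.contDiff.comp (contDiff_const_smul _),
    k.hasCompactSupport.comp_homeomorph (Homeomorph.smulOfNeZero ρ⁻¹ (inv_ne_zero hρ)), fun _ _ => trivial⟩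

theorem dtest_dilTest (ρ : ℝ) (hρ : ρ ≠ 0) (k : Test) (i : Fin 2) (x : Plane) :
    dtest i (dilTest ρ hρ k) x = ρ⁻¹ * dilTest ρ hρ (dtest i k) x := by
  rw [dtest_apply]
  change fderiv ℝ (fun x => k (ρ⁻¹ • x)) x (bv i) = ρ⁻¹ * dtest i k (ρ⁻¹ • x)
  rw [dtest_apply, fderiv_comp_smul]
  simp

theorem cv_dilTest {ρ : ℝ} (hρ : 0 < ρ) (φ k : Test) (z : Plane) :
    cv φ (dilTest ρ hρ.ne' k) z = ρ ^ 2 * ofFun φ (rescale z ρ hρ (dilTest (-1) (by norm_num) k)) := by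
  rw [ofFun_apply φ.locallyIntegrable, cv, ← integral_const_mul]
  refine integral_congr_ae (Eventually.of_forall fun y => ?_)
  change φ y * k (ρ⁻¹ • (z - y)) = ρ ^ 2 * ((ρ ^ 2)⁻¹ * k ((-1)⁻¹ • (ρ⁻¹ • (y - z))) * φ y)
  have : ((-1 : ℝ))⁻¹ • (ρ⁻¹ • (y - z)) = ρ⁻¹ • (z - y) := by
    rw [smul_comm]; congr 1; simp [inv_neg]
  rw [this]
  field_simp

theorem exists_abs_cv_dilTest_le {κ : ℝ} (hκ : 0 ≤ κ) (hκ1 : κ ≤ 1) (k : Test) :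
    ∃ C : ℝ, 0 < C ∧ ∀ (φ : Test) (z : Plane) (ρ : ℝ) (hρ : 0 < ρ), ρ ≤ 1 →
      |cv φ (dilTest ρ hρ.ne' k) z| ≤
        C * ρ ^ (1 - κ) * polyWeight κ z * (holderNorm (-1 - κ) (polyWeight κ) (ofFun φ)).toReal := by
  obtain ⟨C, hC, h⟩ := exists_abs_rescale_le_of_test hκ hκ1 (-1 - κ) (dilTest (-1) (by norm_num) k)
  refine ⟨C, hC, fun φ z ρ hρ hρ1 => ?_⟩
  have hfin : holderNorm (-1 - κ) (polyWeight κ) (ofFun φ) < ⊤ :=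
    holderNorm_test_lt_top (by linarith) (one_le_polyWeight hκ) φ
  have hp := polyWeight_pos κ z
  have hr : 0 < ρ ^ (-1 - κ) := Real.rpow_pos_of_pos hρ _
  have := h (ofFun φ) z ρ hρ hρ1
  rw [← ENNReal.ofReal_toReal hfin.ne, ← ofReal_mul (by positivity),
    ENNReal.ofReal_le_ofReal_iff (by positivity)] at this
  rw [cv_dilTest hρ, abs_mul, abs_of_pos (by positivity)]
  have e : ρ ^ (1 - κ) = ρ ^ 2 * ρ ^ (-1 - κ) := by
    rw [← Real.rpow_natCast, ← Real.rpow_add hρ]; congr 1; push_cast; ring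
  calc _ ≤ ρ ^ 2 * _ := mul_le_mul_of_nonneg_left this (by positivity)
    _ = _ := by rw [e]; ring

theorem ofReal_abs_integral_rescale_le {κ : ℝ} (hκ : 0 ≤ κ) (hκ1 : κ ≤ 1) {m : ℕ} {ψ : Test} (hψ : ψ ∈ unitTests m)
    {f : Plane → ℝ} {B : ℝ} (hB : 0 ≤ B) (hf : ∀ z, |f z| ≤ B * polyWeight κ z) (x : Plane) {r : ℝ} (hr : 0 < r)
    (hr1 : r ≤ 1) :
    ofReal |∫ y, rescale x r hr ψ y * f y| ≤
      volume (Metric.closedBall (0 : Plane) 1) * ofReal (2 * B * polyWeight κ x) := by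
  have hp := polyWeight_pos κ x
  rw [← Real.norm_eq_abs, ofReal_norm]
  refine (enorm_integral_le_lintegral_enorm _).trans ?_
  refine le_trans ?_ (mul_le_mul_left (lintegral_unitTests_le hψ) _)
  rw [← lintegral_rescale x hr ψ, ← lintegral_mul_const _ (rescale x r hr ψ).continuous.measurable.enorm]
  refine lintegral_mono fun y => ?_
  rw [enorm_mul]
  by_cases h0 : rescale x r hr ψ y = 0
  · simp [h0]
  refine mul_le_mul_right ?_ _
  rw [← ofReal_norm]
  refine ofReal_le_ofReal ((hf y).trans ?_)
  have hy : ‖y - x‖ ≤ 1 := by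
    have : r⁻¹ • (y - x) ∈ Metric.closedBall (0 : Plane) 1 :=
      hψ.1 (subset_tsupport _ (right_ne_zero_of_mul (a := (r ^ 2)⁻¹) h0))
    rw [mem_closedBall_zero_iff, norm_smul, norm_inv, Real.norm_of_nonneg hr.le, inv_mul_le_iff₀ hr, mul_one] at this
    exact this.trans hr1
  have := polyWeight_le_of_norm_sub_le hκ hκ1 zero_le_one hy
  calc B * polyWeight κ y ≤ B * ((1 + 1) * polyWeight κ x) := by gcongr
    _ = _ := by ring

theorem dtest_mem_unitTests {ψ : Test} (hψ : ψ ∈ unitTests 1) (i : Fin 2) : dtest i ψ ∈ unitTests 0 := by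
  have e : (dtest i ψ : Plane → ℝ) = fun x => fderiv ℝ ψ x (bv i) := funext fun x => dtest_apply i ψ x
  refine ⟨?_, fun j hj x => ?_⟩
  · rw [e]
    exact (tsupport_fderiv_apply_subset ℝ (bv i)).trans hψ.1
  · obtain rfl : j = 0 := by omega
    rw [norm_iteratedFDeriv_zero, dtest_apply]
    have h1 := hψ.2 1 le_rfl x
    rw [norm_iteratedFDeriv_one] at h1
    exact (ContinuousLinearMap.le_opNorm _ _).trans (by rw [norm_bv, mul_one]; exact h1)

theorem dtest_rescale (x : Plane) {r : ℝ} (hr : 0 < r) (ψ : Test) (i : Fin 2) (y : Plane) :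
    dtest i (rescale x r hr ψ) y = r⁻¹ * rescale x r hr (dtest i ψ) y := by
  have hd : HasFDerivAt (fun y : Plane => (r ^ 2)⁻¹ * ψ (r⁻¹ • (y - x)))
      ((r ^ 2)⁻¹ • ((fderiv ℝ ψ (r⁻¹ • (y - x))).comp (r⁻¹ • ContinuousLinearMap.id ℝ Plane))) y :=
    (((ψ.contDiff.differentiable (by simp)).differentiableAt.hasFDerivAt).comp y
      (((hasFDerivAt_id y).sub_const x).const_smul r⁻¹)).const_mul _
  rw [dtest_apply]
  change fderiv ℝ (fun y : Plane => (r ^ 2)⁻¹ * ψ (r⁻¹ • (y - x))) y (bv i) = _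
  rw [hd.fderiv, rescale_apply, dtest_apply]
  simp
  ring

theorem ceil_neg_neg {κ : ℝ} (hκ : 0 < κ) (hκ1 : κ ≤ 1) : ⌈-(-κ)⌉₊ = 1 := by
  rw [neg_neg, Nat.ceil_eq_iff one_ne_zero]
  simpa using ⟨hκ, hκ1⟩

theorem sum_pow_rpow_le {κ : ℝ} (hκ : 0 < κ) (m : ℕ) :
    ∑ n ∈ Finset.range m, ((1 / 2 : ℝ) ^ n) ^ (-κ) ≤ ((2 : ℝ) ^ κ - 1)⁻¹ * ((1 / 2 : ℝ) ^ m) ^ (-κ) := by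
  have hq : 1 < (2 : ℝ) ^ κ := Real.one_lt_rpow (by norm_num) hκ
  have e : ∀ n : ℕ, ((1 / 2 : ℝ) ^ n) ^ (-κ) = ((2 : ℝ) ^ κ) ^ n := fun n => by
    rw [← Real.rpow_natCast, ← Real.rpow_natCast, ← Real.rpow_mul (by norm_num), ← Real.rpow_mul (by norm_num),
      one_div, Real.inv_rpow (by norm_num), ← Real.rpow_neg (by norm_num)]
    congr 1; ring
  simp_rw [e]
  rw [geom_sum_eq hq.ne', div_eq_inv_mul]
  exact mul_le_mul_of_nonneg_left (by linarith) (inv_nonneg.2 (by linarith))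

theorem sum_Ico_pow_rpow_le {p : ℝ} (hp : 0 < p) (m M : ℕ) :
    ∑ n ∈ Finset.Ico m M, ((1 / 2 : ℝ) ^ n) ^ p ≤ (1 - (1 / 2 : ℝ) ^ p)⁻¹ * ((1 / 2 : ℝ) ^ m) ^ p := by
  have hq : (1 / 2 : ℝ) ^ p < 1 := Real.rpow_lt_one (by norm_num) (by norm_num) hp
  have e : ∀ n : ℕ, ((1 / 2 : ℝ) ^ n) ^ p = ((1 / 2 : ℝ) ^ p) ^ n := fun n => by
    rw [← Real.rpow_natCast, ← Real.rpow_natCast, ← Real.rpow_mul (by norm_num), ← Real.rpow_mul (by norm_num), mul_comm]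
  simp_rw [e]
  rw [mul_comm, ← div_eq_mul_inv]
  exact geom_sum_Ico_le_of_lt_one (by positivity) hq

theorem tendsto_sum_cv_dilTest (χ : Cutoff) (φ : Test) (z : Plane) :
    Tendsto (fun M : ℕ => ∑ n ∈ Finset.range M, cv φ (dilTest ((1 / 2) ^ n) (by positivity) χ.gTest) z) atTop
      (𝓝 (cv φ χ.G z)) := by
  obtain ⟨S, hS⟩ := φ.continuous.bounded_above_of_compact_support φ.hasCompactSupport
  have hS0 : 0 ≤ S := (norm_nonneg _).trans (hS 0)
  have hGi : ∀ M : ℕ, Integrable fun x => χ.G ((2 : ℝ) ^ M • x) := fun M => χ.integrable_G.comp_smul (by positivity)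
  have hi : ∀ M : ℕ, Integrable fun y => φ y * χ.G ((2 : ℝ) ^ M • (z - y)) := fun M =>
    ((hGi M).comp_sub_left z).bdd_mul φ.continuous.aestronglyMeasurable (Eventually.of_forall hS)
  have e : ∀ M : ℕ, (∑ n ∈ Finset.range M, cv φ (dilTest ((1 / 2) ^ n) (by positivity) χ.gTest) z) - cv φ χ.G z =
      - ∫ y, φ y * χ.G ((2 : ℝ) ^ M • (z - y)) := by
    intro M
    have h0 := hi 0
    simp only [pow_zero, one_smul] at h0
    rw [cv, ← integral_neg]
    simp_rw [cv]
    rw [← integral_finsetSum _ fun n _ => integrable_cv_integrand φ.locallyIntegrable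
      (dilTest ((1 / 2) ^ n) (by positivity) χ.gTest).continuous (dilTest ((1 / 2) ^ n) (by positivity) χ.gTest).hasCompactSupport z,
      ← integral_sub (integrable_finsetSum _ fun n _ => integrable_cv_integrand φ.locallyIntegrable
      (dilTest ((1 / 2) ^ n) (by positivity) χ.gTest).continuous (dilTest ((1 / 2) ^ n) (by positivity) χ.gTest).hasCompactSupport z) h0]
    refine integral_congr_ae ?_
    filter_upwards [compl_mem_ae_iff.2 (measure_singleton z)] with y hy
    have hzy : z - y ≠ 0 := sub_ne_zero.2 fun h => hy h.symm
    have := χ.sum_g hzy 0 M (Nat.zero_le _)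
    rw [Finset.range_eq_Ico, ← Finset.mul_sum]
    have e2 : ∀ n : ℕ, dilTest ((1 / 2) ^ n) (by positivity) χ.gTest (z - y) = χ.g ((2 : ℝ) ^ n • (z - y)) := by
      intro n
      change χ.g (_ • _) = _
      rw [one_div, inv_pow, inv_inv]
    simp_rw [e2]
    rw [this, pow_zero, one_smul]
    ring
  have hz : Tendsto (fun M : ℕ => S * ((1 / 4 : ℝ) ^ M * ∫ y, ‖χ.G y‖)) atTop (𝓝 0) := by
    have := ((tendsto_pow_atTop_nhds_zero_of_lt_one (r := (1 / 4 : ℝ)) (by norm_num) (by norm_num)).mul_const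
      (∫ y, ‖χ.G y‖)).const_mul S
    simpa using this
  rw [tendsto_iff_norm_sub_tendsto_zero]
  refine squeeze_zero (fun _ => norm_nonneg _) (fun M => ?_) hz
  rw [e M, norm_neg]
  refine (norm_integral_le_of_norm_le (((hGi M).comp_sub_left z).norm.const_mul S)
    (Eventually.of_forall fun y => ?_)).trans_eq ?_
  · rw [norm_mul]
    exact mul_le_mul_of_nonneg_right (hS y) (norm_nonneg _)
  · rw [integral_const_mul, integral_sub_left_eq_self (fun x => ‖χ.G ((2 : ℝ) ^ M • x)‖) volume z,
      Measure.integral_comp_smul volume (fun x => ‖χ.G x‖) ((2 : ℝ) ^ M)]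
    congr 2
    simp only [finrank_euclideanSpace, Fintype.card_fin]
    rw [abs_of_pos (by positivity), one_div, inv_pow, ← pow_mul, mul_comm M 2, pow_mul]
    norm_num

theorem exists_holderNorm_lineDeriv_potential_le {κ : ℝ} (hκ : 0 < κ) (hκ1 : κ < 1) (χ : Cutoff) :
    ∃ C : ℝ≥0∞, C ≠ ⊤ ∧ ∀ (φ : Test) (i : Fin 2),
      holderNorm (-κ) (polyWeight κ) (∂_{(EuclideanSpace.single i 1 : Plane)} (potential χ (ofFun φ))) ≤
        C * holderNorm (-1 - κ) (polyWeight κ) (ofFun φ) := by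
  obtain ⟨C₁, hC₁, h₁⟩ := exists_abs_cv_dilTest_le hκ.le hκ1.le χ.gTest
  choose C₂ hC₂ h₂ using fun i => exists_abs_cv_dilTest_le hκ.le hκ1.le (dtest i χ.gTest)
  set D₁ : ℝ := C₁ * (1 - (1 / 2 : ℝ) ^ (1 - κ))⁻¹ with hD₁
  set D₂ : ℝ := (C₂ 0 + C₂ 1) * ((2 : ℝ) ^ κ - 1)⁻¹ with hD₂
  have hq : (1 / 2 : ℝ) ^ (1 - κ) < 1 := Real.rpow_lt_one (by norm_num) (by norm_num) (by linarith)
  have hq' : 1 < (2 : ℝ) ^ κ := Real.one_lt_rpow (by norm_num) hκ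
  have hD₁0 : 0 ≤ D₁ := mul_nonneg hC₁.le (inv_nonneg.2 (by linarith))
  have hC20 := hC₂ 0
  have hC21 := hC₂ 1
  have hD₂0 : 0 ≤ D₂ := mul_nonneg (by positivity) (inv_nonneg.2 (by linarith))
  have hvol : volume (Metric.closedBall (0 : Plane) 1) ≠ ⊤ := (isCompact_closedBall (0 : Plane) 1).measure_lt_top.ne
  refine ⟨volume (Metric.closedBall (0 : Plane) 1) * ofReal (2 * D₂ + 4 * D₁),
    mul_ne_top hvol ofReal_ne_top, fun φ i => ?_⟩
  have hfin : holderNorm (-1 - κ) (polyWeight κ) (ofFun φ) < ⊤ :=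
    holderNorm_test_lt_top (by linarith) (one_le_polyWeight hκ.le) φ
  set N := (holderNorm (-1 - κ) (polyWeight κ) (ofFun φ)).toReal with hN
  have hN0 : 0 ≤ N := ENNReal.toReal_nonneg
  rw [potential, conv_ofFun, lineDeriv_ofFun_test]
  refine iSup_le fun x => iSup_le fun r => iSup₂_le fun ψ hψ => ?_
  rw [ceil_neg_neg hκ hκ1.le] at hψ
  obtain ⟨r, hr, hr1⟩ := r
  simp only
  have hp := polyWeight_pos κ x
  have hrk : 0 < r ^ (-κ) := Real.rpow_pos_of_pos hr _
  obtain ⟨m, hm1, hm2⟩ := exists_nat_pow_near_of_lt_one hr hr1 (by norm_num : (0 : ℝ) < 1 / 2) (by norm_num)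
  let gn : ℕ → Test := fun n => dilTest ((1 / 2) ^ n) (by positivity) χ.gTest
  let Φ := convTest χ.G χ.integrable_G χ.hasCompactSupport_G φ
  let Ψ : ℕ → Test := fun n => convTest (gn n) (gn n).integrable' (gn n).hasCompactSupport φ
  have hΨ : ∀ n z, Ψ n z = cv φ (gn n) z := fun n z => convTest_apply _ _ _ φ z
  have hdΨ : ∀ n z, dtest i (Ψ n) z = ((1 / 2 : ℝ) ^ n)⁻¹ * cv φ (dilTest ((1 / 2) ^ n) (by positivity) (dtest i χ.gTest)) z := by
    intro n z
    rw [dtest_apply, show (Ψ n : Plane → ℝ) = cv φ (gn n) from funext (hΨ n), fderiv_cv, cv, cv, ← integral_const_mul]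
    refine integral_congr_ae (Eventually.of_forall fun y => ?_)
    simp only [gn]
    rw [dtest_dilTest]
    ring
  have hb1 : ∀ z, |∑ n ∈ Finset.range m, dtest i (Ψ n) z| ≤ (D₂ * r ^ (-κ) * N) * polyWeight κ z := by
    intro z
    have hpz := polyWeight_pos κ z
    have hCi : C₂ i ≤ C₂ 0 + C₂ 1 := by fin_cases i <;> simp <;> linarith
    have hCi0 := hC₂ i
    calc |∑ n ∈ Finset.range m, dtest i (Ψ n) z| ≤ ∑ n ∈ Finset.range m, |dtest i (Ψ n) z| := Finset.abs_sum_le_sum_abs _ _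
      _ ≤ ∑ n ∈ Finset.range m, (C₂ i * polyWeight κ z * N) * ((1 / 2 : ℝ) ^ n) ^ (-κ) := by
          refine Finset.sum_le_sum fun n _ => ?_
          rw [hdΨ, abs_mul, abs_of_pos (by positivity)]
          have hρ : (0 : ℝ) < (1 / 2) ^ n := by positivity
          have e : ((1 / 2 : ℝ) ^ n) ^ (-κ) = ((1 / 2 : ℝ) ^ n)⁻¹ * ((1 / 2 : ℝ) ^ n) ^ (1 - κ) := by
            rw [← Real.rpow_neg_one, ← Real.rpow_add hρ]; congr 1; ring
          rw [e]
          refine (mul_le_mul_of_nonneg_left (h₂ i φ z _ hρ (pow_le_one₀ (by norm_num) (by norm_num))) (by positivity)).trans_eq ?_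
          ring
      _ ≤ (C₂ i * polyWeight κ z * N) * (((2 : ℝ) ^ κ - 1)⁻¹ * ((1 / 2 : ℝ) ^ m) ^ (-κ)) := by
          rw [← Finset.mul_sum]
          exact mul_le_mul_of_nonneg_left (sum_pow_rpow_le hκ m) (by positivity)
      _ ≤ ((C₂ 0 + C₂ 1) * polyWeight κ z * N) * (((2 : ℝ) ^ κ - 1)⁻¹ * r ^ (-κ)) := by
          have h3 : ((1 / 2 : ℝ) ^ m) ^ (-κ) ≤ r ^ (-κ) := Real.rpow_le_rpow_of_nonpos hr hm2 (by linarith)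
          have h4 : 0 ≤ ((2 : ℝ) ^ κ - 1)⁻¹ := inv_nonneg.2 (by linarith)
          gcongr
      _ = _ := by rw [hD₂]; ring
  have hb2 : ∀ z, |Φ z - ∑ n ∈ Finset.range m, Ψ n z| ≤ (D₁ * (2 * r ^ (1 - κ)) * N) * polyWeight κ z := by
    intro z
    have hpz := polyWeight_pos κ z
    have ht : Tendsto (fun M : ℕ => |∑ n ∈ Finset.Ico m M, Ψ n z|) atTop (𝓝 |Φ z - ∑ n ∈ Finset.range m, Ψ n z|) := by
      have h3 : Tendsto (fun M : ℕ => (∑ n ∈ Finset.range M, Ψ n z) - ∑ n ∈ Finset.range m, Ψ n z) atTop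
          (𝓝 (Φ z - ∑ n ∈ Finset.range m, Ψ n z)) := by
        refine Tendsto.sub_const ?_ _
        simp_rw [hΨ]
        rw [show Φ z = cv φ χ.G z from convTest_apply _ _ _ φ z]
        exact tendsto_sum_cv_dilTest χ φ z
      refine (h3.congr' ?_).abs
      filter_upwards [eventually_ge_atTop m] with M hM
      exact (Finset.sum_Ico_eq_sub _ hM).symm
    refine le_of_tendsto ht (Eventually.of_forall fun M => ?_)
    calc |∑ n ∈ Finset.Ico m M, Ψ n z| ≤ ∑ n ∈ Finset.Ico m M, |Ψ n z| := Finset.abs_sum_le_sum_abs _ _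
      _ ≤ ∑ n ∈ Finset.Ico m M, (C₁ * polyWeight κ z * N) * ((1 / 2 : ℝ) ^ n) ^ (1 - κ) := by
          refine Finset.sum_le_sum fun n _ => ?_
          rw [hΨ]
          exact (h₁ φ z _ (by positivity) (pow_le_one₀ (by norm_num) (by norm_num))).trans_eq (by ring)
      _ ≤ (C₁ * polyWeight κ z * N) * ((1 - (1 / 2 : ℝ) ^ (1 - κ))⁻¹ * ((1 / 2 : ℝ) ^ m) ^ (1 - κ)) := by
          rw [← Finset.mul_sum]
          exact mul_le_mul_of_nonneg_left (sum_Ico_pow_rpow_le (by linarith) m M) (by positivity)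
      _ ≤ (C₁ * polyWeight κ z * N) * ((1 - (1 / 2 : ℝ) ^ (1 - κ))⁻¹ * (2 * r ^ (1 - κ))) := by
          have h3 : ((1 / 2 : ℝ) ^ m) ^ (1 - κ) ≤ 2 * r ^ (1 - κ) := by
            have : (1 / 2 : ℝ) ^ m ≤ 2 * r := by rw [pow_succ] at hm1; linarith
            refine (Real.rpow_le_rpow (by positivity) this (by linarith)).trans ?_
            rw [Real.mul_rpow (by norm_num) hr.le]
            refine mul_le_mul_of_nonneg_right ?_ (by positivity)
            calc (2 : ℝ) ^ (1 - κ) ≤ 2 ^ (1 : ℝ) := Real.rpow_le_rpow_of_exponent_le (by norm_num) (by linarith)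
              _ = 2 := Real.rpow_one 2
          have h4 : 0 ≤ (1 - (1 / 2 : ℝ) ^ (1 - κ))⁻¹ := inv_nonneg.2 (by linarith)
          gcongr
      _ = _ := by rw [hD₁]; ring
  have hcont1 : Continuous fun z => ∑ n ∈ Finset.range m, dtest i (Ψ n) z :=
    continuous_finsetSum _ fun n _ => (dtest i (Ψ n)).continuous
  have hcont2 : ContDiff ℝ 1 fun z => Φ z - ∑ n ∈ Finset.range m, Ψ n z :=
    (Φ.contDiff.of_le (by exact_mod_cast le_top)).sub (ContDiff.sum fun n _ => (Ψ n).contDiff.of_le (by exact_mod_cast le_top))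
  have hd2 : ∀ z, fderiv ℝ (fun z => Φ z - ∑ n ∈ Finset.range m, Ψ n z) z (bv i) =
      dtest i Φ z - ∑ n ∈ Finset.range m, dtest i (Ψ n) z := by
    intro z
    have hdf : ∀ θ : Test, DifferentiableAt ℝ θ z := fun θ => (θ.contDiff.differentiable (by simp)).differentiableAt
    rw [fderiv_fun_sub (hdf Φ) (DifferentiableAt.fun_sum fun n _ => hdf (Ψ n)), fderiv_fun_sum fun n _ => hdf (Ψ n)]
    simp [dtest_apply]
  have hsplit : ofFun (dtest i Φ) (rescale x r hr ψ) =
      (∫ y, rescale x r hr ψ y * ∑ n ∈ Finset.range m, dtest i (Ψ n) y) -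
        r⁻¹ * ∫ y, rescale x r hr (dtest i ψ) y * (Φ y - ∑ n ∈ Finset.range m, Ψ n y) := by
    have e1 := integral_test_mul_fderiv hcont2 (rescale x r hr ψ) i
    simp_rw [hd2, dtest_rescale, mul_assoc] at e1
    rw [integral_const_mul] at e1
    rw [ofFun_apply (Test.locallyIntegrable _), sub_eq_add_neg, ← e1, ← integral_add
      (integrable_test_mul hcont1.locallyIntegrable _)
      (integrable_test_mul (g := fun y => dtest i Φ y - ∑ n ∈ Finset.range m, dtest i (Ψ n) y)
        ((dtest i Φ).continuous.sub hcont1).locallyIntegrable _)]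
    refine integral_congr_ae (Eventually.of_forall fun y => ?_)
    simp only
    ring
  have k1 := ofReal_abs_integral_rescale_le hκ.le hκ1.le hψ (by positivity) hb1 x hr hr1
  have k2 := ofReal_abs_integral_rescale_le hκ.le hκ1.le (dtest_mem_unitTests hψ i) (by positivity) hb2 x hr hr1
  rw [ENNReal.ofReal_div_of_pos (by positivity)]
  refine ENNReal.div_le_of_le_mul ?_
  rw [hsplit]
  refine (ofReal_le_ofReal (abs_sub _ _)).trans (ENNReal.ofReal_add_le.trans ?_)
  rw [abs_mul, abs_of_pos (inv_pos.2 hr), ofReal_mul (by positivity)]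
  refine (add_le_add k1 (mul_le_mul_right k2 _)).trans_eq ?_
  rw [mul_left_comm (ofReal r⁻¹), ← ofReal_mul (by positivity), ← mul_add, ← ENNReal.ofReal_add (by positivity) (by positivity),
    ← ENNReal.ofReal_toReal hfin.ne, ← hN, mul_assoc (volume _), ← ofReal_mul (by positivity), mul_assoc (volume _),
    ← ofReal_mul (by positivity)]
  congr 2
  have e : r⁻¹ * r ^ (1 - κ) = r ^ (-κ) := by
    rw [← Real.rpow_neg_one, ← Real.rpow_add hr]; congr 1; ring
  linear_combination (4 * D₁ * N * polyWeight κ x) * e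

theorem exists_holderNorm_conv_F_le {κ : ℝ} (hκ : 0 < κ) (hκ1 : κ < 1) (χ : Cutoff) :
    ∃ C : ℝ≥0∞, C ≠ ⊤ ∧ ∀ φ : Test,
      holderNorm (-κ) (polyWeight κ) (conv χ.F χ.integrable_F χ.hasCompactSupport_F (ofFun φ)) ≤
        C * holderNorm (-1 - κ) (polyWeight κ) (ofFun φ) := by
  obtain ⟨C₁, hC₁, h₁⟩ := exists_abs_cv_dilTest_le hκ.le hκ1.le χ.FTest
  have hvol : volume (Metric.closedBall (0 : Plane) 1) ≠ ⊤ := (isCompact_closedBall (0 : Plane) 1).measure_lt_top.ne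
  refine ⟨volume (Metric.closedBall (0 : Plane) 1) * ofReal (2 * C₁),
    mul_ne_top hvol ofReal_ne_top, fun φ => ?_⟩
  have hfin : holderNorm (-1 - κ) (polyWeight κ) (ofFun φ) < ⊤ :=
    holderNorm_test_lt_top (by linarith) (one_le_polyWeight hκ.le) φ
  set N := (holderNorm (-1 - κ) (polyWeight κ) (ofFun φ)).toReal with hN
  have hN0 : 0 ≤ N := ENNReal.toReal_nonneg
  rw [conv_ofFun]
  refine iSup_le fun x => iSup_le fun r => iSup₂_le fun ψ hψ => ?_
  obtain ⟨r, hr, hr1⟩ := r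
  simp only
  have hp := polyWeight_pos κ x
  have hrk : 1 ≤ r ^ (-κ) := Real.one_le_rpow_of_pos_of_le_one_of_nonpos hr hr1 (by linarith)
  have hb : ∀ z, |convTest χ.F χ.integrable_F χ.hasCompactSupport_F φ z| ≤ (C₁ * N) * polyWeight κ z := by
    intro z
    have := h₁ φ z 1 one_pos le_rfl
    rw [Real.one_rpow, show (dilTest 1 one_pos.ne' χ.FTest : Plane → ℝ) = χ.F from funext fun x => by
      change χ.F ((1 : ℝ)⁻¹ • x) = _; simp] at this
    rw [convTest_apply]
    exact this.trans_eq (by ring)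
  have k := ofReal_abs_integral_rescale_le hκ.le hκ1.le hψ (by positivity) hb x hr hr1
  rw [ofFun_apply (Test.locallyIntegrable _), ENNReal.ofReal_div_of_pos (by positivity)]
  refine ENNReal.div_le_of_le_mul (k.trans ?_)
  rw [← ENNReal.ofReal_toReal hfin.ne, ← hN, mul_assoc (volume _), ← ofReal_mul (by positivity), mul_assoc (volume _),
    ← ofReal_mul (by positivity)]
  refine mul_le_mul_right (ofReal_le_ofReal ?_) _
  have : 0 ≤ 2 * C₁ * N * polyWeight κ x := by positivity
  nlinarith

theorem abs_apply_le_of_holderNorm {κ : ℝ} (hκ : 0 ≤ κ) (hκ1 : κ ≤ 1) (α : ℝ) (ψ : Test) :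
    ∃ C : ℝ≥0∞, C ≠ ⊤ ∧ ∀ S : Distr, ofReal |S ψ| ≤ C * holderNorm α (polyWeight κ) S := by
  obtain ⟨C, -, h⟩ := exists_abs_rescale_le_of_test hκ hκ1 α ψ
  refine ⟨ofReal (C * 1 ^ α * polyWeight κ 0), ofReal_ne_top, fun S => ?_⟩
  have := h S 0 1 one_pos le_rfl
  rwa [rescale_zero_one] at this

theorem HolderSpace.sub_ofFun {α : ℝ} {ρ : Plane → ℝ} {S : Distr} (h : S ∈ HolderSpace α ρ) (φ : Test) :
    S - ofFun φ ∈ HolderSpace α ρ := fun ε hε => by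
  obtain ⟨φ', h'⟩ := h ε hε
  refine ⟨φ' - φ, ?_⟩
  rwa [ofFun_test_sub, sub_sub_sub_cancel_right]

theorem HolderSpace.holderNorm_lt_top {α : ℝ} (hα : α ≤ 0) {κ : ℝ} (hκ : 0 ≤ κ) {S : Distr}
    (h : S ∈ HolderSpace α (polyWeight κ)) : holderNorm α (polyWeight κ) S < ⊤ := by
  obtain ⟨φ, hφ⟩ := h 1 one_pos
  have := holderNorm_add_le α (polyWeight_pos κ) (S - ofFun φ) (ofFun φ)
  rw [sub_add_cancel] at this
  exact this.trans_lt (ENNReal.add_lt_top.2 ⟨hφ.trans ENNReal.one_lt_top, holderNorm_test_lt_top hα (one_le_polyWeight hκ) φ⟩)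

/-- A map of distributions given by duality, which is bounded on test functions, is bounded on
`HolderSpace`. -/
theorem holderNorm_map_le {κ α β : ℝ} (hκ : 0 ≤ κ) (hκ1 : κ ≤ 1) {A : Distr → Distr} {B : Test → Test}
    {A' : Test → Test} (hAB : ∀ S ψ, A S ψ = S (B ψ)) (hA' : ∀ φ : Test, A (ofFun φ) = ofFun (A' φ)) {C : ℝ≥0∞} (hC : C ≠ ⊤)
    (h : ∀ φ : Test, holderNorm β (polyWeight κ) (A (ofFun φ)) ≤ C * holderNorm α (polyWeight κ) (ofFun φ)) {S : Distr}
    (hS : S ∈ HolderSpace α (polyWeight κ)) :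
    holderNorm β (polyWeight κ) (A S) ≤ C * holderNorm α (polyWeight κ) S ∧ A S ∈ HolderSpace β (polyWeight κ) := by
  have key : ∀ S ∈ HolderSpace α (polyWeight κ),
      holderNorm β (polyWeight κ) (A S) ≤ C * holderNorm α (polyWeight κ) S := by
    intro S hS
    refine iSup_le fun x => iSup_le fun r => iSup₂_le fun ψ hψ => ?_
    have hp := polyWeight_pos κ x
    have hrk : 0 < (r : ℝ) ^ β := Real.rpow_pos_of_pos r.2.1 _
    obtain ⟨K, hK, hKψ⟩ := abs_apply_le_of_holderNorm hκ hκ1 α (B (rescale x r r.2.1 ψ))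
    set w := (r : ℝ) ^ β * polyWeight κ x with hw
    have hw0 : 0 < w := by positivity
    have hlim : Tendsto (fun ε : ℝ≥0∞ => C * (holderNorm α (polyWeight κ) S + ε) + ofReal w⁻¹ * (K * ε)) (𝓝[>] 0)
        (𝓝 (C * (holderNorm α (polyWeight κ) S + 0) + ofReal w⁻¹ * (K * 0))) := by
      have hid : Tendsto (fun ε : ℝ≥0∞ => ε) (𝓝[>] 0) (𝓝 0) := tendsto_nhdsWithin_of_tendsto_nhds tendsto_id
      exact (ENNReal.Tendsto.const_mul (hid.const_add _) (Or.inr hC)).add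
        (ENNReal.Tendsto.const_mul (ENNReal.Tendsto.const_mul hid (Or.inr hK)) (Or.inr ofReal_ne_top))
    rw [mul_zero, mul_zero, add_zero, add_zero] at hlim
    refine ge_of_tendsto hlim ?_
    filter_upwards [self_mem_nhdsWithin] with ε hε
    obtain ⟨φ, hφ⟩ := hS ε hε
    have h1 : ofReal (|A (ofFun φ) (rescale x r r.2.1 ψ)| / w) ≤ C * (holderNorm α (polyWeight κ) S + ε) := by
      refine (le_holderNorm (A (ofFun φ)) r.2.1 r.2.2 hψ).trans ((h φ).trans (mul_le_mul_right ?_ _))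
      have := holderNorm_add_le α (polyWeight_pos κ) S (ofFun φ - S)
      rw [add_sub_cancel, holderNorm_sub_comm] at this
      exact this.trans (add_le_add le_rfl hφ.le)
    have h2 : ofReal (w⁻¹ * |(S - ofFun φ) (B (rescale x r r.2.1 ψ))|) ≤ ofReal w⁻¹ * (K * ε) := by
      rw [ofReal_mul (by positivity)]
      exact mul_le_mul_right ((hKψ _).trans (mul_le_mul_right hφ.le _)) _
    refine le_trans ?_ (add_le_add h1 h2)
    rw [← ENNReal.ofReal_add (by positivity) (by positivity)]
    refine ofReal_le_ofReal ?_
    rw [hAB, hAB, div_eq_inv_mul, div_eq_inv_mul, ← mul_add]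
    refine mul_le_mul_of_nonneg_left ?_ (by positivity)
    have e : S (B (rescale x r r.2.1 ψ)) = ofFun φ (B (rescale x r r.2.1 ψ)) + (S - ofFun φ) (B (rescale x r r.2.1 ψ)) := by
      change _ = _ + (S _ - ofFun φ _)
      ring
    rw [e]
    exact abs_add_le _ _
  refine ⟨key S hS, fun ε hε => ?_⟩
  obtain ⟨δ, hδ, hδε⟩ : ∃ δ : ℝ≥0∞, 0 < δ ∧ C * δ < ε := by
    have ht : Tendsto (fun δ : ℝ≥0∞ => C * δ) (𝓝[>] 0) (𝓝 (C * 0)) :=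
      ENNReal.Tendsto.const_mul (tendsto_nhdsWithin_of_tendsto_nhds tendsto_id) (Or.inr hC)
    rw [mul_zero] at ht
    obtain ⟨δ, hδ⟩ := (((ht.eventually (gt_mem_nhds hε)).and self_mem_nhdsWithin)).exists
    exact ⟨δ, hδ.2, hδ.1⟩
  obtain ⟨φ, hφ⟩ := hS δ hδ
  refine ⟨A' φ, lt_of_le_of_lt ?_ hδε⟩
  have e : A S - ofFun (A' φ) = A (S - ofFun φ) := by
    rw [← hA']
    ext ψ
    change A S ψ - A (ofFun φ) ψ = _
    rw [hAB, hAB, hAB]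
    rfl
  rw [e]
  exact (key _ (HolderSpace.sub_ofFun hS φ)).trans (mul_le_mul_right hφ.le _)

theorem HolderSpace.add {α κ : ℝ} {S S' : Distr} (h : S ∈ HolderSpace α (polyWeight κ))
    (h' : S' ∈ HolderSpace α (polyWeight κ)) : S + S' ∈ HolderSpace α (polyWeight κ) := fun ε hε => by
  obtain ⟨φ, hφ⟩ := h (ε / 2) (ENNReal.half_pos hε.ne')
  obtain ⟨φ', hφ'⟩ := h' (ε / 2) (ENNReal.half_pos hε.ne')
  refine ⟨φ + φ', ?_⟩
  rw [ofFun_test_add, add_sub_add_comm]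
  exact (holderNorm_add_le α (polyWeight_pos κ) _ _).trans_lt ((ENNReal.add_lt_add hφ hφ').trans_eq (ENNReal.add_halves ε))

theorem HolderSpace.neg {α κ : ℝ} {S : Distr} (h : S ∈ HolderSpace α (polyWeight κ)) :
    -S ∈ HolderSpace α (polyWeight κ) := fun ε hε => by
  obtain ⟨φ, hφ⟩ := h ε hε
  refine ⟨0 - φ, ?_⟩
  rwa [ofFun_test_sub, show ofFun ((0 : Test) : Plane → ℝ) = 0 from by
    ext ψ; rw [ofFun_apply (Test.locallyIntegrable _)]; simp, zero_sub, sub_neg_eq_add, neg_add_eq_sub, holderNorm_sub_comm]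

theorem HolderSpace.sub {α κ : ℝ} {S S' : Distr} (h : S ∈ HolderSpace α (polyWeight κ))
    (h' : S' ∈ HolderSpace α (polyWeight κ)) : S - S' ∈ HolderSpace α (polyWeight κ) := by
  have e : S - S' = S + -S' := sub_eq_add_neg S S'
  rw [e]
  exact HolderSpace.add h (HolderSpace.neg h')

theorem Noise.sub {κ : ℝ} {q q' : Distr × Distr} (h : q ∈ Noise κ) (h' : q' ∈ Noise κ) : q - q' ∈ Noise κ :=
  ⟨HolderSpace.sub h.1 h'.1, HolderSpace.sub h.2 h'.2⟩

/-- The coefficients `U + F * X`, `∂₁V`, `∂₂V`. -/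
def tgt (χ : Cutoff) (q : Distr × Distr) (j : Fin 3) : Distr :=
  Fin.cases (zeroOrder χ q) (fun i : Fin 2 => ∂_{(EuclideanSpace.single i 1 : Plane)} (potential χ q.1)) j

theorem conv_sub (k : Plane → ℝ) (hk : Integrable k) (hc : HasCompactSupport k) (X Y : Distr) :
    conv k hk hc (X - Y) = conv k hk hc X - conv k hk hc Y := by
  ext ψ
  rfl

theorem lineDeriv_distr_sub (i : Fin 2) (X Y : Distr) : ∂_{(EuclideanSpace.single i 1 : Plane)} (X - Y) =
    ∂_{(EuclideanSpace.single i 1 : Plane)} X - ∂_{(EuclideanSpace.single i 1 : Plane)} Y := by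
  ext ψ
  have h : (∂_{(EuclideanSpace.single i 1 : Plane)} (X - Y)) ψ = - (X (dtest i ψ) - Y (dtest i ψ)) := rfl
  have h' : (∂_{(EuclideanSpace.single i 1 : Plane)} X - ∂_{(EuclideanSpace.single i 1 : Plane)} Y) ψ =
    - X (dtest i ψ) - - Y (dtest i ψ) := rfl
  rw [h, h']
  ring

theorem tgt_sub (χ : Cutoff) (q q' : Distr × Distr) (j : Fin 3) : tgt χ (q - q') j = tgt χ q j - tgt χ q' j := by
  refine Fin.cases ?_ (fun i => ?_) j
  · simp only [tgt, Fin.cases_zero, zeroOrder, Prod.fst_sub, Prod.snd_sub, conv_sub]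
    abel
  · simp only [tgt, Fin.cases_succ, potential, Prod.fst_sub, conv_sub, lineDeriv_distr_sub]

theorem exists_holderNorm_tgt_le {κ : ℝ} (hκ : 0 < κ) (hκ1 : κ < 1) (χ : Cutoff) :
    ∃ C : ℝ≥0∞, C ≠ ⊤ ∧ ∀ q ∈ Noise κ, ∀ j, tgt χ q j ∈ HolderSpace (-κ) (polyWeight κ) ∧
      holderNorm (-κ) (polyWeight κ) (tgt χ q j) ≤ C * noiseNorm κ q := by
  obtain ⟨C₁, hC₁, h₁⟩ := exists_holderNorm_lineDeriv_potential_le hκ hκ1 χ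
  obtain ⟨C₂, hC₂, h₂⟩ := exists_holderNorm_conv_F_le hκ hκ1 χ
  refine ⟨1 + C₂ + C₁, by simp [hC₁, hC₂], fun q hq j => ?_⟩
  refine Fin.cases ?_ (fun i => ?_) j
  · obtain ⟨h3, h4⟩ := holderNorm_map_le hκ.le hκ1.le (A := conv χ.F χ.integrable_F χ.hasCompactSupport_F)
      (B := convTest (fun x => χ.F (-x)) χ.integrable_F.comp_neg
        (χ.hasCompactSupport_F.comp_homeomorph (Homeomorph.neg Plane)))
      (A' := convTest χ.F χ.integrable_F χ.hasCompactSupport_F) (fun S ψ => rfl) (conv_ofFun _ _ _) hC₂ h₂ hq.1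
    refine ⟨HolderSpace.add hq.2 h4, (holderNorm_add_le _ (polyWeight_pos κ) _ _).trans ?_⟩
    rw [noiseNorm, add_mul, mul_add]
    refine le_add_right ?_
    rw [add_comm]
    refine (add_le_add (h3.trans (mul_le_mul_left (le_add_self : C₂ ≤ 1 + C₂) _)) ?_)
    exact le_mul_of_one_le_left' le_self_add
  · obtain ⟨h3, h4⟩ := holderNorm_map_le hκ.le hκ1.le
      (A := fun X => ∂_{(EuclideanSpace.single i 1 : Plane)} (potential χ X))
      (B := fun ψ => - convTest (fun x => χ.G (-x)) χ.integrable_G.comp_neg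
        (χ.hasCompactSupport_G.comp_homeomorph (Homeomorph.neg Plane)) (dtest i ψ))
      (A' := fun φ => dtest i (convTest χ.G χ.integrable_G χ.hasCompactSupport_G φ))
      (fun S ψ => (map_neg S _).symm) (fun φ => by rw [potential, conv_ofFun, lineDeriv_ofFun_test]) hC₁
      (fun φ => h₁ φ i) hq.1
    exact ⟨h4, h3.trans (mul_le_mul' le_add_self le_self_add)⟩

/-- A sequence of test functions approximating `S`. -/
def apx (κ : ℝ) (S : Distr) (n : ℕ) : Test :=
  Classical.epsilon fun φ : Test => holderNorm (-κ) (polyWeight κ) (S - ofFun φ) < (n + 1 : ℝ≥0∞)⁻¹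

theorem holderNorm_sub_apx_lt {κ : ℝ} {S : Distr} (h : S ∈ HolderSpace (-κ) (polyWeight κ)) (n : ℕ) :
    holderNorm (-κ) (polyWeight κ) (S - ofFun (apx κ S n)) < (n + 1 : ℝ≥0∞)⁻¹ :=
  Classical.epsilon_spec (h (n + 1 : ℝ≥0∞)⁻¹ (by simp))

theorem tendsto_holderNorm_apx {κ : ℝ} {S : Distr} (h : S ∈ HolderSpace (-κ) (polyWeight κ)) :
    Tendsto (fun n => holderNorm (-κ) (polyWeight κ) (S - ofFun (apx κ S n))) atTop (𝓝 0) := by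
  refine tendsto_of_tendsto_of_tendsto_of_le_of_le tendsto_const_nhds ?_ (fun _ => zero_le)
    fun n => (holderNorm_sub_apx_lt h n).le
  have := ENNReal.tendsto_inv_nat_nhds_zero.comp (tendsto_add_atTop_nat 1)
  simpa [Function.comp_def] using this

theorem hol_sub_le {κ : ℝ} (S : Distr) (φ φ' : Test) : hol κ (φ - φ') ≤
    holderNorm (-κ) (polyWeight κ) (S - ofFun φ) + holderNorm (-κ) (polyWeight κ) (S - ofFun φ') := by
  rw [hol, ofFun_test_sub, holderNorm_sub_comm _ _ S (ofFun φ), ← sub_add_sub_cancel (ofFun φ) S]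
  exact holderNorm_add_le _ (polyWeight_pos κ) _ _

/-- Coefficient sequences of the equation. -/
def coefs (χ : Cutoff) (κ : ℝ) (q : Distr × Distr) (j : Fin 3) (n : ℕ) : Test :=
  (Fin.cases 1 (fun _ => -2) j : ℝ) • apx κ (tgt χ q j) n

theorem hol_smul (κ c : ℝ) (φ : Test) : hol κ (c • φ) ≤ ‖c‖ₑ * hol κ φ := by
  rw [hol, show ofFun ((c • φ : Test) : Plane → ℝ) = c • ofFun φ from ofFun_const_mul φ.locallyIntegrable c]
  exact holderNorm_smul _ _ _ _

theorem enorm_coef_le (j : Fin 3) : ‖(Fin.cases 1 (fun _ => -2) j : ℝ)‖ₑ ≤ 2 := by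
  refine Fin.cases ?_ (fun i => ?_) j
  · simp
  · simp [← ofReal_norm]

theorem coefs_sub (χ : Cutoff) (κ : ℝ) (q q' : Distr × Distr) (j : Fin 3) (m n : ℕ) :
    coefs χ κ q j m - coefs χ κ q' j n =
      (Fin.cases 1 (fun _ => -2) j : ℝ) • (apx κ (tgt χ q j) m - apx κ (tgt χ q' j) n) := by
  rw [coefs, coefs, smul_sub]

theorem isCoef_coefs {χ : Cutoff} {κ : ℝ} {q : Distr × Distr} (h : ∀ j, tgt χ q j ∈ HolderSpace (-κ) (polyWeight κ))
    (j : Fin 3) : IsCoef κ (coefs χ κ q j) := by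
  intro ε hε
  have ht := (tendsto_holderNorm_apx (h j)).eventually (gt_mem_nhds (ENNReal.div_pos hε.ne' (by simp : (4 : ℝ≥0∞) ≠ ⊤)))
  obtain ⟨N, hN⟩ := eventually_atTop.1 ht
  refine ⟨N, fun m hm n hn => ?_⟩
  rw [coefs_sub]
  refine (hol_smul _ _ _).trans ((mul_le_mul' (enorm_coef_le j) ((hol_sub_le (tgt χ q j) _ _).trans
    (add_le_add (hN m hm).le (hN n hn).le))).trans_eq ?_)
  rw [← mul_two, ← mul_assoc, mul_comm 2, mul_assoc, show (2 : ℝ≥0∞) * 2 = 4 by norm_num, ENNReal.div_mul_cancel (by simp) (by simp)]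

theorem coefBound_coefs_sub {χ : Cutoff} {κ : ℝ} {q q' : Distr × Distr}
    (h : ∀ j, tgt χ q j ∈ HolderSpace (-κ) (polyWeight κ)) (h' : ∀ j, tgt χ q' j ∈ HolderSpace (-κ) (polyWeight κ))
    {R δ : ℝ≥0∞} (hR : ∀ j, holderNorm (-κ) (polyWeight κ) (tgt χ q j - tgt χ q' j) ≤ R) (hδ : 0 < δ) :
    CoefBound κ (coefs χ κ q - coefs χ κ q') (2 * R + δ) := by
  refine ⟨fun j => (isCoef_coefs h j).sub (isCoef_coefs h' j), fun j => ?_⟩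
  have hδ' : 0 < δ / 4 := ENNReal.div_pos hδ.ne' (by simp)
  filter_upwards [(tendsto_holderNorm_apx (h j)).eventually (gt_mem_nhds hδ'),
    (tendsto_holderNorm_apx (h' j)).eventually (gt_mem_nhds hδ')] with n h1 h2
  change hol κ (coefs χ κ q j n - coefs χ κ q' j n) ≤ _
  rw [coefs_sub]
  refine (hol_smul _ _ _).trans ((mul_le_mul' (enorm_coef_le j) (?_ : _ ≤ R + (δ / 4 + δ / 4))).trans_eq ?_)
  · rw [hol, ofFun_test_sub]
    have e : ofFun (apx κ (tgt χ q j) n) - ofFun (apx κ (tgt χ q' j) n) = (tgt χ q j - tgt χ q' j) +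
        (-(tgt χ q j - ofFun (apx κ (tgt χ q j) n)) + (tgt χ q' j - ofFun (apx κ (tgt χ q' j) n))) := by abel
    rw [e]
    refine (holderNorm_add_le _ (polyWeight_pos κ) _ _).trans (add_le_add (hR j)
      ((holderNorm_add_le _ (polyWeight_pos κ) _ _).trans ?_))
    rw [holderNorm_neg]
    exact add_le_add h1.le h2.le
  · rw [mul_add]
    congr 1
    rw [← mul_two, ← mul_assoc, mul_comm 2, mul_assoc, show (2 : ℝ≥0∞) * 2 = 4 by norm_num, ENNReal.div_mul_cancel (by simp) (by simp)]

theorem coefBound_coefs {χ : Cutoff} {κ : ℝ} {q : Distr × Distr}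
    (h : ∀ j, tgt χ q j ∈ HolderSpace (-κ) (polyWeight κ)) {R : ℝ≥0∞}
    (hR : ∀ j, holderNorm (-κ) (polyWeight κ) (tgt χ q j) ≤ R) : CoefBound κ (coefs χ κ q) (2 * R + 2) := by
  refine ⟨isCoef_coefs h, fun j => Eventually.of_forall fun n => (hol_smul _ _ _).trans
    ((mul_le_mul' (enorm_coef_le j) (?_ : _ ≤ R + 1)).trans_eq (by ring))⟩
  rw [hol, ← sub_add_cancel (ofFun (apx κ (tgt χ q j) n)) (tgt χ q j), add_comm R]
  refine (holderNorm_add_le _ (polyWeight_pos κ) _ _).trans (add_le_add ?_ (hR j))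
  rw [holderNorm_sub_comm]
  exact (holderNorm_sub_apx_lt (h j) n).le.trans (by simp)

instance neBot_approx {α : ℝ} {ρ : Plane → ℝ} {S : Distr} [h : Fact (S ∈ HolderSpace α ρ)] : (approx α ρ S).NeBot := by
  refine comap_neBot fun t ht => ?_
  obtain ⟨ε, hε, hεt⟩ := (ENNReal.nhds_zero_basis).mem_iff.1 ht
  obtain ⟨φ, hφ⟩ := h.out ε hε
  exact ⟨φ, hεt hφ⟩

theorem tendsto_pairing_approx {κ τ : ℝ} (hκ : 0 < κ) (hκ1 : κ ≤ 1 / 2) (hτ : 0 < τ) {S : Distr}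
    (hS : S ∈ HolderSpace (-κ) (polyWeight κ)) {g : Plane → ℝ} (hg : Reg κ g) (x : Plane) :
    Tendsto (fun φ : Test => ∫ y, φ y * g y * heatKernel τ (x - y)) (approx (-κ) (polyWeight κ) S)
      (𝓝 (pair (apx κ S) g τ x)) := by
  obtain ⟨C, hC, h⟩ := exists_pairing_bound hκ (by linarith) τ
  obtain ⟨l, hl⟩ := hg.2
  have hcoef : IsCoef κ (apx κ S) := by
    intro ε hε
    obtain ⟨N, hN⟩ := eventually_atTop.1 ((tendsto_holderNorm_apx hS).eventually (gt_mem_nhds (ENNReal.half_pos hε.ne')))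
    exact ⟨N, fun m hm n hn => (hol_sub_le S _ _).trans ((add_le_add (hN m hm).le (hN n hn).le).trans_eq (ENNReal.add_halves ε))⟩
  set K : ℝ≥0∞ := C * ofReal (τ ^ (-(κ / 2))) * kconv (4 * τ) (fun y => pw κ y * gm κ g y) x with hK
  have hKt : K ≠ ⊤ := mul_ne_top (mul_ne_top hC ofReal_ne_top)
    (kconv_pw_gm_lt_top hκ hκ1 hτ hg (by positivity) x).ne
  have hb : ∀ φ φ' : Test, ‖(∫ y, φ y * g y * heatKernel τ (x - y)) - ∫ y, φ' y * g y * heatKernel τ (x - y)‖ₑ ≤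
      K * (holderNorm (-κ) (polyWeight κ) (S - ofFun φ) + holderNorm (-κ) (polyWeight κ) (S - ofFun φ')) := by
    intro φ φ'
    rw [← integral_sub (integrable_pairing φ hg.locallyIntegrable τ x) (integrable_pairing φ' hg.locallyIntegrable τ x)]
    have e : ∀ y, φ y * g y * heatKernel τ (x - y) - φ' y * g y * heatKernel τ (x - y) =
        (φ - φ' : Test) y * g y * heatKernel τ (x - y) := fun y => by
      change _ = (φ y - φ' y) * _ * _; ring
    simp_rw [e]
    refine (h (φ - φ') l τ hτ le_rfl g hg.1 ((eLpNorm_le_nrm κ l g).trans_lt hl) x).trans ?_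
    rw [hK, mul_right_comm C, mul_right_comm _ (holderNorm _ _ _)]
    exact mul_le_mul_right (hol_sub_le S φ φ') _
  have hlim : ∀ φ : Test, ‖(∫ y, φ y * g y * heatKernel τ (x - y)) - pair (apx κ S) g τ x‖ₑ ≤
      K * holderNorm (-κ) (polyWeight κ) (S - ofFun φ) := by
    intro φ
    have h1 := (tendsto_const_nhds (x := ∫ y, φ y * g y * heatKernel τ (x - y))).sub (tendsto_pair hκ hκ1 hτ hcoef hg x)
    have h2 := ENNReal.Tendsto.const_mul (a := K) ((tendsto_holderNorm_apx hS).const_add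
      (holderNorm (-κ) (polyWeight κ) (S - ofFun φ))) (Or.inr hKt)
    rw [add_zero] at h2
    exact le_of_tendsto_of_tendsto' h1.enorm h2 fun n => hb φ _
  rw [tendsto_iff_edist_tendsto_0]
  have h3 : Tendsto (fun φ : Test => K * holderNorm (-κ) (polyWeight κ) (S - ofFun φ)) (approx (-κ) (polyWeight κ) S) (𝓝 0) := by
    have := ENNReal.Tendsto.const_mul (a := K) (tendsto_comap : Tendsto _ (approx (-κ) (polyWeight κ) S) _) (Or.inr hKt)
    rwa [mul_zero] at this
  refine tendsto_of_tendsto_of_tendsto_of_le_of_le tendsto_const_nhds h3 (fun _ => zero_le) fun φ => ?_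
  rw [edist_eq_enorm_sub]
  exact hlim φ

theorem hasProductPairing_iff {κ τ : ℝ} (hκ : 0 < κ) (hκ1 : κ ≤ 1 / 2) (hτ : 0 < τ) {S : Distr}
    (hS : S ∈ HolderSpace (-κ) (polyWeight κ)) {g v : Plane → ℝ} (hg : Reg κ g) (hv : v =ᵐ[volume] g) (x : Plane) (c : ℝ) :
    HasProductPairing κ S v (fun y => heatKernel τ (x - y)) c ↔ c = pair (apx κ S) g τ x := by
  have := Fact.mk hS
  have e : ∀ φ : Test, ∫ y, φ y * v y * heatKernel τ (x - y) = ∫ y, φ y * g y * heatKernel τ (x - y) := fun φ =>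
    integral_congr_ae (hv.mono fun y hy => by simp only [hy])
  rw [HasProductPairing]
  simp_rw [e]
  have ht := tendsto_pairing_approx hκ hκ1 hτ hS hg x
  exact ⟨fun h => tendsto_nhds_unique h.2 ht, fun h => ⟨hS, h ▸ ht⟩⟩

theorem pair_coefs {χ : Cutoff} {κ τ : ℝ} (hκ : 0 < κ) (hκ1 : κ ≤ 1 / 2) (hτ : 0 < τ) {q : Distr × Distr}
    (h : ∀ j, tgt χ q j ∈ HolderSpace (-κ) (polyWeight κ)) (j : Fin 3) {g : Plane → ℝ} (hg : Reg κ g) (x : Plane) :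
    pair (coefs χ κ q j) g τ x = (Fin.cases 1 (fun _ => -2) j : ℝ) * pair (apx κ (tgt χ q j)) g τ x := by
  have := Fact.mk (h j)
  have h1 := tendsto_pairing_approx hκ hκ1 hτ (h j) hg x
  have h2 : Tendsto (apx κ (tgt χ q j)) atTop (approx (-κ) (polyWeight κ) (tgt χ q j)) :=
    tendsto_comap_iff.2 (tendsto_holderNorm_apx (h j))
  refine tendsto_nhds_unique (tendsto_pair hκ hκ1 hτ (isCoef_coefs h j) hg x) ?_
  refine ((h1.comp h2).const_mul _).congr fun n => ?_
  simp only [Function.comp_apply]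
  rw [← integral_const_mul]
  refine integral_congr_ae (Eventually.of_forall fun y => ?_)
  change _ = (_ * apx κ (tgt χ q j) n y) * _ * _
  ring

theorem hasForcingPairing_iff {χ : Cutoff} {κ τ : ℝ} (hκ : 0 < κ) (hκ1 : κ ≤ 1 / 2) (hτ : 0 < τ) {q : Distr × Distr}
    (h : ∀ j, tgt χ q j ∈ HolderSpace (-κ) (polyWeight κ)) {V : Fin 3 → Plane → ℝ} (hV : ∀ j, Reg κ (V j))
    (hg : IsWeakGrad (V 0) fun i => V i.succ) {v : Plane → ℝ} (hv : v =ᵐ[volume] V 0) (x : Plane) (c : ℝ) :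
    HasForcingPairing χ κ q v (fun y => heatKernel τ (x - y)) c ↔ c = forc (coefs χ κ q) V τ x := by
  have e : forc (coefs χ κ q) V τ x = -2 * (∑ i : Fin 2, pair (apx κ (tgt χ q i.succ)) (V i.succ) τ x) +
      pair (apx κ (tgt χ q 0)) (V 0) τ x := by
    rw [forc, Fin.sum_univ_succ, pair_coefs hκ hκ1 hτ h 0 (hV 0)]
    simp_rw [fun i : Fin 2 => pair_coefs hκ hκ1 hτ h i.succ (hV i.succ) x]
    simp only [Fin.cases_zero, Fin.cases_succ, one_mul, ← Finset.mul_sum]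
    rw [add_comm]
  rw [e]
  constructor
  · rintro ⟨D, a, b, hD, ha, hb, rfl⟩
    have hD' := (hD.congr hv fun i => EventuallyEq.rfl).unique hg
    rw [← (hasProductPairing_iff hκ hκ1 hτ (h 0) (hV 0) hv x b).1 hb]
    congr 2
    exact Finset.sum_congr rfl fun i _ => (hasProductPairing_iff hκ hκ1 hτ (h i.succ) (hV i.succ) (hD' i) x _).1 (ha i)
  · intro hc
    refine ⟨fun i => V i.succ, _, _, hg.congr hv.symm fun i => EventuallyEq.rfl, fun i => ?_, ?_, hc⟩
    · exact (hasProductPairing_iff hκ hκ1 hτ (h i.succ) (hV i.succ) EventuallyEq.rfl x _).2 rfl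
    · exact (hasProductPairing_iff hκ hκ1 hτ (h 0) (hV 0) hv x _).2 rfl

theorem hconv_forc {κ r τ : ℝ} (hκ : 0 < κ) (hκ1 : κ ≤ 1 / 2) (hr : 0 < r) (hτ : 0 < τ) {a : Coef}
    (ha : ∀ j, IsCoef κ (a j)) {v : Fin 3 → Plane → ℝ} (hv : ∀ j, Reg κ (v j)) (x : Plane) :
    hconv 0 r (forc a v τ) x = forc a v (r + τ) x := by
  have hi : ∀ j, Integrable fun y => kern 0 r (x - y) * pair (a j) (v j) τ y := by
    intro j
    obtain ⟨l, hl⟩ := (hv j).2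
    obtain ⟨R, hR, hRa⟩ := (ha j).exists_bound hκ
    obtain ⟨C, hC, h⟩ := exists_eLpNorm_pair_le hκ hκ1 |l| τ
    exact integrable_kern_mul hr 0 (measurable_pair (a j) (G := fun _ => v j) ((hv j).1.comp measurable_snd)
      measurable_const measurable_id) ((h (a j) R l τ le_rfl (ha j) hRa hτ le_rfl (v j) (hv j).1 hl).trans_lt
      (mul_lt_top (mul_lt_top (mul_lt_top hC.lt_top hR.lt_top) ofReal_lt_top) hl)) x
  simp_rw [hconv, forc, Finset.mul_sum]
  rw [integral_finsetSum _ fun j _ => hi j]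
  exact Finset.sum_congr rfl fun j _ => hconv_pair hκ hκ1 hr hτ (ha j) (hv j) x

theorem contDiff_integral_mul_sub {μ : Measure (ℝ × Plane)} {h : ℝ × Plane → ℝ} (hh : Integrable h μ) {R : ℝ}
    (hR : ∀ᵐ q ∂μ, h q ≠ 0 → ‖q‖ ≤ R) {k : ℝ × Plane → ℝ} (hk : ContDiff ℝ ∞ k) :
    ContDiff ℝ ∞ fun p => ∫ q, h q * k (p - q) ∂μ := by
  rw [contDiff_iff_contDiffAt]
  intro p₀
  let θ : ContDiffBump (0 : ℝ × Plane) := ⟨‖p₀‖ + 1 + |R|, ‖p₀‖ + 2 + |R|, by positivity, by linarith⟩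
  have hs : ContDiff ℝ ∞ (h ⋆[ContinuousLinearMap.mul ℝ ℝ, μ] fun p => θ p * k p) :=
    (θ.hasCompactSupport.mul_right).contDiff_convolution_right _ hh.locallyIntegrable (θ.contDiff.mul hk)
  refine hs.contDiffAt.congr_of_eventuallyEq ?_
  filter_upwards [Metric.ball_mem_nhds p₀ one_pos] with p hp
  rw [convolution_def]
  refine integral_congr_ae ?_
  filter_upwards [hR] with q hq
  by_cases h0 : h q = 0
  · simp [h0]
  rw [ContinuousLinearMap.mul_apply', θ.one_of_mem_closedBall, one_mul]
  rw [mem_closedBall_zero_iff]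
  have h1 : ‖p‖ ≤ ‖p₀‖ + 1 := by
    have := norm_le_norm_add_norm_sub' p p₀
    rw [Metric.mem_ball, dist_eq_norm] at hp
    linarith
  exact (norm_sub_le _ _).trans (add_le_add h1 ((hq h0).trans (le_abs_self R)))

/-- A smooth cutoff in time, vanishing below `ε / 2` and equal to one above `ε`. -/
def cut (ε τ : ℝ) : ℝ := Real.smoothTransition (2 * τ / ε - 1)

theorem cut_eq_zero {ε τ : ℝ} (hε : 0 < ε) (h : τ ≤ ε / 2) : cut ε τ = 0 :=
  Real.smoothTransition.zero_of_nonpos (by rw [sub_nonpos, div_le_one hε]; linarith)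

theorem cut_eq_one {ε τ : ℝ} (hε : 0 < ε) (h : ε ≤ τ) : cut ε τ = 1 :=
  Real.smoothTransition.one_of_one_le (by rw [le_sub_iff_add_le, le_div_iff₀ hε]; linarith)

theorem cut_mem (ε τ : ℝ) : 0 ≤ cut ε τ ∧ cut ε τ ≤ 1 :=
  ⟨Real.smoothTransition.nonneg _, Real.smoothTransition.le_one _⟩

theorem abs_cut_le (ε τ : ℝ) : |cut ε τ| ≤ 1 := by
  rw [abs_of_nonneg (cut_mem ε τ).1]
  exact (cut_mem ε τ).2

theorem contDiff_cut (ε : ℝ) : ContDiff ℝ ∞ (cut ε) :=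
  Real.smoothTransition.contDiff.comp ((contDiff_const.mul contDiff_id).div_const _ |>.sub contDiff_const)

theorem contDiff_cut_mul_heatKernel {ε : ℝ} (hε : 0 < ε) :
    ContDiff ℝ ∞ fun p : ℝ × Plane => cut ε p.1 * heatKernel p.1 p.2 := by
  rw [contDiff_iff_contDiffAt]
  intro p
  rcases lt_or_ge p.1 (ε / 2) with h | h
  · refine contDiffAt_const.congr_of_eventuallyEq (f := fun _ => (0 : ℝ)) ?_
    filter_upwards [(isOpen_lt continuous_fst continuous_const).mem_nhds h] with y hy
    rw [cut_eq_zero hε (le_of_lt hy), zero_mul]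
  · have hp : p.1 ≠ 0 := by linarith
    have h1 : ContDiffAt ℝ ∞ (fun p : ℝ × Plane => p.1) p := contDiffAt_fst
    unfold heatKernel
    refine ((contDiff_cut ε).contDiffAt.comp p h1).mul (((contDiffAt_const.mul h1).inv (by simp [hp, Real.pi_ne_zero])).mul ?_)
    exact (((contDiff_norm_sq ℝ).comp contDiff_snd).neg.contDiffAt.div (contDiffAt_const.mul h1) (by simp [hp])).exp

theorem contDiffOn_hconv {f : Plane → ℝ} (hf : Integrable f) (hc : HasCompactSupport f) :
    ContDiffOn ℝ ∞ (fun p : ℝ × Plane => hconv 0 p.1 f p.2) (Set.Ioi 0 ×ˢ Set.univ) := by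
  intro p hp
  have hp0 : 0 < p.1 := hp.1
  refine ContDiffAt.contDiffWithinAt ?_
  obtain ⟨R, hR⟩ := hc.isCompact.isBounded.exists_norm_le
  have hm : MeasurableEmbedding (Prod.mk (0 : ℝ) : Plane → ℝ × Plane) := measurableEmbedding_prodMk_left 0
  have hs := contDiff_integral_mul_sub (μ := volume.map (Prod.mk (0 : ℝ))) (h := fun q => f q.2) (R := R)
    (hm.integrable_map_iff.2 hf) (by
      rw [hm.ae_map_iff]
      refine Eventually.of_forall fun y hy => ?_
      rw [Prod.norm_mk, norm_zero, max_eq_right (norm_nonneg _)]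
      exact hR y (subset_tsupport _ hy)) (contDiff_cut_mul_heatKernel (ε := p.1 / 2) (by positivity))
  refine hs.contDiffAt.congr_of_eventuallyEq ?_
  filter_upwards [(isOpen_lt continuous_const continuous_fst).mem_nhds (show p.1 / 2 < p.1 by linarith)] with x hx
  rw [hm.integral_map, hconv]
  refine integral_congr_ae (Eventually.of_forall fun y => ?_)
  simp only [Prod.fst_sub, Prod.snd_sub, sub_zero]
  rw [cut_eq_one (by positivity) (le_of_lt hx), one_mul, mul_comm]
  rfl

theorem pair_const (φ : Test) (g : Plane → ℝ) (τ : ℝ) (x : Plane) :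
    pair (fun _ => φ) g τ x = ∫ y, φ y * g y * heatKernel τ (x - y) := tendsto_const_nhds.limUnder_eq

theorem Adm.integrable_mul {κ l T : ℝ} (hκ1 : κ < 1 / 2) {W : Fld} (h : Adm κ l T W)
    (φ : Test) (j : Fin 3) :
    Integrable (fun p : ℝ × Plane => φ p.2 * W j p.1 p.2) ((volume.restrict (Ioo 0 T)).prod volume) := by
  obtain ⟨hm, c, hc0, hc, hB⟩ := h
  rcases le_or_gt T 0 with hT | hT
  · simp [Set.Ioo_eq_empty (not_lt.2 hT)]
  have hi : ∫⁻ s in Ioo 0 T, c * ofReal (s ^ (-(1 / 2 + κ))) ≠ ⊤ := by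
    rw [lintegral_const_mul' _ _ hc, lintegral_Ioo_rpow (by linarith) hT]
    exact mul_ne_top hc ofReal_ne_top
  have hsq := (eLpNorm_integral_le (expMeas (l + T)) (volume.restrict (Ioo 0 T)) (u := W j)
    (B := fun s => c * ofReal (s ^ (-(1 / 2 + κ)))) (hm j) (by fun_prop) (by
      filter_upwards [ae_restrict_mem measurableSet_Ioo] with s hs
      have := hs.1
      exact ⟨mul_ne_zero hc0 (by simp only [ne_eq, ENNReal.ofReal_eq_zero, not_le]; positivity),
        mul_ne_top hc ofReal_ne_top⟩) (by
      filter_upwards [ae_restrict_mem measurableSet_Ioo] with s hs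
      have h1 := hB s ⟨hs.1, hs.2.le⟩ j
      rw [zero_mul, Real.exp_zero, mul_one] at h1
      exact ((eLpNorm_mono_measure _ (expMeas_mono (by linarith [hs.2]))).trans (eLpNorm_le_nrm κ (l + s) _)).trans h1) hi).2.1
  exact (integrable_test_mul_prod (volume.restrict (Ioo 0 T)) (hm j) hsq φ).swap

theorem exists_contDiff_duh {κ l T : ℝ} (hκ : 0 < κ) (hκ1 : κ < 1 / 10) {W : Fld} (h : Adm κ l T W)
    (b : Fin 3 → Test) {ε : ℝ} (hε : 0 < ε) : ∃ S : ℝ × Plane → ℝ, ContDiff ℝ ∞ S ∧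
      ∀ t ∈ Ioc 0 T, ∀ x, duh (cut ε) (fun j _ => b j) W 0 t x = S (t, x) := by
  set μ : Measure (ℝ × Plane) := (volume.restrict (Ioo 0 T)).prod volume with hμ
  have hint := fun j => h.integrable_mul (by linarith) (b j) j
  obtain ⟨R, hR⟩ : ∃ R, ∀ j, ∀ y, b j y ≠ 0 → ‖y‖ ≤ R := by
    have := fun j => (b j).hasCompactSupport.isCompact.isBounded.exists_norm_le
    choose R hR using this
    refine ⟨∑ j, |R j|, fun j y hy => (hR j y (subset_tsupport _ hy)).trans ((le_abs_self _).trans ?_)⟩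
    exact Finset.single_le_sum (f := fun j => |R j|) (fun _ _ => abs_nonneg _) (Finset.mem_univ j)
  refine ⟨fun p => ∑ j, ∫ q, (b j q.2 * W j q.1 q.2) * (cut ε (p - q).1 * heatKernel (p - q).1 (p - q).2) ∂μ,
    ContDiff.sum fun j _ => contDiff_integral_mul_sub (hint j) (R := max T R) ?_ (contDiff_cut_mul_heatKernel hε),
    fun t ht x => ?_⟩
  · have : ∀ᵐ q ∂μ, q.1 ∈ Ioo 0 T := by
      rw [hμ]
      exact Measure.quasiMeasurePreserving_fst.ae (ae_restrict_mem measurableSet_Ioo)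
    filter_upwards [this] with q hq h0
    rw [Prod.norm_def]
    refine max_le_max ?_ (hR j _ (left_ne_zero_of_mul h0))
    rw [Real.norm_of_nonneg hq.1.le]
    exact hq.2.le
  · obtain ⟨K, hK⟩ : ∃ K, ∀ q : ℝ × Plane, ‖cut ε q.1 * heatKernel q.1 q.2‖ ≤ K := by
      refine ⟨1 * (4 * Real.pi * (ε / 2))⁻¹, fun q => ?_⟩
      rcases le_or_gt q.1 (ε / 2) with hq | hq
      · rw [cut_eq_zero hε hq, zero_mul, norm_zero]; positivity
      · have hq0 : 0 < q.1 := by linarith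
        rw [norm_mul]
        refine mul_le_mul ?_ ?_ (norm_nonneg _) zero_le_one
        · exact abs_cut_le ε _
        · rw [Real.norm_of_nonneg (heatKernel_nonneg hq0.le _), heatKernel]
          have h1 : Real.exp (-‖q.2‖ ^ 2 / (4 * q.1)) ≤ 1 := Real.exp_le_one_iff.2 (by
            rw [neg_div, neg_nonpos]; positivity)
          calc _ ≤ (4 * Real.pi * q.1)⁻¹ * 1 := by gcongr
            _ ≤ _ := by rw [mul_one]; gcongr
    have hj : ∀ j, Integrable (fun q : ℝ × Plane => (b j q.2 * W j q.1 q.2) *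
        (cut ε (t - q.1) * heatKernel (t - q.1) (x - q.2))) μ := fun j =>
      (hint j).mul_bdd (c := K) ((contDiff_cut_mul_heatKernel hε).continuous.comp
        (continuous_const.sub continuous_id : Continuous fun q : ℝ × Plane => (t, x) - q)).aestronglyMeasurable
        (Eventually.of_forall fun q => hK ((t, x) - q))
    simp only [Prod.fst_sub, Prod.snd_sub]
    rw [← integral_finsetSum _ fun j _ => hj j, hμ, integral_prod _ (integrable_finsetSum _ fun j _ => hj j), duh]
    have hsub : Ioo 0 t ⊆ Ioo 0 T := Set.Ioo_subset_Ioo_right ht.2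
    rw [setIntegral_eq_of_subset_of_forall_sdiff_eq_zero measurableSet_Ioo hsub]
    · refine setIntegral_congr_fun measurableSet_Ioo fun s hs => ?_
      have hst : 0 < (t - s) / 2 := by linarith [hs.2]
      have hr : ∀ j, Reg κ (W j s) := h.reg ⟨hs.1, hs.2.le.trans ht.2⟩
      simp only [duhI]
      rw [hconv_forc hκ (by linarith) hst hst (fun j => isCoef_const κ (b j)) hr, add_halves, forc, Finset.mul_sum,
        integral_finsetSum]
      · refine Finset.sum_congr rfl fun j _ => ?_
        rw [pair_const, ← integral_const_mul]
        refine integral_congr_ae (Eventually.of_forall fun y => ?_)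
        simp only
        ring
      · intro j _
        refine ((integrable_pairing (b j) (hr j).locallyIntegrable (t - s) x).const_mul (cut ε (t - s))).congr
          (Eventually.of_forall fun y => ?_)
        simp only
        ring
    · intro s hs
      have hst : t - s ≤ ε / 2 := by
        have : ¬ s < t := fun h' => hs.2 ⟨hs.1.1, h'⟩
        linarith
      simp [cut_eq_zero hε hst]

instance (l : ℝ) : IsLocallyFiniteMeasure (expMeas l) := IsLocallyFiniteMeasure.withDensity_ofReal (by fun_prop)

theorem exists_test_eLpNorm_sub_le {l : ℝ} {f : Plane → ℝ} (hf : Measurable f) (h : eLpNorm f 2 (expMeas l) < ⊤)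
    {ε : ℝ} (hε : 0 < ε) : ∃ φ : Test, eLpNorm (fun x => f x - φ x) 2 (expMeas l) ≤ ofReal ε := by
  obtain ⟨g, hg, hg', hg''⟩ := MemLp.exist_eLpNorm_sub_le (by simp) (by simp)
    (⟨hf.aestronglyMeasurable, h⟩ : MemLp f 2 (expMeas l)) hε
  exact ⟨⟨g, hg', hg, fun _ _ => trivial⟩, hg''⟩

theorem eLpNorm_test_lt_top (φ : Test) (l : ℝ) : eLpNorm φ 2 (expMeas l) < ⊤ :=
  (φ.continuous.memLp_of_hasCompactSupport φ.hasCompactSupport).2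

theorem exists_pos_mul_lt {K ε : ℝ≥0∞} (hK : K ≠ ⊤) (hε : 0 < ε) : ∃ δ : ℝ, 0 < δ ∧ K * ofReal δ < ε := by
  have ht : Tendsto (fun δ : ℝ => K * ofReal δ) (𝓝[>] 0) (𝓝 (K * ofReal 0)) :=
    ENNReal.Tendsto.const_mul (ENNReal.tendsto_ofReal (tendsto_nhdsWithin_of_tendsto_nhds tendsto_id)) (Or.inr hK)
  rw [ENNReal.ofReal_zero, mul_zero] at ht
  obtain ⟨δ, hδ⟩ := (((ht.eventually (gt_mem_nhds hε)).and self_mem_nhdsWithin)).exists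
  exact ⟨δ, hδ.2, hδ.1⟩

theorem Bdd.pathNorm_le {κ l T : ℝ} {c : ℝ≥0∞} {V : Fld} (h : Bdd κ l T 0 c V)
    (hg : ∀ t ∈ Ioc 0 T, IsWeakGrad (V 0 t) fun i => V i.succ t) {u : ℝ → Plane → ℝ}
    (hu : ∀ t ∈ Ioc 0 T, u t =ᵐ[volume] V 0 t) : pathNorm l T (2 * κ) (1 / 2 + κ) u ≤ 3 * c := by
  refine iSup₂_le fun t ht => ?_
  have ht0 : 0 < t := ht.1
  have e : sobolevNorm (2 * κ) (expWeight (l + t)) (u t) = sobolevNorm (2 * κ) (expWeight (l + t)) (V 0 t) := by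
    rw [sobolevNorm_eq κ _ (hg t ht), sobolevNorm_eq κ _ ((hg t ht).congr (hu t ht).symm fun i => EventuallyEq.rfl),
      eLpNorm_congr_ae ((expMeas_absolutelyContinuous _).ae_eq (hu t ht))]
  have h1 := sobolevNorm_le κ (l + t) (V := fun i => V i t) (hg t ht)
  rw [e]
  refine (mul_le_mul_right (h1.trans (Finset.sum_le_card_nsmul _ _ _ fun i _ => h t ht i)) _).trans_eq ?_
  rw [Finset.card_univ, Fintype.card_fin, nsmul_eq_mul, zero_mul, Real.exp_zero, mul_one, ← mul_assoc, mul_left_comm, ← mul_assoc,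
    mul_assoc, mul_comm (ofReal _), mul_assoc, ← ofReal_mul (by positivity), ← Real.rpow_add ht0]
  simp [mul_comm]

theorem duh_cut_sub {κ l T : ℝ} (hκ : 0 < κ) (hκ1 : κ < 1 / 10) {W : Fld} (h : Adm κ l T W)
    (ε : ℝ) {a : Coef} {R : ℝ≥0∞} (ha : CoefBound κ a R) (hR : R ≠ ⊤) {t : ℝ} (ht : t ∈ Ioc 0 T)
    (i : Fin 3) : ∀ᵐ x, duh (fun τ => 1 - cut ε τ) a W i t x = duh 1 a W i t x - duh (cut ε) a W i t x := by
  have h1 := ((h.duh_facts hκ hκ1 (η := 1) measurable_const (fun _ => by simp) ha hR).1 t ht i).1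
  have h2 := ((h.duh_facts hκ hκ1 (contDiff_cut ε).continuous.measurable (abs_cut_le ε) ha hR).1 t ht i).1
  filter_upwards [h1, h2] with x hx1 hx2
  rw [duh, duh, duh, ← integral_sub hx1 hx2]
  refine integral_congr_ae (Eventually.of_forall fun s => ?_)
  simp only [duhI, Pi.one_apply]
  ring

theorem one_sub_cut_le {ε τ : ℝ} (hε : 0 < ε) (hτ : 0 < τ) : ‖1 - cut ε τ‖ₑ ≤
    ofReal (ε ^ (1 / 4 : ℝ)) * ofReal (τ ^ (-(1 / 4 : ℝ))) := by
  rcases le_or_gt ε τ with h | h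
  · rw [cut_eq_one hε h]; simp
  · rw [← ofReal_mul (by positivity), ← ofReal_norm, Real.norm_of_nonneg (by linarith [(cut_mem ε τ).2]),
      Real.rpow_neg hτ.le, ← div_eq_mul_inv]
    refine ofReal_le_ofReal (le_trans (by linarith [(cut_mem ε τ).1] : _ ≤ (1 : ℝ)) ?_)
    rw [one_le_div (by positivity)]
    exact Real.rpow_le_rpow hτ.le h.le (by norm_num)

theorem isWeakGrad_of_solves {κ l T : ℝ} (hκ : 0 < κ) (hκ1 : κ < 1 / 10) {W : Fld} (h : Adm κ l T W)
    {a : Coef} {R : ℝ≥0∞} (ha : CoefBound κ a R) (hR : R ≠ ⊤) {f : Plane → ℝ} (hf : Measurable f)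
    (hfl : eLpNorm f 2 (expMeas l) < ⊤) (hs : Solves T a (heat f) W) {t : ℝ} (ht : t ∈ Ioc 0 T) :
    IsWeakGrad (W 0 t) fun i => W i.succ t := by
  have := (isWeakGrad_hconv ht.1 hf hfl).lin (h.isWeakGrad_duh hκ hκ1 (η := 1) measurable_const (fun _ => by simp) ha hR ht) 1 1
  refine this.congr ((hs t ht 0).mono fun x hx => ?_) fun i => (hs t ht i.succ).mono fun x hx => ?_
  all_goals (simp only [one_mul]; rw [hx]; rfl)

theorem mem_pathSpace_of_solves {κ l T : ℝ} (hκ : 0 < κ) (hκ1 : κ < 1 / 10) (hT : 0 < T) {W : Fld}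
    (h : Adm κ l T W) {a : Coef} {R : ℝ≥0∞} (ha : CoefBound κ a R) (hR : R ≠ ⊤) {f : Plane → ℝ}
    (hf : Measurable f) (hfl : eLpNorm f 2 (expMeas l) < ⊤) (hs : Solves T a (heat f) W) {u : ℝ → Plane → ℝ}
    (hu : ∀ t ∈ Ioc 0 T, u t =ᵐ[volume] W 0 t) : u ∈ PathSpace l T (2 * κ) (1 / 2 + κ) := by
  obtain ⟨c, hc0, hc, hB⟩ := h.2
  refine ⟨(hB.pathNorm_le (fun t ht => isWeakGrad_of_solves hκ hκ1 h ha hR hf hfl hs ht) hu).trans_lt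
    (mul_lt_top (by simp) hc.lt_top), fun ε hε => ?_⟩
  obtain ⟨C₁, hC₁, h₁⟩ := exists_bdd_heat hκ (by linarith) |l| T
  obtain ⟨C₂, hC₂, h₂⟩ := exists_bdd_duh hκ hκ1 |l| T
  set A : ℝ≥0∞ := ofReal (T ^ (1 / 4 : ℝ)) with hA
  have hA0 : A ≠ 0 := by
    rw [hA]; simp only [ne_eq, ENNReal.ofReal_eq_zero, not_le]; positivity
  have hR1 : R + 1 ≠ ⊤ := by simp [hR]
  obtain ⟨δ, hδ, hδε⟩ := exists_pos_mul_lt (K := 3 * (C₁ + C₂ * A * c + C₂ * (R + 1) * c)) (by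
    refine mul_ne_top (by simp) (ENNReal.add_ne_top.2 ⟨ENNReal.add_ne_top.2 ⟨hC₁, ?_⟩, ?_⟩)
    · exact mul_ne_top (mul_ne_top hC₂ ofReal_ne_top) hc
    · exact mul_ne_top (mul_ne_top hC₂ hR1) hc) hε
  have hδ0 : ofReal δ ≠ 0 := by simpa using hδ
  obtain ⟨φ, hφ⟩ := exists_test_eLpNorm_sub_le hf hfl hδ
  obtain ⟨N, hN1, hN2⟩ : ∃ N, (∀ j, ∀ n ≥ N, hol κ (a j n - a j N) ≤ ofReal δ) ∧ ∀ j, hol κ (a j N) ≤ R := by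
    have h1 := fun j => ha.coef j (ofReal δ) (ENNReal.ofReal_pos.2 hδ)
    choose N hN using h1
    obtain ⟨M, hM⟩ := eventually_atTop.1 (eventually_all.2 ha.le)
    refine ⟨max M (Finset.univ.sup N), fun j n hn => ?_, fun j => hM _ (le_max_left _ _) j⟩
    have : N j ≤ max M (Finset.univ.sup N) := (Finset.le_sup (Finset.mem_univ j)).trans (le_max_right _ _)
    exact hN j n (this.trans hn) _ this
  set b : Coef := fun j _ => a j N with hb
  have hbB : CoefBound κ b (R + 1) := ⟨fun j => isCoef_const κ _, fun j => Eventually.of_forall fun _ => (hN2 j).trans le_self_add⟩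
  have habB : CoefBound κ (a - b) (ofReal δ) := ⟨fun j => (ha.coef j).sub (isCoef_const κ _), fun j => by
    filter_upwards [eventually_ge_atTop N] with n hn
    exact hN1 j n hn⟩
  set ε' : ℝ := δ ^ (4 : ℝ) with hε'
  have hε'0 : 0 < ε' := by positivity
  have hεδ : ε' ^ (1 / 4 : ℝ) = δ := by rw [hε', ← Real.rpow_mul hδ.le]; norm_num
  have hcm : Measurable (cut ε') := (contDiff_cut ε').continuous.measurable
  have hfφ : Measurable fun x => f x - φ x := hf.sub φ.continuous.measurable
  have B1 := (h₁ l _ le_rfl hfφ (hφ.trans_lt ofReal_lt_top)).mono (mul_le_mul_right hφ C₁)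
  have B2 := (h₂ 1 (a - b) W l 0 A (ofReal δ) c le_rfl measurable_const (fun τ hτ => by
    rw [hA, ← ofReal_mul (by positivity), Real.rpow_neg hτ.1.le, ← div_eq_mul_inv]
    simp only [Pi.one_apply, enorm_one, zero_mul, neg_zero, Real.exp_zero, ENNReal.ofReal_one, one_mul,
      ENNReal.one_le_ofReal]
    have := hτ.1
    rw [one_le_div (by positivity)]
    exact Real.rpow_le_rpow hτ.1.le hτ.2 (by norm_num)) habB h.1 hA0 ofReal_ne_top hδ0 ofReal_ne_top hc0 hc hB).2
  have B3 := (h₂ (fun τ => 1 - cut ε' τ) b W l 0 (ofReal δ) (R + 1) c le_rfl (measurable_const.sub hcm) (fun τ hτ => by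
    rw [zero_mul, neg_zero, Real.exp_zero, ENNReal.ofReal_one, mul_one, ← hεδ]
    exact one_sub_cut_le hε'0 hτ.1) hbB h.1 hδ0 ofReal_ne_top (by simp) hR1 hc0 hc hB).2
  have M1 := measurable_heat hfφ
  have M2 := measurable_duh (η := 1) measurable_const (a - b) h.1
  have M3 := measurable_duh (η := fun τ => 1 - cut ε' τ) (measurable_const.sub hcm) b h.1
  set V : Fld := fun i t x => heat φ i t x + duh (cut ε') b W i t x with hV
  have hE := (B1.lin B2 M1 M2 1 1).lin B3 (fun j => ((M1 j).const_mul 1).add ((M2 j).const_mul 1)) M3 1 1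
  refine ⟨V 0, ?_, ?_⟩
  · obtain ⟨S, hS, hSe⟩ := exists_contDiff_duh hκ hκ1 h (fun j => a j N) hε'0
    refine (((contDiffOn_hconv φ.integrable' φ.hasCompactSupport).mono ?_).add hS.contDiffOn).congr fun p hp => ?_
    · exact fun p hp => ⟨hp.1.1, trivial⟩
    · simp only [Function.uncurry, hV, heat, hb]
      rw [hSe p.1 hp.1 p.2]
  · refine (hE.pathNorm_le (fun t ht => ?_) (fun t ht => ?_)).trans_lt (lt_of_le_of_lt (le_of_eq ?_) hδε)
    · refine ((isWeakGrad_hconv ht.1 hfφ (hφ.trans_lt ofReal_lt_top)).lin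
        (h.isWeakGrad_duh hκ hκ1 (η := 1) measurable_const (fun _ => by simp) habB ofReal_ne_top ht) 1 1).lin
        (h.isWeakGrad_duh hκ hκ1 (η := fun τ => 1 - cut ε' τ) (measurable_const.sub hcm) (fun τ => ?_) hbB hR1 ht) 1 1
      rw [abs_of_nonneg] <;> linarith [(cut_mem ε' τ).1, (cut_mem ε' τ).2]
    · filter_upwards [hu t ht, hs t ht 0, duh_coef_sub hκ hκ1 h (η := 1) measurable_const (fun _ => by simp) ha hR hbB hR1 ht 0,
        duh_cut_sub hκ hκ1 h ε' hbB hR1 ht 0] with x e1 e2 e3 e4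
      have e5 := hconv_lin ht.1 0 hf φ.continuous.measurable hfl (eLpNorm_test_lt_top φ l) 1 (-1) x
      have e6 : (fun y => 1 * f y + -1 * φ y) = fun y => f y - φ y := by funext y; ring
      rw [e6] at e5
      simp only [Pi.sub_apply]
      rw [e1, e2, e3, e4]
      simp only [hV, heat, e5]
      ring
    · simp only [enorm_one, one_mul]
      ring

theorem IsWeakGrad.exists_measurable {v : Plane → ℝ} {D : Fin 2 → Plane → ℝ} (h : IsWeakGrad v D) :
    ∃ V : Fin 3 → Plane → ℝ, (∀ j, Measurable (V j)) ∧ v =ᵐ[volume] V 0 ∧ IsWeakGrad (V 0) fun i => V i.succ := by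
  have m0 := h.1.aestronglyMeasurable.aemeasurable
  have m := fun i => (h.2 i).1.aestronglyMeasurable.aemeasurable
  let V : Fin 3 → Plane → ℝ := fun j => Fin.cases (m0.mk v) (fun i => (m i).mk (D i)) j
  exact ⟨V, Fin.cases m0.measurable_mk fun i => (m i).measurable_mk,
    m0.ae_eq_mk, h.congr m0.ae_eq_mk fun i => (m i).ae_eq_mk⟩

theorem sobolevNorm_congr_ae (κ l : ℝ) {v v' : Plane → ℝ} {D : Fin 2 → Plane → ℝ} (h : IsWeakGrad v D) (he : v =ᵐ[volume] v') :
    sobolevNorm (2 * κ) (expWeight l) v = sobolevNorm (2 * κ) (expWeight l) v' := by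
  rw [sobolevNorm_eq κ l h, sobolevNorm_eq κ l (h.congr he fun i => EventuallyEq.rfl),
    eLpNorm_congr_ae ((expMeas_absolutelyContinuous l).ae_eq he)]

theorem sobolevNorm_sub_le (κ l : ℝ) {u u' : Plane → ℝ} (h : sobolevNorm (2 * κ) (expWeight l) u < ⊤)
    (h' : sobolevNorm (2 * κ) (expWeight l) u' < ⊤) : sobolevNorm (2 * κ) (expWeight l) (fun x => u x - u' x) ≤
      5 * (sobolevNorm (2 * κ) (expWeight l) u + sobolevNorm (2 * κ) (expWeight l) u') := by
  obtain ⟨D, hD⟩ := exists_isWeakGrad_of_sobolevNorm h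
  obtain ⟨D', hD'⟩ := exists_isWeakGrad_of_sobolevNorm h'
  obtain ⟨V, mV, eV, gV⟩ := hD.exists_measurable
  obtain ⟨V', mV', eV', gV'⟩ := hD'.exists_measurable
  rw [sobolevNorm_congr_ae κ l hD eV, sobolevNorm_congr_ae κ l hD' eV']
  set Z := sobolevNorm (2 * κ) (expWeight l) (V 0) + sobolevNorm (2 * κ) (expWeight l) (V' 0) with hZ
  have hg : IsWeakGrad (fun x => u x - u' x) fun i x => V i.succ x - V' i.succ x := by
    refine (gV.lin gV' 1 (-1)).congr ?_ fun i => Eventually.of_forall fun x => by ring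
    filter_upwards [eV, eV'] with x e e'
    rw [e, e']; ring
  have e0 : eLpNorm (fun x => u x - u' x) 2 (expMeas l) ≤ Z := by
    have e := eLpNorm_congr_ae (p := 2) ((expMeas_absolutelyContinuous l).ae_eq (eV.sub eV'))
    change eLpNorm (u - u') 2 (expMeas l) ≤ Z
    rw [e]
    exact (eLpNorm_sub_le (mV 0).aestronglyMeasurable (mV' 0).aestronglyMeasurable (by simp)).trans
      (add_le_add (le_sobolevNorm κ l gV).1 (le_sobolevNorm κ l gV').1)
  have e1 : ∀ i : Fin 2, nrm κ l (fun x => V i.succ x - V' i.succ x) ≤ 2 * Z := fun i => by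
    refine (nrm_sub_le κ l (mV i.succ) (mV' i.succ)).trans ?_
    rw [hZ, mul_add]
    exact add_le_add ((le_sobolevNorm κ l gV).2 i) ((le_sobolevNorm κ l gV').2 i)
  rw [sobolevNorm_eq κ l hg]
  have : (5 * Z) = ((5 * Z) ^ 2) ^ (1 / 2 : ℝ) := by
    rw [← ENNReal.rpow_natCast, ← ENNReal.rpow_mul]; norm_num
  rw [this]
  refine ENNReal.rpow_le_rpow ?_ (by norm_num)
  have e2 := fun i => le_self_add.trans (e1 i)
  have e3 := fun i => le_add_self.trans (e1 i)
  calc _ ≤ Z ^ 2 + ∑ _i : Fin 2, (2 * Z) ^ 2 + ∑ _i : Fin 2, (2 * Z) ^ 2 :=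
        add_le_add (add_le_add (pow_le_pow_left' e0 2) (Finset.sum_le_sum fun i _ => pow_le_pow_left' (e2 i) 2))
          (Finset.sum_le_sum fun i _ => pow_le_pow_left' (e3 i) 2)
    _ = 17 * Z ^ 2 := by simp only [Finset.sum_const, Finset.card_univ, Fintype.card_fin, nsmul_eq_mul]; push_cast; ring
    _ ≤ 25 * Z ^ 2 := mul_le_mul_left (by norm_num) _
    _ = (5 * Z) ^ 2 := by ring

/-- A function of time and space together with its spatial derivatives, on the time interval `(0, T]`. -/
def jet (T : ℝ) (v : ℝ → Plane → ℝ) (i : Fin 3) (t : ℝ) (x : Plane) : ℝ :=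
  (Ioc 0 T ×ˢ (Set.univ : Set Plane)).indicator
    (fun p => Fin.cases (v p.1 p.2) (fun j : Fin 2 => fderiv ℝ (v p.1) p.2 (bv j)) i) (t, x)

theorem jet_zero {T t : ℝ} (ht : t ∈ Ioc 0 T) (v : ℝ → Plane → ℝ) : jet T v 0 t = v t := by
  funext x
  rw [jet, Set.indicator_of_mem (show (t, x) ∈ Ioc 0 T ×ˢ (Set.univ : Set Plane) from ⟨ht, trivial⟩)]
  rfl

theorem jet_succ {T t : ℝ} (ht : t ∈ Ioc 0 T) (v : ℝ → Plane → ℝ) (j : Fin 2) :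
    jet T v j.succ t = fun x => fderiv ℝ (v t) x (bv j) := by
  funext x
  rw [jet, Set.indicator_of_mem (show (t, x) ∈ Ioc 0 T ×ˢ (Set.univ : Set Plane) from ⟨ht, trivial⟩)]
  rfl

theorem contDiff_slice {T t : ℝ} (ht : t ∈ Ioc 0 T) {v : ℝ → Plane → ℝ}
    (hv : ContDiffOn ℝ ∞ (Function.uncurry v) (Ioc 0 T ×ˢ Set.univ)) : ContDiff ℝ 1 (v t) := by
  rw [← contDiffOn_univ]
  exact (hv.of_le (by exact_mod_cast le_top)).comp (f := fun x => (t, x)) (contDiff_prodMk_right t).contDiffOn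
    fun x _ => ⟨ht, trivial⟩

theorem measurable_jet {T : ℝ} {v : ℝ → Plane → ℝ}
    (hv : ContDiffOn ℝ ∞ (Function.uncurry v) (Ioc 0 T ×ˢ Set.univ)) (i : Fin 3) :
    Measurable (Function.uncurry (jet T v i)) := by
  classical
  have hS : MeasurableSet (Ioc 0 T ×ˢ (Set.univ : Set Plane)) := measurableSet_Ioc.prod .univ
  have hU : UniqueDiffOn ℝ (Ioc 0 T ×ˢ (Set.univ : Set Plane)) := (uniqueDiffOn_Ioc 0 T).prod uniqueDiffOn_univ
  suffices h : ContinuousOn (fun p : ℝ × Plane => (Fin.cases (v p.1 p.2) (fun j : Fin 2 => fderiv ℝ (v p.1) p.2 (bv j)) i : ℝ))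
      (Ioc 0 T ×ˢ (Set.univ : Set Plane)) by
    have := h.measurable_piecewise (g := 0) continuousOn_const hS
    rw [Set.piecewise_eq_indicator] at this
    exact this
  refine Fin.cases hv.continuousOn (fun j => ?_) i
  refine ((hv.continuousOn_fderivWithin hU (by exact_mod_cast le_top)).clm_apply
    (continuousOn_const (c := ((0 : ℝ), bv j)))).congr fun p hp => ?_
  have h1 := ((hv.differentiableOn (by simp)) p hp).hasFDerivWithinAt
  have h2 : HasFDerivWithinAt (fun x : Plane => (p.1, x)) (ContinuousLinearMap.inr ℝ ℝ Plane) Set.univ p.2 :=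
    (hasFDerivAt_prodMk_right p.1 p.2).hasFDerivWithinAt
  have h3 := (h1.comp (f := fun x => (p.1, x)) p.2 h2 fun x _ => ⟨hp.1, trivial⟩).hasFDerivAt univ_mem
  have h4 : (Function.uncurry v) ∘ (fun x => (p.1, x)) = v p.1 := rfl
  rw [h4] at h3
  simp only [Fin.cases_succ]
  rw [h3.fderiv]
  rfl

theorem isWeakGrad_jet {T t : ℝ} (ht : t ∈ Ioc 0 T) {v : ℝ → Plane → ℝ}
    (hv : ContDiffOn ℝ ∞ (Function.uncurry v) (Ioc 0 T ×ˢ Set.univ)) :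
    IsWeakGrad (jet T v 0 t) fun i => jet T v i.succ t := by
  have := isWeakGrad_of_contDiff (contDiff_slice ht hv)
  simp only [jet_zero ht, jet_succ ht]
  exact this

theorem le_pathNorm {l T σ β t : ℝ} (ht : t ∈ Ioc 0 T) (u : ℝ → Plane → ℝ) :
    sobolevNorm σ (expWeight (l + t)) (u t) ≤ pathNorm l T σ β u * ofReal (t ^ (-β)) := by
  have h := le_iSup₂ (f := fun t (_ : t ∈ Ioc 0 T) => ofReal (t ^ β) * sobolevNorm σ (expWeight (l + t)) (u t)) t ht
  have ht0 : 0 < t := ht.1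
  refine le_trans (le_of_eq ?_) (mul_le_mul_left h _)
  rw [mul_right_comm, ← ofReal_mul (by positivity), ← Real.rpow_add ht0]
  simp

/-- Elements of the path space have jointly measurable representatives, together with their weak gradients. -/
theorem exists_adm_of_mem_pathSpace {κ l T : ℝ} (hκ1 : κ < 1 / 10) {u : ℝ → Plane → ℝ}
    (hu : u ∈ PathSpace l T (2 * κ) (1 / 2 + κ)) : ∃ V : Fld, Adm κ l T V ∧
      ∀ t ∈ Ioc 0 T, (IsWeakGrad (V 0 t) fun i => V i.succ t) ∧ u t =ᵐ[volume] V 0 t := by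
  obtain ⟨C, hC, hCn⟩ := exists_nrm_le_sobolevNorm (κ := κ) (by linarith) (|l| + T)
  set c : ℝ≥0∞ := pathNorm l T (2 * κ) (1 / 2 + κ) u + 1 with hc
  have hct : c ≠ ⊤ := ENNReal.add_ne_top.2 ⟨hu.1.ne, by simp⟩
  have hc0 : c ≠ 0 := by simp [hc]
  have hex : ∀ n : ℕ, ∃ v : ℝ → Plane → ℝ, ContDiffOn ℝ ∞ (Function.uncurry v) (Ioc 0 T ×ˢ Set.univ) ∧
      (n = 0 → v = 0) ∧ pathNorm l T (2 * κ) (1 / 2 + κ) (u - v) ≤ c * 2⁻¹ ^ n := fun n => by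
    rcases Nat.eq_zero_or_pos n with rfl | hn
    · refine ⟨0, contDiffOn_const (c := (0 : ℝ)), fun _ => rfl, ?_⟩
      rw [sub_zero, pow_zero, mul_one]
      exact le_self_add
    · obtain ⟨v, hv, hv'⟩ := hu.2 (c * 2⁻¹ ^ n) (pos_iff_ne_zero.2 (mul_ne_zero hc0 (by simp)))
      exact ⟨v, hv, fun h => absurd h hn.ne', hv'.le⟩
  choose v hv hv0 hvu using hex
  have hfin : ∀ n, ∀ t ∈ Ioc 0 T, sobolevNorm (2 * κ) (expWeight (l + t)) ((u - v n) t) ≤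
      c * 2⁻¹ ^ n * ofReal (t ^ (-(1 / 2 + κ))) := fun n t ht =>
    (le_pathNorm ht _).trans (mul_le_mul_left (hvu n) _)
  have hft : ∀ n, ∀ t ∈ Ioc 0 T, sobolevNorm (2 * κ) (expWeight (l + t)) ((u - v n) t) < ⊤ := fun n t ht =>
    (hfin n t ht).trans_lt (mul_lt_top (mul_lt_top hct.lt_top (by simp)) ofReal_lt_top)
  set d : ℕ → ℝ → Plane → ℝ := fun k t x => v (k + 1) t x - v k t x with hd
  have hdS : ∀ k, ContDiffOn ℝ ∞ (Function.uncurry (d k)) (Ioc 0 T ×ˢ Set.univ) := fun k => (hv (k + 1)).sub (hv k)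
  set K : ℝ≥0∞ := (C + 1) * 10 * c with hK
  have hK0 : K ≠ 0 := mul_ne_zero (by simp) hc0
  have hKt : K ≠ ⊤ := mul_ne_top (mul_ne_top (by simp [hC]) (by simp)) hct
  have hdn : ∀ k, ∀ t ∈ Ioc 0 T, ∀ i, nrm κ (l + t) (jet T (d k) i t) ≤
      K * 2⁻¹ ^ k * ofReal (t ^ (-(1 / 2 + κ))) := fun k t ht i => by
    have hl : |l + t| ≤ |l| + T := (abs_add_le l t).trans (by rw [abs_of_pos ht.1]; linarith [ht.2])
    have h1 := hCn (l + t) (d k t) hl (contDiff_slice ht (hdS k))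
    have h2 : sobolevNorm (2 * κ) (expWeight (l + t)) (d k t) ≤ 10 * c * 2⁻¹ ^ k * ofReal (t ^ (-(1 / 2 + κ))) := by
      have h3 := sobolevNorm_sub_le κ (l + t) (hft k t ht) (hft (k + 1) t ht)
      have e : (fun x => (u - v k) t x - (u - v (k + 1)) t x) = d k t := by
        funext x; simp only [Pi.sub_apply, hd]; ring
      rw [e] at h3
      refine h3.trans ((mul_le_mul_right (add_le_add (hfin k t ht) ((hfin (k + 1) t ht).trans
        (mul_le_mul_left (mul_le_mul_right (pow_le_pow_right_of_le_one' (by simp) k.le_succ) c) _))) 5).trans_eq ?_)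
      ring
    have h4 : nrm κ (l + t) (jet T (d k) i t) ≤ C * sobolevNorm (2 * κ) (expWeight (l + t)) (d k t) := by
      refine Fin.cases ?_ (fun j => ?_) i
      · rw [jet_zero ht]; exact h1.1
      · rw [jet_succ ht]; exact h1.2 j
    refine h4.trans ((mul_le_mul' (le_self_add : C ≤ C + 1) h2).trans_eq ?_)
    rw [hK]; ring
  have hm : ∀ i t, Measurable (Function.uncurry fun k x => jet T (d k) i t x) := fun i t =>
    measurable_from_prod_countable_right fun k => (measurable_jet (hdS k) i).comp (measurable_const.prodMk measurable_id)
  set V : Fld := fun i t x => ∫ k, jet T (d k) i t x ∂(Measure.count : Measure ℕ) with hV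
  have key : ∀ t ∈ Ioc 0 T, ∀ i, (∀ᵐ x, Integrable (fun k => jet T (d k) i t x) Measure.count) ∧
      ∫⁻ x, (∫⁻ k, ‖jet T (d k) i t x‖ₑ ∂Measure.count) ^ 2 ∂(expMeas (l + t)) < ⊤ ∧
      nrm κ (l + t) (V i t) ≤ 4 * K * ofReal (t ^ (-(1 / 2 + κ)) * Real.exp (0 * t)) := fun t ht i => by
    have ht0 := ht.1
    set w := ofReal (t ^ (-(1 / 2 + κ))) with hw
    have hw0 : w ≠ 0 := by
      rw [hw]; simp only [ne_eq, ENNReal.ofReal_eq_zero, not_le]; positivity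
    have hB : ∫⁻ k, K * 2⁻¹ ^ k * w ∂(Measure.count : Measure ℕ) = 2 * K * w := by
      rw [lintegral_count, ENNReal.tsum_mul_right, ENNReal.tsum_mul_left, ENNReal.tsum_geometric]
      rw [ENNReal.one_sub_inv_two, inv_inv]
      ring
    obtain ⟨h1, h1', h2⟩ := nrm_integral_le κ (l + t) (Measure.count : Measure ℕ)
      (u := fun k x => jet T (d k) i t x) (B := fun k => K * 2⁻¹ ^ k * w) (hm i t) (measurable_of_countable _)
      (Eventually.of_forall fun k => ⟨mul_ne_zero (mul_ne_zero hK0 (by simp)) hw0,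
        mul_ne_top (mul_ne_top hKt (by simp)) ofReal_ne_top⟩)
      (Eventually.of_forall fun k => hdn k t ht i)
      (by rw [hB]; exact mul_ne_top (mul_ne_top (by simp) hKt) ofReal_ne_top)
    refine ⟨h1, h1', h2.trans_eq ?_⟩
    rw [hB, zero_mul, Real.exp_zero, mul_one]; ring
  refine ⟨V, ⟨fun j => ?_, 4 * K, mul_ne_zero (by simp) hK0, mul_ne_top (by simp) hKt, fun t ht i => (key t ht i).2.2⟩,
    fun t ht => ⟨?_, ?_⟩⟩
  · exact measurable_integral_param (Measure.count : Measure ℕ) (u := fun k (p : ℝ × Plane) => jet T (d k) j p.1 p.2)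
      (measurable_from_prod_countable_right fun k => measurable_jet (hdS k) j)
  · exact isWeakGrad_integral Measure.count (u := fun i k x => jet T (d k) i t x) (fun i => hm i t)
      (fun i => (key t ht i).2.1) (Eventually.of_forall fun k => isWeakGrad_jet ht (hdS k))
  · have hlim : ∀ᵐ x, Tendsto (fun n => (u - v n) t x) atTop (𝓝 (u t x - V 0 t x)) := by
      filter_upwards [(key t ht 0).1] with x hx
      have hs := (integrable_count_iff.1 hx).of_norm
      have h1 := hs.hasSum.tendsto_sum_nat
      rw [← integral_count_eq_tsum hs] at h1
      refine (tendsto_const_nhds.sub h1).congr fun n => ?_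
      simp only [jet_zero ht, hd, Pi.sub_apply]
      rw [Finset.sum_range_sub (fun k => v k t x), hv0 0 rfl]
      simp
    have hsob : ∀ n, AEStronglyMeasurable ((u - v n) t) volume ∧ eLpNorm ((u - v n) t) 2 (expMeas (l + t)) ≤
        c * 2⁻¹ ^ n * ofReal (t ^ (-(1 / 2 + κ))) := fun n => by
      obtain ⟨D, hD⟩ := exists_isWeakGrad_of_sobolevNorm (hft n t ht)
      exact ⟨hD.1.aestronglyMeasurable, (le_sobolevNorm κ (l + t) hD).1.trans (hfin n t ht)⟩
    have ac := expMeas_absolutelyContinuous (l + t)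
    have h0 : eLpNorm (fun x => u t x - V 0 t x) 2 (expMeas (l + t)) = 0 := by
      refine le_antisymm ((Lp.eLpNorm_lim_le_liminf_eLpNorm (fun n => (hsob n).1.mono_ac ac) _ (ac.ae_le hlim)).trans ?_) bot_le
      have : Tendsto (fun n => eLpNorm ((u - v n) t) 2 (expMeas (l + t))) atTop (𝓝 0) := by
        refine tendsto_of_tendsto_of_tendsto_of_le_of_le tendsto_const_nhds ?_ (fun _ => bot_le) fun n => (hsob n).2
        have h2 := ENNReal.Tendsto.mul_const (ENNReal.Tendsto.const_mul (a := c)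
          (ENNReal.tendsto_pow_atTop_nhds_zero_of_lt_one (r := 2⁻¹) (by simp)) (Or.inr hct))
          (b := ofReal (t ^ (-(1 / 2 + κ)))) (Or.inr ofReal_ne_top)
        simpa using h2
      exact this.liminf_eq.le
    have hm0 : AEStronglyMeasurable (fun x => u t x - V 0 t x) volume :=
      aestronglyMeasurable_of_tendsto_ae atTop (fun n => (hsob n).1) hlim
    rw [eLpNorm_eq_zero_iff (hm0.mono_ac ac) (by simp)] at h0
    filter_upwards [(absolutelyContinuous_expMeas (l + t)).ae_le h0] with x hx
    exact sub_eq_zero.1 hx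

theorem duhI_eq_forc {κ s t : ℝ} (hκ : 0 < κ) (hκ1 : κ < 1 / 10) {W : Fld} (h : ∀ j, Reg κ (W j s))
    {a : Coef} (ha : ∀ j, IsCoef κ (a j)) (hst : s < t) (x : Plane) :
    duhI 1 a W 0 t s x = forc a (fun j => W j s) (t - s) x := by
  have h2 : 0 < (t - s) / 2 := by linarith
  rw [duhI, Pi.one_apply, one_mul, hconv_forc hκ (by linarith) h2 h2 ha h, add_halves]

theorem Solves.of_zero {κ l T : ℝ} (hκ : 0 < κ) (hκ1 : κ < 1 / 10) {W : Fld} (h : Adm κ l T W)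
    {a : Coef} {R : ℝ≥0∞} (ha : CoefBound κ a R) (hR : R ≠ ⊤) {f : Plane → ℝ} (hf : Measurable f)
    (hfl : eLpNorm f 2 (expMeas l) < ⊤) (hW : ∀ t ∈ Ioc 0 T, IsWeakGrad (W 0 t) fun i => W i.succ t)
    (hs : ∀ t ∈ Ioc 0 T, ∀ᵐ x, W 0 t x = heat f 0 t x + duh 1 a W 0 t x) : Solves T a (heat f) W := fun t ht i => by
  refine Fin.cases (hs t ht) (fun j => ?_) i
  have := (isWeakGrad_hconv ht.1 hf hfl).lin (h.isWeakGrad_duh hκ hκ1 (η := 1) measurable_const (fun _ => by simp) ha hR ht) 1 1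
  have h2 := (this.congr (v' := W 0 t) ((hs t ht).mono fun x hx => by simp only [one_mul]; rw [hx]; rfl)
    fun _ => EventuallyEq.rfl)
  filter_upwards [(hW t ht).unique h2 j] with x hx
  rw [hx, one_mul, one_mul]; rfl

theorem IsMildSolution.of_solves {χ : Cutoff} {κ l T : ℝ} (hκ : 0 < κ) (hκ1 : κ < 1 / 10) (hT : 0 < T) {q : Distr × Distr}
    (hq : ∀ j, tgt χ q j ∈ HolderSpace (-κ) (polyWeight κ)) {R : ℝ≥0∞} (ha : CoefBound κ (coefs χ κ q) R) (hR : R ≠ ⊤)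
    {f : Plane →ₘ[volume] ℝ} (hf : f ∈ L2exp l) {W : Fld} (h : Adm κ l T W)
    (hs : Solves T (coefs χ κ q) (heat f) W) {w : ℝ → Plane →ₘ[volume] ℝ} (hw : ∀ t ∈ Ioc 0 T, w t =ᵐ[volume] W 0 t) :
    IsMildSolution χ κ q l T f w := by
  have hfl : eLpNorm f 2 (expMeas l) < ⊤ := by rw [← l2Norm_eq_eLpNorm]; exact hf
  have hfm : Measurable f := f.measurable
  refine ⟨mem_pathSpace_of_solves hκ hκ1 hT h ha hR hfm hfl hs hw, fun t ht => ?_⟩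
  have hIoc : ∀ s ∈ Ioo 0 t, s ∈ Ioc 0 T := fun s hs' => ⟨hs'.1, (hs'.2.trans_le ht.2).le⟩
  refine ⟨fun s x => forc (coefs χ κ q) (fun j => W j s) (t - s) x, fun s hs' x => ?_, ?_⟩
  · exact (hasForcingPairing_iff (V := fun j => W j s) hκ (by linarith) (sub_pos.2 hs'.2) hq (h.reg (hIoc s hs'))
      (isWeakGrad_of_solves hκ hκ1 h ha hR hfm hfl hs (hIoc s hs')) (hw s (hIoc s hs')) x _).2 rfl
  · filter_upwards [hw t ht, hs t ht 0, ((h.duh_facts hκ hκ1 (η := 1) measurable_const (fun _ => by simp) ha hR).1 t ht 0).1]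
      with x e1 e2 e3
    have e4 : Set.EqOn (fun s => duhI 1 (coefs χ κ q) W 0 t s x)
        (fun s => forc (coefs χ κ q) (fun j => W j s) (t - s) x) (Ioo 0 t) := fun s hs' =>
      duhI_eq_forc hκ hκ1 (h.reg (hIoc s hs')) ha.coef hs'.2 x
    refine ⟨?_, ?_⟩
    · rw [intervalIntegrable_iff_integrableOn_Ioo_of_le ht.1.le]
      exact e3.congr_fun e4 measurableSet_Ioo
    · rw [e1, e2, intervalIntegral.integral_of_le ht.1.le, integral_Ioc_eq_integral_Ioo,
        ← setIntegral_congr_fun measurableSet_Ioo e4]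
      rfl

theorem IsMildSolution.exists_solves {χ : Cutoff} {κ l T : ℝ} (hκ : 0 < κ) (hκ1 : κ < 1 / 10) {q : Distr × Distr}
    (hq : ∀ j, tgt χ q j ∈ HolderSpace (-κ) (polyWeight κ)) {R : ℝ≥0∞} (ha : CoefBound κ (coefs χ κ q) R) (hR : R ≠ ⊤)
    {f : Plane →ₘ[volume] ℝ} (hf : f ∈ L2exp l) {w : ℝ → Plane →ₘ[volume] ℝ} (h : IsMildSolution χ κ q l T f w) :
    ∃ W : Fld, Adm κ l T W ∧ Solves T (coefs χ κ q) (heat f) W ∧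
      ∀ t ∈ Ioc 0 T, w t =ᵐ[volume] W 0 t := by
  have hfl : eLpNorm f 2 (expMeas l) < ⊤ := by rw [← l2Norm_eq_eLpNorm]; exact hf
  obtain ⟨W, hA, hW⟩ := exists_adm_of_mem_pathSpace hκ1 h.mem
  refine ⟨W, hA, Solves.of_zero hκ hκ1 hA ha hR f.measurable hfl (fun t ht => (hW t ht).1) fun t ht => ?_,
    fun t ht => (hW t ht).2⟩
  obtain ⟨H, h1, h2⟩ := h.eq t ht
  have hIoc : ∀ s ∈ Ioo 0 t, s ∈ Ioc 0 T := fun s hs' => ⟨hs'.1, (hs'.2.trans_le ht.2).le⟩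
  have e : ∀ x, Set.EqOn (fun s => duhI 1 (coefs χ κ q) W 0 t s x) (fun s => H s x) (Ioo 0 t) := fun x s hs' => by
    have h3 := (hasForcingPairing_iff (V := fun j => W j s) hκ (by linarith) (sub_pos.2 hs'.2) hq (hA.reg (hIoc s hs'))
      (hW s (hIoc s hs')).1 (hW s (hIoc s hs')).2 x _).1 (h1 s hs' x)
    simp only [h3]
    exact duhI_eq_forc hκ hκ1 (hA.reg (hIoc s hs')) ha.coef hs'.2 x
  filter_upwards [h2, (hW t ht).2] with x h4 h5
  rw [← h5, h4.2, intervalIntegral.integral_of_le ht.1.le, integral_Ioc_eq_integral_Ioo,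
        ← setIntegral_congr_fun measurableSet_Ioo (e x)]
  rfl

theorem Adm.eLpNorm_lt_top {κ l T : ℝ} {W : Fld} (h : Adm κ l T W) {t : ℝ} (ht : t ∈ Ioc 0 T)
    (i : Fin 3) : eLpNorm (W i t) 2 (expMeas (l + t)) < ⊤ := by
  obtain ⟨c, -, hc, hB⟩ := h.2
  exact (eLpNorm_le_nrm κ _ _).trans_lt ((hB t ht i).trans_lt (mul_lt_top hc.lt_top ofReal_lt_top))

theorem Adm.shift {κ l T r : ℝ} (hκ : 0 < κ) {W : Fld} (h : Adm κ l T W) (hr : 0 < r) :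
    Adm κ (l + r) (T - r) fun i t => W i (t + r) := by
  obtain ⟨c, hc0, hc, hB⟩ := h.2
  refine ⟨fun j => (h.1 j).comp ((measurable_fst.add_const r).prodMk measurable_snd), c, hc0, hc, fun t ht i => ?_⟩
  have ht0 := ht.1
  have := hB (t + r) ⟨by linarith, by linarith [ht.2]⟩ i
  rw [show l + (t + r) = l + r + t by ring, zero_mul] at this
  rw [zero_mul]
  refine this.trans (mul_le_mul_right (ofReal_le_ofReal (mul_le_mul_of_nonneg_right ?_ (Real.exp_pos _).le)) c)
  exact Real.rpow_le_rpow_of_nonpos ht0 (by linarith) (by linarith)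

theorem duh_zero_eq {κ l T : ℝ} (hκ : 0 < κ) (hκ1 : κ < 1 / 10) {W : Fld} (h : Adm κ l T W)
    {a : Coef} {R : ℝ≥0∞} (ha : CoefBound κ a R) (hR : R ≠ ⊤) {t : ℝ} (ht : t ∈ Ioc 0 T) :
    (∀ x, duh 1 a W 0 t x = ∫ s in (0 : ℝ)..t, forc a (fun j => W j s) (t - s) x) ∧
      ∀ᵐ x, IntervalIntegrable (fun s => forc a (fun j => W j s) (t - s) x) volume 0 t := by
  have e : ∀ x, Set.EqOn (fun s => duhI 1 a W 0 t s x) (fun s => forc a (fun j => W j s) (t - s) x) (Ioo 0 t) :=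
    fun x s hs => duhI_eq_forc hκ hκ1 (h.reg ⟨hs.1, (hs.2.trans_le ht.2).le⟩) ha.coef hs.2 x
  refine ⟨fun x => ?_, ?_⟩
  · rw [intervalIntegral.integral_of_le ht.1.le, integral_Ioc_eq_integral_Ioo, ← setIntegral_congr_fun measurableSet_Ioo (e x)]
    rfl
  · filter_upwards [((h.duh_facts hκ hκ1 (η := 1) measurable_const (fun _ => by simp) ha hR).1 t ht 0).1] with x hx
    rw [intervalIntegrable_iff_integrableOn_Ioo_of_le ht.1.le]
    exact hx.congr_fun (e x) measurableSet_Ioo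

theorem hconv_zero_integral {β : Type*} [MeasurableSpace β] (ν : Measure β) [SFinite ν] {l t : ℝ} (ht : 0 < t)
    {u : β → Plane → ℝ} (hu : Measurable (Function.uncurry u))
    (hsq : ∫⁻ x, (∫⁻ s, ‖u s x‖ₑ ∂ν) ^ 2 ∂(expMeas l) < ⊤) (x : Plane) :
    hconv 0 t (fun y => ∫ s, u s y ∂ν) x = ∫ s, hconv 0 t (u s) x ∂ν := by
  have hk := kconv_lt_top ht (F := fun y => ∫⁻ s, ‖u s y‖ₑ ∂ν)
    (Measurable.lintegral_prod_left' (f := fun p : β × Plane => ‖u p.1 p.2‖ₑ) hu.enorm) hsq x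
  have hM : Measurable fun p : Plane × β => heatKernel t (x - p.1) * u p.2 p.1 :=
    ((continuous_heatKernel t).measurable.comp (measurable_const.sub measurable_fst)).mul (hu.comp measurable_swap)
  have hI : Integrable (Function.uncurry fun y s => heatKernel t (x - y) * u s y) (volume.prod ν) := by
    refine ⟨hM.aestronglyMeasurable, ?_⟩
    simp only [HasFiniteIntegral, Function.uncurry_def]
    rw [lintegral_prod _ hM.enorm.aemeasurable]
    refine lt_of_le_of_lt (lintegral_mono fun y => ?_) hk
    rw [← lintegral_const_mul' _ _ ofReal_ne_top]
    refine lintegral_mono fun s => ?_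
    rw [enorm_mul, Real.enorm_of_nonneg (heatKernel_nonneg ht.le _)]
  have := integral_integral_swap hI
  simp only [integral_const_mul] at this
  exact this

theorem hconv_zero_duh {κ l T : ℝ} (hκ : 0 < κ) (hκ1 : κ < 1 / 10) {W : Fld} (h : Adm κ l T W)
    {a : Coef} {R : ℝ≥0∞} (ha : CoefBound κ a R) (hR : R ≠ ⊤) {r t : ℝ} (hr : r ∈ Ioc 0 T) (ht : 0 < t)
    (x : Plane) : hconv 0 t (duh 1 a W 0 r) x = ∫ s in (0 : ℝ)..r, forc a (fun j => W j s) (t + r - s) x := by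
  rw [intervalIntegral.integral_of_le hr.1.le, integral_Ioc_eq_integral_Ioo]
  refine (hconv_zero_integral _ ht (measurable_duhI_slice (η := 1) measurable_const a h.1 0 r)
    ((h.duh_facts hκ hκ1 (η := 1) measurable_const (fun _ => by simp) ha hR).1 r hr 0).2 x).trans
    (setIntegral_congr_fun measurableSet_Ioo fun s hs => ?_)
  have hreg := h.reg (t := s) ⟨hs.1, (hs.2.trans_le hr.2).le⟩
  have e : duhI 1 a W 0 r s = forc a (fun j => W j s) (r - s) := funext (duhI_eq_forc hκ hκ1 hreg ha.coef hs.2)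
  change hconv 0 t (duhI 1 a W 0 r s) x = _
  rw [e, hconv_forc hκ (by linarith) ht (sub_pos.2 hs.2) ha.coef hreg, add_sub_assoc]

/-- Restarting a solution at time `r`. -/
theorem Solves.shift {κ l T : ℝ} (hκ : 0 < κ) (hκ1 : κ < 1 / 10) {W : Fld} (h : Adm κ l T W)
    {a : Coef} {R : ℝ≥0∞} (ha : CoefBound κ a R) (hR : R ≠ ⊤) {f : Plane → ℝ} (hf : Measurable f)
    (hfl : eLpNorm f 2 (expMeas l) < ⊤) (hs : Solves T a (heat f) W) {r : ℝ} (hr : 0 < r) {g : Plane → ℝ} (hgm : Measurable g)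
    (hg : g =ᵐ[volume] W 0 r) : Solves (T - r) a (heat g) fun i t => W i (t + r) := by
  by_cases hrT : T - r ≤ 0
  · exact fun t ht => absurd (ht.1.trans_le ht.2) (not_lt.2 hrT)
  have hrm : r ∈ Ioc 0 T := ⟨hr, by linarith⟩
  have hA := h.shift hκ hr
  have hshift : ∀ t ∈ Ioc 0 (T - r), t + r ∈ Ioc 0 T := fun t ht => ⟨by linarith [ht.1], by linarith [ht.2]⟩
  refine Solves.of_zero hκ hκ1 hA ha hR hgm ?_ (fun t ht => isWeakGrad_of_solves hκ hκ1 h ha hR hf hfl hs (hshift t ht))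
    fun t ht => ?_
  · rw [eLpNorm_congr_ae ((expMeas_absolutelyContinuous _).ae_eq hg)]
    exact h.eLpNorm_lt_top hrm 0
  have hd := (h.duh_facts hκ hκ1 (η := 1) measurable_const (fun _ => by simp) ha hR).2
  have hfr := adm_heat (κ := κ) hκ (by linarith) l T hf hfl
  filter_upwards [hs (t + r) (hshift t ht) 0, (duh_zero_eq hκ hκ1 h ha hR (hshift t ht)).2] with x e1 e2
  have hsub : ∀ {c d : ℝ}, 0 ≤ c → c ≤ d → d ≤ t + r →
      IntervalIntegrable (fun s => forc a (fun j => W j s) (t + r - s) x) volume c d := fun h0 hcd hd' => e2.mono_set (by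
    rw [Set.uIcc_of_le hcd, Set.uIcc_of_le ((h0.trans hcd).trans hd')]
    exact Set.Icc_subset_Icc h0 hd')
  have e3 : heat g 0 t x = hconv 0 (t + r) f x + ∫ s in (0 : ℝ)..r, forc a (fun j => W j s) (t + r - s) x := by
    have e4 : g =ᵐ[volume] fun y => 1 * heat f 0 r y + 1 * duh 1 a W 0 r y := by
      filter_upwards [hg, hs r hrm 0] with y h1 h2
      rw [h1, h2, one_mul, one_mul]
    rw [heat, hconv_congr_ae 0 t e4, hconv_lin ht.1 0 (hfr.slice r 0)
      (hd.slice r 0) (hfr.eLpNorm_lt_top hrm 0) (hd.eLpNorm_lt_top hrm 0), hconv_zero_duh hκ hκ1 h ha hR hrm ht.1, one_mul, one_mul]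
    congr 1
    exact hconv_zero_hconv_zero ht.1 hr hf hfl x
  have ht0 := ht.1
  rw [e3, (duh_zero_eq hκ hκ1 hA ha hR ht).1 x, e1, (duh_zero_eq hκ hκ1 h ha hR (hshift t ht)).1 x,
    ← intervalIntegral.integral_add_adjacent_intervals (hsub le_rfl hr.le (by linarith)) (hsub hr.le (by linarith) le_rfl), heat,
    add_assoc]
  congr 2
  have e5 := intervalIntegral.integral_comp_add_right (a := 0) (b := t) (fun s => forc a (fun j => W j s) (t + r - s) x) r
  rw [zero_add] at e5
  rw [← e5]
  simp only [add_sub_add_right_eq_sub]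

theorem exists_eLpNorm_hconv_test_sub_le (φ : Test) (l : ℝ) : ∃ C : ℝ≥0∞, C ≠ ⊤ ∧ ∀ h ∈ Ioc (0 : ℝ) 1,
    eLpNorm (fun x => hconv 0 h φ x - φ x) 2 (expMeas l) ≤ C * ofReal √h := by
  obtain ⟨K, hK⟩ := (φ.contDiff.of_le (m := 1) (by exact_mod_cast le_top)).lipschitzWith_of_hasCompactSupport
    φ.hasCompactSupport one_ne_zero
  set q : Plane → ℝ≥0∞ := (tsupport φ).indicator 1 with hq
  have hqm : Measurable q := measurable_one.indicator (isClosed_tsupport φ).measurableSet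
  have hQ : ∫⁻ x, q x ^ 2 ∂(expMeas l) < ⊤ := by
    have e : ∀ x, q x ^ 2 = (tsupport φ).indicator 1 x := fun x => by
      by_cases hx : x ∈ tsupport φ <;> simp [hq, hx]
    simp only [e]
    rw [lintegral_indicator_one (isClosed_tsupport φ).measurableSet]
    exact φ.hasCompactSupport.isCompact.measure_lt_top
  set Q := ∫⁻ x, q x ^ 2 ∂(expMeas l) with hQd
  set B : ℝ≥0∞ := 2 * (Q + ofReal (2 * Real.exp (2 * l ^ 2 * 2)) * Q) with hB
  have hBt : B ≠ ⊤ := mul_ne_top (by simp) (ENNReal.add_ne_top.2 ⟨hQ.ne, mul_ne_top ofReal_ne_top hQ.ne⟩)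
  refine ⟨ofReal (4 * K) * B ^ (1 / 2 : ℝ), mul_ne_top ofReal_ne_top
    (ENNReal.rpow_ne_top_of_nonneg (by norm_num) hBt), fun h hh => ?_⟩
  have h0 := hh.1
  have hpt : ∀ x, ‖hconv 0 h φ x - φ x‖ₑ ≤ ofReal (4 * K * √h) * (q x + kconv (2 * h) q x) := fun x => by
    have hi : Integrable fun y => heatKernel h (x - y) := (integrable_heatKernel h0).comp_sub_left x
    have e : hconv 0 h φ x - φ x = ∫ y, heatKernel h (x - y) * (φ y - φ x) := by
      simp only [mul_sub]
      have hi' : Integrable fun y => heatKernel h (x - y) * φ y :=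
        integrable_kern_mul h0 0 φ.continuous.measurable (eLpNorm_test_lt_top φ l) x
      rw [integral_sub hi' (hi.mul_const _),
        integral_mul_const, integral_sub_left_eq_self (heatKernel h), integral_heatKernel h0, one_mul]
      rfl
    have e2 : q x + kconv (2 * h) q x = ∫⁻ y, ofReal (heatKernel (2 * h) (x - y)) * (q x + q y) := by
      have hm : Measurable fun y => ofReal (heatKernel (2 * h) (x - y)) :=
        ((continuous_heatKernel (2 * h)).comp (continuous_const.sub continuous_id)).measurable.ennreal_ofReal
      simp only [mul_add]
      rw [lintegral_add_left (hm.mul_const _), lintegral_mul_const _ hm,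
        lintegral_sub_left_eq_self (fun z => ofReal (heatKernel (2 * h) z)), lintegral_heatKernel (by linarith), one_mul]
      rfl
    rw [e, e2, ← lintegral_const_mul' _ _ ofReal_ne_top]
    refine (enorm_integral_le_lintegral_enorm _).trans (lintegral_mono fun y => ?_)
    have hd : ‖φ y - φ x‖ₑ ≤ ofReal (K * ‖x - y‖) * (q x + q y) := by
      by_cases hxy : x ∈ tsupport φ ∨ y ∈ tsupport φ
      · have h1 : ‖φ y - φ x‖ₑ ≤ ofReal (K * ‖x - y‖) := by
          rw [← ofReal_norm, norm_sub_rev x y]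
          exact ofReal_le_ofReal (by simpa [dist_eq_norm] using hK.dist_le_mul y x)
        have h2 : 1 ≤ q x + q y := by
          rcases hxy with hx | hx <;> simp [hq, hx]
        exact h1.trans (le_mul_of_one_le_right' h2)
      · rw [not_or] at hxy
        rw [image_eq_zero_of_notMem_tsupport hxy.1, image_eq_zero_of_notMem_tsupport hxy.2]
        simp
    rw [enorm_mul, Real.enorm_of_nonneg (heatKernel_nonneg h0.le _)]
    refine (mul_le_mul_right hd _).trans ?_
    rw [← mul_assoc, ← mul_assoc, ← ofReal_mul (heatKernel_nonneg h0.le _), ← ofReal_mul (by positivity)]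
    refine mul_le_mul_left (ofReal_le_ofReal ?_) _
    have := mul_le_mul_of_nonneg_left (norm_mul_heatKernel_le h0 (x - y)) K.coe_nonneg
    nlinarith
  rw [← (ENNReal.pow_le_pow_left_iff two_ne_zero), eLpNorm_two_sq]
  calc _ ≤ ∫⁻ x, ofReal (4 * K * √h) ^ 2 * (2 * (q x ^ 2 + kconv (2 * h) q x ^ 2)) ∂(expMeas l) :=
        lintegral_mono fun x => by
          refine (pow_le_pow_left' (hpt x) 2).trans ?_
          rw [mul_pow]
          have := ENNReal.rpow_add_le_mul_rpow_add_rpow (q x) (kconv (2 * h) q x) (p := 2) one_le_two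
          norm_num at this
          exact mul_le_mul_right this _
    _ = ofReal (4 * K * √h) ^ 2 * (2 * (Q + ∫⁻ x, kconv (2 * h) q x ^ 2 ∂(expMeas l))) := by
        rw [lintegral_const_mul' _ _ (ENNReal.pow_ne_top ofReal_ne_top), lintegral_const_mul' _ _ (by simp), lintegral_add_left (hqm.pow_const 2)]
    _ ≤ ofReal (4 * K * √h) ^ 2 * B := by
        refine mul_le_mul_right (mul_le_mul_right (add_le_add le_rfl ((lintegral_kconv_sq_le (by linarith) hqm).trans
          (mul_le_mul_left (ofReal_le_ofReal ?_) _))) _) _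
        have : (2 : ℝ) * h ≤ 2 := by linarith [hh.2]
        gcongr
    _ = _ := by
        rw [ofReal_mul (by positivity), mul_pow, mul_pow, mul_pow, rpow_half_sq]
        ring

theorem tendsto_hconv_zero {l : ℝ} {f : Plane → ℝ} (hf : Measurable f) (hfl : eLpNorm f 2 (expMeas l) < ⊤) :
    Tendsto (fun h => eLpNorm (fun x => hconv 0 h f x - f x) 2 (expMeas l)) (𝓝[>] 0) (𝓝 0) := by
  rw [ENNReal.tendsto_nhds_zero]
  intro ε hε
  have hε2 : 0 < ε / 2 := ENNReal.half_pos hε.ne'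
  set K : ℝ≥0∞ := ofReal (2 * Real.exp (l ^ 2 * 1)) + 1 with hK
  obtain ⟨δ, hδ, hδε⟩ := exists_pos_mul_lt (K := K) (ENNReal.add_ne_top.2 ⟨ofReal_ne_top, by simp⟩) hε2
  obtain ⟨φ, hφ⟩ := exists_test_eLpNorm_sub_le hf hfl hδ
  obtain ⟨C, hC, hCφ⟩ := exists_eLpNorm_hconv_test_sub_le φ l
  have ht : Tendsto (fun h : ℝ => C * ofReal √h) (𝓝[>] 0) (𝓝 (C * ofReal √0)) :=
    ENNReal.Tendsto.const_mul (ENNReal.tendsto_ofReal (Real.continuous_sqrt.continuousWithinAt)) (Or.inr hC)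
  rw [Real.sqrt_zero, ENNReal.ofReal_zero, mul_zero] at ht
  filter_upwards [ht.eventually (gt_mem_nhds hε2), Ioc_mem_nhdsGT (zero_lt_one' ℝ)] with h h1 h2
  have hφm : Measurable φ := φ.continuous.measurable
  have hfφ : Measurable fun x => f x - φ x := hf.sub hφm
  have e : (fun x => hconv 0 h f x - f x) =
      (fun x => hconv 0 h (fun y => f y - φ y) x) + (fun x => hconv 0 h φ x - φ x) - fun x => f x - φ x := by
    funext x
    have := hconv_lin h2.1 0 hf hφm hfl (eLpNorm_test_lt_top φ l) 1 (-1) x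
    simp only [one_mul, neg_mul, ← sub_eq_add_neg] at this
    simp only [Pi.add_apply, Pi.sub_apply, this]
    ring
  have m1 := (measurable_hconv 0 h hfφ).aestronglyMeasurable (μ := expMeas l)
  have m2 := ((measurable_hconv 0 h hφm).sub hφm).aestronglyMeasurable (μ := expMeas l)
  rw [e]
  refine (eLpNorm_sub_le (m1.add m2) hfφ.aestronglyMeasurable (by simp)).trans ?_
  refine (add_le_add (eLpNorm_add_le m1 m2 (by simp)) hφ).trans ?_
  have b1 : eLpNorm (hconv 0 h fun y => f y - φ y) 2 (expMeas l) ≤ ofReal (2 * Real.exp (l ^ 2 * 1)) * ofReal δ := by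
    refine (eLpNorm_hconv_zero_le h2.1 hfφ).trans (mul_le_mul' (ofReal_le_ofReal ?_) hφ)
    have := h2.2
    gcongr
  calc _ ≤ ofReal (2 * Real.exp (l ^ 2 * 1)) * ofReal δ + ε / 2 + ofReal δ :=
        add_le_add (add_le_add b1 ((hCφ h h2).trans h1.le)) le_rfl
    _ = K * ofReal δ + ε / 2 := by rw [hK]; ring
    _ ≤ ε / 2 + ε / 2 := add_le_add hδε.le le_rfl
    _ = ε := ENNReal.add_halves ε

theorem exists_eLpNorm_solves_le {κ : ℝ} (hκ : 0 < κ) (hκ1 : κ < 1 / 10) (L T : ℝ) {R : ℝ≥0∞} (hR0 : R ≠ 0) (hR : R ≠ ⊤) :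
    ∃ C : ℝ≥0∞, C ≠ ⊤ ∧ ∀ (l : ℝ) (a : Coef) (f : Plane → ℝ) (W : Fld) (N : ℝ≥0∞), |l| ≤ L →
      CoefBound κ a R → Measurable f → eLpNorm f 2 (expMeas l) ≤ N → N ≠ 0 → N ≠ ⊤ → Adm κ l T W → Solves T a (heat f) W →
      ∀ t ∈ Ioc 0 T, eLpNorm (fun x => W 0 t x - heat f 0 t x) 2 (expMeas (l + t)) ≤
        C * N * ofReal (t ^ (1 / 2 - 5 * κ / 2)) := by
  obtain ⟨C₁, hC₁, h₁⟩ := exists_bdd_heat hκ (by linarith) L T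
  obtain ⟨M, hM, h₂⟩ := exists_contraction hκ hκ1 L T hR
  obtain ⟨C₃, hC₃, h₃⟩ := exists_eLpNorm_duh_le hκ hκ1 L T
  set E := ofReal (Real.exp (M * T)) with hE
  refine ⟨C₃ * R * (2 * (C₁ + 1) * E), mul_ne_top (mul_ne_top hC₃ hR) (mul_ne_top
    (mul_ne_top (by simp) (by simp [hC₁])) ofReal_ne_top), fun l a f W N hl ha hf hfN hN0 hN hA hs t ht => ?_⟩
  have hfl := hfN.trans_lt hN.lt_top
  have hc : Contr κ l T M a := fun W c hW h0 ht hb => h₂ M le_rfl a W l c hl ha hW h0 ht hb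
  have hb := hc.apriori hM (measurable_heat hf) hA hs (mul_ne_top (by simp [hC₁]) hN)
    (((h₁ l f hl hf hfl).mono (mul_le_mul' (le_self_add : C₁ ≤ C₁ + 1) hfN)).mono_exp hM)
  have hb0 : Bdd κ l T 0 (2 * (C₁ + 1) * E * N) W := fun s hs' i => by
    refine (hb s hs' i).trans ?_
    have hs0 := hs'.1
    rw [zero_mul, Real.exp_zero, mul_one, ofReal_mul (by positivity), mul_comm (ofReal (s ^ _)), ← mul_assoc]
    refine mul_le_mul_left ?_ _
    calc _ ≤ 2 * ((C₁ + 1) * N) * E := mul_le_mul_right (ofReal_le_ofReal (Real.exp_le_exp.2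
          (mul_le_mul_of_nonneg_left hs'.2 hM))) _
      _ = _ := by ring
  have hE0 : E ≠ 0 := by simp [hE, Real.exp_pos]
  have := h₃ l a W R _ hl ha hA.1 hR0 hR (mul_ne_zero (mul_ne_zero (mul_ne_zero (by simp) (by simp)) hE0) hN0)
    (mul_ne_top (mul_ne_top (mul_ne_top (by simp) (by simp [hC₁])) ofReal_ne_top) hN) hb0 t ht
  refine (le_of_eq ?_).trans (this.trans_eq (by ring))
  refine eLpNorm_congr_ae ((expMeas_absolutelyContinuous _).ae_le ((hs t ht 0).mono fun x hx => ?_))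
  simp only [hx, add_sub_cancel_left]

theorem tendsto_solves_zero {κ l T : ℝ} (hκ : 0 < κ) (hκ1 : κ < 1 / 10) (hT : 0 < T) {W : Fld}
    (h : Adm κ l T W) {a : Coef} {R : ℝ≥0∞} (ha : CoefBound κ a R) (hR0 : R ≠ 0) (hR : R ≠ ⊤) {f : Plane → ℝ}
    (hf : Measurable f) (hfl : eLpNorm f 2 (expMeas l) < ⊤) (hs : Solves T a (heat f) W) :
    Tendsto (fun t => eLpNorm (fun x => W 0 t x - f x) 2 (expMeas (l + t))) (𝓝[>] 0) (𝓝 0) := by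
  obtain ⟨C, hC, hb⟩ := exists_eLpNorm_solves_le hκ hκ1 |l| T hR0 hR
  set N := eLpNorm f 2 (expMeas l) + 1 with hN
  have hNt : N ≠ ⊤ := ENNReal.add_ne_top.2 ⟨hfl.ne, by simp⟩
  have hp : 0 < 1 / 2 - 5 * κ / 2 := by linarith
  have h1 : Tendsto (fun t : ℝ => C * N * ofReal (t ^ (1 / 2 - 5 * κ / 2))) (𝓝[>] 0) (𝓝 0) := by
    have := ENNReal.Tendsto.const_mul (a := C * N) (ENNReal.tendsto_ofReal
      ((Real.continuousAt_rpow_const 0 (1 / 2 - 5 * κ / 2) (Or.inr hp.le)).continuousWithinAt (s := Set.Ioi 0)))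
      (Or.inr (mul_ne_top hC hNt))
    simp only [] at this
    rwa [Real.zero_rpow hp.ne', ENNReal.ofReal_zero, mul_zero] at this
  have h2 := h1.add (tendsto_hconv_zero hf hfl)
  rw [add_zero] at h2
  refine tendsto_of_tendsto_of_tendsto_of_le_of_le' tendsto_const_nhds h2 (Eventually.of_forall fun _ => bot_le) ?_
  filter_upwards [Ioc_mem_nhdsGT hT] with t ht
  have hm : Measurable (heat f 0 t) := measurable_hconv 0 t hf
  have e : (fun x => W 0 t x - f x) = (fun x => W 0 t x - heat f 0 t x) + fun x => hconv 0 t f x - f x := by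
    funext x; simp only [Pi.add_apply, heat]; ring
  rw [e]
  refine (eLpNorm_add_le ((h.slice t 0).sub hm).aestronglyMeasurable (hm.sub hf).aestronglyMeasurable (by simp)).trans
    (add_le_add (hb l a f W N le_rfl ha hf le_self_add (by simp [hN]) hNt h hs t ht)
      (eLpNorm_mono_measure _ (expMeas_mono (by linarith [ht.1]))))

theorem l2Norm_sub_eq (l : ℝ) (u v : Plane → ℝ) : l2Norm (expWeight l) (u - v) = eLpNorm (fun x => u x - v x) 2 (expMeas l) :=
  l2Norm_eq_eLpNorm l _

theorem l2Norm_coeFn_sub (l : ℝ) (f g : Plane →ₘ[volume] ℝ) :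
    l2Norm (expWeight l) (f - g : Plane →ₘ[volume] ℝ) = l2Norm (expWeight l) (f - g) := by
  rw [l2Norm_eq_eLpNorm, l2Norm_eq_eLpNorm]
  exact eLpNorm_congr_ae ((expMeas_absolutelyContinuous l).ae_le (AEEqFun.coeFn_sub f g))

theorem l2Norm_mono {l l' : ℝ} (h : l ≤ l') (v : Plane → ℝ) : l2Norm (expWeight l') v ≤ l2Norm (expWeight l) v := by
  rw [l2Norm_eq_eLpNorm, l2Norm_eq_eLpNorm]
  exact eLpNorm_mono_measure _ (expMeas_mono h)

theorem mem_L2exp {l : ℝ} {f : Plane →ₘ[volume] ℝ} : f ∈ L2exp l ↔ eLpNorm f 2 (expMeas l) < ⊤ := by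
  rw [← l2Norm_eq_eLpNorm]; rfl

theorem L2exp_mono {l l' : ℝ} (h : l ≤ l') {f : Plane →ₘ[volume] ℝ} (hf : f ∈ L2exp l) : f ∈ L2exp l' :=
  (l2Norm_mono h _).trans_lt hf

theorem coeFn_lin (f g : Plane →ₘ[volume] ℝ) (a b : ℝ) :
    (a • f + b • g : Plane →ₘ[volume] ℝ) =ᵐ[volume] fun x => a * f x + b * g x := by
  filter_upwards [AEEqFun.coeFn_add (a • f) (b • g), AEEqFun.coeFn_smul a f, AEEqFun.coeFn_smul b g] with x h1 h2 h3
  rw [h1, Pi.add_apply, h2, h3]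
  rfl

theorem exists_coefBound {κ : ℝ} (hκ : 0 < κ) (hκ1 : κ < 1 / 10) (χ : Cutoff) {q : Distr × Distr} (hq : q ∈ Noise κ) :
    (∀ j, tgt χ q j ∈ HolderSpace (-κ) (polyWeight κ)) ∧ ∃ R : ℝ≥0∞, R ≠ 0 ∧ R ≠ ⊤ ∧ CoefBound κ (coefs χ κ q) R := by
  obtain ⟨C, hC, h⟩ := exists_holderNorm_tgt_le hκ (by linarith) χ
  have hn : noiseNorm κ q ≠ ⊤ := ENNReal.add_ne_top.2 ⟨(HolderSpace.holderNorm_lt_top (by linarith) hκ.le hq.1).ne,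
    (HolderSpace.holderNorm_lt_top (by linarith) hκ.le hq.2).ne⟩
  exact ⟨fun j => (h q hq j).1, 2 * (C * noiseNorm κ q) + 2, by simp, ENNReal.add_ne_top.2 ⟨mul_ne_top (by simp)
    (mul_ne_top hC hn), by simp⟩, coefBound_coefs (fun j => (h q hq j).1) fun j => (h q hq j).2⟩

/-- The solution at time `t`, as the sum of the Picard series. -/
def sol (χ : Cutoff) (κ : ℝ) (q : Distr × Distr) (f : Plane →ₘ[volume] ℝ) (t : ℝ) : Plane →ₘ[volume] ℝ :=
  if t ≤ 0 then f else AEEqFun.mk (picard (coefs χ κ q) (heat f) 0 t)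
    ((measurable_picard _ (measurable_heat f.measurable) 0).comp (measurable_const.prodMk measurable_id)).aestronglyMeasurable

variable {χ : Cutoff} {κ l T t : ℝ} {q : Distr × Distr} {f g : Plane →ₘ[volume] ℝ}

theorem sol_zero (h : t ≤ 0) : sol χ κ q f t = f := if_pos h

theorem coeFn_sol (h : 0 < t) : sol χ κ q f t =ᵐ[volume] picard (coefs χ κ q) (heat f) 0 t := by
  rw [sol, if_neg (not_le.2 h)]
  exact AEEqFun.coeFn_mk _ _

theorem picard_heat_solves (hκ : 0 < κ) (hκ1 : κ < 1 / 10) (χ : Cutoff) (hq : q ∈ Noise κ) (hf : f ∈ L2exp l) (T : ℝ) :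
    Adm κ l T (picard (coefs χ κ q) (heat f)) ∧ Solves T (coefs χ κ q) (heat f) (picard (coefs χ κ q) (heat f)) := by
  obtain ⟨-, R, -, hR, ha⟩ := exists_coefBound hκ hκ1 χ hq
  exact picard_solves hκ hκ1 ha hR (adm_heat hκ (by linarith) l T f.measurable (mem_L2exp.1 hf))

theorem coeFn_sol_eq_of_solves (hκ : 0 < κ) (hκ1 : κ < 1 / 10) (hq : q ∈ Noise κ) (hf : f ∈ L2exp l)
    {W : Fld} (hW : Adm κ l T W) (hs : Solves T (coefs χ κ q) (heat f) W) (ht : t ∈ Ioc 0 T) :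
    sol χ κ q f t =ᵐ[volume] W 0 t := by
  obtain ⟨-, R, -, hR, ha⟩ := exists_coefBound hκ hκ1 χ hq
  obtain ⟨h1, h2⟩ := picard_heat_solves hκ hκ1 χ hq hf T
  exact (coeFn_sol ht.1).trans (ae_eq_of_solves hκ hκ1 ha hR h1 hW h2 hs ht 0)

theorem sol_mem (hκ : 0 < κ) (hκ1 : κ < 1 / 10) (hq : q ∈ Noise κ) (hf : f ∈ L2exp l) (ht : 0 ≤ t) :
    sol χ κ q f t ∈ L2exp (l + t) := by
  rcases ht.eq_or_lt with rfl | ht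
  · rwa [sol_zero le_rfl, add_zero]
  rw [mem_L2exp, eLpNorm_congr_ae ((expMeas_absolutelyContinuous _).ae_eq (coeFn_sol ht))]
  exact (picard_heat_solves hκ hκ1 χ hq hf t).1.eLpNorm_lt_top ⟨ht, le_rfl⟩ 0

theorem sol_isMildSolution (hκ : 0 < κ) (hκ1 : κ < 1 / 10) (hq : q ∈ Noise κ) (hf : f ∈ L2exp l) (hT : 0 < T) :
    IsMildSolution χ κ q l T f (sol χ κ q f) := by
  obtain ⟨hq', R, -, hR, ha⟩ := exists_coefBound hκ hκ1 χ hq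
  obtain ⟨h1, h2⟩ := picard_heat_solves hκ hκ1 χ hq hf T
  exact .of_solves hκ hκ1 hT hq' ha hR hf h1 h2 fun t ht => coeFn_sol ht.1

theorem IsMildSolution.eq_sol (hκ : 0 < κ) (hκ1 : κ < 1 / 10) (hq : q ∈ Noise κ) (hf : f ∈ L2exp l)
    {v : ℝ → Plane →ₘ[volume] ℝ} (h : IsMildSolution χ κ q l T f v) (ht : t ∈ Ioc 0 T) : v t = sol χ κ q f t := by
  obtain ⟨hq', R, -, hR, ha⟩ := exists_coefBound hκ hκ1 χ hq
  obtain ⟨W, hA, hs, hv⟩ := h.exists_solves hκ hκ1 hq' ha hR hf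
  exact AEEqFun.ext ((hv t ht).trans (coeFn_sol_eq_of_solves hκ hκ1 hq hf hA hs ht).symm)

theorem sol_lin (hκ : 0 < κ) (hκ1 : κ < 1 / 10) (hq : q ∈ Noise κ) (hf : f ∈ L2exp l) (hg : g ∈ L2exp l) (a b : ℝ) (t : ℝ) :
    a • f + b • g ∈ L2exp l ∧ sol χ κ q (a • f + b • g) t = a • sol χ κ q f t + b • sol χ κ q g t := by
  have hab : a • f + b • g ∈ L2exp l := by
    have h1 := mem_L2exp.1 hf
    have h2 := mem_L2exp.1 hg
    rw [mem_L2exp, eLpNorm_congr_ae ((expMeas_absolutelyContinuous _).ae_eq (coeFn_lin f g a b))]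
    have m1 : MemLp f 2 (expMeas l) := ⟨f.measurable.aestronglyMeasurable, h1⟩
    have m2 : MemLp g 2 (expMeas l) := ⟨g.measurable.aestronglyMeasurable, h2⟩
    exact ((m1.const_mul a).add (m2.const_mul b)).2
  refine ⟨hab, ?_⟩
  rcases le_or_gt t 0 with ht | ht
  · rw [sol_zero ht, sol_zero ht, sol_zero ht]
  obtain ⟨-, R, -, hR, ha⟩ := exists_coefBound hκ hκ1 χ hq
  obtain ⟨h1, h2⟩ := picard_heat_solves hκ hκ1 χ hq hf t
  obtain ⟨h3, h4⟩ := picard_heat_solves hκ hκ1 χ hq hg t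
  refine AEEqFun.ext ((coeFn_sol_eq_of_solves hκ hκ1 hq hab (h1.lin h3 a b) (fun s hs i => ?_) ⟨ht, le_rfl⟩).trans ?_)
  · filter_upwards [h2 s hs i, h4 s hs i, duh_lin hκ hκ1 h1 h3 (η := 1) measurable_const (fun _ => by simp) ha hR a b hs i]
      with x e1 e2 e3
    simp only [heat] at e1 e2 ⊢
    rw [e1, e2, e3, hconv_congr_ae i s (coeFn_lin f g a b), hconv_lin hs.1 i f.measurable g.measurable
      (mem_L2exp.1 hf) (mem_L2exp.1 hg)]
    ring
  · filter_upwards [coeFn_lin (sol χ κ q f t) (sol χ κ q g t) a b, coeFn_sol (f := f) (χ := χ) (κ := κ) (q := q) ht,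
      coeFn_sol (f := g) (χ := χ) (κ := κ) (q := q) ht] with x e1 e2 e3
    rw [e1, e2, e3]

theorem sol_semigroup (hκ : 0 < κ) (hκ1 : κ < 1 / 10) (hq : q ∈ Noise κ) (hf : f ∈ L2exp l) {s : ℝ} (hs : 0 ≤ s) (hst : s ≤ t) :
    sol χ κ q f t = sol χ κ q (sol χ κ q f (t - s)) s := by
  rcases hs.eq_or_lt with rfl | hs
  · rw [sub_zero, sol_zero le_rfl]
  rcases hst.eq_or_lt with rfl | hst
  · rw [sub_self, sol_zero le_rfl]
  obtain ⟨-, R, -, hR, ha⟩ := exists_coefBound hκ hκ1 χ hq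
  obtain ⟨h1, h2⟩ := picard_heat_solves hκ hκ1 χ hq hf t
  have hr : 0 < t - s := sub_pos.2 hst
  have h3 := h1.shift hκ hr
  have h4 := h2.shift hκ hκ1 h1 ha hR f.measurable (mem_L2exp.1 hf) hr (sol χ κ q f (t - s)).measurable (coeFn_sol hr)
  rw [sub_sub_cancel] at h3 h4
  have h5 := coeFn_sol_eq_of_solves hκ hκ1 hq (sol_mem (χ := χ) hκ hκ1 hq hf hr.le) h3 h4 ⟨hs, le_rfl⟩
  rw [add_sub_cancel] at h5
  exact AEEqFun.ext ((coeFn_sol (hs.trans hst)).trans h5.symm)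

theorem exists_l2Norm_sol_le (hκ : 0 < κ) (hκ1 : κ < 1 / 10) (χ : Cutoff) (hq : q ∈ Noise κ) (L T : ℝ) :
    ∃ C : ℝ≥0∞, C ≠ ⊤ ∧ ∀ (l : ℝ) (f : Plane →ₘ[volume] ℝ) (N : ℝ≥0∞), |l| ≤ L → l2Norm (expWeight l) f ≤ N → N ≠ 0 → N ≠ ⊤ →
      ∀ t ∈ Ioc 0 T, l2Norm (expWeight (l + t)) (sol χ κ q f t) ≤ C * N := by
  obtain ⟨-, R, hR0, hR, ha⟩ := exists_coefBound hκ hκ1 χ hq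
  obtain ⟨C, hC, h⟩ := exists_eLpNorm_solves_le hκ hκ1 L T hR0 hR
  set E := ofReal (2 * Real.exp ((L + T) ^ 2 * T)) with hE
  refine ⟨C * ofReal (T ^ (1 / 2 - 5 * κ / 2)) + E, ENNReal.add_ne_top.2 ⟨mul_ne_top hC ofReal_ne_top,
    ofReal_ne_top⟩, fun l f N hl hf hN0 hN t ht => ?_⟩
  have ht0 := ht.1
  have hfl : f ∈ L2exp l := hf.trans_lt hN.lt_top
  rw [l2Norm_eq_eLpNorm] at hf ⊢
  obtain ⟨h1, h2⟩ := picard_heat_solves hκ hκ1 χ hq hfl T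
  rw [eLpNorm_congr_ae ((expMeas_absolutelyContinuous _).ae_eq (coeFn_sol ht.1))]
  set W := picard (coefs χ κ q) (heat f) with hW
  have hm : Measurable (heat f 0 t) := measurable_hconv 0 t f.measurable
  have e : W 0 t = (fun x => W 0 t x - heat f 0 t x) + heat f 0 t := by funext x; simp
  rw [e, add_mul]
  refine (eLpNorm_add_le ((h1.slice t 0).sub hm).aestronglyMeasurable hm.aestronglyMeasurable (by simp)).trans (add_le_add ?_ ?_)
  · refine (h l _ f W N hl ha f.measurable hf hN0 hN h1 h2 t ht).trans ?_
    rw [mul_right_comm]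
    refine mul_le_mul_left (mul_le_mul_right (ofReal_le_ofReal (Real.rpow_le_rpow ht0.le ht.2 (by linarith))) _) _
  · refine (eLpNorm_hconv_zero_le ht.1 f.measurable).trans (mul_le_mul' (ofReal_le_ofReal ?_)
      ((eLpNorm_mono_measure _ (expMeas_mono (by linarith))).trans hf))
    have h3 : (l + t) ^ 2 ≤ (L + T) ^ 2 := by
      rw [← sq_abs]
      refine pow_le_pow_left₀ (abs_nonneg _) ((abs_add_le _ _).trans (add_le_add hl ?_)) 2
      rw [abs_of_pos ht0]; exact ht.2
    have := ht.2
    gcongr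

theorem tendsto_sol_zero (hκ : 0 < κ) (hκ1 : κ < 1 / 10) (hq : q ∈ Noise κ) (hf : f ∈ L2exp l) :
    Tendsto (fun t => l2Norm (expWeight (l + t)) (sol χ κ q f t - f)) (𝓝[>] 0) (𝓝 0) := by
  obtain ⟨-, R, hR0, hR, ha⟩ := exists_coefBound hκ hκ1 χ hq
  obtain ⟨h1, h2⟩ := picard_heat_solves hκ hκ1 χ hq hf 1
  refine (tendsto_solves_zero hκ hκ1 one_pos h1 ha hR0 hR f.measurable (mem_L2exp.1 hf) h2).congr' ?_
  filter_upwards [self_mem_nhdsWithin] with t ht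
  rw [l2Norm_sub_eq]
  refine eLpNorm_congr_ae ((expMeas_absolutelyContinuous _).ae_le ?_)
  filter_upwards [coeFn_sol (f := f) (χ := χ) (κ := κ) (q := q) ht] with x hx
  rw [hx]

theorem tendsto_sol (hκ : 0 < κ) (hκ1 : κ < 1 / 10) (hq : q ∈ Noise κ) (hf : f ∈ L2exp l) (ht : t ∈ Set.Icc 0 T) :
    Tendsto (fun s => l2Norm (expWeight (l + T)) (sol χ κ q f s - sol χ κ q f t))
      (𝓝[Set.Icc 0 T] t) (𝓝 0) := by
  rw [ENNReal.tendsto_nhds_zero]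
  intro ε hε
  obtain ⟨C, hC, hCs⟩ := exists_l2Norm_sol_le hκ hκ1 χ hq (|l| + T) T
  obtain ⟨δ, hδ, hδε⟩ := exists_pos_mul_lt (K := C + 1) (by simp [hC]) hε
  obtain ⟨r₁, hr₁, h₁⟩ := mem_nhdsGT_iff_exists_Ioo_subset.1
    ((tendsto_sol_zero (χ := χ) hκ hκ1 hq (sol_mem (χ := χ) hκ hκ1 hq hf ht.1)).eventually (gt_mem_nhds hε))
  obtain ⟨r₂, hr₂, h₂⟩ := mem_nhdsGT_iff_exists_Ioo_subset.1
    ((tendsto_sol_zero (χ := χ) hκ hκ1 hq hf).eventually (gt_mem_nhds (ENNReal.ofReal_pos.2 hδ)))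
  rw [Set.mem_Ioi] at hr₁ hr₂
  filter_upwards [self_mem_nhdsWithin, nhdsWithin_le_nhds (Ioo_mem_nhds (sub_lt_self t hr₂) (lt_add_of_pos_right t hr₁))] with s hs hst
  rcases lt_trichotomy s t with hlt | rfl | hlt
  · have hh : t - s ∈ Ioo 0 r₂ := ⟨sub_pos.2 hlt, by linarith [hst.1]⟩
    have hb : l2Norm (expWeight (l + (t - s))) (sol χ κ q f (t - s) - f) < ofReal δ := h₂ hh
    have hle : l2Norm (expWeight (l + t)) (sol χ κ q f s - sol χ κ q f t) ≤ (C + 1) * ofReal δ := by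
      rw [l2Norm_eq_eLpNorm, eLpNorm_sub_comm, ← l2Norm_eq_eLpNorm, add_mul, one_mul]
      rcases hs.1.eq_or_lt with rfl | hs0
      · rw [sub_zero] at hb
        rw [sol_zero le_rfl]
        exact hb.le.trans le_add_self
      · have hl : |l + (t - s)| ≤ |l| + T := (abs_add_le _ _).trans (add_le_add le_rfl (by
          rw [abs_of_pos hh.1]; linarith [ht.2]))
        have h3 := hCs (l + (t - s)) (sol χ κ q f (t - s) - f) _ hl ((l2Norm_coeFn_sub _ _ _).trans_le hb.le) (by simpa using hδ) ofReal_ne_top s ⟨hs0, hs.2⟩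
        have h4 := (sol_lin (χ := χ) hκ hκ1 hq (sol_mem (χ := χ) hκ hκ1 hq hf hh.1.le) (L2exp_mono (by linarith [hh.1]) hf) 1 (-1) s).2
        rw [one_smul, one_smul, neg_one_smul, neg_one_smul, ← sub_eq_add_neg, ← sub_eq_add_neg,
          ← sol_semigroup hκ hκ1 hq hf hs.1 hlt.le] at h4
        rw [h4, l2Norm_coeFn_sub, add_assoc, sub_add_cancel] at h3
        exact h3.trans le_self_add
    exact (l2Norm_mono (by linarith [ht.2]) _).trans (hle.trans hδε.le)
  · rw [l2Norm_sub_eq]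
    simp
  · have h3 : l2Norm (expWeight (l + t + (s - t))) (sol χ κ q (sol χ κ q f t) (s - t) - sol χ κ q f t) < ε :=
      h₁ ⟨sub_pos.2 hlt, by linarith [hst.2]⟩
    have h4 := sol_semigroup (χ := χ) (s := s - t) (t := s) hκ hκ1 hq hf (sub_pos.2 hlt).le (by linarith [ht.1])
    rw [sub_sub_cancel] at h4
    rw [← h4, add_assoc, add_sub_cancel] at h3
    exact (l2Norm_mono (by linarith [hs.2]) _).trans h3.le

theorem exists_sol_sub_lt {χ : Cutoff} {κ l t : ℝ} {q : Distr × Distr} {f : Plane →ₘ[volume] ℝ} (hκ : 0 < κ) (hκ1 : κ < 1 / 10)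
    (hq : q ∈ Noise κ) (hf : f ∈ L2exp l) (ht : 0 ≤ t) {ε : ℝ≥0∞} (hε : 0 < ε) :
    ∃ δ > 0, ∀ q' ∈ Noise κ, ∀ f' ∈ L2exp l, noiseNorm κ (q' - q) < δ →
      l2Norm (expWeight l) (f' - f) < δ →
      l2Norm (expWeight (l + t)) (sol χ κ q' f' t - sol χ κ q f t) < ε := by
  rcases ht.eq_or_lt with rfl | ht
  · refine ⟨ε, hε, fun q' _ f' _ _ h => ?_⟩
    rwa [sol_zero le_rfl, sol_zero le_rfl, add_zero]
  obtain ⟨C₀, hC₀, h₀⟩ := exists_holderNorm_tgt_le hκ (by linarith) χ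
  obtain ⟨hq₀, R, -, hR, ha⟩ := exists_coefBound hκ hκ1 χ hq
  have hn : noiseNorm κ q ≠ ⊤ := ENNReal.add_ne_top.2 ⟨(HolderSpace.holderNorm_lt_top (by linarith) hκ.le hq.1).ne,
    (HolderSpace.holderNorm_lt_top (by linarith) hκ.le hq.2).ne⟩
  set R' : ℝ≥0∞ := 2 * (C₀ * noiseNorm κ q + C₀) + 2 with hR'd
  have hR' : R' ≠ ⊤ := ENNReal.add_ne_top.2 ⟨mul_ne_top (by simp) (ENNReal.add_ne_top.2 ⟨mul_ne_top hC₀ hn, hC₀⟩),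
    by simp⟩
  obtain ⟨M, hM, hcon⟩ := exists_contr hκ hκ1 l t hR'
  obtain ⟨C₁, hC₁, h₁⟩ := exists_bdd_heat hκ (by linarith) |l| t
  obtain ⟨C₂, hC₂, h₂⟩ := exists_bdd_duh hκ hκ1 |l| t
  obtain ⟨hA, hs⟩ := picard_heat_solves hκ hκ1 χ hq hf t
  set W := picard (coefs χ κ q) (heat f) with hW
  obtain ⟨c, hc0, hc, hB⟩ := hA.2
  set A : ℝ≥0∞ := ofReal (t ^ (1 / 4 : ℝ)) with hAd
  have hA0 : A ≠ 0 := by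
    rw [hAd]; simp only [ne_eq, ENNReal.ofReal_eq_zero, not_le]; positivity
  set K : ℝ≥0∞ := C₁ + C₂ * (2 * C₀ + 1) * A * c with hK
  have hKt : K ≠ ⊤ := ENNReal.add_ne_top.2 ⟨hC₁, mul_ne_top (mul_ne_top (mul_ne_top hC₂
    (ENNReal.add_ne_top.2 ⟨mul_ne_top (by simp) hC₀, by simp⟩)) ofReal_ne_top) hc⟩
  obtain ⟨δ, hδ, hδε⟩ := exists_pos_mul_lt
    (K := 2 * K * ofReal (t ^ (-(1 / 2 + κ)) * Real.exp (M * t)))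
    (mul_ne_top (mul_ne_top (by simp) hKt) ofReal_ne_top) hε
  set D : ℝ≥0∞ := min (ofReal δ) 1 with hD
  have hD0 : 0 < D := lt_min (ENNReal.ofReal_pos.2 hδ) one_pos
  have hDt : D ≠ ⊤ := ((min_le_right _ _).trans_lt ENNReal.one_lt_top).ne
  refine ⟨D, hD0, fun q' hq' f' hf' hqq hff => ?_⟩
  have htq : ∀ j, holderNorm (-κ) (polyWeight κ) (tgt χ q' j - tgt χ q j) ≤ C₀ * D := fun j => by
    rw [← tgt_sub]
    exact (h₀ _ (Noise.sub hq' hq) j).2.trans (mul_le_mul_right hqq.le _)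
  have hq₁ : ∀ j, tgt χ q' j ∈ HolderSpace (-κ) (polyWeight κ) := fun j => (h₀ q' hq' j).1
  have hdif : CoefBound κ (coefs χ κ q' - coefs χ κ q) ((2 * C₀ + 1) * D) := by
    have := coefBound_coefs_sub hq₁ hq₀ htq hD0
    rwa [← mul_assoc, ← add_one_mul] at this
  have ha' : CoefBound κ (coefs χ κ q') R' := coefBound_coefs hq₁ fun j => by
    have e : tgt χ q' j = tgt χ q j + (tgt χ q' j - tgt χ q j) := (add_sub_cancel _ _).symm
    rw [e]
    refine (holderNorm_add_le _ (polyWeight_pos κ) _ _).trans (add_le_add (h₀ q hq j).2 ((htq j).trans ?_))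
    exact mul_le_of_le_one_right' (min_le_right _ _)
  obtain ⟨hA', hs'⟩ := picard_heat_solves hκ hκ1 χ hq' hf' t
  set W' := picard (coefs χ κ q') (heat f') with hW'
  rw [l2Norm_sub_eq] at hff
  have hfm : Measurable fun x => f' x - f x := f'.measurable.sub f.measurable
  have B1 := (h₁ l _ le_rfl hfm (hff.trans_le le_top)).mono (mul_le_mul_right hff.le C₁)
  have B2 := (h₂ 1 _ W l 0 A _ c le_rfl measurable_const (fun τ hτ => by
    have hτ0 := hτ.1
    rw [hAd, ← ofReal_mul (by positivity), Real.rpow_neg hτ0.le, ← div_eq_mul_inv]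
    simp only [Pi.one_apply, enorm_one, zero_mul, neg_zero, Real.exp_zero, ENNReal.ofReal_one, one_mul,
      ENNReal.one_le_ofReal]
    rw [one_le_div (by positivity)]
    exact Real.rpow_le_rpow hτ0.le hτ.2 (by norm_num)) hdif hA.1 hA0 ofReal_ne_top
    (mul_ne_zero (by simp) hD0.ne') (mul_ne_top (ENNReal.add_ne_top.2 ⟨mul_ne_top (by simp) hC₀, by simp⟩) hDt)
    hc0 hc hB).2
  have M1 := measurable_heat hfm
  have M2 := measurable_duh (η := 1) measurable_const (coefs χ κ q' - coefs χ κ q) hA.1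
  have B3 := ((B1.lin B2 M1 M2 1 1).mono (c' := K * D) (by
    simp only [enorm_one, one_mul, hK]; exact le_of_eq (by ring))).mono_exp hM
  have hd : Solves t (coefs χ κ q') (fun i s x => 1 * heat (fun x => f' x - f x) i s x +
      1 * duh 1 (coefs χ κ q' - coefs χ κ q) W i s x) fun i s x => 1 * W' i s x + -1 * W i s x := fun s hst i => by
    filter_upwards [hs s hst i, hs' s hst i,
      duh_lin hκ hκ1 hA' hA (η := 1) measurable_const (fun _ => by simp) ha' hR' 1 (-1) hst i,
      duh_coef_sub hκ hκ1 hA (η := 1) measurable_const (fun _ => by simp) ha' hR' ha hR hst i] with x e1 e2 e3 e4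
    have e5 := hconv_lin hst.1 i f'.measurable f.measurable (mem_L2exp.1 hf') (mem_L2exp.1 hf) 1 (-1) x
    have e6 : (fun y => 1 * f' y + -1 * f y) = fun y => f' y - f y := by funext y; ring
    rw [e6] at e5
    simp only [heat] at e1 e2 ⊢
    rw [e3, e4, e1, e2, e5]
    ring
  have hGm : ∀ j, Measurable (Function.uncurry fun s x => 1 * heat (fun x => f' x - f x) j s x +
      1 * duh 1 (coefs χ κ q' - coefs χ κ q) W j s x) := fun j => ((M1 j).const_mul 1).add ((M2 j).const_mul 1)
  have := (hcon _ ha').apriori hM hGm (hA'.lin hA 1 (-1)) hd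
    (mul_ne_top hKt hDt) B3 t ⟨ht, le_rfl⟩ 0
  rw [l2Norm_sub_eq]
  refine lt_of_le_of_lt ?_ hδε
  refine (le_of_eq (eLpNorm_congr_ae ((expMeas_absolutelyContinuous _).ae_le ?_))).trans
    ((eLpNorm_le_nrm κ _ _).trans (this.trans ?_))
  · filter_upwards [coeFn_sol (f := f) (χ := χ) (κ := κ) (q := q) ht, coeFn_sol (f := f') (χ := χ) (κ := κ) (q := q') ht]
      with x e1 e2
    rw [e1, e2]
    ring
  · exact (le_of_eq (by ring)).trans (mul_le_mul_right (min_le_left _ _ : D ≤ ofReal δ) _)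

end PAM
end

theorem theorem3p3 : ∃ κ₀ > (0 : ℝ), ∀ κ ∈ Set.Ioo 0 κ₀, ∀ χ : Cutoff,
    ∃ w : Distr × Distr → (Plane →ₘ[volume] ℝ) → ℝ → (Plane →ₘ[volume] ℝ), ∀ l : ℝ,
      -- `w q f` is the unique mild solution started from `f`
      (∀ q ∈ Noise κ, ∀ f ∈ L2exp l, w q f 0 = f ∧
        ∀ T > 0, IsMildSolution χ κ q l T f (w q f) ∧
          ∀ v, IsMildSolution χ κ q l T f v → ∀ t ∈ Set.Ioc 0 T, v t = w q f t) ∧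
      -- continuity and linearity in the data
      (∀ t ≥ 0,
        (∀ q ∈ Noise κ, ∀ f ∈ L2exp l, w q f t ∈ L2exp (l + t)) ∧
        (∀ q ∈ Noise κ, ∀ f ∈ L2exp l, ∀ ε > 0, ∃ δ > 0, ∀ q' ∈ Noise κ, ∀ f' ∈ L2exp l,
          noiseNorm κ (q' - q) < δ → l2Norm (expWeight l) (f' - f) < δ →
            l2Norm (expWeight (l + t)) (w q' f' t - w q f t) < ε) ∧
        (∀ q ∈ Noise κ, ∀ f ∈ L2exp l, ∀ g ∈ L2exp l, ∀ a b : ℝ,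
          w q (a • f + b • g) t = a • w q f t + b • w q g t)) ∧
      -- continuity in time
      (∀ q ∈ Noise κ, ∀ f ∈ L2exp l, ∀ T > 0, ∀ t ∈ Set.Icc 0 T,
        w q f t ∈ L2exp (l + T) ∧
        Tendsto (fun s => l2Norm (expWeight (l + T)) (w q f s - w q f t))
          (𝓝[Set.Icc 0 T] t) (𝓝 0)) ∧
      -- semigroup property
      (∀ q ∈ Noise κ, ∀ f ∈ L2exp l, ∀ s t : ℝ, 0 ≤ s → s ≤ t →
        w q f t = w q (w q f (t - s)) s) := by
  refine ⟨1 / 10, by norm_num, fun κ hκ χ => ⟨sol χ κ, fun l => ⟨fun q hq f hf => ⟨sol_zero le_rfl, fun T hT =>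
    ⟨sol_isMildSolution hκ.1 hκ.2 hq hf hT, fun v hv t ht => hv.eq_sol hκ.1 hκ.2 hq hf ht⟩⟩, fun t ht =>
    ⟨fun q hq f hf => sol_mem hκ.1 hκ.2 hq hf ht, fun q hq f hf ε hε => exists_sol_sub_lt hκ.1 hκ.2 hq hf ht hε,
      fun q hq f hf g hg a b => (sol_lin hκ.1 hκ.2 hq hf hg a b t).2⟩, fun q hq f hf T hT t ht =>
    ⟨L2exp_mono (by linarith [ht.2]) (sol_mem hκ.1 hκ.2 hq hf ht.1), tendsto_sol hκ.1 hκ.2 hq hf ht⟩,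
    fun q hq f hf s t hs hst => sol_semigroup hκ.1 hκ.2 hq hf hs hst⟩⟩⟩
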